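/- Let $k$ be a field. Let $\mathcal H$ be a Hopf algebra over $k$ with invertible antipode and let $\mathcal L$ be an $\mathcal H$-base algebra: a left $\mathcal H$-module algebra (action $\triangleright$) and left $\mathcal H$-comodule algebra (coaction $\delta(\lambda)=\lambda^{(1)}\otimes\lambda^{[\infty]}$) which is a Yetter--Drinfeld module and satisfies $\lambda\mu=(\lambda^{(1)}\triangleright\mu)\lambda^{[\infty]}$. Let $\mathcal U\supset\mathcal H$ be a quasitriangular Hopf algebra with universal R-matrix $\mathcal R$, containing $\mathcal H$ as a Hopf subalgebra; $\gamma$ denotes antipodes, and $\bar x$ an inverse $x^{-1}$. Let $\mathcal F=\mathcal F_1\otimes\mathcal F_2\otimes\mathcal F_{\mathcal L}\in\mathcal U\otimes\mathcal U\otimes\mathcal L$ be a dynamical twist, i.e. an invertible element, with inverse $\bar{\mathcal F}$, such that $\Delta(h^{(1)})(\mathcal F_1\otimes\mathcal F_2)\otimes h^{(2)}\triangleright\mathcal F_{\mathcal L}=(\mathcal F_1\otimes\mathcal F_2)\Delta(h)\otimes\mathcal F_{\mathcal L}$ for $h\in\mathcal H$, $\mathcal F_{(12)3}\mathcal F_{12|3}=\mathcal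 F_{1(23)}\mathcal F_{23}$ (where $\mathcal F_{(12)3}$, $\mathcal F_{1(23)}$, $\mathcal F_{12|3}$ result from applying $\Delta$ to the first factor, $\Delta$ to the second factor, $\delta$ to the factor in $\mathcal L$) and $(\varepsilon\otimes\mathrm{id}\otimes\mathrm{id})(\mathcal F)=1=(\mathrm{id}\otimes\varepsilon\otimes\mathrm{id})(\mathcal F)$. Put $$\zeta=\zeta_1\otimes\zeta_{\mathcal L}:=\bar{\mathcal F}_2\gamma^{-1}(\bar{\mathcal F}_1)\otimes\bar{\mathcal F}_{\mathcal L}\in\mathcal U\otimes\mathcal L .$$ Let $\mathcal U^*$ be a Hopf algebra of linear functionals on $\mathcal U$, with the structure maps dual to those of $\mathcal U$ (a Hopf subalgebra of the restricted dual). It is a $\mathcal U$-bimodule by $(x\blacktriangleright a)(u)=a(ux)$ for $x\in\mathcal U$ and $(y\blacktriangleright a)(u)=a(yu)$ for $y\in\mathcal U_{op}$. The twisted dual $\tilde{\mathcal U}^*$ is the vector space $\mathcal U^*\otimes\mathcal L_{op}\otimes\mathcal L$ with the product obtained from the twist $\bar{\mathcal F}\otimes\mathcal F$; writing all products of elements of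 $\mathcal U_{op}$ and $\mathcal L_{op}$ in $\mathcal U$ and $\mathcal L$, it is $$(a\otimes\mu\otimes\lambda)*(b\otimes\mu'\otimes\lambda')=\bigl(\bar{\mathcal F}_1\blacktriangleright\mathcal F_1\blacktriangleright a\bigr)\bigl((\mu^{(1)}\bar{\mathcal F}_2)\blacktriangleright(\mathcal F_2\lambda^{(1)})\blacktriangleright b\bigr)\otimes\mu'\mu^{[\infty]}\bar{\mathcal F}_{\mathcal L}\otimes\mathcal F_{\mathcal L}\lambda^{[\infty]}\lambda' .$$ It has the source map $s(\lambda)=1\otimes1\otimes\lambda$ and the target map $t(\mu)=1\otimes\mu\otimes1$, and $a\in\mathcal U^*$ is identified with $a\otimes1\otimes1$. Let $\rho$ be a representation of $\mathcal U$ by $n\times n$ matrices whose matrix coefficients belong to $\mathcal U^*$, and let $U=(U_{ij})$ be the matrix of these coefficients, $U_{ij}(u)=\rho(u)_{ij}$. **(1)** The element $\zeta$ is invertible in $\mathcal U\otimes\mathcal L$, and, with $\bar\zeta=\zeta^{-1}=\bar\zeta_1\otimes\bar\zeta_{\mathcal L}$, the matrix $U$ is invertible over $\tilde{\mathcal U}^*$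 with (two-sided) inverse $$\bar U=\rho(\gamma(\zeta_1))\,\gamma_{\mathcal U^*}(U)\,\rho(\gamma(\bar\zeta_1))\otimes\bar\zeta_{\mathcal L}\otimes\zeta_{\mathcal L}.$$ Let $\tilde S=P\tilde R$, where $P$ is the flip and $\tilde R$ is the image of $\tilde{\mathcal R}=\bar{\mathcal F}_{21}\mathcal R\mathcal F$ under $\rho\otimes\rho\otimes\mathrm{id}$, and let $\tilde S_{op}=\tilde S\cdot(\rho\otimes\rho)\Delta(\gamma(\tilde S_{\mathcal L}^{(1)}))\otimes\tilde S_{\mathcal L}^{[\infty]}$. The extended dynamical FRT algebra $\tilde{\mathcal T}_{ext}$ is generated by the entries of two $n\times n$ matrices $T$, $\bar T$ and by commuting copies of $\mathcal L$ and $\mathcal L_{op}$, embedded by $s$ and $t$, subject to $$\lambda T=T\rho(\lambda^{(1)})\lambda^{[\infty]},\quad \lambda\bar T=\rho(\gamma(\lambda^{(1)}))\bar T\lambda^{[\infty]},\quad \mu T=\rho(\mu^{(1)})T\mu^{[\infty]},\quad \mu\bar T=\bar T\rho(\gamma(\mu^{(1)}))\mu^{[\infty]}$$ for $\lambda\in\mathcal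 L$, $\mu\in\mathcal L_{op}$, and $$\tilde S_{op}T_1T_2=T_1T_2\tilde S,\quad T_2\tilde S\bar T_2=\bar T_1\tilde S_{op}T_1,\quad \tilde S\bar T_2\bar T_1=\bar T_2\bar T_1\tilde S_{op},\quad \bar TT=1=T\bar T,$$ where the entries of $\tilde S$ are taken in $\mathcal L$ and those of $\tilde S_{op}$ in $\mathcal L_{op}$. **(2)** The algebra $\tilde{\mathcal T}_{ext}$ has a right $\mathcal L$-bialgebroid structure with source $s$, target $t$, $\Delta(T_{ij})=\sum_rT_{ir}\otimes_{\mathcal L}T_{rj}$, $\Delta(\bar T_{ij})=\sum_r\bar T_{rj}\otimes_{\mathcal L}\bar T_{ir}$ and anchor action (where $\lambda\dashv x=\varepsilon(s(\lambda)x)$) $\lambda\dashv T=\rho(\lambda^{(1)})\lambda^{[\infty]}$, $\lambda\dashv\bar T=\rho(\gamma(\lambda^{(1)}))\lambda^{[\infty]}$; the algebra $\tilde{\mathcal U}^*$ has a right $\mathcal L$-bialgebroid structure with source $s$, target $t$, $\Delta(a)=a^{(1)}\otimes_{\mathcal L}a^{(2)}$ and $\varepsilon(a)=\varepsilon_{\mathcal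 U^*}(a)1_{\mathcal L}$ for $a\in\mathcal U^*$. For these structures there is exactly one homomorphism of right $\mathcal L$-bialgebroids $\tilde{\mathcal T}_{ext}\to\tilde{\mathcal U}^*$ (an algebra homomorphism compatible with $s$, $t$, $\Delta$ and $\varepsilon$) with $T_{ij}\mapsto U_{ij}$ and $\bar T_{ij}\mapsto\bar U_{ij}$. -/

import Mathlib

namespace DynFRT

open TensorProduct

set_option linter.unusedSimpArgs false
set_option linter.unusedSectionVars false
set_option maxSynthPendingDepth 3

/-- An `H`-base algebra `L`: a left `H`-module algebra and left `H`-comodule algebra, with coaction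
`δ(x) = x₁ ⊗ x∞`, such that `L` is a Yetter-Drinfeld module,
`h₁ x₁ ⊗ h₂ ▷ x∞ = (h₁ ▷ x)₁ h₂ ⊗ (h₁ ▷ x)∞`, and `x y = (x₁ ▷ y) x∞`. -/
structure BaseAlgebra (k H L : Type*) [Field k] [Ring H] [HopfAlgebra k H]
    [Ring L] [Algebra k L] where
  act : H →ₐ[k] Module.End k L
  coact : L →ₐ[k] H ⊗[k] L
  act_mul : ∀ (h : H) (x y : L), act h (x * y) =
    LinearMap.mul' k L (TensorProduct.map (act.toLinearMap.flip x) (act.toLinearMap.flip y)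
      (Coalgebra.comul (R := k) h))
  act_one : ∀ h : H, act h 1 = Coalgebra.counit (R := k) h • (1 : L)
  coassoc : ∀ x : L,
    TensorProduct.assoc k H H L ((Coalgebra.comul (R := k) (A := H)).rTensor L (coact x)) =
      coact.toLinearMap.lTensor H (coact x)
  counit : ∀ x : L,
    TensorProduct.lid k L ((Coalgebra.counit (R := k) (A := H)).rTensor L (coact x)) = x
  yetterDrinfeld : ∀ (h : H) (x : L),
    TensorProduct.map (LinearMap.mul' k H) (TensorProduct.lift act.toLinearMap)
        (TensorProduct.tensorTensorTensorComm k H H H L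
          (Coalgebra.comul (R := k) h ⊗ₜ[k] coact x)) =
      TensorProduct.lift
        (LinearMap.mk₂ k (fun h₁ h₂ => coact (act h₁ x) * (h₂ ⊗ₜ[k] (1 : L)))
          (by intros; simp [add_mul]) (by intros; simp)
          (by intros; simp [TensorProduct.add_tmul, mul_add])
          (by intros; simp [← TensorProduct.smul_tmul']))
        (Coalgebra.comul (R := k) h)
  comm : ∀ x y : L, x * y =
    LinearMap.mul' k L ((act.toLinearMap.flip y).rTensor L (coact x))

/-- A Hopf algebra `A` of linear functionals on the Hopf algebra `U`: the map `pair : A → U*` is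
injective, the product and unit of `A` are the convolution product and the counit of `U`, the
coproduct and counit are dual to the product and unit of `U`, the antipode is the transpose of the
antipode. For instance the restricted (Sweedler) dual of `U`, or its Hopf subalgebra generated by
matrix coefficients. -/
structure HopfDual (k U A : Type*) [Field k] [Ring U] [HopfAlgebra k U]
    [Ring A] [HopfAlgebra k A] where
  pair : A →ₗ[k] Module.Dual k U
  injective : Function.Injective pair
  pair_one : ∀ u : U, pair 1 u = Coalgebra.counit (R := k) u
  pair_mul : ∀ (a b : A) (u : U), pair (a * b) u =
    LinearMap.mul' k k (TensorProduct.map (pair a) (pair b) (Coalgebra.comul (R := k) u))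
  pair_counit : ∀ a : A, Coalgebra.counit (R := k) a = pair a 1
  pair_comul : ∀ (a : A) (u v : U), pair a (u * v) =
    LinearMap.mul' k k (TensorProduct.map (pair.flip u) (pair.flip v) (Coalgebra.comul (R := k) a))
  pair_antipode : ∀ (a : A) (u : U),
    pair (HopfAlgebra.antipode k a) u = pair a (HopfAlgebra.antipode k u)


section Notions

variable {k H U L : Type*} [Field k] [Ring H] [HopfAlgebra k H] [Ring U] [HopfAlgebra k U]
  [Ring L] [Algebra k L]

/-- The coaction of `L`, with its first factor embedded in `U`. -/
noncomputable def BaseAlgebra.coactU (B : BaseAlgebra k H L) (ι : H →ₐc[k] U) :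
    L →ₐ[k] U ⊗[k] L :=
  (Algebra.TensorProduct.map (ι : H →ₐ[k] U) (AlgHom.id k L)).comp B.coact

variable (k U L) in
/-- `F ↦ F₍₁₂₎₃`: the coproduct of the first factor. -/
noncomputable def copFst : U ⊗[k] (U ⊗[k] L) →ₐ[k] U ⊗[k] (U ⊗[k] (U ⊗[k] L)) :=
  ((Algebra.TensorProduct.assoc k k k U U (U ⊗[k] L)) : _ →ₐ[k] _).comp
    (Algebra.TensorProduct.map (Bialgebra.comulAlgHom k U) (AlgHom.id k (U ⊗[k] L)))

variable (k U L) in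
/-- `F ↦ F₁₍₂₃₎`: the coproduct of the second factor. -/
noncomputable def copSnd : U ⊗[k] (U ⊗[k] L) →ₐ[k] U ⊗[k] (U ⊗[k] (U ⊗[k] L)) :=
  Algebra.TensorProduct.map (AlgHom.id k U)
    (((Algebra.TensorProduct.assoc k k k U U L) : _ →ₐ[k] _).comp
      (Algebra.TensorProduct.map (Bialgebra.comulAlgHom k U) (AlgHom.id k L)))

/-- `F ↦ F₁₂|₃ = F₁ ⊗ F₂ ⊗ δ(F_L)`. -/
noncomputable def BaseAlgebra.coactLast (B : BaseAlgebra k H L) (ι : H →ₐc[k] U) :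
    U ⊗[k] (U ⊗[k] L) →ₐ[k] U ⊗[k] (U ⊗[k] (U ⊗[k] L)) :=
  Algebra.TensorProduct.map (AlgHom.id k U)
    (Algebra.TensorProduct.map (AlgHom.id k U) (B.coactU ι))

variable (L) in
/-- `x ⊗ y ↦ x ⊗ y ⊗ 1`. -/
noncomputable def inUU : U ⊗[k] U →ₐ[k] U ⊗[k] (U ⊗[k] L) :=
  Algebra.TensorProduct.map (AlgHom.id k U) Algebra.TensorProduct.includeLeft

/-- `(h₁ ⊗ h₂ ⊗ h₃) · (x ⊗ y ⊗ l) = h₁ x ⊗ h₂ y ⊗ (h₃ ▷ l)`. -/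
noncomputable def BaseAlgebra.leftAct (B : BaseAlgebra k H L) (ι : H →ₐc[k] U) :
    H ⊗[k] (H ⊗[k] H) →ₗ[k] Module.End k (U ⊗[k] (U ⊗[k] L)) :=
  TensorProduct.homTensorHomMap (RingHom.id k) U (U ⊗[k] L) U (U ⊗[k] L) ∘ₗ
    TensorProduct.map (LinearMap.mul k U ∘ₗ (ι : H →ₐ[k] U).toLinearMap)
      (TensorProduct.homTensorHomMap (RingHom.id k) U L U L ∘ₗ
        TensorProduct.map (LinearMap.mul k U ∘ₗ (ι : H →ₐ[k] U).toLinearMap)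
          B.act.toLinearMap)


/-- A dynamical `(U, H, L)`-twist: an invertible `F` in `U ⊗ U ⊗ L` such that
`(Δ(h₁) ⊗ h₂ ▷) F = F (Δ(h) ⊗ 1)` for `h` in `H`, `F₍₁₂₎₃ F₁₂|₃ = F₁₍₂₃₎ F₂₃`, and
`(ε ⊗ id ⊗ id)(F) = 1 = (id ⊗ ε ⊗ id)(F)`. -/
structure DynamicalTwist (B : BaseAlgebra k H L) (ι : H →ₐc[k] U) where
  F : (U ⊗[k] (U ⊗[k] L))ˣ
  invariant : ∀ h : H,
    B.leftAct ι ((Coalgebra.comul (R := k) (A := H)).lTensor H (Coalgebra.comul (R := k) h))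
        (F : U ⊗[k] (U ⊗[k] L)) =
      F * inUU L (Coalgebra.comul (R := k) (ι h))
  cocycle : copFst k U L F * B.coactLast ι F = copSnd k U L F * ((1 : U) ⊗ₜ[k] (F : U ⊗[k] (U ⊗[k] L)))
  norm_fst : TensorProduct.lid k (U ⊗[k] L)
    ((Coalgebra.counit (R := k) (A := U)).rTensor (U ⊗[k] L) F) = 1
  norm_snd : ((TensorProduct.lid k L).toLinearMap ∘ₗ
    (Coalgebra.counit (R := k) (A := U)).rTensor L).lTensor U F = 1

end Notions

section TwistedDual

variable {k H U L A : Type*} [Field k] [Ring H] [HopfAlgebra k H] [Ring U] [HopfAlgebra k U]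
  [Ring L] [Algebra k L] [Ring A] [HopfAlgebra k A]

/-- The action `x ▶ a = a₁ ⟨a₂, x⟩` of `U` on its dual, `(x ▶ a)(u) = a(u x)`. -/
noncomputable def HopfDual.lact (D : HopfDual k U A) : U →ₗ[k] Module.End k A :=
  LinearMap.mk₂ k (fun x a =>
      TensorProduct.rid k A ((D.pair.flip x).lTensor A (Coalgebra.comul (R := k) a)))
    (by intros; simp [LinearMap.lTensor_add]) (by intros; simp [LinearMap.lTensor_smul])
    (by intros; simp) (by intros; simp)

/-- The action `y ▶ a = ⟨a₁, y⟩ a₂` of `U_op` on the dual of `U`, `(y ▶ a)(u) = a(y u)`. -/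
noncomputable def HopfDual.ract (D : HopfDual k U A) : U →ₗ[k] Module.End k A :=
  LinearMap.mk₂ k (fun y a =>
      TensorProduct.lid k A ((D.pair.flip y).rTensor A (Coalgebra.comul (R := k) a)))
    (by intros; simp [LinearMap.rTensor_add]) (by intros; simp [LinearMap.rTensor_smul])
    (by intros; simp) (by intros; simp)

/-- `a ⊗ (y ⊗ x) ↦ y ▶ x ▶ a`, for `y` in `U_op` and `x` in `U`. -/
noncomputable def HopfDual.bact (D : HopfDual k U A) : A ⊗[k] (U ⊗[k] U) →ₗ[k] A :=
  TensorProduct.lift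
    (TensorProduct.lift ((LinearMap.mul k (Module.End k A)).compl₁₂ D.ract D.lact)).flip

@[simp] theorem HopfDual.bact_tmul (D : HopfDual k U A) (a : A) (y x : U) :
    D.bact (a ⊗ₜ[k] (y ⊗ₜ[k] x)) = D.ract y (D.lact x a) := rfl

/-- Act by the first factors: `(a ⊗ x) ⊗ ((y ⊗ p) ⊗ (z ⊗ q)) ↦ (y ▶ z ▶ a) ⊗ f(x ⊗ (p ⊗ q))`. -/
noncomputable def HopfDual.step (D : HopfDual k U A) {X P Y : Type*} [AddCommGroup X] [Module k X]
    [AddCommGroup P] [Module k P] [AddCommGroup Y] [Module k Y]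
    (f : X ⊗[k] (P ⊗[k] P) →ₗ[k] Y) :
    (A ⊗[k] X) ⊗[k] ((U ⊗[k] P) ⊗[k] (U ⊗[k] P)) →ₗ[k] A ⊗[k] Y :=
  TensorProduct.map D.bact f ∘ₗ
    (TensorProduct.tensorTensorTensorComm k A X (U ⊗[k] U) (P ⊗[k] P)).toLinearMap ∘ₗ
    (TensorProduct.tensorTensorTensorComm k U P U P).toLinearMap.lTensor (A ⊗[k] X)

/-- `a ⊗ ((y ⊗ m) ⊗ (z ⊗ l)) ↦ (y ▶ z ▶ a) ⊗ m ⊗ l`. -/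
noncomputable def HopfDual.base (D : HopfDual k U A) (L : Type*) [Ring L] [Algebra k L] :
    A ⊗[k] ((U ⊗[k] L) ⊗[k] (U ⊗[k] L)) →ₗ[k] A ⊗[k] (L ⊗[k] L) :=
  TensorProduct.map D.bact LinearMap.id ∘ₗ
    (TensorProduct.assoc k A (U ⊗[k] U) (L ⊗[k] L)).symm.toLinearMap ∘ₗ
    (TensorProduct.tensorTensorTensorComm k U L U L).toLinearMap.lTensor A

variable (k A) in
/-- `a ⊗ b ⊗ y ↦ a b ⊗ y`. -/
noncomputable def mulFst (Y : Type*) [AddCommGroup Y] [Module k Y] :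
    A ⊗[k] (A ⊗[k] Y) →ₗ[k] A ⊗[k] Y :=
  (LinearMap.mul' k A).rTensor Y ∘ₗ (TensorProduct.assoc k A A Y).symm.toLinearMap

/-- `(a ⊗ b) ⊗ ((g₁ ⊗ g₂ ⊗ m) ⊗ (f₁ ⊗ f₂ ⊗ l)) ↦ (g₁ ▶ f₁ ▶ a)(g₂ ▶ f₂ ▶ b) ⊗ m ⊗ l`,
where the `f` act as elements of `U` and the `g` as elements of `U_op`. -/
noncomputable def HopfDual.core (D : HopfDual k U A) (L : Type*) [Ring L] [Algebra k L] :
    (A ⊗[k] A) ⊗[k] ((U ⊗[k] (U ⊗[k] L)) ⊗[k] (U ⊗[k] (U ⊗[k] L))) →ₗ[k] A ⊗[k] (L ⊗[k] L) :=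
  mulFst k A (L ⊗[k] L) ∘ₗ D.step (D.base L)

theorem HopfDual.core_tmul (D : HopfDual k U A) (a b : A) (g₁ g₂ f₁ f₂ : U) (m l : L) :
    D.core L ((a ⊗ₜ[k] b) ⊗ₜ[k] ((g₁ ⊗ₜ[k] (g₂ ⊗ₜ[k] m)) ⊗ₜ[k] (f₁ ⊗ₜ[k] (f₂ ⊗ₜ[k] l)))) =
      (D.ract g₁ (D.lact f₁ a) * D.ract g₂ (D.lact f₂ b)) ⊗ₜ[k] (m ⊗ₜ[k] l) := by
  simp [HopfDual.core, HopfDual.step, HopfDual.base, mulFst]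

/-- The analogue of `core` with three factors. -/
noncomputable def HopfDual.core₃ (D : HopfDual k U A) (L : Type*) [Ring L] [Algebra k L] :
    (A ⊗[k] (A ⊗[k] A)) ⊗[k]
      ((U ⊗[k] (U ⊗[k] (U ⊗[k] L))) ⊗[k] (U ⊗[k] (U ⊗[k] (U ⊗[k] L)))) →ₗ[k] A ⊗[k] (L ⊗[k] L) :=
  mulFst k A (L ⊗[k] L) ∘ₗ (mulFst k A (L ⊗[k] L)).lTensor A ∘ₗ D.step (D.step (D.base L))

theorem HopfDual.core₃_tmul (D : HopfDual k U A) (a b c : A) (g₁ g₂ g₃ f₁ f₂ f₃ : U) (m l : L) :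
    D.core₃ L ((a ⊗ₜ[k] (b ⊗ₜ[k] c)) ⊗ₜ[k]
      ((g₁ ⊗ₜ[k] (g₂ ⊗ₜ[k] (g₃ ⊗ₜ[k] m))) ⊗ₜ[k] (f₁ ⊗ₜ[k] (f₂ ⊗ₜ[k] (f₃ ⊗ₜ[k] l))))) =
      (D.ract g₁ (D.lact f₁ a) * (D.ract g₂ (D.lact f₂ b) * D.ract g₃ (D.lact f₃ c)))
        ⊗ₜ[k] (m ⊗ₜ[k] l) := by
  simp [HopfDual.core₃, HopfDual.step, HopfDual.base, mulFst]


variable (k U L) in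
/-- `l ↦ 1 ⊗ 1 ⊗ l`. -/
noncomputable def inL₂ : L →ₐ[k] U ⊗[k] (U ⊗[k] L) :=
  (Algebra.TensorProduct.includeRight).comp (Algebra.TensorProduct.includeRight)

/-- `l ↦ 1 ⊗ δ(l)`. -/
noncomputable def BaseAlgebra.coact₂ (B : BaseAlgebra k H L) (ι : H →ₐc[k] U) :
    L →ₐ[k] U ⊗[k] (U ⊗[k] L) :=
  (Algebra.TensorProduct.includeRight).comp (B.coactU ι)

/-- `m ⊗ m' ↦ m' · (1 ⊗ δ(m)) · P`; products of elements of `L_op` are written in `L`. -/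
noncomputable def targetPart (B : BaseAlgebra k H L) (ι : H →ₐc[k] U)
    (P : U ⊗[k] (U ⊗[k] L)) : L ⊗[k] L →ₗ[k] U ⊗[k] (U ⊗[k] L) :=
  TensorProduct.lift ((LinearMap.mul k (U ⊗[k] (U ⊗[k] L))).flip.compl₁₂
    (LinearMap.mulRight k P ∘ₗ (B.coact₂ ι).toLinearMap) (inL₂ k U L).toLinearMap)

/-- `l ⊗ l' ↦ P · (1 ⊗ δ(l)) · l'`. -/
noncomputable def sourcePart (B : BaseAlgebra k H L) (ι : H →ₐc[k] U)
    (P : U ⊗[k] (U ⊗[k] L)) : L ⊗[k] L →ₗ[k] U ⊗[k] (U ⊗[k] L) :=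
  TensorProduct.lift ((LinearMap.mul k (U ⊗[k] (U ⊗[k] L))).compl₁₂
    (LinearMap.mulLeft k P ∘ₗ (B.coact₂ ι).toLinearMap) (inL₂ k U L).toLinearMap)

/-- The product on `A ⊗ L_op ⊗ L` twisted by `P'` in `U_op ⊗ U_op ⊗ L_op` and `P` in `U ⊗ U ⊗ L`.
With the products of elements of `U_op` and `L_op` written in `U` and `L`, it is
`(a ⊗ m ⊗ l) * (b ⊗ m' ⊗ l')
  = (P'₁ ▶ P₁ ▶ a)((m₁ P'₂) ▶ (P₂ l₁) ▶ b) ⊗ m' m∞ P'_L ⊗ P_L l∞ l'`.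
In particular `a * b = (P'₁ ▶ P₁ ▶ a)(P'₂ ▶ P₂ ▶ b) ⊗ P'_L ⊗ P_L`, and `l * a = (l₁ ▶ a) ⊗ l∞`,
`a * l = a ⊗ l` for `l` in `L` or in `L_op` when `P` and `P'` are normalized. -/
noncomputable def twMul (D : HopfDual k U A) (B : BaseAlgebra k H L) (ι : H →ₐc[k] U)
    (P' P : U ⊗[k] (U ⊗[k] L)) :
    A ⊗[k] (L ⊗[k] L) →ₗ[k] A ⊗[k] (L ⊗[k] L) →ₗ[k] A ⊗[k] (L ⊗[k] L) :=
  (TensorProduct.mk k (A ⊗[k] (L ⊗[k] L)) (A ⊗[k] (L ⊗[k] L))).compr₂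
    (D.core L ∘ₗ
      (TensorProduct.map (targetPart B ι P') (sourcePart B ι P)).lTensor (A ⊗[k] A) ∘ₗ
      (TensorProduct.tensorTensorTensorComm k L L L L).toLinearMap.lTensor (A ⊗[k] A) ∘ₗ
      (TensorProduct.tensorTensorTensorComm k A (L ⊗[k] L) A (L ⊗[k] L)).toLinearMap)

theorem twMul_tmul (D : HopfDual k U A) (B : BaseAlgebra k H L) (ι : H →ₐc[k] U)
    (P' P : U ⊗[k] (U ⊗[k] L)) (a b : A) (m l m' l' : L) :
    twMul D B ι P' P (a ⊗ₜ[k] (m ⊗ₜ[k] l)) (b ⊗ₜ[k] (m' ⊗ₜ[k] l')) =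
      D.core L ((a ⊗ₜ[k] b) ⊗ₜ[k]
        ((inL₂ k U L m' * (B.coact₂ ι m * P')) ⊗ₜ[k] (P * B.coact₂ ι l * inL₂ k U L l'))) := rfl

/-! laws of the two actions -/

theorem HopfDual.pair_lact (D : HopfDual k U A) (x u : U) (a : A) :
    D.pair (D.lact x a) u = D.pair a (u * x) := by
  rw [D.pair_comul]
  change D.pair (TensorProduct.rid k A ((D.pair.flip x).lTensor A (Coalgebra.comul (R := k) a))) u = _
  induction Coalgebra.comul (R := k) a using TensorProduct.induction_on with
  | zero => simp
  | tmul p q => simp [mul_comm]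
  | add p q hp hq => simp only [map_add, LinearMap.add_apply, hp, hq]

theorem HopfDual.pair_ract (D : HopfDual k U A) (y u : U) (a : A) :
    D.pair (D.ract y a) u = D.pair a (y * u) := by
  rw [D.pair_comul]
  change D.pair (TensorProduct.lid k A ((D.pair.flip y).rTensor A (Coalgebra.comul (R := k) a))) u = _
  induction Coalgebra.comul (R := k) a using TensorProduct.induction_on with
  | zero => simp
  | tmul p q => simp
  | add p q hp hq => simp only [map_add, LinearMap.add_apply, hp, hq]

theorem HopfDual.ext (D : HopfDual k U A) {a b : A} (h : ∀ u, D.pair a u = D.pair b u) : a = b :=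
  D.injective (LinearMap.ext h)

theorem HopfDual.lact_lact (D : HopfDual k U A) (x y : U) (a : A) :
    D.lact x (D.lact y a) = D.lact (x * y) a :=
  D.ext fun u => by simp only [D.pair_lact, mul_assoc]

theorem HopfDual.ract_ract (D : HopfDual k U A) (x y : U) (a : A) :
    D.ract x (D.ract y a) = D.ract (y * x) a :=
  D.ext fun u => by simp only [D.pair_ract, mul_assoc]

theorem HopfDual.lact_ract (D : HopfDual k U A) (x y : U) (a : A) :
    D.lact x (D.ract y a) = D.ract y (D.lact x a) :=
  D.ext fun u => by simp only [D.pair_ract, D.pair_lact, mul_assoc]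

theorem HopfDual.lact_unit (D : HopfDual k U A) (a : A) : D.lact 1 a = a :=
  D.ext fun u => by simp only [D.pair_lact, mul_one]

theorem HopfDual.ract_unit (D : HopfDual k U A) (a : A) : D.ract 1 a = a :=
  D.ext fun u => by simp only [D.pair_ract, one_mul]

theorem HopfDual.lact_one (D : HopfDual k U A) (x : U) :
    D.lact x 1 = Coalgebra.counit (R := k) x • (1 : A) :=
  D.ext fun u => by simp [D.pair_lact, D.pair_one, mul_comm]

theorem HopfDual.ract_one (D : HopfDual k U A) (x : U) :
    D.ract x 1 = Coalgebra.counit (R := k) x • (1 : A) :=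
  D.ext fun u => by simp [D.pair_ract, D.pair_one]

theorem HopfDual.lact_mul (D : HopfDual k U A) (x : U) (a b : A) :
    D.lact x (a * b) = ∑ i ∈ (Coalgebra.Repr.arbitrary k x).index,
      D.lact ((Coalgebra.Repr.arbitrary k x).left i) a *
        D.lact ((Coalgebra.Repr.arbitrary k x).right i) b := by
  refine D.ext fun u => ?_
  rw [D.pair_lact, D.pair_mul, Bialgebra.comul_mul]
  simp only [map_sum, LinearMap.sum_apply, D.pair_mul]
  conv_lhs => rw [← (Coalgebra.Repr.arbitrary k x).eq]
  rw [Finset.mul_sum, map_sum, map_sum]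
  refine Finset.sum_congr rfl fun i _ => ?_
  induction Coalgebra.comul (R := k) u using TensorProduct.induction_on with
  | zero => simp
  | tmul p q => simp [D.pair_lact]
  | add p q hp hq => simp only [add_mul, map_add, hp, hq]

theorem HopfDual.ract_mul (D : HopfDual k U A) (x : U) (a b : A) :
    D.ract x (a * b) = ∑ i ∈ (Coalgebra.Repr.arbitrary k x).index,
      D.ract ((Coalgebra.Repr.arbitrary k x).left i) a *
        D.ract ((Coalgebra.Repr.arbitrary k x).right i) b := by
  refine D.ext fun u => ?_
  rw [D.pair_ract, D.pair_mul, Bialgebra.comul_mul]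
  simp only [map_sum, LinearMap.sum_apply, D.pair_mul]
  conv_lhs => rw [← (Coalgebra.Repr.arbitrary k x).eq]
  rw [Finset.sum_mul, map_sum, map_sum]
  refine Finset.sum_congr rfl fun i _ => ?_
  induction Coalgebra.comul (R := k) u using TensorProduct.induction_on with
  | zero => simp
  | tmul p q => simp [D.pair_ract]
  | add p q hp hq => simp only [mul_add, map_add, hp, hq]

/-! associativity -/
variable (k U L) in
/-- The product of `U ⊗ U ⊗ U ⊗ L`. -/
noncomputable def mul₃ : U ⊗[k] (U ⊗[k] (U ⊗[k] L)) →ₗ[k] U ⊗[k] (U ⊗[k] (U ⊗[k] L)) →ₗ[k]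
    U ⊗[k] (U ⊗[k] (U ⊗[k] L)) :=
  TensorProduct.map₂ (LinearMap.mul k U) (LinearMap.mul k (U ⊗[k] (U ⊗[k] L)))

theorem mul₃_tmul (x₁ x₂ x₃ y₁ y₂ y₃ : U) (x y : L) :
    mul₃ k U L (x₁ ⊗ₜ[k] (x₂ ⊗ₜ[k] (x₃ ⊗ₜ[k] x))) (y₁ ⊗ₜ[k] (y₂ ⊗ₜ[k] (y₃ ⊗ₜ[k] y))) =
      (x₁ * y₁) ⊗ₜ[k] ((x₂ * y₂) ⊗ₜ[k] ((x₃ * y₃) ⊗ₜ[k] (x * y))) := by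
  rw [mul₃, TensorProduct.map₂_apply_tmul]
  simp

theorem mul₃_eq (x y : U ⊗[k] (U ⊗[k] (U ⊗[k] L))) : mul₃ k U L x y = x * y := by
  have h : mul₃ k U L = LinearMap.mul k (U ⊗[k] (U ⊗[k] (U ⊗[k] L))) := by
    ext x₁ x₂ x₃ x y₁ y₂ y₃ y
    simp [mul₃]
  rw [h]
  exact LinearMap.mul_apply' x y

theorem twMul_core_left (D : HopfDual k U A) (B : BaseAlgebra k H L) (ι : H →ₐc[k] U)
    (P' P G' G : U ⊗[k] (U ⊗[k] L)) (a b c : A) (m l : L) :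
    twMul D B ι P' P (D.core L ((a ⊗ₜ[k] b) ⊗ₜ[k] (G' ⊗ₜ[k] G))) (c ⊗ₜ[k] (m ⊗ₜ[k] l)) =
      D.core₃ L ((a ⊗ₜ[k] (b ⊗ₜ[k] c)) ⊗ₜ[k]
        (mul₃ k U L ((1 : U) ⊗ₜ[k] inL₂ k U L m)
            (mul₃ k U L (B.coactLast ι G') (copFst k U L P')) ⊗ₜ[k]
          mul₃ k U L (mul₃ k U L (copFst k U L P) (B.coactLast ι G))
            ((1 : U) ⊗ₜ[k] inL₂ k U L l))) := by
  induction G' using TensorProduct.induction_on with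
  | zero => simp
  | add p q hp hq =>
    simp only [TensorProduct.add_tmul, TensorProduct.tmul_add, map_add, mul_add, add_mul,
      LinearMap.add_apply, hp, hq]
  | tmul g₁ g =>
  induction g using TensorProduct.induction_on with
  | zero => simp
  | add p q hp hq =>
    simp only [TensorProduct.add_tmul, TensorProduct.tmul_add, map_add, mul_add, add_mul,
      LinearMap.add_apply, hp, hq]
  | tmul g₂ m' =>
  induction G using TensorProduct.induction_on with
  | zero => simp
  | add p q hp hq =>
    simp only [TensorProduct.add_tmul, TensorProduct.tmul_add, map_add, mul_add, add_mul,
      LinearMap.add_apply, hp, hq]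
  | tmul f₁ f =>
  induction f using TensorProduct.induction_on with
  | zero => simp
  | add p q hp hq =>
    simp only [TensorProduct.add_tmul, TensorProduct.tmul_add, map_add, mul_add, add_mul,
      LinearMap.add_apply, hp, hq]
  | tmul f₂ l' =>
  rw [D.core_tmul, twMul_tmul]
  have e1 : B.coact₂ ι m' = (1 : U) ⊗ₜ[k] B.coactU ι m' := rfl
  have e2 : B.coact₂ ι l' = (1 : U) ⊗ₜ[k] B.coactU ι l' := rfl
  have e3 : B.coactLast ι (g₁ ⊗ₜ[k] (g₂ ⊗ₜ[k] m')) = g₁ ⊗ₜ[k] (g₂ ⊗ₜ[k] B.coactU ι m') := rfl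
  have e4 : B.coactLast ι (f₁ ⊗ₜ[k] (f₂ ⊗ₜ[k] l')) = f₁ ⊗ₜ[k] (f₂ ⊗ₜ[k] B.coactU ι l') := rfl
  rw [e1, e2, e3, e4]
  generalize B.coactU ι m' = Q'
  generalize B.coactU ι l' = Q
  induction Q' using TensorProduct.induction_on with
  | zero => simp
  | add p q hp hq =>
    simp only [TensorProduct.add_tmul, TensorProduct.tmul_add, map_add, mul_add, add_mul,
      LinearMap.add_apply, hp, hq]
  | tmul q₁' q₂' =>
  induction Q using TensorProduct.induction_on with
  | zero => simp
  | add p q hp hq =>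
    simp only [TensorProduct.add_tmul, TensorProduct.tmul_add, map_add, mul_add, add_mul,
      LinearMap.add_apply, hp, hq]
  | tmul q₁ q₂ =>
  induction P' using TensorProduct.induction_on with
  | zero => simp
  | add p q hp hq =>
    simp only [TensorProduct.add_tmul, TensorProduct.tmul_add, map_add, mul_add, add_mul,
      LinearMap.add_apply, hp, hq]
  | tmul p₁' p' =>
  induction p' using TensorProduct.induction_on with
  | zero => simp
  | add p q hp hq =>
    simp only [TensorProduct.add_tmul, TensorProduct.tmul_add, map_add, mul_add, add_mul,
      LinearMap.add_apply, hp, hq]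
  | tmul p₂' pl' =>
  induction P using TensorProduct.induction_on with
  | zero => simp
  | add p q hp hq =>
    simp only [TensorProduct.add_tmul, TensorProduct.tmul_add, map_add, mul_add, add_mul,
      LinearMap.add_apply, hp, hq]
  | tmul p₁ p =>
  induction p using TensorProduct.induction_on with
  | zero => simp
  | add p q hp hq =>
    simp only [TensorProduct.add_tmul, TensorProduct.tmul_add, map_add, mul_add, add_mul,
      LinearMap.add_apply, hp, hq]
  | tmul p₂ pl =>
  have c1 : copFst k U L (p₁' ⊗ₜ[k] (p₂' ⊗ₜ[k] pl')) =
      ∑ i ∈ (Coalgebra.Repr.arbitrary k p₁').index, (Coalgebra.Repr.arbitrary k p₁').left i ⊗ₜ[k]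
        ((Coalgebra.Repr.arbitrary k p₁').right i ⊗ₜ[k] (p₂' ⊗ₜ[k] pl')) := by
    simp only [copFst, AlgHom.comp_apply, Algebra.TensorProduct.map_tmul,
      Bialgebra.comulAlgHom_apply]
    rw [← (Coalgebra.Repr.arbitrary k p₁').eq, TensorProduct.sum_tmul, map_sum]
    rfl
  have c2 : copFst k U L (p₁ ⊗ₜ[k] (p₂ ⊗ₜ[k] pl)) =
      ∑ i ∈ (Coalgebra.Repr.arbitrary k p₁).index, (Coalgebra.Repr.arbitrary k p₁).left i ⊗ₜ[k]
        ((Coalgebra.Repr.arbitrary k p₁).right i ⊗ₜ[k] (p₂ ⊗ₜ[k] pl)) := by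
    simp only [copFst, AlgHom.comp_apply, Algebra.TensorProduct.map_tmul,
      Bialgebra.comulAlgHom_apply]
    rw [← (Coalgebra.Repr.arbitrary k p₁).eq, TensorProduct.sum_tmul, map_sum]
    rfl
  have i1 : ∀ x : L, inL₂ k U L x = (1 : U) ⊗ₜ[k] ((1 : U) ⊗ₜ[k] x) := fun _ => rfl
  rw [c1, c2, i1, i1]
  simp only [Algebra.TensorProduct.tmul_mul_tmul, one_mul, mul_one, D.core_tmul,
    Finset.mul_sum, Finset.sum_mul, TensorProduct.sum_tmul, TensorProduct.tmul_sum, map_sum,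
    D.core₃_tmul, mul₃_tmul, LinearMap.sum_apply, D.lact_mul, D.ract_mul, D.lact_ract, D.ract_ract, D.lact_lact, mul_assoc]

theorem twMul_core_right (D : HopfDual k U A) (B : BaseAlgebra k H L) (ι : H →ₐc[k] U)
    (P' P G' G : U ⊗[k] (U ⊗[k] L)) (a b c : A) (m l : L) :
    twMul D B ι P' P (a ⊗ₜ[k] (m ⊗ₜ[k] l)) (D.core L ((b ⊗ₜ[k] c) ⊗ₜ[k] (G' ⊗ₜ[k] G))) =
      D.core₃ L ((a ⊗ₜ[k] (b ⊗ₜ[k] c)) ⊗ₜ[k]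
        (mul₃ k U L ((1 : U) ⊗ₜ[k] G') (copSnd k U L (B.coact₂ ι m * P')) ⊗ₜ[k]
          mul₃ k U L (copSnd k U L (P * B.coact₂ ι l)) ((1 : U) ⊗ₜ[k] G))) := by
  induction G' using TensorProduct.induction_on with
  | zero => simp
  | add p q hp hq =>
    simp only [TensorProduct.add_tmul, TensorProduct.tmul_add, map_add, mul_add, add_mul,
      LinearMap.add_apply, hp, hq]
  | tmul g₁ g =>
  induction g using TensorProduct.induction_on with
  | zero => simp
  | add p q hp hq =>
    simp only [TensorProduct.add_tmul, TensorProduct.tmul_add, map_add, mul_add, add_mul,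
      LinearMap.add_apply, hp, hq]
  | tmul g₂ m' =>
  induction G using TensorProduct.induction_on with
  | zero => simp
  | add p q hp hq =>
    simp only [TensorProduct.add_tmul, TensorProduct.tmul_add, map_add, mul_add, add_mul,
      LinearMap.add_apply, hp, hq]
  | tmul f₁ f =>
  induction f using TensorProduct.induction_on with
  | zero => simp
  | add p q hp hq =>
    simp only [TensorProduct.add_tmul, TensorProduct.tmul_add, map_add, mul_add, add_mul,
      LinearMap.add_apply, hp, hq]
  | tmul f₂ l' =>
  rw [D.core_tmul, twMul_tmul]
  generalize B.coact₂ ι m * P' = X'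
  generalize P * B.coact₂ ι l = X
  induction X' using TensorProduct.induction_on with
  | zero => simp
  | add p q hp hq =>
    simp only [TensorProduct.add_tmul, TensorProduct.tmul_add, map_add, mul_add, add_mul,
      LinearMap.add_apply, hp, hq]
  | tmul p₁' p' =>
  induction p' using TensorProduct.induction_on with
  | zero => simp
  | add p q hp hq =>
    simp only [TensorProduct.add_tmul, TensorProduct.tmul_add, map_add, mul_add, add_mul,
      LinearMap.add_apply, hp, hq]
  | tmul p₂' pl' =>
  induction X using TensorProduct.induction_on with
  | zero => simp
  | add p q hp hq =>
    simp only [TensorProduct.add_tmul, TensorProduct.tmul_add, map_add, mul_add, add_mul,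
      LinearMap.add_apply, hp, hq]
  | tmul p₁ p =>
  induction p using TensorProduct.induction_on with
  | zero => simp
  | add p q hp hq =>
    simp only [TensorProduct.add_tmul, TensorProduct.tmul_add, map_add, mul_add, add_mul,
      LinearMap.add_apply, hp, hq]
  | tmul p₂ pl =>
  have c1 : ∀ (p₁ p₂ : U) (pl : L), copSnd k U L (p₁ ⊗ₜ[k] (p₂ ⊗ₜ[k] pl)) =
      ∑ i ∈ (Coalgebra.Repr.arbitrary k p₂).index, p₁ ⊗ₜ[k]
        ((Coalgebra.Repr.arbitrary k p₂).left i ⊗ₜ[k]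
          ((Coalgebra.Repr.arbitrary k p₂).right i ⊗ₜ[k] pl)) := by
    intro p₁ p₂ pl
    simp only [copSnd, AlgHom.comp_apply, Algebra.TensorProduct.map_tmul,
      Bialgebra.comulAlgHom_apply]
    rw [← (Coalgebra.Repr.arbitrary k p₂).eq, TensorProduct.sum_tmul, map_sum,
      TensorProduct.tmul_sum]
    rfl
  have i1 : ∀ x : L, inL₂ k U L x = (1 : U) ⊗ₜ[k] ((1 : U) ⊗ₜ[k] x) := fun _ => rfl
  rw [c1, c1, i1, i1]
  simp only [Algebra.TensorProduct.tmul_mul_tmul, one_mul, mul_one, D.core_tmul,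
    Finset.mul_sum, Finset.sum_mul, TensorProduct.sum_tmul, TensorProduct.tmul_sum, map_sum,
    D.core₃_tmul, mul₃_tmul, LinearMap.sum_apply, D.lact_mul, D.ract_mul, D.lact_ract, D.ract_ract, D.lact_lact]


/-! commutation -/
/-- The iterated coaction. -/
noncomputable def BaseAlgebra.delta₂ (B : BaseAlgebra k H L) (ι : H →ₐc[k] U) (x : L) :
    U ⊗[k] (U ⊗[k] L) :=
  TensorProduct.assoc k U U L ((Coalgebra.comul (R := k) (A := U)).rTensor L (B.coactU ι x))

theorem copSnd_coact₂ (B : BaseAlgebra k H L) (ι : H →ₐc[k] U) (x : L) :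
    copSnd k U L (B.coact₂ ι x) = (1 : U) ⊗ₜ[k] B.delta₂ ι x := rfl

theorem comul_ι (ι : H →ₐc[k] U) (h : H) : Coalgebra.comul (R := k) (ι h) =
    TensorProduct.map ι.toCoalgHom.toLinearMap ι.toCoalgHom.toLinearMap
      (Coalgebra.comul (R := k) h) := by
  exact (CoalgHomClass.map_comp_comul_apply ι h).symm

theorem delta₂_eq (B : BaseAlgebra k H L) (ι : H →ₐc[k] U) (x : L) :
    B.delta₂ ι x = (B.coactU ι).toLinearMap.lTensor U (B.coactU ι x) := by
  have h := B.coassoc x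
  have h2 := congrArg (TensorProduct.map ι.toCoalgHom.toLinearMap
    (ι.toCoalgHom.toLinearMap.rTensor L)) h
  have e : ∀ x, B.coactU ι x = ι.toCoalgHom.toLinearMap.rTensor L (B.coact x) := fun x => rfl
  rw [BaseAlgebra.delta₂, e]
  trans (TensorProduct.map ι.toCoalgHom.toLinearMap
    (ι.toCoalgHom.toLinearMap.rTensor L)) ((TensorProduct.assoc k H H L)
       ((LinearMap.rTensor L Coalgebra.comul) (B.coact x)))
  · induction B.coact x using TensorProduct.induction_on with
    | zero => simp
    | add p q hp hq => simp only [map_add, hp, hq]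
    | tmul p q =>
      simp only [LinearMap.rTensor_tmul]
      change TensorProduct.assoc k U U L (Coalgebra.comul (R := k) (ι p) ⊗ₜ[k] q) = _
      rw [comul_ι]
      induction Coalgebra.comul (R := k) p using TensorProduct.induction_on with
      | zero => simp
      | add p q hp hq => simp only [map_add, TensorProduct.add_tmul, hp, hq]
      | tmul p q => simp
  · rw [h2]
    induction B.coact x using TensorProduct.induction_on with
    | zero => simp
    | add p q hp hq => simp only [map_add, hp, hq]
    | tmul p q =>
      simp only [LinearMap.rTensor_tmul, LinearMap.lTensor_tmul, TensorProduct.map_tmul]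
      rfl

theorem coactLast_coact₂ (B : BaseAlgebra k H L) (ι : H →ₐc[k] U) (x : L) :
    B.coactLast ι (B.coact₂ ι x) = copSnd k U L (B.coact₂ ι x) := by
  rw [copSnd_coact₂, delta₂_eq]
  rfl

theorem coactLast_inL₂ (B : BaseAlgebra k H L) (ι : H →ₐc[k] U) (x : L) :
    B.coactLast ι (inL₂ k U L x) = (1 : U) ⊗ₜ[k] B.coact₂ ι x := rfl

/-- `(f₁ ⊗ f₂ ⊗ f) ⊗ (h₁ ⊗ h₂ ⊗ h₃ ⊗ x) ↦ h₁ f₁ ⊗ h₂ f₂ ⊗ (h₃ ▷ f) x`. -/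
noncomputable def psi (B : BaseAlgebra k H L) (ι : H →ₐc[k] U) :
    U ⊗[k] (U ⊗[k] L) →ₗ[k] H ⊗[k] (H ⊗[k] (H ⊗[k] L)) →ₗ[k] U ⊗[k] (U ⊗[k] L) :=
  TensorProduct.map₂ (LinearMap.mul k U ∘ₗ ι.toCoalgHom.toLinearMap).flip
    (TensorProduct.map₂ (LinearMap.mul k U ∘ₗ ι.toCoalgHom.toLinearMap).flip
      (LinearMap.mk₂ k (fun f w => LinearMap.mul' k L ((B.act.toLinearMap.flip f).rTensor L w))
        (by intros; simp [LinearMap.rTensor_add]) (by intros; simp [LinearMap.rTensor_smul])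
        (by intros; simp) (by intros; simp)))


end TwistedDual

section TwistedDual

variable {k H U L A : Type*} [Field k] [Ring H] [HopfAlgebra k H] [Ring U] [HopfAlgebra k U]
  [Ring L] [Algebra k L] [Ring A] [HopfAlgebra k A]
theorem delta₂_comm (B : BaseAlgebra k H L) (ι : H →ₐc[k] U) (J : DynamicalTwist B ι) (x : L) :
    (J.F : U ⊗[k] (U ⊗[k] L)) * B.delta₂ ι x = B.delta₂ ι x * J.F := by
  have hinv := J.invariant
  generalize (J.F : U ⊗[k] (U ⊗[k] L)) = F at hinv ⊢
  -- left side
  have e : ∀ x, B.coactU ι x = ι.toCoalgHom.toLinearMap.rTensor L (B.coact x) := fun x => rfl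
  have i1 : ∀ x : L, inL₂ k U L x = (1 : U) ⊗ₜ[k] ((1 : U) ⊗ₜ[k] x) := fun _ => rfl
  have l1 : ∀ w : H ⊗[k] L, F * TensorProduct.assoc k U U L
      ((Coalgebra.comul (R := k) (A := U)).rTensor L (ι.toCoalgHom.toLinearMap.rTensor L w)) =
      psi B ι F ((((TensorProduct.assoc k H H L).toLinearMap ∘ₗ
        (Coalgebra.comul (R := k) (A := H)).rTensor L).lTensor H) (TensorProduct.assoc k H H L
          ((Coalgebra.comul (R := k) (A := H)).rTensor L w))) := by
    intro w
    induction w using TensorProduct.induction_on with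
    | zero => simp
    | add p q hp hq => simp only [map_add, mul_add, hp, hq]
    | tmul h m =>
      have a1 : F * TensorProduct.assoc k U U L
        ((Coalgebra.comul (R := k) (A := U)).rTensor L
          (ι.toCoalgHom.toLinearMap.rTensor L (h ⊗ₜ[k] m))) =
          (F * inUU L (Coalgebra.comul (R := k) (ι h))) * inL₂ k U L m := by
        rw [mul_assoc]
        congr 1
        change TensorProduct.assoc k U U L (Coalgebra.comul (R := k) (ι h) ⊗ₜ[k] m) = _
        induction Coalgebra.comul (R := k) (ι h) using TensorProduct.induction_on with
        | zero => simp
        | add p q hp hq => simp only [map_add, TensorProduct.add_tmul, hp, hq, add_mul]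
        | tmul p q => simp [inUU, i1]
      rw [a1, ← hinv h]
      simp only [LinearMap.rTensor_tmul]
      clear hinv a1
      induction Coalgebra.comul (R := k) h using TensorProduct.induction_on with
      | zero => simp
      | add p q hp hq =>
        simp only [map_add, TensorProduct.add_tmul, hp, hq, add_mul, LinearMap.add_apply]
      | tmul p q =>
      simp only [TensorProduct.assoc_tmul, LinearMap.lTensor_tmul, LinearMap.comp_apply,
        LinearMap.rTensor_tmul, LinearEquiv.coe_coe]
      induction Coalgebra.comul (R := k) q using TensorProduct.induction_on with
      | zero => simp
      | add p q hp hq =>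
        simp only [map_add, TensorProduct.add_tmul, TensorProduct.tmul_add, hp, hq, add_mul,
          LinearMap.add_apply]
      | tmul q r =>
      induction F using TensorProduct.induction_on with
      | zero => simp
      | add p q hp hq => simp only [map_add, hp, hq, add_mul, LinearMap.add_apply]
      | tmul f₁ f =>
      induction f using TensorProduct.induction_on with
      | zero => simp
      | add p q hp hq =>
        simp only [map_add, TensorProduct.tmul_add, hp, hq, add_mul, LinearMap.add_apply]
      | tmul f₂ f =>
      rw [i1]
      simp [psi, BaseAlgebra.leftAct]
      rfl
  have l2 : B.delta₂ ι x * F = psi B ι F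
      ((B.coact.toLinearMap.lTensor H).lTensor H (TensorProduct.assoc k H H L
          ((Coalgebra.comul (R := k) (A := H)).rTensor L (B.coact x)))) := by
    rw [BaseAlgebra.delta₂, e]
    clear hinv l1
    induction B.coact x using TensorProduct.induction_on with
    | zero => simp
    | add p q hp hq => simp only [map_add, add_mul, hp, hq]
    | tmul h m =>
    have a1 : TensorProduct.assoc k U U L ((Coalgebra.comul (R := k) (A := U)).rTensor L
          (ι.toCoalgHom.toLinearMap.rTensor L (h ⊗ₜ[k] m))) =
        TensorProduct.assoc k U U L ((Coalgebra.comul (R := k) (ι h)) ⊗ₜ[k] m) := rfl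
    rw [a1, comul_ι]
    simp only [LinearMap.rTensor_tmul]
    induction Coalgebra.comul (R := k) h using TensorProduct.induction_on with
    | zero => simp
    | add p q hp hq =>
      simp only [map_add, TensorProduct.add_tmul, hp, hq, add_mul]
    | tmul p q =>
    induction F using TensorProduct.induction_on with
    | zero => simp
    | add p q hp hq => simp only [map_add, hp, hq, mul_add, LinearMap.add_apply]
    | tmul f₁ f =>
    induction f using TensorProduct.induction_on with
    | zero => simp
    | add p q hp hq =>
      simp only [map_add, TensorProduct.tmul_add, hp, hq, mul_add, LinearMap.add_apply]
    | tmul f₂ f =>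
    simp [psi, B.comm m f]
  have l3 : (((TensorProduct.assoc k H H L).toLinearMap ∘ₗ
        (Coalgebra.comul (R := k) (A := H)).rTensor L).lTensor H) (TensorProduct.assoc k H H L
          ((Coalgebra.comul (R := k) (A := H)).rTensor L (B.coact x))) =
      (B.coact.toLinearMap.lTensor H).lTensor H (TensorProduct.assoc k H H L
          ((Coalgebra.comul (R := k) (A := H)).rTensor L (B.coact x))) := by
    rw [B.coassoc x]
    induction B.coact x using TensorProduct.induction_on with
    | zero => simp
    | add p q hp hq => simp only [map_add, hp, hq]
    | tmul p q =>
      have := B.coassoc q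
      simp only [LinearMap.lTensor_tmul, LinearMap.comp_apply, LinearEquiv.coe_coe]
      exact congrArg (p ⊗ₜ[k] ·) this
  rw [l2, ← l3, ← l1, BaseAlgebra.delta₂, e]

theorem assoc_aux₁ {R : Type*} [Monoid R] {cF lF sF oF d x y : R} (h : cF * lF = sF * oF)
    (h2 : oF * d = d * oF) : cF * (lF * d * x) * y = sF * d * (oF * x * y) := by
  rw [show cF * (lF * d * x) * y = cF * lF * d * x * y by simp only [mul_assoc], h,
    mul_assoc sF, h2]
  simp only [mul_assoc]

theorem assoc_aux₂ {R : Type*} [Monoid R] {cF lF sF oF d x y : R} (h : lF * cF = oF * sF)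
    (h2 : oF * d = d * oF) : y * (x * (d * lF) * cF) = y * (x * oF) * (d * sF) := by
  rw [show y * (x * (d * lF) * cF) = y * x * (d * (lF * cF)) by simp only [mul_assoc], h,
    ← mul_assoc d, ← h2]
  simp only [mul_assoc]

theorem inv_aux {R : Type*} [Monoid R] {cF lF sF oF cG lG sG oG : R} (h : cF * lF = sF * oF)
    (h1 : cG * cF = 1) (h2 : lG * lF = 1) (h3 : sF * sG = 1) (h4 : oF * oG = 1) :
    lG * cG = oG * sG := by
  calc lG * cG = lG * cG * (sF * oF * (oG * sG)) := by
        rw [mul_assoc sF, ← mul_assoc oF, h4, one_mul, h3, mul_one]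
    _ = lG * (cG * cF) * lF * (oG * sG) := by rw [← h]; simp only [mul_assoc]
    _ = oG * sG := by rw [h1, mul_one, h2, one_mul]

theorem DynamicalTwist.cocycle_inv {B : BaseAlgebra k H L} {ι : H →ₐc[k] U}
    (J : DynamicalTwist B ι) :
    B.coactLast ι (↑J.F⁻¹ : U ⊗[k] (U ⊗[k] L)) * copFst k U L (↑J.F⁻¹ : U ⊗[k] (U ⊗[k] L)) =
      ((1 : U) ⊗ₜ[k] (↑J.F⁻¹ : U ⊗[k] (U ⊗[k] L))) *
        copSnd k U L (↑J.F⁻¹ : U ⊗[k] (U ⊗[k] L)) := by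
  refine inv_aux J.cocycle ?_ ?_ ?_ ?_
  · rw [← map_mul, Units.inv_mul, map_one]
  · rw [← map_mul, Units.inv_mul, map_one]
  · rw [← map_mul, Units.mul_inv, map_one]
  · rw [Algebra.TensorProduct.tmul_mul_tmul, Units.mul_inv, one_mul]; rfl

theorem delta₂_comm_inv (B : BaseAlgebra k H L) (ι : H →ₐc[k] U) (J : DynamicalTwist B ι) (x : L) :
    (↑J.F⁻¹ : U ⊗[k] (U ⊗[k] L)) * B.delta₂ ι x = B.delta₂ ι x * (↑J.F⁻¹ : U ⊗[k] (U ⊗[k] L)) := by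
  rw [Units.inv_mul_eq_iff_eq_mul, ← mul_assoc, delta₂_comm, mul_assoc, Units.mul_inv, mul_one]

theorem twMul_assoc_tmul (D : HopfDual k U A) {B : BaseAlgebra k H L} {ι : H →ₐc[k] U}
    (J : DynamicalTwist B ι) (a b c : A) (m l m' l' m'' l'' : L) :
    twMul D B ι ↑J.F⁻¹ J.F (twMul D B ι ↑J.F⁻¹ J.F (a ⊗ₜ[k] (m ⊗ₜ[k] l)) (b ⊗ₜ[k] (m' ⊗ₜ[k] l')))
        (c ⊗ₜ[k] (m'' ⊗ₜ[k] l'')) =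
      twMul D B ι ↑J.F⁻¹ J.F (a ⊗ₜ[k] (m ⊗ₜ[k] l))
        (twMul D B ι ↑J.F⁻¹ J.F (b ⊗ₜ[k] (m' ⊗ₜ[k] l')) (c ⊗ₜ[k] (m'' ⊗ₜ[k] l''))) := by
  have o : ∀ x y : U ⊗[k] (U ⊗[k] L), (1 : U) ⊗ₜ[k] (x * y) = ((1 : U) ⊗ₜ[k] x) * ((1 : U) ⊗ₜ[k] y) := by
    intro x y
    rw [Algebra.TensorProduct.tmul_mul_tmul, one_mul]
  rw [twMul_tmul D B ι _ _ a b, twMul_tmul D B ι _ _ b c, twMul_core_left, twMul_core_right]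
  simp only [mul₃_eq]
  congr 2
  congr 1
  · rw [map_mul, map_mul, map_mul, coactLast_coact₂, coactLast_inL₂, o, o]
    refine assoc_aux₂ J.cocycle_inv ?_
    rw [copSnd_coact₂, ← o, delta₂_comm_inv, o]
  · rw [map_mul, map_mul, map_mul, coactLast_coact₂, coactLast_inL₂, o, o]
    refine assoc_aux₁ J.cocycle ?_
    rw [copSnd_coact₂, ← o, delta₂_comm, o]

variable (k U L) in
/-- `ε ⊗ id ⊗ id`. -/
noncomputable def counitFst : U ⊗[k] (U ⊗[k] L) →ₐ[k] U ⊗[k] L :=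
  ((Algebra.TensorProduct.lid k (U ⊗[k] L)) : _ →ₐ[k] _).comp
    (Algebra.TensorProduct.map (Bialgebra.counitAlgHom k U) (AlgHom.id k (U ⊗[k] L)))

variable (k U L) in
/-- `id ⊗ ε ⊗ id`. -/
noncomputable def counitSnd : U ⊗[k] (U ⊗[k] L) →ₐ[k] U ⊗[k] L :=
  Algebra.TensorProduct.map (AlgHom.id k U)
    (((Algebra.TensorProduct.lid k L) : _ →ₐ[k] _).comp
      (Algebra.TensorProduct.map (Bialgebra.counitAlgHom k U) (AlgHom.id k L)))

theorem core_one_left (D : HopfDual k U A) (b : A) (G' G : U ⊗[k] (U ⊗[k] L)) :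
    D.core L (((1 : A) ⊗ₜ[k] b) ⊗ₜ[k] (G' ⊗ₜ[k] G)) =
      D.base L (b ⊗ₜ[k] (counitFst k U L G' ⊗ₜ[k] counitFst k U L G)) := by
  have h : D.core L ∘ₗ TensorProduct.mk k (A ⊗[k] A) _ (1 ⊗ₜ b) =
      D.base L ∘ₗ TensorProduct.mk k A _ b ∘ₗ
        TensorProduct.map (counitFst k U L).toLinearMap (counitFst k U L).toLinearMap := by
    ext g₁ g₂ m f₁ f₂ l
    change D.core L ((1 ⊗ₜ[k] b) ⊗ₜ[k] ((g₁ ⊗ₜ[k] (g₂ ⊗ₜ[k] m)) ⊗ₜ[k] (f₁ ⊗ₜ[k] (f₂ ⊗ₜ[k] l)))) =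
      D.base L (b ⊗ₜ[k] ((Coalgebra.counit (R := k) g₁ • (g₂ ⊗ₜ[k] m)) ⊗ₜ[k]
        (Coalgebra.counit (R := k) f₁ • (f₂ ⊗ₜ[k] l))))
    rw [D.core_tmul, D.lact_one, map_smul, D.ract_one, ← TensorProduct.smul_tmul',
      TensorProduct.tmul_smul, TensorProduct.tmul_smul, TensorProduct.tmul_smul, map_smul,
      map_smul, smul_mul_assoc, smul_mul_assoc, one_mul, ← TensorProduct.smul_tmul',
      ← TensorProduct.smul_tmul', smul_comm]
    rfl
  exact LinearMap.congr_fun h (G' ⊗ₜ[k] G)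

theorem core_one_right (D : HopfDual k U A) (b : A) (G' G : U ⊗[k] (U ⊗[k] L)) :
    D.core L ((b ⊗ₜ[k] (1 : A)) ⊗ₜ[k] (G' ⊗ₜ[k] G)) =
      D.base L (b ⊗ₜ[k] (counitSnd k U L G' ⊗ₜ[k] counitSnd k U L G)) := by
  have h : D.core L ∘ₗ TensorProduct.mk k (A ⊗[k] A) _ (b ⊗ₜ 1) =
      D.base L ∘ₗ TensorProduct.mk k A _ b ∘ₗ
        TensorProduct.map (counitSnd k U L).toLinearMap (counitSnd k U L).toLinearMap := by
    ext g₁ g₂ m f₁ f₂ l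
    change D.core L ((b ⊗ₜ[k] 1) ⊗ₜ[k] ((g₁ ⊗ₜ[k] (g₂ ⊗ₜ[k] m)) ⊗ₜ[k] (f₁ ⊗ₜ[k] (f₂ ⊗ₜ[k] l)))) =
      D.base L (b ⊗ₜ[k] ((g₁ ⊗ₜ[k] (Coalgebra.counit (R := k) g₂ • m)) ⊗ₜ[k]
        (f₁ ⊗ₜ[k] (Coalgebra.counit (R := k) f₂ • l))))
    rw [D.core_tmul, D.lact_one, map_smul, D.ract_one, TensorProduct.tmul_smul,
      TensorProduct.tmul_smul, ← TensorProduct.smul_tmul',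
      TensorProduct.tmul_smul, TensorProduct.tmul_smul, TensorProduct.tmul_smul, map_smul,
      map_smul, mul_smul_comm, mul_smul_comm, mul_one, ← TensorProduct.smul_tmul',
      ← TensorProduct.smul_tmul', smul_comm]
    rfl
  exact LinearMap.congr_fun h (G' ⊗ₜ[k] G)

theorem DynamicalTwist.counitFst_F {B : BaseAlgebra k H L} {ι : H →ₐc[k] U}
    (J : DynamicalTwist B ι) : counitFst k U L J.F = 1 := J.norm_fst

theorem DynamicalTwist.counitSnd_F {B : BaseAlgebra k H L} {ι : H →ₐc[k] U}
    (J : DynamicalTwist B ι) : counitSnd k U L J.F = 1 := J.norm_snd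

theorem map_inv_of_one {R S : Type*} [Semiring R] [Semiring S] [Algebra k R] [Algebra k S]
    (f : R →ₐ[k] S) (u : Rˣ) (h : f u = 1) : f ↑u⁻¹ = 1 := by
  have : f u * f ↑u⁻¹ = 1 := by rw [← map_mul, Units.mul_inv, map_one]
  rwa [h, one_mul] at this

theorem base_tmul (D : HopfDual k U A) (b : A) (m l : L) :
    D.base L (b ⊗ₜ[k] (((1 : U) ⊗ₜ[k] m) ⊗ₜ[k] ((1 : U) ⊗ₜ[k] l))) = b ⊗ₜ[k] (m ⊗ₜ[k] l) := by
  simp [HopfDual.base, D.lact_unit, D.ract_unit]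

theorem counitSnd_coact₂ (B : BaseAlgebra k H L) (ι : H →ₐc[k] U) (x : L) :
    counitSnd k U L (B.coact₂ ι x) = (1 : U) ⊗ₜ[k] x := by
  have h := B.counit x
  change (1 : U) ⊗ₜ[k] (TensorProduct.lid k L ((Coalgebra.counit (R := k) (A := U)).rTensor L
    (B.coactU ι x))) = _
  congr 1
  refine Eq.trans ?_ h
  change TensorProduct.lid k L ((Coalgebra.counit (R := k) (A := U)).rTensor L
    (ι.toCoalgHom.toLinearMap.rTensor L (B.coact x))) = _
  induction B.coact x using TensorProduct.induction_on with
  | zero => simp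
  | add p q hp hq => simp only [map_add, hp, hq]
  | tmul p q => simp

theorem twMul_one_left (D : HopfDual k U A) {B : BaseAlgebra k H L} {ι : H →ₐc[k] U}
    (J : DynamicalTwist B ι) (b : A) (m l : L) :
    twMul D B ι ↑J.F⁻¹ J.F ((1 : A) ⊗ₜ[k] ((1 : L) ⊗ₜ[k] (1 : L))) (b ⊗ₜ[k] (m ⊗ₜ[k] l)) =
      b ⊗ₜ[k] (m ⊗ₜ[k] l) := by
  have e : ∀ x : L, counitFst k U L (inL₂ k U L x) = (1 : U) ⊗ₜ[k] x := fun x => by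
    simp [counitFst, inL₂]
  rw [twMul_tmul, core_one_left, map_one, one_mul, mul_one, map_mul, map_mul, J.counitFst_F,
    map_inv_of_one _ _ J.counitFst_F, one_mul, mul_one, e, e, base_tmul]

theorem twMul_one_right (D : HopfDual k U A) {B : BaseAlgebra k H L} {ι : H →ₐc[k] U}
    (J : DynamicalTwist B ι) (b : A) (m l : L) :
    twMul D B ι ↑J.F⁻¹ J.F (b ⊗ₜ[k] (m ⊗ₜ[k] l)) ((1 : A) ⊗ₜ[k] ((1 : L) ⊗ₜ[k] (1 : L))) =
      b ⊗ₜ[k] (m ⊗ₜ[k] l) := by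
  rw [twMul_tmul, core_one_right, map_one, one_mul, mul_one, map_mul, map_mul, J.counitSnd_F,
    map_inv_of_one _ _ J.counitSnd_F, one_mul, mul_one, counitSnd_coact₂, counitSnd_coact₂,
    base_tmul]

theorem tripleInduction {p : A ⊗[k] (L ⊗[k] L) → Prop} (x : A ⊗[k] (L ⊗[k] L))
    (h0 : p 0) (hadd : ∀ x y, p x → p y → p (x + y))
    (h : ∀ a m l, p (a ⊗ₜ[k] (m ⊗ₜ[k] l))) : p x := by
  induction x using TensorProduct.induction_on with
  | zero => exact h0
  | add x y hx hy => exact hadd x y hx hy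
  | tmul a y =>
    induction y using TensorProduct.induction_on with
    | zero => simpa using h0
    | add x y hx hy => rw [TensorProduct.tmul_add]; exact hadd _ _ hx hy
    | tmul m l => exact h a m l

theorem twMul_assoc (D : HopfDual k U A) {B : BaseAlgebra k H L} {ι : H →ₐc[k] U}
    (J : DynamicalTwist B ι) (x y z : A ⊗[k] (L ⊗[k] L)) :
    twMul D B ι ↑J.F⁻¹ J.F (twMul D B ι ↑J.F⁻¹ J.F x y) z =
      twMul D B ι ↑J.F⁻¹ J.F x (twMul D B ι ↑J.F⁻¹ J.F y z) := by
  generalize hT : twMul D B ι (↑J.F⁻¹ : U ⊗[k] (U ⊗[k] L)) (J.F : U ⊗[k] (U ⊗[k] L)) = T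
  refine tripleInduction (p := fun x => T (T x y) z = T x (T y z)) x ?_ ?_ fun a m l => ?_
  · simp only [map_zero, LinearMap.zero_apply]
  · intro _ _ h h'
    simp only [map_add, LinearMap.add_apply, h, h']
  refine tripleInduction (p := fun y => T (T _ y) z = T _ (T y z)) y ?_ ?_ fun b m' l' => ?_
  · simp only [map_zero, LinearMap.zero_apply]
  · intro _ _ h h'
    simp only [map_add, LinearMap.add_apply, h, h']
  refine tripleInduction (p := fun z => T (T _ _) z = T _ (T _ z)) z ?_ ?_ fun c m'' l'' => ?_
  · simp only [map_zero]
  · intro _ _ h h'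
    simp only [map_add, h, h']
  rw [← hT]
  exact twMul_assoc_tmul D J a b c m l m' l' m'' l''

/-- The twisted dual: the space `A ⊗ L_op ⊗ L`, where `A` is the dual of `U`, with the product
twisted by `F⁻¹ ⊗ F`. -/
def TwistedDual (_D : HopfDual k U A) {B : BaseAlgebra k H L} {ι : H →ₐc[k] U}
    (_J : DynamicalTwist B ι) : Type _ := A ⊗[k] (L ⊗[k] L)

namespace TwistedDual

variable (D : HopfDual k U A) {B : BaseAlgebra k H L} {ι : H →ₐc[k] U} (J : DynamicalTwist B ι)

noncomputable instance instAddCommGroup : AddCommGroup (TwistedDual D J) :=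
  inferInstanceAs (AddCommGroup (A ⊗[k] (L ⊗[k] L)))

noncomputable instance : Module k (TwistedDual D J) :=
  inferInstanceAs (Module k (A ⊗[k] (L ⊗[k] L)))

/-- The element `a ⊗ μ ⊗ l`. -/
noncomputable def elem (a : A) (m l : L) : TwistedDual D J := a ⊗ₜ[k] (m ⊗ₜ[k] l)

/-- The twisted product. -/
noncomputable def mulMap : TwistedDual D J →ₗ[k] TwistedDual D J →ₗ[k] TwistedDual D J :=
  twMul D B ι (↑J.F⁻¹ : U ⊗[k] (U ⊗[k] L)) (J.F : U ⊗[k] (U ⊗[k] L))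

noncomputable instance : Ring (TwistedDual D J) where
  __ := instAddCommGroup D J
  mul x y := mulMap D J x y
  one := elem D J 1 1 1
  mul_assoc := twMul_assoc D J
  one_mul x := tripleInduction (k := k) (p := fun x => mulMap D J (elem D J 1 1 1) x = x) x
    (map_zero _) (fun x y h h' => (map_add (mulMap D J (elem D J 1 1 1)) x y).trans
      (congrArg₂ _ h h')) (twMul_one_left D J)
  mul_one x := tripleInduction (k := k) (p := fun x => (mulMap D J).flip (elem D J 1 1 1) x = x) x
    (map_zero _) (fun x y h h' => (map_add ((mulMap D J).flip (elem D J 1 1 1)) x y).trans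
      (congrArg₂ _ h h')) (twMul_one_right D J)
  zero_mul x := LinearMap.congr_fun (map_zero (mulMap D J)) x
  mul_zero x := map_zero (mulMap D J x)
  left_distrib x y z := map_add (mulMap D J x) y z
  right_distrib x y z := LinearMap.congr_fun (map_add (mulMap D J) x y) z

theorem mul_eq (x y : TwistedDual D J) : x * y = mulMap D J x y := rfl
theorem one_eq : (1 : TwistedDual D J) = elem D J 1 1 1 := rfl

noncomputable instance : Algebra k (TwistedDual D J) :=
  Algebra.ofModule (fun r x y => LinearMap.congr_fun (map_smul (mulMap D J) r x) y)
    (fun r x y => map_smul (mulMap D J x) r y)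

/-- The explicit product. -/
theorem elem_mul_elem (a b : A) (m l m' l' : L) :
    elem D J a m l * elem D J b m' l' = D.core L ((a ⊗ₜ[k] b) ⊗ₜ[k]
      ((inL₂ k U L m' * (B.coact₂ ι m * (↑J.F⁻¹ : U ⊗[k] (U ⊗[k] L)))) ⊗ₜ[k]
        ((J.F : U ⊗[k] (U ⊗[k] L)) * B.coact₂ ι l * inL₂ k U L l'))) := rfl

theorem elem_mul_source (a : A) (m l l' : L) :
    elem D J a m l * elem D J 1 1 l' = elem D J a m (l * l') := by
  rw [elem_mul_elem, core_one_right]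
  have e : ∀ x : L, counitSnd k U L (inL₂ k U L x) = (1 : U) ⊗ₜ[k] x := fun x => by
    simp [counitSnd, inL₂]
  rw [map_mul, map_mul, map_mul, map_mul, J.counitSnd_F, map_inv_of_one _ _ J.counitSnd_F,
    counitSnd_coact₂, counitSnd_coact₂, e, e, one_mul, mul_one,
    Algebra.TensorProduct.tmul_mul_tmul, Algebra.TensorProduct.tmul_mul_tmul, one_mul, one_mul,
    base_tmul]
  rfl

theorem elem_mul_target (a : A) (m l m' : L) :
    elem D J a m l * elem D J 1 m' 1 = elem D J a (m' * m) l := by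
  rw [elem_mul_elem, core_one_right]
  have e : ∀ x : L, counitSnd k U L (inL₂ k U L x) = (1 : U) ⊗ₜ[k] x := fun x => by
    simp [counitSnd, inL₂]
  rw [map_mul, map_mul, map_mul, map_mul, J.counitSnd_F, map_inv_of_one _ _ J.counitSnd_F,
    counitSnd_coact₂, counitSnd_coact₂, e, e, one_mul, mul_one,
    Algebra.TensorProduct.tmul_mul_tmul, Algebra.TensorProduct.tmul_mul_tmul, one_mul, mul_one,
    base_tmul]
  rfl

/-- The source map `s(l) = 1 ⊗ 1 ⊗ l`. -/
noncomputable def source : L →ₐ[k] TwistedDual D J :=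
  AlgHom.ofLinearMap
    (TensorProduct.mk k A (L ⊗[k] L) 1 ∘ₗ TensorProduct.mk k L L 1 : L →ₗ[k] A ⊗[k] (L ⊗[k] L))
    rfl (fun l l' => (elem_mul_source D J 1 1 l l').symm)

/-- The target map `t(m) = 1 ⊗ m ⊗ 1`. -/
noncomputable def target : Lᵐᵒᵖ →ₐ[k] TwistedDual D J :=
  AlgHom.ofLinearMap
    (TensorProduct.mk k A (L ⊗[k] L) 1 ∘ₗ (TensorProduct.mk k L L).flip 1 ∘ₗ
      (MulOpposite.opLinearEquiv k).symm.toLinearMap : Lᵐᵒᵖ →ₗ[k] A ⊗[k] (L ⊗[k] L))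
    rfl (fun m m' => (elem_mul_target D J 1 m.unop 1 m'.unop).symm)

theorem source_apply (l : L) : source D J l = elem D J 1 1 l := rfl
theorem target_apply (m : Lᵐᵒᵖ) : target D J m = elem D J 1 m.unop 1 := rfl

/-- The inclusion `a ↦ a ⊗ 1 ⊗ 1`; it is linear, not multiplicative. -/
noncomputable def inDual : A →ₗ[k] TwistedDual D J :=
  ((TensorProduct.mk k A (L ⊗[k] L)).flip ((1 : L) ⊗ₜ[k] (1 : L)) : A →ₗ[k] A ⊗[k] (L ⊗[k] L))

end TwistedDual
end TwistedDual

section Bialgebroid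

variable {k L B B' : Type*} [Field k] [Ring L] [Algebra k L] [Ring B] [Algebra k B]
  [Ring B'] [Algebra k B']

/-- The left ideal of `B ⊗ B` generated by the elements `s(l) ⊗ 1 - 1 ⊗ t(l)`. With the bimodule
structure `l . b . m = b s(m) t(l)`, it is spanned by the elements `b . l ⊗ b' - b ⊗ l . b'`. -/
def balancedIdeal (s : L →ₐ[k] B) (t : Lᵐᵒᵖ →ₐ[k] B) : Submodule (B ⊗[k] B) (B ⊗[k] B) :=
  Submodule.span (B ⊗[k] B)
    (Set.range fun l : L => s l ⊗ₜ[k] (1 : B) - (1 : B) ⊗ₜ[k] t (MulOpposite.op l))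

/-- The tensor product `B ⊗_L B`, as a left module over `B ⊗ B`. -/
abbrev BalancedTensor (s : L →ₐ[k] B) (t : Lᵐᵒᵖ →ₐ[k] B) : Type _ :=
  (B ⊗[k] B) ⧸ balancedIdeal s t

/-- The left ideal of `B ⊗ B ⊗ B` whose quotient is `B ⊗_L B ⊗_L B`. -/
def balancedIdeal₃ (s : L →ₐ[k] B) (t : Lᵐᵒᵖ →ₐ[k] B) :
    Submodule (B ⊗[k] (B ⊗[k] B)) (B ⊗[k] (B ⊗[k] B)) :=
  Submodule.span (B ⊗[k] (B ⊗[k] B))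
    ((Set.range fun l : L => s l ⊗ₜ[k] (1 : B ⊗[k] B) -
        (1 : B) ⊗ₜ[k] (t (MulOpposite.op l) ⊗ₜ[k] (1 : B))) ∪
      (Set.range fun l : L => (1 : B) ⊗ₜ[k] (s l ⊗ₜ[k] (1 : B)) -
        (1 : B) ⊗ₜ[k] ((1 : B) ⊗ₜ[k] t (MulOpposite.op l))))

/-- A right bialgebroid `(B, L, s, t)`. Products of elements of `B ⊗_L B` are computed on
representatives `z` in `B ⊗ B`; `takeuchi` says that `Δ` takes values in the Takeuchi algebra
`B ×_L B`, where this is legitimate. Coassociativity is the equality of `(Δ ⊗ id) ∘ Δ` and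
`(id ⊗ Δ) ∘ Δ` in `B ⊗_L B ⊗_L B`, computed with linear lifts `D : B → B ⊗ B` of `Δ`. -/
structure RightBialgebroid (s : L →ₐ[k] B) (t : Lᵐᵒᵖ →ₐ[k] B) where
  commute : ∀ (l : L) (m : Lᵐᵒᵖ), Commute (s l) (t m)
  comul : B →ₗ[k] BalancedTensor s t
  counit : B →ₗ[k] L
  takeuchi : ∀ (l : L) (b : B), (s l ⊗ₜ[k] (1 : B)) • comul b =
    ((1 : B) ⊗ₜ[k] t (MulOpposite.op l)) • comul b
  comul_bimodule : ∀ (b : B) (l m : L) (z : B ⊗[k] B), (balancedIdeal s t).mkQ z = comul b →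
    comul (b * t (MulOpposite.op l) * s m) =
      (balancedIdeal s t).mkQ (z * (t (MulOpposite.op l) ⊗ₜ[k] s m))
  comul_one : comul 1 = (balancedIdeal s t).mkQ 1
  comul_mul : ∀ (a b : B) (z : B ⊗[k] B), (balancedIdeal s t).mkQ z = comul a →
    comul (a * b) = z • comul b
  coassoc : ∀ D : B →ₗ[k] B ⊗[k] B, (∀ b, (balancedIdeal s t).mkQ (D b) = comul b) → ∀ b,
    (balancedIdeal₃ s t).mkQ (TensorProduct.assoc k B B B (D.rTensor B (D b))) =
      (balancedIdeal₃ s t).mkQ (D.lTensor B (D b))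
  counit_bimodule : ∀ (b : B) (l m : L),
    counit (b * t (MulOpposite.op l) * s m) = l * counit b * m
  counit_one : counit 1 = 1
  counit_source : ∀ a b : B, counit (s (counit a) * b) = counit (a * b)
  counit_target : ∀ a b : B, counit (t (MulOpposite.op (counit a)) * b) = counit (a * b)
  counit_comul : ∀ (b : B) (z : B ⊗[k] B), (balancedIdeal s t).mkQ z = comul b →
    LinearMap.mul' k B (TensorProduct.comm k B B (TensorProduct.map
      (t.toLinearMap ∘ₗ (MulOpposite.opLinearEquiv k).toLinearMap ∘ₗ counit) LinearMap.id z)) = b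
  comul_counit : ∀ (b : B) (z : B ⊗[k] B), (balancedIdeal s t).mkQ z = comul b →
    LinearMap.mul' k B (TensorProduct.map LinearMap.id (s.toLinearMap ∘ₗ counit) z) = b

/-- The anchor `l ⊣ b = ε(s(l) b)`. -/
def RightBialgebroid.anchor {s : L →ₐ[k] B} {t : Lᵐᵒᵖ →ₐ[k] B} (G : RightBialgebroid s t)
    (l : L) (b : B) : L := G.counit (s l * b)

/-- Homomorphisms of right bialgebroids over the same base `L`. -/
structure RightBialgebroid.IsHom {s : L →ₐ[k] B} {t : Lᵐᵒᵖ →ₐ[k] B} {s' : L →ₐ[k] B'}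
    {t' : Lᵐᵒᵖ →ₐ[k] B'} (G : RightBialgebroid s t) (G' : RightBialgebroid s' t')
    (φ : B →ₐ[k] B') : Prop where
  source : ∀ l : L, φ (s l) = s' l
  target : ∀ l : Lᵐᵒᵖ, φ (t l) = t' l
  counit : ∀ b : B, G'.counit (φ b) = G.counit b
  comul : ∀ (b : B) (z : B ⊗[k] B), (balancedIdeal s t).mkQ z = G.comul b →
    G'.comul (φ b) = (balancedIdeal s' t').mkQ (Algebra.TensorProduct.map φ φ z)

end Bialgebroid

section ExtendedFRT

variable {k H L n : Type*} [Field k] [Ring H] [HopfAlgebra k H] [Ring L] [Algebra k L]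
  [Fintype n] [DecidableEq n]

/-- The map `f ⊗ id : X ⊗ L → k ⊗ L = L`. -/
noncomputable def contract {X : Type*} [AddCommGroup X] [Module k X] (f : X →ₗ[k] k) :
    X ⊗[k] L →ₗ[k] L := (TensorProduct.lid k L).toLinearMap ∘ₗ f.rTensor L

/-- The matrix coefficient `x ↦ σ(x)ᵢⱼ`. -/
noncomputable def coeff {X : Type*} [Ring X] [Algebra k X] (σ : X →ₐ[k] Matrix n n k) (i j : n) :
    X →ₗ[k] k := Matrix.entryLinearMap k k i j ∘ₗ σ.toLinearMap

/-- The matrix coefficients of `(σ ⊗ σ) ∘ Δ`. -/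
noncomputable def coeff₂ (σ : H →ₐ[k] Matrix n n k) (p q : n × n) : H →ₗ[k] k :=
  LinearMap.mul' k k ∘ₗ TensorProduct.map (coeff σ p.1 q.1) (coeff σ p.2 q.2) ∘ₗ
    Coalgebra.comul (R := k)

/-- The matrix `S_op = S · (σ ⊗ σ)(Δ(γ(x₁))) ⊗ x∞`, where `x` is the `L`-component of `S`
and `x₁ ⊗ x∞` its coaction. -/
noncomputable def BaseAlgebra.opMatrix (B : BaseAlgebra k H L) (σ : H →ₐ[k] Matrix n n k)
    (S : Matrix (n × n) (n × n) L) : Matrix (n × n) (n × n) L :=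
  Matrix.of fun p q => ∑ r, contract (coeff₂ σ r q ∘ₗ HopfAlgebra.antipode k) (B.coact (S p r))

/-- Generators of the extended dynamical FRT algebra: `Tᵢⱼ`, `T̄ᵢⱼ`, and copies of `L`, `L_op`. -/
inductive FRTGen (L n : Type*) : Type _
  | T (i j : n) : FRTGen L n
  | Tbar (i j : n) : FRTGen L n
  | src (l : L) : FRTGen L n
  | tgt (l : L) : FRTGen L n

variable (k) in
/-- A matrix of generators, in the free algebra. -/
noncomputable def frtMat (g : n → n → FRTGen L n) : Matrix n n (FreeAlgebra k (FRTGen L n)) :=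
  Matrix.of fun i j => FreeAlgebra.ι k (g i j)

variable (k n) in
/-- The generator of the free algebra given by `l` in `L`. -/
noncomputable def frtSrc (l : L) : FreeAlgebra k (FRTGen L n) := FreeAlgebra.ι k (FRTGen.src l)

variable (k n) in
/-- The generator of the free algebra given by `l` in `L_op`. -/
noncomputable def frtTgt (l : L) : FreeAlgebra k (FRTGen L n) := FreeAlgebra.ι k (FRTGen.tgt l)

/-- `M₁ = M ⊗ 1`. -/
def leg₁ {R : Type*} [Ring R] (M : Matrix n n R) : Matrix (n × n) (n × n) R :=
  Matrix.kroneckerMap (· * ·) M 1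

/-- `M₂ = 1 ⊗ M`. -/
def leg₂ {R : Type*} [Ring R] (M : Matrix n n R) : Matrix (n × n) (n × n) R :=
  Matrix.kroneckerMap (· * ·) 1 M

variable (k) in
/-- The matrix `S` with coefficients in the copy of `L` (through `s`). -/
noncomputable def frtS (S : Matrix (n × n) (n × n) L) :
    Matrix (n × n) (n × n) (FreeAlgebra k (FRTGen L n)) := S.map (frtSrc k n)

/-- The matrix `S_op` with coefficients in the copy of `L_op` (through `t`). -/
noncomputable def frtSop (B : BaseAlgebra k H L) (σ : H →ₐ[k] Matrix n n k)
    (S : Matrix (n × n) (n × n) L) :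
    Matrix (n × n) (n × n) (FreeAlgebra k (FRTGen L n)) := (B.opMatrix σ S).map (frtTgt k n)

/-- The defining relations: `L` and `L_op` are commuting subalgebras;
`l T = T σ(l₁) l∞`, `l T̄ = σ(γ(l₁)) T̄ l∞` for `l` in `L`;
`m T = σ(m₁) T m∞`, `m T̄ = T̄ σ(γ(m₁)) m∞` for `m` in `L_op`;
`S_op T₁ T₂ = T₁ T₂ S`, `T₂ S T̄₂ = T̄₁ S_op T₁`, `S T̄₂ T̄₁ = T̄₂ T̄₁ S_op`;
`T̄ T = 1 = T T̄`. The coefficients of `S` are in `L`, those of `S_op` in `L_op`. -/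
inductive FRTRel (B : BaseAlgebra k H L) (σ : H →ₐ[k] Matrix n n k)
    (S : Matrix (n × n) (n × n) L) :
    FreeAlgebra k (FRTGen L n) → FreeAlgebra k (FRTGen L n) → Prop
  | src_add (l m : L) : FRTRel B σ S (frtSrc k n (l + m)) (frtSrc k n l + frtSrc k n m)
  | src_smul (c : k) (l : L) : FRTRel B σ S (frtSrc k n (c • l)) (c • frtSrc k n l)
  | src_one : FRTRel B σ S (frtSrc k n 1) 1
  | src_mul (l m : L) : FRTRel B σ S (frtSrc k n (l * m)) (frtSrc k n l * frtSrc k n m)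
  | tgt_add (l m : L) : FRTRel B σ S (frtTgt k n (l + m)) (frtTgt k n l + frtTgt k n m)
  | tgt_smul (c : k) (l : L) : FRTRel B σ S (frtTgt k n (c • l)) (c • frtTgt k n l)
  | tgt_one : FRTRel B σ S (frtTgt k n 1) 1
  | tgt_mul (l m : L) : FRTRel B σ S (frtTgt k n (l * m)) (frtTgt k n m * frtTgt k n l)
  | src_tgt (l m : L) : FRTRel B σ S (frtSrc k n l * frtTgt k n m) (frtTgt k n m * frtSrc k n l)
  | src_T (l : L) (i j : n) : FRTRel B σ S (frtSrc k n l * frtMat k FRTGen.T i j)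
      (∑ r, frtMat k FRTGen.T i r * frtSrc k n (contract (coeff σ r j) (B.coact l)))
  | src_Tbar (l : L) (i j : n) : FRTRel B σ S (frtSrc k n l * frtMat k FRTGen.Tbar i j)
      (∑ r, frtMat k FRTGen.Tbar r j *
        frtSrc k n (contract (coeff σ i r ∘ₗ HopfAlgebra.antipode k) (B.coact l)))
  | tgt_T (l : L) (i j : n) : FRTRel B σ S (frtTgt k n l * frtMat k FRTGen.T i j)
      (∑ r, frtMat k FRTGen.T r j * frtTgt k n (contract (coeff σ i r) (B.coact l)))
  | tgt_Tbar (l : L) (i j : n) : FRTRel B σ S (frtTgt k n l * frtMat k FRTGen.Tbar i j)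
      (∑ r, frtMat k FRTGen.Tbar i r *
        frtTgt k n (contract (coeff σ r j ∘ₗ HopfAlgebra.antipode k) (B.coact l)))
  | T_T (p q : n × n) : FRTRel B σ S
      ((frtSop B σ S * leg₁ (frtMat k FRTGen.T) * leg₂ (frtMat k FRTGen.T) :
        Matrix (n × n) (n × n) (FreeAlgebra k (FRTGen L n))) p q)
      ((leg₁ (frtMat k FRTGen.T) * leg₂ (frtMat k FRTGen.T) * frtS k S :
        Matrix (n × n) (n × n) (FreeAlgebra k (FRTGen L n))) p q)
  | T_Tbar (p q : n × n) : FRTRel B σ S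
      ((leg₂ (frtMat k FRTGen.T) * frtS k S * leg₂ (frtMat k FRTGen.Tbar) :
        Matrix (n × n) (n × n) (FreeAlgebra k (FRTGen L n))) p q)
      ((leg₁ (frtMat k FRTGen.Tbar) * frtSop B σ S * leg₁ (frtMat k FRTGen.T) :
        Matrix (n × n) (n × n) (FreeAlgebra k (FRTGen L n))) p q)
  | Tbar_Tbar (p q : n × n) : FRTRel B σ S
      ((frtS k S * leg₂ (frtMat k FRTGen.Tbar) * leg₁ (frtMat k FRTGen.Tbar) :
        Matrix (n × n) (n × n) (FreeAlgebra k (FRTGen L n))) p q)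
      ((leg₂ (frtMat k FRTGen.Tbar) * leg₁ (frtMat k FRTGen.Tbar) * frtSop B σ S :
        Matrix (n × n) (n × n) (FreeAlgebra k (FRTGen L n))) p q)
  | Tbar_mul_T (i j : n) : FRTRel B σ S
      ((frtMat k FRTGen.Tbar * frtMat k FRTGen.T :
        Matrix n n (FreeAlgebra k (FRTGen L n))) i j)
      ((1 : Matrix n n (FreeAlgebra k (FRTGen L n))) i j)
  | T_mul_Tbar (i j : n) : FRTRel B σ S
      ((frtMat k FRTGen.T * frtMat k FRTGen.Tbar :
        Matrix n n (FreeAlgebra k (FRTGen L n))) i j)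
      ((1 : Matrix n n (FreeAlgebra k (FRTGen L n))) i j)

/-- The extended dynamical FRT algebra of the matrix `S`. -/
def ExtFRT (B : BaseAlgebra k H L) (σ : H →ₐ[k] Matrix n n k) (S : Matrix (n × n) (n × n) L) :
    Type _ := RingQuot (FRTRel B σ S)

namespace ExtFRT

variable (B : BaseAlgebra k H L) (σ : H →ₐ[k] Matrix n n k) (S : Matrix (n × n) (n × n) L)

noncomputable instance : Ring (ExtFRT B σ S) := inferInstanceAs (Ring (RingQuot (FRTRel B σ S)))

noncomputable instance : Algebra k (ExtFRT B σ S) :=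
  inferInstanceAs (Algebra k (RingQuot (FRTRel B σ S)))

/-- The projection of the free algebra. -/
noncomputable def proj : FreeAlgebra k (FRTGen L n) →ₐ[k] ExtFRT B σ S :=
  RingQuot.mkAlgHom k (FRTRel B σ S)

theorem proj_rel {x y : FreeAlgebra k (FRTGen L n)} (h : FRTRel B σ S x y) :
    proj B σ S x = proj B σ S y := RingQuot.mkAlgHom_rel k h

/-- The matrix `T` of generators. -/
noncomputable def T : Matrix n n (ExtFRT B σ S) := (frtMat k FRTGen.T).map (proj B σ S)

/-- The matrix `T̄` of generators. -/
noncomputable def Tbar : Matrix n n (ExtFRT B σ S) := (frtMat k FRTGen.Tbar).map (proj B σ S)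

/-- The source map. -/
noncomputable def source : L →ₐ[k] ExtFRT B σ S :=
  AlgHom.ofLinearMap
    { toFun := fun l => proj B σ S (frtSrc k n l)
      map_add' := fun l m => by rw [proj_rel B σ S (.src_add l m), map_add]
      map_smul' := fun c l => by rw [proj_rel B σ S (.src_smul c l), map_smul, RingHom.id_apply] }
    (by
      change proj B σ S (frtSrc k n 1) = 1
      rw [proj_rel B σ S .src_one, map_one])
    (fun l m => by
      change proj B σ S (frtSrc k n (l * m)) = proj B σ S (frtSrc k n l) * proj B σ S (frtSrc k n m)
      rw [proj_rel B σ S (.src_mul l m), map_mul])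

/-- The target map. -/
noncomputable def target : Lᵐᵒᵖ →ₐ[k] ExtFRT B σ S :=
  AlgHom.ofLinearMap
    { toFun := fun l => proj B σ S (frtTgt k n l.unop)
      map_add' := fun l m => by
        rw [MulOpposite.unop_add, proj_rel B σ S (.tgt_add l.unop m.unop), map_add]
      map_smul' := fun c l => by
        rw [MulOpposite.unop_smul, proj_rel B σ S (.tgt_smul c l.unop), map_smul,
          RingHom.id_apply] }
    (by
      change proj B σ S (frtTgt k n 1) = 1
      rw [proj_rel B σ S .tgt_one, map_one])
    (fun l m => by
      change proj B σ S (frtTgt k n (m.unop * l.unop)) =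
        proj B σ S (frtTgt k n l.unop) * proj B σ S (frtTgt k n m.unop)
      rw [proj_rel B σ S (.tgt_mul m.unop l.unop), map_mul])

variable {B σ S} in
/-- The bialgebroid structure of the extended dynamical FRT algebra:
`Δ(Tᵢⱼ) = ∑ Tᵢᵣ ⊗ Tᵣⱼ`, `Δ(T̄ᵢⱼ) = ∑ T̄ᵣⱼ ⊗ T̄ᵢᵣ`,
with anchor action `l ⊣ T = σ(l₁) l∞`, `l ⊣ T̄ = σ(γ(l₁)) l∞`. -/
structure IsStandard (G : RightBialgebroid (source B σ S) (target B σ S)) : Prop where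
  comul_T : ∀ i j : n, G.comul (T B σ S i j) =
    (balancedIdeal _ _).mkQ (∑ r, T B σ S i r ⊗ₜ[k] T B σ S r j)
  comul_Tbar : ∀ i j : n, G.comul (Tbar B σ S i j) =
    (balancedIdeal _ _).mkQ (∑ r, Tbar B σ S r j ⊗ₜ[k] Tbar B σ S i r)
  anchor_T : ∀ (l : L) (i j : n),
    G.anchor l (T B σ S i j) = contract (coeff σ i j) (B.coact l)
  anchor_Tbar : ∀ (l : L) (i j : n), G.anchor l (Tbar B σ S i j) =
    contract (coeff σ i j ∘ₗ HopfAlgebra.antipode k) (B.coact l)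

end ExtFRT

end ExtendedFRT

section TwistData

variable {k H U L A n : Type*} [Field k] [Ring H] [HopfAlgebra k H] [Ring U] [HopfAlgebra k U]
  [Ring L] [Algebra k L] [Ring A] [HopfAlgebra k A] [Fintype n] [DecidableEq n]

/-- A universal R-matrix: `R Δ(u) = Δ_op(u) R`, `(Δ ⊗ id)R = R₁₃ R₂₃`, `(id ⊗ Δ)R = R₁₃ R₁₂`. -/
structure UniversalRMatrix (k U : Type*) [Field k] [Ring U] [HopfAlgebra k U] where
  R : (U ⊗[k] U)ˣ
  intertwines : ∀ u : U, (R : U ⊗[k] U) * Coalgebra.comul (R := k) u =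
    TensorProduct.comm k U U (Coalgebra.comul (R := k) u) * R
  comul_fst : TensorProduct.assoc k U U U
      ((Coalgebra.comul (R := k) (A := U)).rTensor U (R : U ⊗[k] U)) =
    Algebra.TensorProduct.map (AlgHom.id k U) Algebra.TensorProduct.includeRight (R : U ⊗[k] U) *
      (1 : U) ⊗ₜ[k] (R : U ⊗[k] U)
  comul_snd : (Coalgebra.comul (R := k) (A := U)).lTensor U (R : U ⊗[k] U) =
    Algebra.TensorProduct.map (AlgHom.id k U) Algebra.TensorProduct.includeRight (R : U ⊗[k] U) *
      Algebra.TensorProduct.map (AlgHom.id k U) Algebra.TensorProduct.includeLeft (R : U ⊗[k] U)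

variable (k U) in
open Classical in
/-- The inverse of the antipode (zero if the antipode is not bijective). -/
noncomputable def antipodeInv : U →ₗ[k] U :=
  if h : Function.Bijective (HopfAlgebra.antipode k (A := U)) then
    (LinearEquiv.ofBijective (HopfAlgebra.antipode k (A := U)) h).symm.toLinearMap else 0

namespace DynamicalTwist

variable {B : BaseAlgebra k H L} {ι : H →ₐc[k] U} (J : DynamicalTwist B ι)

/-- `ζ = F̄₂ γ⁻¹(F̄₁) ⊗ F̄_L`, where `F̄ = F⁻¹`. -/
noncomputable def zeta : U ⊗[k] L :=
  (TensorProduct.lift (LinearMap.mul k U).flip ∘ₗ (antipodeInv k U).rTensor U).rTensor L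
    ((TensorProduct.assoc k U U L).symm (↑J.F⁻¹ : U ⊗[k] (U ⊗[k] L)))

/-- The dynamical R-matrix `F₂₁⁻¹ R F`. -/
noncomputable def dynR (R : UniversalRMatrix k U) : U ⊗[k] (U ⊗[k] L) :=
  TensorProduct.leftComm k U U L (↑J.F⁻¹ : U ⊗[k] (U ⊗[k] L)) * inUU L (R.R : U ⊗[k] U) *
    (J.F : U ⊗[k] (U ⊗[k] L))

/-- The matrix `P R̃`, where `R̃` is the image of the dynamical R-matrix and `P` the flip. -/
noncomputable def dynS (R : UniversalRMatrix k U) (ρ : U →ₐ[k] Matrix n n k) :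
    Matrix (n × n) (n × n) L :=
  Matrix.of fun p q => contract (LinearMap.mul' k k ∘ₗ
    TensorProduct.map (coeff ρ p.2 q.1) (coeff ρ p.1 q.2))
      ((TensorProduct.assoc k U U L).symm (J.dynR R))

end DynamicalTwist

namespace TwistedDual

variable (D : HopfDual k U A) {B : BaseAlgebra k H L} {ι : H →ₐc[k] U} (J : DynamicalTwist B ι)

/-- The matrix of matrix coefficients, with entries in the twisted dual. -/
noncomputable def matU (c : Matrix n n A) : Matrix n n (TwistedDual D J) := c.map (inDual D J)

/-- `Ū = ρ(γ(ζ₁)) γ(c) ρ(γ(ζ̄₁)) ⊗ ζ̄_L ⊗ ζ_L`, where `ζ̄ = ζ⁻¹` and `γ(c)` is the antipode of the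
dual applied to the entries of `c`. -/
noncomputable def matUbar (c : Matrix n n A) (ρ : U →ₐ[k] Matrix n n k) :
    Matrix n n (TwistedDual D J) :=
  Matrix.of fun i j => ∑ p, ∑ q, elem D J (HopfAlgebra.antipode k (c p q))
    (contract (coeff ρ q j ∘ₗ HopfAlgebra.antipode k) (Ring.inverse J.zeta))
    (contract (coeff ρ i p ∘ₗ HopfAlgebra.antipode k) J.zeta)

variable {D J} in
/-- The bialgebroid structure of the twisted dual: `Δ(a) = a₁ ⊗ a₂` and `ε(a) = ε(a) 1` for `a`
in the dual of `U`. -/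
structure IsStandard (G : RightBialgebroid (source D J) (target D J)) : Prop where
  comul_inDual : ∀ a : A, G.comul (inDual D J a) =
    (balancedIdeal _ _).mkQ (TensorProduct.map (inDual D J) (inDual D J)
      (Coalgebra.comul (R := k) a))
  counit_inDual : ∀ a : A, G.counit (inDual D J a) = Coalgebra.counit (R := k) a • (1 : L)

end TwistedDual
end TwistData

end DynFRT

/-! Notation: F̄ = F⁻¹, γ for antipodes, δ for the coaction of L, δ₂ for the iterated coaction with
values in U ⊗ U ⊗ L, c for the matrix of coefficients of ρ.

Invertibility of ζ. Quasitriangularity makes γ bijective on U, because u = γ(R₂)R₁ is invertible and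
implements γ² by conjugation (`UniversalRMatrix.antipode_bijective`). Since γ⁻¹ ⊗ id reverses
products from U ⊗ L_op to U ⊗ L, it is enough to invert γ(ζ) = F̄₁γ(F̄₂) ⊗ F̄_L in U ⊗ L_op. The
cocycle equation can be rewritten as F̄₁₍₂₃₎F₍₁₂₎₃ = F₂₃F̄₁₂|₃ and as F̄₍₁₂₎₃F₁₍₂₃₎ = F₁₂|₃F̄₂₃.
Apply xγ(y)z to the first three factors of the former and γ(x)yγ(z) to those of the latter: the left
sides become 1 by the antipode axiom and the normalization of F, and the right sides are the two
products of γ(ζ) with γ(F₁)F₂ ⊗ F_L, corrected by the coaction (`kap_foldInv`, `kapConj_foldInv`).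
For a constant twist this is the classical argument for F̄₁γ(F̄₂).

The inverse of U. The two actions of U on c are multiplications by matrices ρ(x), and on γ(c) they
are multiplications by ρ(γ(x)) on the opposite sides. So the product of U and Ū is ρ(F̄₁) c
ρ(F₁γ(ζ₁)γ(F₂)) γ(c) ρ(γ(F̄₂)γ(ζ̄₁)), with the components in L and L_op understood. The innermost
bracket is 1 because F F̄ = 1; then c γ(c) = 1 closes the gap, and what is left is a product of γ(ζ)
and γ(ζ̄) in U ⊗ L_op (`sum_core_right`). The other order is analogous, with the coactions of ζ̄_L
and ζ_L entering (`sum_core_left`).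

Bialgebroids. The left B ⊗ B-module B ⊗_L B is cyclic, so its endomorphisms are the elements
satisfying the Takeuchi condition, with opposite multiplication. A multiplicative coproduct is
therefore an algebra homomorphism from B to an opposite endomorphism algebra. Likewise the counit is
the value at 1 of the anchor, an algebra homomorphism from B to the opposite of End(L). Both can be
defined on generators. The counit axioms and coassociativity are stable under sums and products, so
they too need only be verified on generators (`PreBialgebroid.Good.mul`). For the FRT algebra the
universal property produces both homomorphisms; the anchor exists because S̃ commutes with the
matrices (ρ ⊗ ρ)δ₂(l). For the twisted dual the product of two coproducts contains F in one factor
and F̄ in the other, and these meet across ⊗_L and cancel (`TwistedDual.mkQ_corePair`); the anchor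
is multiplicative because F commutes with δ₂(l).

The homomorphism. All relations containing T̄ follow from T̄ = T⁻¹ and from those for T
(`FRTRep.free_rel`). The relations of U with L and L_op express the actions of U on c. The quadratic
relation is the ordinary FRT relation for c, conjugated by F: with Ř = P(ρ ⊗ ρ)(R) one has S̃ = F̄ŘF
(`TwistedDual.matU_mul_matU_dynS`). Compatibility with coproduct and anchor is tested on T.
Uniqueness holds because a homomorphism carries T̄ to the inverse of the image of T. -/

namespace DynFRT

open TensorProduct

set_option maxSynthPendingDepth 3
set_option linter.unusedSectionVars false

/-! ### Right bialgebroids from a coproduct and an anchor that are algebra homomorphisms -/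

section Construction

variable {k L B : Type*} [Field k] [Ring L] [Algebra k L] [Ring B] [Algebra k B]

section Ideals

variable {s : L →ₐ[k] B} {t : Lᵐᵒᵖ →ₐ[k] B}

theorem mkQ_eq_iff {x y : B ⊗[k] B} :
    (balancedIdeal s t).mkQ x = (balancedIdeal s t).mkQ y ↔ x - y ∈ balancedIdeal s t :=
  Submodule.Quotient.eq _

theorem mkQ₃_eq_iff {x y : B ⊗[k] (B ⊗[k] B)} :
    (balancedIdeal₃ s t).mkQ x = (balancedIdeal₃ s t).mkQ y ↔ x - y ∈ balancedIdeal₃ s t :=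
  Submodule.Quotient.eq _

theorem mkQ_mul (x y : B ⊗[k] B) :
    (balancedIdeal s t).mkQ (x * y) = x • (balancedIdeal s t).mkQ y := map_smul _ x y

theorem mkQ₃_mul (x y : B ⊗[k] (B ⊗[k] B)) :
    (balancedIdeal₃ s t).mkQ (x * y) = x • (balancedIdeal₃ s t).mkQ y := map_smul _ x y

theorem mkQ_gen (l : L) : (balancedIdeal s t).mkQ (s l ⊗ₜ[k] (1 : B)) =
    (balancedIdeal s t).mkQ ((1 : B) ⊗ₜ[k] t (MulOpposite.op l)) :=
  mkQ_eq_iff.2 (Submodule.subset_span ⟨l, rfl⟩)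

/-- The relations generate a left ideal, so a generator may be multiplied on the left by any x ⊗ y;
this gives the usual balancing, with s(l) and t(l) acting by right multiplication. -/
theorem mkQ_balance (l : L) (x y : B) :
    (balancedIdeal s t).mkQ ((x * s l) ⊗ₜ[k] y) =
      (balancedIdeal s t).mkQ (x ⊗ₜ[k] (y * t (MulOpposite.op l))) := by
  have h : ∀ z w : B, (x * z) ⊗ₜ[k] (y * w) = (x ⊗ₜ[k] y) * (z ⊗ₜ[k] w) := fun z w => by simp
  calc _ = (balancedIdeal s t).mkQ ((x ⊗ₜ[k] y) * (s l ⊗ₜ[k] (1 : B))) := by rw [← h, mul_one]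
    _ = _ := by rw [mkQ_mul, mkQ_gen, ← mkQ_mul, ← h, mul_one]

/-- An additive map on `B ⊗ B` compatible with the balancing relation descends to `B ⊗_L B`. -/
theorem eq_of_mkQ_eq {V F : Type*} [AddCommGroup V] [FunLike F (B ⊗[k] B) V]
    [AddMonoidHomClass F (B ⊗[k] B) V] (f : F)
    (h : ∀ x y l, f ((x * s l) ⊗ₜ[k] y) = f (x ⊗ₜ[k] (y * t (MulOpposite.op l))))
    {z w : B ⊗[k] B} (hzw : (balancedIdeal s t).mkQ z = (balancedIdeal s t).mkQ w) :
    f z = f w := by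
  rw [mkQ_eq_iff] at hzw
  rw [← sub_eq_zero, ← map_sub]
  generalize z - w = x at hzw
  induction hzw using Submodule.closure_induction with
  | zero => exact map_zero f
  | add x y _ _ hx hy => rw [map_add, hx, hy, add_zero]
  | smul_mem r x hx =>
    obtain ⟨l, rfl⟩ := hx
    induction r using TensorProduct.induction_on with
    | zero => rw [zero_smul, map_zero]
    | add p q hp hq => rw [add_smul, map_add, hp, hq, add_zero]
    | tmul p q => simp [mul_sub, h]

theorem mkQ₃_fst (l : L) : (balancedIdeal₃ s t).mkQ (s l ⊗ₜ[k] (1 : B ⊗[k] B)) =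
    (balancedIdeal₃ s t).mkQ ((1 : B) ⊗ₜ[k] (t (MulOpposite.op l) ⊗ₜ[k] (1 : B))) :=
  mkQ₃_eq_iff.2 (Submodule.subset_span (Or.inl ⟨l, rfl⟩))

theorem mkQ₃_snd (l : L) : (balancedIdeal₃ s t).mkQ ((1 : B) ⊗ₜ[k] (s l ⊗ₜ[k] (1 : B))) =
    (balancedIdeal₃ s t).mkQ ((1 : B) ⊗ₜ[k] ((1 : B) ⊗ₜ[k] t (MulOpposite.op l))) :=
  mkQ₃_eq_iff.2 (Submodule.subset_span (Or.inr ⟨l, rfl⟩))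

/-- The second family of generators balances the last two factors. With `mkQ₃_assoc_of_mkQ_eq`,
which uses the first family, this permits replacing the value of a lift of Δ by any convenient
representative inside B ⊗_L B ⊗_L B. -/
theorem mkQ₃_tmul_of_mkQ_eq (b : B) {z w : B ⊗[k] B}
    (h : (balancedIdeal s t).mkQ z = (balancedIdeal s t).mkQ w) :
    (balancedIdeal₃ s t).mkQ (b ⊗ₜ[k] z) = (balancedIdeal₃ s t).mkQ (b ⊗ₜ[k] w) := by
  refine eq_of_mkQ_eq ((balancedIdeal₃ s t).mkQ.toAddMonoidHom.comp
    (TensorProduct.mk k B (B ⊗[k] B) b).toAddMonoidHom) (fun x y l => ?_) h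
  have e : ∀ v w : B, b ⊗ₜ[k] ((x * v) ⊗ₜ[k] (y * w)) =
    (b ⊗ₜ[k] (x ⊗ₜ[k] y)) * ((1 : B) ⊗ₜ[k] (v ⊗ₜ[k] w)) := fun v w => by simp
  change (balancedIdeal₃ s t).mkQ (b ⊗ₜ[k] ((x * s l) ⊗ₜ[k] y)) =
    (balancedIdeal₃ s t).mkQ (b ⊗ₜ[k] (x ⊗ₜ[k] (y * t (MulOpposite.op l))))
  have e₁ := e (s l) 1
  have e₂ := e 1 (t (MulOpposite.op l))
  rw [mul_one] at e₁ e₂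
  rw [e₁, e₂, mkQ₃_mul, mkQ₃_snd, mkQ₃_mul]

theorem mkQ₃_assoc_of_mkQ_eq (b : B) {z w : B ⊗[k] B}
    (h : (balancedIdeal s t).mkQ z = (balancedIdeal s t).mkQ w) :
    (balancedIdeal₃ s t).mkQ (TensorProduct.assoc k B B B (z ⊗ₜ[k] b)) =
      (balancedIdeal₃ s t).mkQ (TensorProduct.assoc k B B B (w ⊗ₜ[k] b)) := by
  refine eq_of_mkQ_eq ((balancedIdeal₃ s t).mkQ.toAddMonoidHom.comp
    ((TensorProduct.assoc k B B B).toLinearMap ∘ₗ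
      (TensorProduct.mk k (B ⊗[k] B) B).flip b).toAddMonoidHom) (fun x y l => ?_) h
  change (balancedIdeal₃ s t).mkQ ((x * s l) ⊗ₜ[k] (y ⊗ₜ[k] b)) =
    (balancedIdeal₃ s t).mkQ (x ⊗ₜ[k] ((y * t (MulOpposite.op l)) ⊗ₜ[k] b))
  have e₁ : (x * s l) ⊗ₜ[k] (y ⊗ₜ[k] b) = (x ⊗ₜ[k] (y ⊗ₜ[k] b)) * (s l ⊗ₜ[k] (1 : B ⊗[k] B)) := by
    simp
  have e₂ : x ⊗ₜ[k] ((y * t (MulOpposite.op l)) ⊗ₜ[k] b) =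
    (x ⊗ₜ[k] (y ⊗ₜ[k] b)) * ((1 : B) ⊗ₜ[k] (t (MulOpposite.op l) ⊗ₜ[k] (1 : B))) := by simp
  rw [e₁, e₂, mkQ₃_mul, mkQ₃_fst, mkQ₃_mul]

end Ideals

/-- The coproduct and the anchor of a right bialgebroid as algebra homomorphisms: the Takeuchi
algebra is the opposite of the algebra of endomorphisms of the left `B ⊗ B`-module `B ⊗_L B`. -/
structure PreBialgebroid (s : L →ₐ[k] B) (t : Lᵐᵒᵖ →ₐ[k] B) where
  commute : ∀ (l : L) (m : Lᵐᵒᵖ), Commute (s l) (t m)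
  copEnd : B →ₐ[k] (Module.End (B ⊗[k] B) (BalancedTensor s t))ᵐᵒᵖ
  anchorEnd : B →ₐ[k] (Module.End k L)ᵐᵒᵖ
  copEnd_source : ∀ l, (copEnd (s l)).unop ((balancedIdeal s t).mkQ 1) =
    (balancedIdeal s t).mkQ ((1 : B) ⊗ₜ[k] s l)
  copEnd_target : ∀ l, (copEnd (t l)).unop ((balancedIdeal s t).mkQ 1) =
    (balancedIdeal s t).mkQ (t l ⊗ₜ[k] (1 : B))
  anchorEnd_source : ∀ l x, (anchorEnd (s l)).unop x = x * l
  anchorEnd_target : ∀ l x, (anchorEnd (t (MulOpposite.op l))).unop x = l * x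

namespace PreBialgebroid

variable {s : L →ₐ[k] B} {t : Lᵐᵒᵖ →ₐ[k] B} (G : PreBialgebroid s t)

/-- The coproduct. -/
def comul : B →ₗ[k] BalancedTensor s t where
  toFun b := (G.copEnd b).unop ((balancedIdeal s t).mkQ 1)
  map_add' a b := by simp
  map_smul' c b := by simp

/-- The counit. -/
def counit : B →ₗ[k] L where
  toFun b := (G.anchorEnd b).unop 1
  map_add' a b := by simp
  map_smul' c b := by simp

theorem comul_apply (b : B) : G.comul b = (G.copEnd b).unop ((balancedIdeal s t).mkQ 1) := rfl

theorem counit_apply (b : B) : G.counit b = (G.anchorEnd b).unop 1 := rfl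

/-- The class of 1 generates the module, so an endomorphism is right multiplication by its value
there. -/
theorem copEnd_apply (b : B) (z : B ⊗[k] B) :
    (G.copEnd b).unop ((balancedIdeal s t).mkQ z) = z • G.comul b := by
  rw [comul_apply, ← map_smul, ← map_smul, smul_eq_mul, mul_one]

/-- In the opposite algebra the endomorphism of a acts before that of b, and linearity pulls out the
representative z. That the result does not depend on z is contained in the existence of the
endomorphism. -/
theorem comul_mul (a b : B) (z : B ⊗[k] B) (hz : (balancedIdeal s t).mkQ z = G.comul a) :
    G.comul (a * b) = z • G.comul b := by
  rw [← copEnd_apply, hz, comul_apply, comul_apply, map_mul]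
  rfl

theorem comul_one : G.comul 1 = (balancedIdeal s t).mkQ 1 := by
  rw [comul_apply, map_one]
  rfl

/-- The endomorphism of b is applied to the equality of the classes of s(l) ⊗ 1 and 1 ⊗ t(l). -/
theorem takeuchi (l : L) (b : B) : (s l ⊗ₜ[k] (1 : B)) • G.comul b =
    ((1 : B) ⊗ₜ[k] t (MulOpposite.op l)) • G.comul b := by
  rw [← copEnd_apply, mkQ_gen, copEnd_apply]

theorem comul_mul_source (b : B) (l : L) (z : B ⊗[k] B)
    (hz : (balancedIdeal s t).mkQ z = G.comul b) :
    G.comul (b * s l) = (balancedIdeal s t).mkQ (z * ((1 : B) ⊗ₜ[k] s l)) := by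
  rw [G.comul_mul b _ z hz, mkQ_mul, ← G.copEnd_source, comul_apply]

theorem comul_mul_target (b : B) (l : Lᵐᵒᵖ) (z : B ⊗[k] B)
    (hz : (balancedIdeal s t).mkQ z = G.comul b) :
    G.comul (b * t l) = (balancedIdeal s t).mkQ (z * (t l ⊗ₜ[k] (1 : B))) := by
  rw [G.comul_mul b _ z hz, mkQ_mul, ← G.copEnd_target, comul_apply]

theorem comul_target_mul (b : B) (l : Lᵐᵒᵖ) :
    G.comul (t l * b) = (t l ⊗ₜ[k] (1 : B)) • G.comul b :=
  G.comul_mul _ _ _ (G.copEnd_target l).symm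

/-- Multiplicativity of the anchor, evaluated at 1. Since s(l) and t(l) both have counit l, the
axioms ε(s(ε(a))b) = ε(ab) = ε(t(ε(a))b) follow. -/
theorem counit_mul (a b : B) : G.counit (a * b) = (G.anchorEnd b).unop (G.counit a) := by
  rw [counit_apply, map_mul]
  rfl

theorem counit_source_mul (l : L) (b : B) : G.counit (s l * b) = (G.anchorEnd b).unop l := by
  rw [counit_mul, counit_apply, anchorEnd_source, one_mul]

theorem counit_target_mul (l : L) (b : B) :
    G.counit (t (MulOpposite.op l) * b) = (G.anchorEnd b).unop l := by
  rw [counit_mul, counit_apply, anchorEnd_target, mul_one]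

theorem counit_mul_source (b : B) (l : L) : G.counit (b * s l) = G.counit b * l := by
  rw [counit_mul, anchorEnd_source]

theorem counit_mul_target (b : B) (l : L) :
    G.counit (b * t (MulOpposite.op l)) = l * G.counit b := by
  rw [counit_mul, anchorEnd_target]

/-- `b₁ ⊗ b₂ ↦ b₂ t(ε(b₁))`. -/
noncomputable def contractLeft : B ⊗[k] B →ₗ[k] B :=
  LinearMap.mul' k B ∘ₗ (TensorProduct.comm k B B).toLinearMap ∘ₗ TensorProduct.map
    (t.toLinearMap ∘ₗ (MulOpposite.opLinearEquiv k).toLinearMap ∘ₗ G.counit) LinearMap.id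

/-- `b₁ ⊗ b₂ ↦ b₁ s(ε(b₂))`. -/
noncomputable def contractRight : B ⊗[k] B →ₗ[k] B :=
  LinearMap.mul' k B ∘ₗ TensorProduct.map LinearMap.id (s.toLinearMap ∘ₗ G.counit)

theorem contractLeft_tmul (a b : B) :
    G.contractLeft (a ⊗ₜ[k] b) = b * t (MulOpposite.op (G.counit a)) := rfl

theorem contractRight_tmul (a b : B) : G.contractRight (a ⊗ₜ[k] b) = a * s (G.counit b) := rfl

theorem contractLeft_congr {z w : B ⊗[k] B}
    (h : (balancedIdeal s t).mkQ z = (balancedIdeal s t).mkQ w) :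
    G.contractLeft z = G.contractLeft w :=
  eq_of_mkQ_eq G.contractLeft (fun x y l => by
    rw [contractLeft_tmul, contractLeft_tmul, counit_mul_source, MulOpposite.op_mul, map_mul,
      mul_assoc]) h

theorem contractRight_congr {z w : B ⊗[k] B}
    (h : (balancedIdeal s t).mkQ z = (balancedIdeal s t).mkQ w) :
    G.contractRight z = G.contractRight w :=
  eq_of_mkQ_eq G.contractRight (fun x y l => by
    rw [contractRight_tmul, contractRight_tmul, counit_mul_target, map_mul, mul_assoc]) h

/-- By ε(ap) = ε(t(ε(a))p) the factor a matters only through its counit. What remains is a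
contraction with an extra t(l), which is why the conditions in `Good` are required for every l and
not only for l = 1. -/
theorem contractLeft_tmul_mul (a b : B) (w : B ⊗[k] B) :
    G.contractLeft ((a ⊗ₜ[k] b) * w) =
      b * G.contractLeft ((t (MulOpposite.op (G.counit a)) ⊗ₜ[k] (1 : B)) * w) := by
  induction w using TensorProduct.induction_on with
  | zero => simp
  | add p q hp hq => simp only [mul_add, map_add, hp, hq]
  | tmul p q =>
    rw [Algebra.TensorProduct.tmul_mul_tmul, contractLeft_tmul,
      Algebra.TensorProduct.tmul_mul_tmul, contractLeft_tmul, one_mul, counit_target_mul,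
      counit_mul, mul_assoc]

theorem contractRight_tmul_mul (a b : B) (w : B ⊗[k] B) :
    G.contractRight ((a ⊗ₜ[k] b) * w) =
      a * G.contractRight (((1 : B) ⊗ₜ[k] s (G.counit b)) * w) := by
  induction w using TensorProduct.induction_on with
  | zero => simp
  | add p q hp hq => simp only [mul_add, map_add, hp, hq]
  | tmul p q =>
    rw [Algebra.TensorProduct.tmul_mul_tmul, contractRight_tmul,
      Algebra.TensorProduct.tmul_mul_tmul, contractRight_tmul, one_mul, counit_source_mul,
      counit_mul, mul_assoc]

/-- The coproduct of `b` has a lift `z` for which the counit and coassociativity axioms hold. -/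
structure Good (b : B) : Prop where
  left : ∃ z, (balancedIdeal s t).mkQ z = G.comul b ∧ ∀ l : L,
    G.contractLeft ((t (MulOpposite.op l) ⊗ₜ[k] (1 : B)) * z) = t (MulOpposite.op l) * b
  right : ∃ z, (balancedIdeal s t).mkQ z = G.comul b ∧ ∀ l : L,
    G.contractRight (((1 : B) ⊗ₜ[k] s l) * z) = s l * b
  coassoc : ∃ z, (balancedIdeal s t).mkQ z = G.comul b ∧
    ∀ D : B →ₗ[k] B ⊗[k] B, (∀ b, (balancedIdeal s t).mkQ (D b) = G.comul b) →
      (balancedIdeal₃ s t).mkQ (TensorProduct.assoc k B B B (D.rTensor B z)) =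
        (balancedIdeal₃ s t).mkQ (D.lTensor B z)

variable {G}

/-- Left multiplication preserves the left ideal and the contraction factors through the quotient,
so a property of one lift of Δ(b) holds for all of them. -/
theorem Good.left_lift {b : B} (h : G.Good b) {z : B ⊗[k] B}
    (hz : (balancedIdeal s t).mkQ z = G.comul b) (l : L) :
    G.contractLeft ((t (MulOpposite.op l) ⊗ₜ[k] (1 : B)) * z) = t (MulOpposite.op l) * b := by
  obtain ⟨w, hw, h⟩ := h.left
  rw [← h]
  apply G.contractLeft_congr
  rw [mkQ_mul, hz, ← hw, mkQ_mul]

theorem Good.right_lift {b : B} (h : G.Good b) {z : B ⊗[k] B}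
    (hz : (balancedIdeal s t).mkQ z = G.comul b) (l : L) :
    G.contractRight (((1 : B) ⊗ₜ[k] s l) * z) = s l * b := by
  obtain ⟨w, hw, h⟩ := h.right
  rw [← h]
  apply G.contractRight_congr
  rw [mkQ_mul, hz, ← hw, mkQ_mul]

variable (G)

/-- From Δ(x s(l)) = Δ(x)(1 ⊗ s(l)) the factor s(l) lands in the middle position, from where it
moves to the third as t(l). Hence Δ ⊗ id is defined on B ⊗_L B. In `lTensor_congr` the formula Δ(y
t(l)) = Δ(y)(t(l) ⊗ 1) plays the same role for id ⊗ Δ. -/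
theorem rTensor_congr (D : B →ₗ[k] B ⊗[k] B) (hD : ∀ b, (balancedIdeal s t).mkQ (D b) = G.comul b)
    {z w : B ⊗[k] B} (h : (balancedIdeal s t).mkQ z = (balancedIdeal s t).mkQ w) :
    (balancedIdeal₃ s t).mkQ (TensorProduct.assoc k B B B (D.rTensor B z)) =
      (balancedIdeal₃ s t).mkQ (TensorProduct.assoc k B B B (D.rTensor B w)) := by
  refine eq_of_mkQ_eq ((balancedIdeal₃ s t).mkQ.toAddMonoidHom.comp
    ((TensorProduct.assoc k B B B).toLinearMap ∘ₗ D.rTensor B).toAddMonoidHom)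
    (fun x y l => ?_) h
  change (balancedIdeal₃ s t).mkQ (TensorProduct.assoc k B B B (D (x * s l) ⊗ₜ[k] y)) =
    (balancedIdeal₃ s t).mkQ (TensorProduct.assoc k B B B (D x ⊗ₜ[k] (y * t (MulOpposite.op l))))
  have h1 : (balancedIdeal s t).mkQ (D (x * s l)) =
      (balancedIdeal s t).mkQ (D x * ((1 : B) ⊗ₜ[k] s l)) := by
    rw [hD, G.comul_mul_source x l (D x) (hD x)]
  rw [mkQ₃_assoc_of_mkQ_eq y h1]
  generalize D x = X
  induction X using TensorProduct.induction_on with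
  | zero => simp
  | add p q hp hq => simp only [add_mul, TensorProduct.add_tmul, map_add, hp, hq]
  | tmul p q =>
    rw [Algebra.TensorProduct.tmul_mul_tmul, mul_one, TensorProduct.assoc_tmul,
      TensorProduct.assoc_tmul]
    exact mkQ₃_tmul_of_mkQ_eq p (mkQ_balance l q y)

theorem lTensor_congr (D : B →ₗ[k] B ⊗[k] B) (hD : ∀ b, (balancedIdeal s t).mkQ (D b) = G.comul b)
    {z w : B ⊗[k] B} (h : (balancedIdeal s t).mkQ z = (balancedIdeal s t).mkQ w) :
    (balancedIdeal₃ s t).mkQ (D.lTensor B z) = (balancedIdeal₃ s t).mkQ (D.lTensor B w) := by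
  refine eq_of_mkQ_eq ((balancedIdeal₃ s t).mkQ.toAddMonoidHom.comp
    (D.lTensor B).toAddMonoidHom) (fun x y l => ?_) h
  change (balancedIdeal₃ s t).mkQ ((x * s l) ⊗ₜ[k] D y) =
    (balancedIdeal₃ s t).mkQ (x ⊗ₜ[k] D (y * t (MulOpposite.op l)))
  have h1 : (balancedIdeal s t).mkQ (D (y * t (MulOpposite.op l))) =
      (balancedIdeal s t).mkQ (D y * (t (MulOpposite.op l) ⊗ₜ[k] (1 : B))) := by
    rw [hD, G.comul_mul_target y _ (D y) (hD y)]
  rw [mkQ₃_tmul_of_mkQ_eq x h1]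
  have e₁ : (x * s l) ⊗ₜ[k] D y = (x ⊗ₜ[k] D y) * (s l ⊗ₜ[k] (1 : B ⊗[k] B)) := by simp
  have e₂ : x ⊗ₜ[k] (D y * (t (MulOpposite.op l) ⊗ₜ[k] (1 : B))) =
    (x ⊗ₜ[k] D y) * ((1 : B) ⊗ₜ[k] (t (MulOpposite.op l) ⊗ₜ[k] (1 : B))) := by simp
  rw [e₁, e₂, mkQ₃_mul, mkQ₃_fst, mkQ₃_mul]

/-- The lift D is only linear, but D(ab) and D(a)D(b) agree modulo the ideal, which is enough in the
triple tensor product. -/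
theorem rTensor_mul (D : B →ₗ[k] B ⊗[k] B) (hD : ∀ b, (balancedIdeal s t).mkQ (D b) = G.comul b)
    (z w : B ⊗[k] B) :
    (balancedIdeal₃ s t).mkQ (TensorProduct.assoc k B B B (D.rTensor B (z * w))) =
      TensorProduct.assoc k B B B (D.rTensor B z) •
        (balancedIdeal₃ s t).mkQ (TensorProduct.assoc k B B B (D.rTensor B w)) := by
  rw [← mkQ₃_mul]
  induction z using TensorProduct.induction_on with
  | zero => simp
  | add p q hp hq => simp only [add_mul, map_add, hp, hq]
  | tmul a a' =>
  induction w using TensorProduct.induction_on with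
  | zero => simp
  | add p q hp hq => simp only [mul_add, map_add, hp, hq]
  | tmul b b' =>
    have h : (balancedIdeal s t).mkQ (D (a * b)) = (balancedIdeal s t).mkQ (D a * D b) := by
      rw [hD, G.comul_mul a b _ (hD a), mkQ_mul, hD]
    rw [Algebra.TensorProduct.tmul_mul_tmul, LinearMap.rTensor_tmul, mkQ₃_assoc_of_mkQ_eq _ h,
      LinearMap.rTensor_tmul, LinearMap.rTensor_tmul, ← Algebra.TensorProduct.tmul_mul_tmul]
    congr 1
    exact map_mul (Algebra.TensorProduct.assoc k k k B B B) (D a ⊗ₜ a') (D b ⊗ₜ b')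

theorem lTensor_mul (D : B →ₗ[k] B ⊗[k] B) (hD : ∀ b, (balancedIdeal s t).mkQ (D b) = G.comul b)
    (z w : B ⊗[k] B) :
    (balancedIdeal₃ s t).mkQ (D.lTensor B (z * w)) =
      D.lTensor B z • (balancedIdeal₃ s t).mkQ (D.lTensor B w) := by
  rw [← mkQ₃_mul]
  induction z using TensorProduct.induction_on with
  | zero => simp
  | add p q hp hq => simp only [add_mul, map_add, hp, hq]
  | tmul a a' =>
  induction w using TensorProduct.induction_on with
  | zero => simp
  | add p q hp hq => simp only [mul_add, map_add, hp, hq]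
  | tmul b b' =>
    have h : (balancedIdeal s t).mkQ (D (a' * b')) = (balancedIdeal s t).mkQ (D a' * D b') := by
      rw [hD, G.comul_mul a' b' _ (hD a'), mkQ_mul, hD]
    rw [Algebra.TensorProduct.tmul_mul_tmul, LinearMap.lTensor_tmul, mkQ₃_tmul_of_mkQ_eq _ h,
      LinearMap.lTensor_tmul, LinearMap.lTensor_tmul, ← Algebra.TensorProduct.tmul_mul_tmul]

/-- The ideal is only a left ideal, so its elements need not act by zero on the quotient. They do
annihilate (id ⊗ Δ)Δ(b): for the first family this is the Takeuchi condition on Δ(b) together with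
Δ(t(l)q) = (t(l) ⊗ 1)Δ(q), for the second it is the Takeuchi condition on Δ(q) for each second
factor q of a representative. -/
theorem smul_lTensor_congr (D : B →ₗ[k] B ⊗[k] B)
    (hD : ∀ b, (balancedIdeal s t).mkQ (D b) = G.comul b) (b : B) (w : B ⊗[k] B)
    (hw : (balancedIdeal s t).mkQ w = G.comul b) {x y : B ⊗[k] (B ⊗[k] B)}
    (h : (balancedIdeal₃ s t).mkQ x = (balancedIdeal₃ s t).mkQ y) :
    x • (balancedIdeal₃ s t).mkQ (D.lTensor B w) =
      y • (balancedIdeal₃ s t).mkQ (D.lTensor B w) := by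
  rw [mkQ₃_eq_iff] at h
  rw [← sub_eq_zero, ← sub_smul]
  generalize x - y = v at h
  induction h using Submodule.closure_induction with
  | zero => rw [zero_smul]
  | add x y _ _ hx hy => rw [add_smul, hx, hy, add_zero]
  | smul_mem r x hx =>
    rw [smul_eq_mul, mul_smul]
    convert smul_zero r
    rw [← mkQ₃_mul]
    rcases hx with ⟨l, rfl⟩ | ⟨l, rfl⟩
    · have h1 : (balancedIdeal₃ s t).mkQ (D.lTensor B ((s l ⊗ₜ[k] (1 : B)) * w)) =
          (balancedIdeal₃ s t).mkQ (D.lTensor B (((1 : B) ⊗ₜ[k] t (MulOpposite.op l)) * w)) := by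
        apply G.lTensor_congr D hD
        rw [mkQ_mul, mkQ_mul, hw, G.takeuchi]
      rw [sub_mul, map_sub, sub_eq_zero]
      convert h1 using 1
      · clear hw h1
        congr 1
        induction w using TensorProduct.induction_on with
        | zero => simp
        | add p q hp hq => simp only [mul_add, map_add, hp, hq]
        | tmul p q => simp
      · clear hw h1
        induction w using TensorProduct.induction_on with
        | zero => simp
        | add p q hp hq => simp only [mul_add, map_add, hp, hq]
        | tmul p q =>
          simp only [LinearMap.lTensor_tmul, Algebra.TensorProduct.tmul_mul_tmul, one_mul]
          refine mkQ₃_tmul_of_mkQ_eq p ?_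
          rw [hD, G.comul_target_mul, ← hD, mkQ_mul]
    · clear hw
      induction w using TensorProduct.induction_on with
      | zero => simp
      | add p q hp hq => simp only [mul_add, map_add, hp, hq, add_zero]
      | tmul p q =>
        rw [sub_mul, map_sub, sub_eq_zero]
        simp only [LinearMap.lTensor_tmul, Algebra.TensorProduct.tmul_mul_tmul, one_mul]
        refine mkQ₃_tmul_of_mkQ_eq p ?_
        rw [mkQ_mul, mkQ_mul, hD, G.takeuchi]

variable {G}

theorem Good.coassoc_lift {b : B} (h : G.Good b) {z : B ⊗[k] B}
    (hz : (balancedIdeal s t).mkQ z = G.comul b) (D : B →ₗ[k] B ⊗[k] B)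
    (hD : ∀ b, (balancedIdeal s t).mkQ (D b) = G.comul b) :
    (balancedIdeal₃ s t).mkQ (TensorProduct.assoc k B B B (D.rTensor B z)) =
        (balancedIdeal₃ s t).mkQ (D.lTensor B z) := by
  obtain ⟨w, hw, h⟩ := h.coassoc
  rw [G.rTensor_congr D hD (hz.trans hw.symm), h D hD, G.lTensor_congr D hD (hz.trans hw.symm)]

theorem Good.of_lift {b : B} (z : B ⊗[k] B) (hz : (balancedIdeal s t).mkQ z = G.comul b)
    (hl : ∀ l : L,
      G.contractLeft ((t (MulOpposite.op l) ⊗ₜ[k] (1 : B)) * z) = t (MulOpposite.op l) * b)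
    (hr : ∀ l : L, G.contractRight (((1 : B) ⊗ₜ[k] s l) * z) = s l * b)
    (hc : ∀ D : B →ₗ[k] B ⊗[k] B, (∀ b, (balancedIdeal s t).mkQ (D b) = G.comul b) →
      (balancedIdeal₃ s t).mkQ (TensorProduct.assoc k B B B (D.rTensor B z)) =
        (balancedIdeal₃ s t).mkQ (D.lTensor B z)) : G.Good b :=
  ⟨⟨z, hz, hl⟩, ⟨z, hz, hr⟩, ⟨z, hz, hc⟩⟩

theorem exists_lift (b : B) : ∃ z, (balancedIdeal s t).mkQ z = G.comul b :=
  Submodule.mkQ_surjective _ _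

/-- Contract the lift zw of Δ(ab) one simple tensor of z at a time: the contracted leg of z leaves
an element of L, for which the condition on b is used, and then the condition on a applies. For
coassociativity both iterated coproducts are multiplicative, and `smul_lTensor_congr` allows
exchanging the two forms for a in front of the one for b. -/
theorem Good.mul {a b : B} (ha : G.Good a) (hb : G.Good b) : G.Good (a * b) := by
  obtain ⟨z, hz⟩ := exists_lift (G := G) a
  obtain ⟨w, hw⟩ := exists_lift (G := G) b
  refine Good.of_lift (z * w) ?_ (fun l => ?_) (fun l => ?_) (fun D hD => ?_)
  · rw [mkQ_mul, hw, G.comul_mul a b z hz]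
  · rw [← mul_assoc, ← mul_assoc, ← ha.left_lift hz]
    generalize (t (MulOpposite.op l) ⊗ₜ[k] (1 : B)) * z = x
    induction x using TensorProduct.induction_on with
    | zero => simp
    | add p q hp hq => simp only [add_mul, map_add, hp, hq]
    | tmul p q =>
      rw [G.contractLeft_tmul_mul, hb.left_lift hw, G.contractLeft_tmul, mul_assoc]
  · rw [← mul_assoc, ← mul_assoc, ← ha.right_lift hz]
    generalize ((1 : B) ⊗ₜ[k] s l) * z = x
    induction x using TensorProduct.induction_on with
    | zero => simp
    | add p q hp hq => simp only [add_mul, map_add, hp, hq]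
    | tmul p q =>
      rw [G.contractRight_tmul_mul, hb.right_lift hw, G.contractRight_tmul, mul_assoc]
  · rw [G.rTensor_mul D hD, G.lTensor_mul D hD, hb.coassoc_lift hw D hD]
    exact G.smul_lTensor_congr D hD b w hw (ha.coassoc_lift hz D hD)

theorem Good.add {a b : B} (ha : G.Good a) (hb : G.Good b) : G.Good (a + b) := by
  obtain ⟨z, hz⟩ := exists_lift (G := G) a
  obtain ⟨w, hw⟩ := exists_lift (G := G) b
  refine Good.of_lift (z + w) ?_ (fun l => ?_) (fun l => ?_) (fun D hD => ?_)
  · rw [map_add, map_add, hz, hw]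
  · rw [mul_add, map_add, ha.left_lift hz, hb.left_lift hw, mul_add]
  · rw [mul_add, map_add, ha.right_lift hz, hb.right_lift hw, mul_add]
  · simp only [map_add, ha.coassoc_lift hz D hD, hb.coassoc_lift hw D hD]

theorem good_source (l : L) : G.Good (s l) := by
  refine Good.of_lift ((1 : B) ⊗ₜ[k] s l) (G.copEnd_source l).symm (fun m => ?_) (fun m => ?_)
    (fun D hD => ?_)
  · rw [Algebra.TensorProduct.tmul_mul_tmul, G.contractLeft_tmul, one_mul, mul_one,
      counit_apply, anchorEnd_target, mul_one, (G.commute l _).eq]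
  · rw [Algebra.TensorProduct.tmul_mul_tmul, G.contractRight_tmul, one_mul, one_mul,
      ← map_mul, counit_apply, anchorEnd_source, one_mul]
  · have h1 : (balancedIdeal s t).mkQ (D 1) = (balancedIdeal s t).mkQ 1 := by rw [hD, G.comul_one]
    have h2 : (balancedIdeal s t).mkQ (D (s l)) = (balancedIdeal s t).mkQ ((1 : B) ⊗ₜ[k] s l) := by
      rw [hD, ← G.copEnd_source, comul_apply]
    rw [LinearMap.rTensor_tmul, LinearMap.lTensor_tmul, mkQ₃_assoc_of_mkQ_eq _ h1,
      mkQ₃_tmul_of_mkQ_eq _ h2]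
    rfl

theorem good_target (l : Lᵐᵒᵖ) : G.Good (t l) := by
  refine Good.of_lift (t l ⊗ₜ[k] (1 : B)) (G.copEnd_target l).symm (fun m => ?_) (fun m => ?_)
    (fun D hD => ?_)
  · rw [Algebra.TensorProduct.tmul_mul_tmul, G.contractLeft_tmul, one_mul, ← map_mul, one_mul,
      ← MulOpposite.op_unop l, ← MulOpposite.op_mul, counit_apply, anchorEnd_target, mul_one]
  · rw [Algebra.TensorProduct.tmul_mul_tmul, G.contractRight_tmul, one_mul, mul_one,
      counit_apply, anchorEnd_source, one_mul, (G.commute m _).eq]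
  · have h1 : (balancedIdeal s t).mkQ (D 1) = (balancedIdeal s t).mkQ 1 := by rw [hD, G.comul_one]
    have h2 : (balancedIdeal s t).mkQ (D (t l)) = (balancedIdeal s t).mkQ (t l ⊗ₜ[k] (1 : B)) := by
      rw [hD, ← G.copEnd_target, comul_apply]
    rw [LinearMap.rTensor_tmul, LinearMap.lTensor_tmul, mkQ₃_assoc_of_mkQ_eq _ h2,
      mkQ₃_tmul_of_mkQ_eq _ h1]
    rfl

theorem good_algebraMap (c : k) : G.Good (algebraMap k B c) := by
  rw [← s.commutes c]
  exact good_source _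

variable (G)

theorem good_of_adjoin {S : Set B} (hS : ∀ b ∈ S, G.Good b) (hT : Algebra.adjoin k S = ⊤) (b : B) :
    G.Good b := by
  have hb : b ∈ Algebra.adjoin k S := hT ▸ Algebra.mem_top
  induction hb using Algebra.adjoin_induction with
  | mem x hx => exact hS x hx
  | algebraMap r => exact good_algebraMap r
  | add x y _ _ hx hy => exact hx.add hy
  | mul x y _ _ hx hy => exact hx.mul hy

/-- The right bialgebroid with given coproduct and anchor. -/
def toRightBialgebroid (hG : ∀ b, G.Good b) : RightBialgebroid s t where
  commute := G.commute
  comul := G.comul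
  counit := G.counit
  takeuchi := G.takeuchi
  comul_bimodule b l m z hz := by
    rw [G.comul_mul_source _ _ (z * (t (MulOpposite.op l) ⊗ₜ[k] (1 : B)))
      (G.comul_mul_target _ _ z hz).symm, mul_assoc, Algebra.TensorProduct.tmul_mul_tmul, mul_one,
      one_mul]
  comul_one := G.comul_one
  comul_mul := G.comul_mul
  coassoc D hD b := (hG b).coassoc_lift (hD b) D hD
  counit_bimodule b l m := by rw [G.counit_mul_source, G.counit_mul_target]
  counit_one := by
    change (G.anchorEnd 1).unop 1 = 1
    rw [map_one G.anchorEnd]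
    rfl
  counit_source a b := by rw [G.counit_source_mul, G.counit_mul]
  counit_target a b := by rw [G.counit_target_mul, G.counit_mul]
  counit_comul b z hz := by
    -- The counit axioms are the case l = 1 of the conditions in `Good`.
    have := (hG b).left_lift hz 1
    rw [MulOpposite.op_one, map_one, one_mul, ← Algebra.TensorProduct.one_def, one_mul] at this
    exact this
  comul_counit b z hz := by
    have := (hG b).right_lift hz 1
    rw [map_one, one_mul, ← Algebra.TensorProduct.one_def, one_mul] at this
    exact this

end PreBialgebroid

end Construction

/-! ### The Takeuchi algebra as an opposite endomorphism algebra -/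

section Takeuchi

variable {k L B X : Type*} [Field k] [Ring L] [Algebra k L] [Ring B] [Algebra k B]
  [Ring X] [Algebra k X] {s : L →ₐ[k] B} {t : Lᵐᵒᵖ →ₐ[k] B}

/-- An element of the Takeuchi algebra, as an endomorphism of `B ⊗_L B`. -/
def takeuchiEnd (m : BalancedTensor s t)
    (hm : ∀ l : L, (s l ⊗ₜ[k] (1 : B)) • m = ((1 : B) ⊗ₜ[k] t (MulOpposite.op l)) • m) :
    (Module.End (B ⊗[k] B) (BalancedTensor s t))ᵐᵒᵖ :=
  MulOpposite.op ((balancedIdeal s t).liftQ (LinearMap.toSpanSingleton (B ⊗[k] B) _ m)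
    (Submodule.span_le.2 (by
      rintro _ ⟨l, rfl⟩
      simp [sub_smul, hm])))

theorem takeuchiEnd_apply (m : BalancedTensor s t)
    (hm : ∀ l : L, (s l ⊗ₜ[k] (1 : B)) • m = ((1 : B) ⊗ₜ[k] t (MulOpposite.op l)) • m) :
    (takeuchiEnd m hm).unop ((balancedIdeal s t).mkQ 1) = m :=
  (Submodule.liftQ_apply _ _ _).trans (one_smul _ m)

theorem takeuchi_ext {f g : (Module.End (B ⊗[k] B) (BalancedTensor s t))ᵐᵒᵖ}
    (h : f.unop ((balancedIdeal s t).mkQ 1) = g.unop ((balancedIdeal s t).mkQ 1)) : f = g := by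
  apply MulOpposite.unop_injective
  refine LinearMap.ext fun m => ?_
  obtain ⟨z, rfl⟩ := (balancedIdeal s t).mkQ_surjective m
  rw [← mul_one z, mkQ_mul, map_smul, map_smul, h]

/-- Linearity of g over B ⊗ B extracts the representative of f. Products in the Takeuchi algebra can
thus be computed in B ⊗ B, where identities between the coproducts of generators will be verified.
-/
theorem takeuchi_mul {f g : (Module.End (B ⊗[k] B) (BalancedTensor s t))ᵐᵒᵖ} {z : B ⊗[k] B}
    (hf : f.unop ((balancedIdeal s t).mkQ 1) = (balancedIdeal s t).mkQ z) :
    (f * g).unop ((balancedIdeal s t).mkQ 1) = z • g.unop ((balancedIdeal s t).mkQ 1) := by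
  change g.unop (f.unop _) = _
  rw [hf, ← map_smul, ← mkQ_mul, mul_one]

theorem takeuchi_mul_mk {f g : (Module.End (B ⊗[k] B) (BalancedTensor s t))ᵐᵒᵖ} {z w : B ⊗[k] B}
    (hf : f.unop ((balancedIdeal s t).mkQ 1) = (balancedIdeal s t).mkQ z)
    (hg : g.unop ((balancedIdeal s t).mkQ 1) = (balancedIdeal s t).mkQ w) :
    (f * g).unop ((balancedIdeal s t).mkQ 1) = (balancedIdeal s t).mkQ (z * w) := by
  rw [takeuchi_mul hf, hg, mkQ_mul]

/-- A multiplicative linear map into `B ⊗_L B` as a homomorphism to the Takeuchi algebra. -/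
noncomputable def takeuchiHom (c : X →ₗ[k] BalancedTensor s t)
    (hc : ∀ (l : L) (x : X), (s l ⊗ₜ[k] (1 : B)) • c x =
      ((1 : B) ⊗ₜ[k] t (MulOpposite.op l)) • c x)
    (h_one : c 1 = (balancedIdeal s t).mkQ 1)
    (h_mul : ∀ x y, ∃ z, (balancedIdeal s t).mkQ z = c x ∧ c (x * y) = z • c y) :
    X →ₐ[k] (Module.End (B ⊗[k] B) (BalancedTensor s t))ᵐᵒᵖ :=
  AlgHom.ofLinearMap
    { toFun := fun x => takeuchiEnd (c x) fun l => hc l x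
      map_add' := fun x y => takeuchi_ext (by simp [takeuchiEnd_apply, -Submodule.mkQ_apply])
      map_smul' := fun a x => takeuchi_ext (by simp [takeuchiEnd_apply, -Submodule.mkQ_apply]) }
    (takeuchi_ext ((takeuchiEnd_apply (c 1) fun l => hc l 1).trans h_one))
    (fun x y => takeuchi_ext (by
      obtain ⟨z, hz, h⟩ := h_mul x y
      change (takeuchiEnd (c (x * y)) fun l => hc l (x * y)).unop _ =
        (takeuchiEnd (c x) (fun l => hc l x) * takeuchiEnd (c y) fun l => hc l y).unop _
      rw [takeuchi_mul ((takeuchiEnd_apply _ _).trans hz.symm), takeuchiEnd_apply,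
        takeuchiEnd_apply, h]))

theorem takeuchiHom_apply (c : X →ₗ[k] BalancedTensor s t)
    (hc : ∀ (l : L) (x : X), (s l ⊗ₜ[k] (1 : B)) • c x =
      ((1 : B) ⊗ₜ[k] t (MulOpposite.op l)) • c x)
    (h_one : c 1 = (balancedIdeal s t).mkQ 1)
    (h_mul : ∀ x y, ∃ z, (balancedIdeal s t).mkQ z = c x ∧ c (x * y) = z • c y) (x : X) :
    (takeuchiHom c hc h_one h_mul x).unop ((balancedIdeal s t).mkQ 1) = c x :=
  (takeuchiEnd_apply (c x) fun l => hc l x :)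

/-- The source map of the Takeuchi algebra. -/
noncomputable def takeuchiSource (hst : ∀ (l : L) (m : Lᵐᵒᵖ), Commute (s l) (t m)) :
    L →ₐ[k] (Module.End (B ⊗[k] B) (BalancedTensor s t))ᵐᵒᵖ :=
  takeuchiHom (((balancedIdeal s t).mkQ.restrictScalars k) ∘ₗ TensorProduct.mk k B B 1 ∘ₗ
      s.toLinearMap)
    (fun l x => by
      change (s l ⊗ₜ[k] (1 : B)) • (balancedIdeal s t).mkQ ((1 : B) ⊗ₜ[k] s x) =
        ((1 : B) ⊗ₜ[k] t (MulOpposite.op l)) • (balancedIdeal s t).mkQ ((1 : B) ⊗ₜ[k] s x)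
      have := mkQ_balance (s := s) (t := t) l 1 (s x)
      rw [one_mul] at this
      rw [← mkQ_mul, ← mkQ_mul, Algebra.TensorProduct.tmul_mul_tmul,
        Algebra.TensorProduct.tmul_mul_tmul, mul_one, one_mul, mul_one, this, (hst x _).eq])
    (by simp [Algebra.TensorProduct.one_def])
    (fun x y => ⟨(1 : B) ⊗ₜ[k] s x, rfl, by
      change (balancedIdeal s t).mkQ ((1 : B) ⊗ₜ[k] s (x * y)) =
        ((1 : B) ⊗ₜ[k] s x) • (balancedIdeal s t).mkQ ((1 : B) ⊗ₜ[k] s y)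
      rw [← mkQ_mul, Algebra.TensorProduct.tmul_mul_tmul, mul_one, map_mul]⟩)

/-- The target map of the Takeuchi algebra. -/
noncomputable def takeuchiTarget (hst : ∀ (l : L) (m : Lᵐᵒᵖ), Commute (s l) (t m)) :
    Lᵐᵒᵖ →ₐ[k] (Module.End (B ⊗[k] B) (BalancedTensor s t))ᵐᵒᵖ :=
  takeuchiHom (((balancedIdeal s t).mkQ.restrictScalars k) ∘ₗ (TensorProduct.mk k B B).flip 1 ∘ₗ
      t.toLinearMap)
    (fun l x => by
      change (s l ⊗ₜ[k] (1 : B)) • (balancedIdeal s t).mkQ (t x ⊗ₜ[k] (1 : B)) =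
        ((1 : B) ⊗ₜ[k] t (MulOpposite.op l)) • (balancedIdeal s t).mkQ (t x ⊗ₜ[k] (1 : B))
      have := mkQ_balance (s := s) (t := t) l (t x) 1
      rw [one_mul] at this
      rw [← mkQ_mul, ← mkQ_mul, Algebra.TensorProduct.tmul_mul_tmul,
        Algebra.TensorProduct.tmul_mul_tmul, mul_one, one_mul, mul_one, (hst l _).eq, this])
    (by simp [Algebra.TensorProduct.one_def])
    (fun x y => ⟨t x ⊗ₜ[k] (1 : B), rfl, by
      change (balancedIdeal s t).mkQ (t (x * y) ⊗ₜ[k] (1 : B)) =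
        (t x ⊗ₜ[k] (1 : B)) • (balancedIdeal s t).mkQ (t y ⊗ₜ[k] (1 : B))
      rw [← mkQ_mul, Algebra.TensorProduct.tmul_mul_tmul, mul_one, map_mul]⟩)

theorem takeuchiSource_apply (hst : ∀ (l : L) (m : Lᵐᵒᵖ), Commute (s l) (t m)) (l : L) :
    (takeuchiSource hst l).unop ((balancedIdeal s t).mkQ 1) =
      (balancedIdeal s t).mkQ ((1 : B) ⊗ₜ[k] s l) := takeuchiHom_apply _ _ _ _ _

theorem takeuchiTarget_apply (hst : ∀ (l : L) (m : Lᵐᵒᵖ), Commute (s l) (t m)) (l : Lᵐᵒᵖ) :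
    (takeuchiTarget hst l).unop ((balancedIdeal s t).mkQ 1) =
      (balancedIdeal s t).mkQ (t l ⊗ₜ[k] (1 : B)) := takeuchiHom_apply _ _ _ _ _

end Takeuchi

/-! ### Functionals on H acting on the base algebra, and tensor squares of representations -/

section Evaluation

variable {k H L n : Type*} [Field k] [Ring H] [HopfAlgebra k H] [Ring L] [Algebra k L]
  [Fintype n] [DecidableEq n]

theorem contract_tmul {X : Type*} [AddCommGroup X] [Module k X] (f : X →ₗ[k] k) (x : X) (l : L) :
    contract f (x ⊗ₜ[k] l) = f x • l := rfl

/-- The action `l ↦ f(l₁) l∞` of a functional. -/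
noncomputable def BaseAlgebra.eval (B : BaseAlgebra k H L) (f : H →ₗ[k] k) : L →ₗ[k] L :=
  contract f ∘ₗ B.coact.toLinearMap

theorem BaseAlgebra.eval_apply (B : BaseAlgebra k H L) (f : H →ₗ[k] k) (l : L) :
    B.eval f l = contract f (B.coact l) := rfl

/-- The convolution product of functionals. -/
noncomputable def convolve (f g : H →ₗ[k] k) : H →ₗ[k] k :=
  LinearMap.mul' k k ∘ₗ TensorProduct.map f g ∘ₗ Coalgebra.comul (R := k)

/-- Coassociativity of δ. The functional applied first pairs with the left factor of the coproduct,
so L becomes a right module over the convolution algebra; this matches the opposite endomorphism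
algebra in which the anchor takes values. -/
theorem BaseAlgebra.eval_eval (B : BaseAlgebra k H L) (f g : H →ₗ[k] k) (l : L) :
    B.eval g (B.eval f l) = B.eval (convolve f g) l := by
  have h := congrArg (contract (L := L) f ∘ (contract (L := L) g).lTensor H) (B.coassoc l)
  simp only [Function.comp_apply] at h
  refine Eq.trans ?_ (h.symm.trans ?_)
  · rw [B.eval_apply f]
    induction B.coact l using TensorProduct.induction_on with
    | zero => simp
    | add p q hp hq => simp only [map_add, hp, hq]
    | tmul p q =>
      rw [contract_tmul, map_smul, LinearMap.lTensor_tmul, LinearMap.lTensor_tmul, contract_tmul]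
      rfl
  · rw [B.eval_apply]
    induction B.coact l using TensorProduct.induction_on with
    | zero => simp
    | add p q hp hq => simp only [map_add, hp, hq]
    | tmul p q =>
      rw [contract_tmul, LinearMap.rTensor_tmul]
      simp only [convolve, LinearMap.comp_apply]
      induction Coalgebra.comul (R := k) p using TensorProduct.induction_on with
      | zero => simp
      | add p q hp hq => simp only [map_add, TensorProduct.add_tmul, hp, hq, add_smul]
      | tmul p q => simp [contract_tmul, mul_smul, smul_comm (g q) (f p)]

theorem BaseAlgebra.eval_counit (B : BaseAlgebra k H L) (l : L) :
    B.eval (Coalgebra.counit (R := k)) l = l := B.counit l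

theorem BaseAlgebra.eval_add (B : BaseAlgebra k H L) (f g : H →ₗ[k] k) (l : L) :
    B.eval (f + g) l = B.eval f l + B.eval g l := by
  simp only [B.eval_apply]
  induction B.coact l using TensorProduct.induction_on with
  | zero => simp
  | add p q hp hq => simp only [map_add, hp, hq]; abel
  | tmul p q => simp [contract_tmul, add_smul]

theorem BaseAlgebra.eval_smul (B : BaseAlgebra k H L) (c : k) (f : H →ₗ[k] k) (l : L) :
    B.eval (c • f) l = c • B.eval f l := by
  simp only [B.eval_apply]
  induction B.coact l using TensorProduct.induction_on with
  | zero => simp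
  | add p q hp hq => simp only [map_add, hp, hq, smul_add]
  | tmul p q => simp [contract_tmul, mul_smul]

theorem BaseAlgebra.eval_sum {ι : Type*} (B : BaseAlgebra k H L) (u : Finset ι)
    (f : ι → H →ₗ[k] k) (l : L) : B.eval (∑ i ∈ u, f i) l = ∑ i ∈ u, B.eval (f i) l :=
  map_sum ({ toFun := fun f => B.eval f l
             map_zero' := by
               have := B.eval_smul 0 0 l
               rwa [zero_smul, zero_smul] at this
             map_add' := fun f g => B.eval_add f g l } : (H →ₗ[k] k) →+ L) f u

theorem coeff_apply {X : Type*} [Ring X] [Algebra k X] (σ : X →ₐ[k] Matrix n n k) (i j : n)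
    (x : X) : coeff σ i j x = σ x i j := rfl

theorem coeff_one {X : Type*} [Ring X] [Algebra k X] (σ : X →ₐ[k] Matrix n n k) (i j : n) :
    coeff σ i j 1 = (1 : Matrix n n k) i j := by
  change σ 1 i j = _
  rw [map_one]

theorem contract_coeff_mul {X : Type*} [Ring X] [Algebra k X] (σ : X →ₐ[k] Matrix n n k) (i j : n)
    (x y : X ⊗[k] L) : contract (coeff σ i j) (x * y) =
      ∑ r, contract (coeff σ i r) x * contract (coeff σ r j) y := by
  induction x using TensorProduct.induction_on with
  | zero => simp
  | add p q hp hq => simp only [add_mul, map_add, hp, hq, Finset.sum_add_distrib]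
  | tmul a a' =>
  induction y using TensorProduct.induction_on with
  | zero => simp
  | add p q hp hq => simp only [mul_add, map_add, hp, hq, Finset.sum_add_distrib]
  | tmul b b' =>
    simp only [Algebra.TensorProduct.tmul_mul_tmul, contract_tmul, coeff_apply, map_mul,
      Matrix.mul_apply, Finset.sum_smul, smul_mul_smul_comm]

/-- Both δ and σ are multiplicative. For the operators x ↦ σ(x₁)x∞ this is the exchange relation of
T with right multiplications and with left multiplications of L at once. -/
theorem BaseAlgebra.eval_coeff_mul (B : BaseAlgebra k H L) (σ : H →ₐ[k] Matrix n n k) (i j : n)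
    (x y : L) : B.eval (coeff σ i j) (x * y) =
      ∑ r, B.eval (coeff σ i r) x * B.eval (coeff σ r j) y := by
  simp only [B.eval_apply, map_mul, contract_coeff_mul]

theorem sum_convolve_antipode_left (σ : H →ₐ[k] Matrix n n k) (i j : n) :
    ∑ r, convolve (coeff σ i r ∘ₗ HopfAlgebra.antipode k) (coeff σ r j) =
      (1 : Matrix n n k) i j • Coalgebra.counit (R := k) := by
  refine LinearMap.ext fun h => ?_
  have e := congrArg (coeff σ i j) (HopfAlgebra.mul_antipode_rTensor_comul_apply (R := k) h)
  rw [Algebra.algebraMap_eq_smul_one, map_smul, coeff_one, smul_eq_mul, mul_comm] at e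
  rw [LinearMap.smul_apply, smul_eq_mul, ← e]
  simp only [convolve, LinearMap.sum_apply, LinearMap.comp_apply]
  induction Coalgebra.comul (R := k) h using TensorProduct.induction_on with
  | zero => simp
  | add p q hp hq => simp only [map_add, Finset.sum_add_distrib, hp, hq]
  | tmul p q => simp [coeff_apply, Matrix.mul_apply]

theorem sum_convolve_antipode_right (σ : H →ₐ[k] Matrix n n k) (i j : n) :
    ∑ r, convolve (coeff σ i r) (coeff σ r j ∘ₗ HopfAlgebra.antipode k) =
      (1 : Matrix n n k) i j • Coalgebra.counit (R := k) := by
  refine LinearMap.ext fun h => ?_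
  have e := congrArg (coeff σ i j) (HopfAlgebra.mul_antipode_lTensor_comul_apply (R := k) h)
  rw [Algebra.algebraMap_eq_smul_one, map_smul, coeff_one, smul_eq_mul, mul_comm] at e
  rw [LinearMap.smul_apply, smul_eq_mul, ← e]
  simp only [convolve, LinearMap.sum_apply, LinearMap.comp_apply]
  induction Coalgebra.comul (R := k) h using TensorProduct.induction_on with
  | zero => simp
  | add p q hp hq => simp only [map_add, Finset.sum_add_distrib, hp, hq]
  | tmul p q => simp [coeff_apply, Matrix.mul_apply]

/-- The antipode axiom seen through σ and then through the action of functionals. Read in the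
opposite endomorphism algebra, it is the anchor version of T̄T = 1; `sum_eval_antipode_right` is
that of TT̄ = 1. -/
theorem BaseAlgebra.sum_eval_antipode_left (B : BaseAlgebra k H L) (σ : H →ₐ[k] Matrix n n k)
    (i j : n) (l : L) :
    ∑ r, B.eval (coeff σ r j) (B.eval (coeff σ i r ∘ₗ HopfAlgebra.antipode k) l) =
      (1 : Matrix n n k) i j • l := by
  simp only [B.eval_eval]
  rw [← B.eval_sum, sum_convolve_antipode_left, B.eval_smul, B.eval_counit]

theorem BaseAlgebra.sum_eval_antipode_right (B : BaseAlgebra k H L) (σ : H →ₐ[k] Matrix n n k)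
    (i j : n) (l : L) :
    ∑ r, B.eval (coeff σ r j ∘ₗ HopfAlgebra.antipode k) (B.eval (coeff σ i r) l) =
      (1 : Matrix n n k) i j • l := by
  simp only [B.eval_eval]
  rw [← B.eval_sum, sum_convolve_antipode_right, B.eval_smul, B.eval_counit]

theorem kroneckerBilinear_apply (x y : Matrix n n k) :
    Matrix.kroneckerBilinear (R := k) x y = Matrix.kroneckerMap (· * ·) x y := rfl

variable (k n) in
/-- The Kronecker product as an algebra homomorphism. -/
noncomputable def kroneckerHom :
    Matrix n n k ⊗[k] Matrix n n k →ₐ[k] Matrix (n × n) (n × n) k :=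
  Algebra.TensorProduct.lift
    (AlgHom.ofLinearMap ((Matrix.kroneckerBilinear (R := k)).flip (1 : Matrix n n k))
      (by simp [kroneckerBilinear_apply])
      (fun x y => by simp [kroneckerBilinear_apply, ← Matrix.mul_kronecker_mul]))
    (AlgHom.ofLinearMap (Matrix.kroneckerBilinear (R := k) (1 : Matrix n n k))
      (by simp [kroneckerBilinear_apply])
      (fun x y => by simp [kroneckerBilinear_apply, ← Matrix.mul_kronecker_mul]))
    (fun x y => by
      change Matrix.kroneckerMap (· * ·) x 1 * Matrix.kroneckerMap (· * ·) 1 y =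
        Matrix.kroneckerMap (· * ·) 1 y * Matrix.kroneckerMap (· * ·) x 1
      simp [← Matrix.mul_kronecker_mul])

theorem kroneckerHom_tmul (x y : Matrix n n k) (p q : n × n) :
    kroneckerHom k n (x ⊗ₜ[k] y) p q = x p.1 q.1 * y p.2 q.2 := by
  change (Matrix.kroneckerMap (· * ·) x 1 * Matrix.kroneckerMap (· * ·) 1 y :
    Matrix (n × n) (n × n) k) p q = _
  rw [← Matrix.mul_kronecker_mul, mul_one, one_mul]
  rfl

/-- The tensor square of a representation. -/
noncomputable def tensorSquare (σ : H →ₐ[k] Matrix n n k) : H →ₐ[k] Matrix (n × n) (n × n) k :=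
  (kroneckerHom k n).comp ((Algebra.TensorProduct.map σ σ).comp (Bialgebra.comulAlgHom k H))

theorem coeff_tensorSquare (σ : H →ₐ[k] Matrix n n k) (p q : n × n) :
    coeff (tensorSquare σ) p q = convolve (coeff σ p.1 q.1) (coeff σ p.2 q.2) := by
  refine LinearMap.ext fun h => ?_
  change kroneckerHom k n (Algebra.TensorProduct.map σ σ (Coalgebra.comul (R := k) h)) p q =
    LinearMap.mul' k k (TensorProduct.map _ _ (Coalgebra.comul (R := k) h))
  induction Coalgebra.comul (R := k) h using TensorProduct.induction_on with
  | zero => simp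
  | add p q hp hq => simp only [map_add, Matrix.add_apply, hp, hq]
  | tmul p q => simp [kroneckerHom_tmul, coeff_apply]

theorem coeff₂_eq (σ : H →ₐ[k] Matrix n n k) (p q : n × n) :
    coeff₂ σ p q = coeff (tensorSquare σ) p q := (coeff_tensorSquare σ p q).symm

theorem BaseAlgebra.eval_tensorSquare (B : BaseAlgebra k H L) (σ : H →ₐ[k] Matrix n n k)
    (p q : n × n) (l : L) : B.eval (coeff (tensorSquare σ) p q) l =
      B.eval (coeff σ p.2 q.2) (B.eval (coeff σ p.1 q.1) l) := by
  rw [B.eval_eval, coeff_tensorSquare]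

theorem BaseAlgebra.opMatrix_apply (B : BaseAlgebra k H L) (σ : H →ₐ[k] Matrix n n k)
    (S : Matrix (n × n) (n × n) L) (p q : n × n) : B.opMatrix σ S p q =
      ∑ r, B.eval (coeff (tensorSquare σ) r q ∘ₗ HopfAlgebra.antipode k) (S p r) := by
  simp only [← coeff₂_eq]
  rfl

/-- The entries of S_op are those of S acted on by (σ ⊗ σ)Δγ, and acting by (σ ⊗ σ)Δ undoes this by
the antipode identity. -/
theorem BaseAlgebra.sum_eval_opMatrix (B : BaseAlgebra k H L) (σ : H →ₐ[k] Matrix n n k)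
    (S : Matrix (n × n) (n × n) L) (p w : n × n) :
    ∑ r, B.eval (coeff (tensorSquare σ) r w) (B.opMatrix σ S p r) = S p w := by
  simp only [B.opMatrix_apply, map_sum]
  rw [Finset.sum_comm]
  simp only [B.sum_eval_antipode_left, Matrix.one_apply]
  simp

end Evaluation

/-! ### The matrices M ⊗ 1 and 1 ⊗ M over a noncommutative ring -/

section Legs

variable {n R R' : Type*} [Fintype n] [DecidableEq n] [Ring R] [Ring R']

theorem leg₁_apply (M : Matrix n n R) (p q : n × n) :
    leg₁ M p q = M p.1 q.1 * (1 : Matrix n n R) p.2 q.2 := rfl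

theorem leg₂_apply (M : Matrix n n R) (p q : n × n) :
    leg₂ M p q = (1 : Matrix n n R) p.1 q.1 * M p.2 q.2 := rfl

theorem leg₁_mul (M N : Matrix n n R) : leg₁ (M * N) = leg₁ M * leg₁ N := by
  ext p q
  simp [leg₁_apply, Matrix.mul_apply, Fintype.sum_prod_type, Matrix.one_apply]

theorem leg₂_mul (M N : Matrix n n R) : leg₂ (M * N) = leg₂ M * leg₂ N := by
  ext p q
  simp [leg₂_apply, Matrix.mul_apply, Fintype.sum_prod_type, Matrix.one_apply, Finset.mul_sum]

theorem leg₁_one : leg₁ (1 : Matrix n n R) = 1 := by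
  ext p q
  simp [leg₁_apply, Matrix.one_apply, Prod.ext_iff, ite_and]
  split_ifs <;> rfl

theorem leg₂_one : leg₂ (1 : Matrix n n R) = 1 := by
  ext p q
  simp [leg₂_apply, Matrix.one_apply, Prod.ext_iff, ite_and]
  split_ifs <;> rfl

theorem leg₁_mul_leg₂_apply (M N : Matrix n n R) (p q : n × n) :
    (leg₁ M * leg₂ N : Matrix (n × n) (n × n) R) p q = M p.1 q.1 * N p.2 q.2 := by
  simp [leg₁_apply, leg₂_apply, Matrix.mul_apply, Fintype.sum_prod_type, Matrix.one_apply]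

theorem leg₁_map (f : R →+* R') (M : Matrix n n R) : (leg₁ M).map f = leg₁ (M.map f) := by
  ext p q
  simp only [leg₁_apply, Matrix.one_apply, Matrix.map_apply, map_mul]
  split_ifs <;> simp

theorem leg₂_map (f : R →+* R') (M : Matrix n n R) : (leg₂ M).map f = leg₂ (M.map f) := by
  ext p q
  simp only [leg₂_apply, Matrix.one_apply, Matrix.map_apply, map_mul]
  split_ifs <;> simp

theorem map_one_apply {F : Type*} [FunLike F R R'] [RingHomClass F R R'] (f : F) (i j : n) :
    f ((1 : Matrix n n R) i j) = (1 : Matrix n n R') i j := by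
  rw [Matrix.one_apply, Matrix.one_apply]
  split_ifs <;> simp

end Legs

/-! ### The universal property of the extended dynamical FRT algebra with a reduced set of relations
-/

section Representations

variable {k H L n R : Type*} [Field k] [Ring H] [HopfAlgebra k H] [Ring L] [Algebra k L]
  [Fintype n] [DecidableEq n] [Ring R] [Algebra k R]

/-- Matrices and maps in an algebra `R` that define a homomorphism from the extended dynamical
FRT algebra. -/
structure FRTRep (B : BaseAlgebra k H L) (σ : H →ₐ[k] Matrix n n k)
    (S : Matrix (n × n) (n × n) L) (R : Type*) [Ring R] [Algebra k R] where
  s : L →ₐ[k] R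
  t : Lᵐᵒᵖ →ₐ[k] R
  T : Matrix n n R
  Tbar : Matrix n n R
  commute : ∀ (l : L) (m : Lᵐᵒᵖ), Commute (s l) (t m)
  Tbar_mul_T : Tbar * T = 1
  T_mul_Tbar : T * Tbar = 1
  src_T : ∀ (l : L) (i j : n), s l * T i j = ∑ r, T i r * s (B.eval (coeff σ r j) l)
  tgt_T : ∀ (l : L) (i j : n), t (MulOpposite.op l) * T i j =
    ∑ r, T r j * t (MulOpposite.op (B.eval (coeff σ i r) l))
  T_T : ∀ p q : n × n, ∑ r : n × n, T r.1 q.1 * T r.2 q.2 * t (MulOpposite.op (S p r)) =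
    ∑ r : n × n, T p.1 r.1 * T p.2 r.2 * s (S r q)

section Relations

variable {B : BaseAlgebra k H L} {σ : H →ₐ[k] Matrix n n k}

theorem tgt_T_T {t : Lᵐᵒᵖ →ₐ[k] R} {T : Matrix n n R}
    (h : ∀ (l : L) (i j : n), t (MulOpposite.op l) * T i j =
      ∑ r, T r j * t (MulOpposite.op (B.eval (coeff σ i r) l))) (l : L) (p q : n × n) :
    t (MulOpposite.op l) * (T p.1 q.1 * T p.2 q.2) = ∑ r : n × n,
      T r.1 q.1 * T r.2 q.2 * t (MulOpposite.op (B.eval (coeff (tensorSquare σ) p r) l)) := by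
  rw [← mul_assoc, h, Finset.sum_mul, Fintype.sum_prod_type]
  refine Finset.sum_congr rfl fun r _ => ?_
  rw [mul_assoc, h, Finset.mul_sum]
  refine Finset.sum_congr rfl fun r' _ => ?_
  rw [B.eval_tensorSquare, mul_assoc]

/-- Carrying t(S_op) to the right past T₁T₂ applies (σ ⊗ σ)Δ to its entries, which cancels the
antipode twist. The quadratic relation thereby takes the form used in `FRTRep`, where S_op no longer
appears. -/
theorem sum_opMatrix_mul {t : Lᵐᵒᵖ →ₐ[k] R} {T : Matrix n n R}
    (h : ∀ (l : L) (i j : n), t (MulOpposite.op l) * T i j =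
      ∑ r, T r j * t (MulOpposite.op (B.eval (coeff σ i r) l)))
    (S : Matrix (n × n) (n × n) L) (p q : n × n) :
    ∑ r, t (MulOpposite.op (B.opMatrix σ S p r)) * (T r.1 q.1 * T r.2 q.2) =
      ∑ r : n × n, T r.1 q.1 * T r.2 q.2 * t (MulOpposite.op (S p r)) := by
  simp only [tgt_T_T h]
  rw [Finset.sum_comm]
  refine Finset.sum_congr rfl fun w _ => ?_
  rw [← B.sum_eval_opMatrix σ S p w, ← Finset.mul_sum, ← map_sum, Finset.op_sum]

/-- As T is invertible, both sides may be compared after right multiplication by T. The left side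
becomes s(l) times the unit matrix; on the right, s passes through T by the relation for T, T̄T
collapses, and the antipode identity leaves s(l). In `tgt_inv` the antipode identity is used before
T̄T collapses. -/
theorem src_inv {s : L →ₐ[k] R} {T Tbar : Matrix n n R} (h₁ : Tbar * T = 1) (h₂ : T * Tbar = 1)
    (h : ∀ (l : L) (i j : n), s l * T i j = ∑ r, T i r * s (B.eval (coeff σ r j) l))
    (l : L) (i j : n) : s l * Tbar i j =
      ∑ r, Tbar r j * s (B.eval (coeff σ i r ∘ₗ HopfAlgebra.antipode k) l) := by
  set Y : Matrix n n R := Matrix.of fun i j =>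
    ∑ r, Tbar r j * s (B.eval (coeff σ i r ∘ₗ HopfAlgebra.antipode k) l) with hY
  have key : s l • Tbar = Y := by
    rw [← mul_one (s l • Tbar), ← mul_one Y, ← h₂, ← mul_assoc, ← mul_assoc, Matrix.smul_mul, h₁]
    congr 1
    ext i q
    have e : ∀ r w, ∑ x, Tbar r x * T x w = (1 : Matrix n n R) r w := fun r w => by
      rw [← h₁, Matrix.mul_apply]
    simp only [hY, Matrix.mul_apply, Matrix.of_apply, Finset.sum_mul, mul_assoc, h, Finset.mul_sum]
    rw [Finset.sum_comm]
    have e2 : ∀ r, ∑ x, ∑ w, Tbar r x * (T x w * s (B.eval (coeff σ w q)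
        (B.eval (coeff σ i r ∘ₗ HopfAlgebra.antipode k) l))) =
        s (B.eval (coeff σ r q) (B.eval (coeff σ i r ∘ₗ HopfAlgebra.antipode k) l)) := fun r => by
      rw [Finset.sum_comm]
      simp only [← mul_assoc, ← Finset.sum_mul, e]
      simp [Matrix.one_apply]
    simp only [e2]
    rw [← map_sum, B.sum_eval_antipode_left]
    simp only [Matrix.one_apply, Matrix.smul_apply]
    split_ifs <;> simp
  exact congrFun (congrFun key i) j

theorem tgt_inv {t : Lᵐᵒᵖ →ₐ[k] R} {T Tbar : Matrix n n R} (h₁ : Tbar * T = 1) (h₂ : T * Tbar = 1)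
    (h : ∀ (l : L) (i j : n), t (MulOpposite.op l) * T i j =
      ∑ r, T r j * t (MulOpposite.op (B.eval (coeff σ i r) l)))
    (l : L) (i j : n) : t (MulOpposite.op l) * Tbar i j =
      ∑ r, Tbar i r *
        t (MulOpposite.op (B.eval (coeff σ r j ∘ₗ HopfAlgebra.antipode k) l)) := by
  set Y : Matrix n n R := Matrix.of fun i j => ∑ r, Tbar i r *
    t (MulOpposite.op (B.eval (coeff σ r j ∘ₗ HopfAlgebra.antipode k) l)) with hY
  have key : t (MulOpposite.op l) • Tbar = Y := by
    rw [← mul_one (t _ • Tbar), ← mul_one Y, ← h₂, ← mul_assoc, ← mul_assoc, Matrix.smul_mul, h₁]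
    congr 1
    ext i q
    have e : ∀ r w, ∑ x, Tbar r x * T x w = (1 : Matrix n n R) r w := fun r w => by
      rw [← h₁, Matrix.mul_apply]
    simp only [hY, Matrix.mul_apply, Matrix.of_apply, Finset.sum_mul, mul_assoc, h, Finset.mul_sum]
    rw [Finset.sum_comm]
    have e2 : ∀ r, ∑ x, ∑ w, Tbar i r * (T w q * t (MulOpposite.op (B.eval (coeff σ x w)
        (B.eval (coeff σ r x ∘ₗ HopfAlgebra.antipode k) l)))) =
        Tbar i r * T r q * t (MulOpposite.op l) := fun r => by
      rw [Finset.sum_comm]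
      simp only [← mul_assoc, ← Finset.mul_sum, ← map_sum, ← Finset.op_sum,
        B.sum_eval_antipode_left]
      rw [Finset.sum_eq_single r (fun b _ hb => by simp [hb.symm]) (by simp)]
      simp
    simp only [e2]
    rw [← Finset.sum_mul, e]
    simp [Matrix.one_apply]
  exact congrFun (congrFun key i) j

end Relations

namespace FRTRep

variable {B : BaseAlgebra k H L} {σ : H →ₐ[k] Matrix n n k} {S : Matrix (n × n) (n × n) L}
  (Φ : FRTRep B σ S R)

/-- The images of the generators. -/
def gen : FRTGen L n → R
  | .T i j => Φ.T i j
  | .Tbar i j => Φ.Tbar i j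
  | .src l => Φ.s l
  | .tgt l => Φ.t (MulOpposite.op l)

/-- The homomorphism from the free algebra. -/
noncomputable def free : FreeAlgebra k (FRTGen L n) →ₐ[k] R := FreeAlgebra.lift k Φ.gen

theorem free_src (l : L) : Φ.free (frtSrc k n l) = Φ.s l := FreeAlgebra.lift_ι_apply _ _
theorem free_tgt (l : L) : Φ.free (frtTgt k n l) = Φ.t (MulOpposite.op l) :=
  FreeAlgebra.lift_ι_apply _ _
theorem free_T (i j : n) : Φ.free (frtMat k FRTGen.T i j) = Φ.T i j :=
  FreeAlgebra.lift_ι_apply _ _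
theorem free_Tbar (i j : n) : Φ.free (frtMat k FRTGen.Tbar i j) = Φ.Tbar i j :=
  FreeAlgebra.lift_ι_apply _ _

theorem map_T : (frtMat k (FRTGen.T : n → n → FRTGen L n)).map (Φ.free : _ →+* R) = Φ.T := by
  ext i j; exact Φ.free_T i j
theorem map_Tbar : (frtMat k (FRTGen.Tbar : n → n → FRTGen L n)).map (Φ.free : _ →+* R) = Φ.Tbar := by
  ext i j; exact Φ.free_Tbar i j
theorem map_S : (frtS k S).map (Φ.free : _ →+* R) = S.map Φ.s := by
  ext i j; exact Φ.free_src _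
theorem map_Sop : (frtSop B σ S).map (Φ.free : _ →+* R) =
    (B.opMatrix σ S).map fun l => Φ.t (MulOpposite.op l) := by
  ext i j; exact Φ.free_tgt _

theorem opMatrix_T_T : (B.opMatrix σ S).map (fun l => Φ.t (MulOpposite.op l)) *
    leg₁ Φ.T * leg₂ Φ.T = leg₁ Φ.T * leg₂ Φ.T * S.map Φ.s := by
  ext p q
  rw [mul_assoc, Matrix.mul_apply, Matrix.mul_apply]
  simp only [leg₁_mul_leg₂_apply, Matrix.map_apply]
  rw [sum_opMatrix_mul Φ.tgt_T, Φ.T_T]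

/-- Only the relations for T, the commutation of s with t and T̄ = T⁻¹ are assumed; the remaining
relations with T̄ come from conjugating those for T. -/
theorem free_rel {x y : FreeAlgebra k (FRTGen L n)} (h : FRTRel B σ S x y) :
    Φ.free x = Φ.free y := by
  have m₁ : leg₁ Φ.Tbar * leg₁ Φ.T = 1 := by rw [← leg₁_mul, Φ.Tbar_mul_T, leg₁_one]
  have m₂ : leg₂ Φ.Tbar * leg₂ Φ.T = 1 := by rw [← leg₂_mul, Φ.Tbar_mul_T, leg₂_one]
  have m₃ : leg₁ Φ.T * leg₁ Φ.Tbar = 1 := by rw [← leg₁_mul, Φ.T_mul_Tbar, leg₁_one]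
  have m₄ : leg₂ Φ.T * leg₂ Φ.Tbar = 1 := by rw [← leg₂_mul, Φ.T_mul_Tbar, leg₂_one]
  have hS := Φ.opMatrix_T_T
  -- The quadratic relation multiplied by T̄₁ on the left and T̄₂ on the right.
  have hS₂ : leg₂ Φ.T * S.map Φ.s * leg₂ Φ.Tbar = leg₁ Φ.Tbar *
      (B.opMatrix σ S).map (fun l => Φ.t (MulOpposite.op l)) * leg₁ Φ.T := by
    calc _ = leg₁ Φ.Tbar * leg₁ Φ.T * leg₂ Φ.T * S.map Φ.s * leg₂ Φ.Tbar := by rw [m₁, one_mul]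
      _ = leg₁ Φ.Tbar * (leg₁ Φ.T * leg₂ Φ.T * S.map Φ.s) * leg₂ Φ.Tbar := by
        simp only [mul_assoc]
      _ = leg₁ Φ.Tbar * (B.opMatrix σ S).map (fun l => Φ.t (MulOpposite.op l)) * leg₁ Φ.T *
          (leg₂ Φ.T * leg₂ Φ.Tbar) := by rw [← hS]; simp only [mul_assoc]
      _ = _ := by rw [m₄, mul_one]
  -- The mixed relation multiplied by T̄₂ on the left and T̄₁ on the right.
  have hS₃ : S.map Φ.s * leg₂ Φ.Tbar * leg₁ Φ.Tbar = leg₂ Φ.Tbar * leg₁ Φ.Tbar *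
      (B.opMatrix σ S).map fun l => Φ.t (MulOpposite.op l) := by
    calc _ = leg₂ Φ.Tbar * (leg₂ Φ.T * S.map Φ.s * leg₂ Φ.Tbar) * leg₁ Φ.Tbar := by
          simp only [← mul_assoc, m₂, one_mul]
      _ = leg₂ Φ.Tbar * leg₁ Φ.Tbar * (B.opMatrix σ S).map
          (fun l => Φ.t (MulOpposite.op l)) * (leg₁ Φ.T * leg₁ Φ.Tbar) := by
        rw [hS₂]; simp only [mul_assoc]
      _ = _ := by rw [m₃, mul_one]
  have ent : ∀ (M : Matrix (n × n) (n × n) (FreeAlgebra k (FRTGen L n))) (p q : n × n),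
    Φ.free (M p q) = M.map (Φ.free : _ →+* R) p q := fun _ _ _ => rfl
  have ent' : ∀ (M : Matrix n n (FreeAlgebra k (FRTGen L n))) (p q : n),
    Φ.free (M p q) = M.map (Φ.free : _ →+* R) p q := fun _ _ _ => rfl
  induction h with
  | src_add l m => simp only [map_add, free_src]
  | src_smul c l => simp only [map_smul, free_src]
  | src_one => simp only [map_one, free_src]
  | src_mul l m => simp only [map_mul, free_src]
  | tgt_add l m => simp only [map_add, free_tgt, MulOpposite.op_add]
  | tgt_smul c l => simp only [map_smul, free_tgt, MulOpposite.op_smul]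
  | tgt_one => simp only [map_one, free_tgt, MulOpposite.op_one]
  | tgt_mul l m => simp only [map_mul, free_tgt, MulOpposite.op_mul]
  | src_tgt l m => simp only [map_mul, free_tgt, free_src, (Φ.commute l _).eq]
  | src_T l i j => simp only [map_mul, free_src, free_T, map_sum, Φ.src_T]; rfl
  | src_Tbar l i j =>
    simp only [map_mul, free_src, free_Tbar, map_sum,
      src_inv Φ.Tbar_mul_T Φ.T_mul_Tbar Φ.src_T]
    rfl
  | tgt_T l i j => simp only [map_mul, free_tgt, free_T, map_sum, Φ.tgt_T]; rfl
  | tgt_Tbar l i j =>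
    simp only [map_mul, free_tgt, free_Tbar, map_sum,
      tgt_inv Φ.Tbar_mul_T Φ.T_mul_Tbar Φ.tgt_T]
    rfl
  | T_T p q =>
    simp only [ent, Matrix.map_mul, leg₁_map, leg₂_map, map_T, map_S, map_Sop, hS]
  | T_Tbar p q =>
    simp only [ent, Matrix.map_mul, leg₁_map, leg₂_map, map_T, map_Tbar, map_S, map_Sop, hS₂]
  | Tbar_Tbar p q =>
    simp only [ent, Matrix.map_mul, leg₁_map, leg₂_map, map_Tbar, map_S, map_Sop, hS₃]
  | Tbar_mul_T i j =>
    simp only [ent', Matrix.map_mul, map_T, map_Tbar, Φ.Tbar_mul_T]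
    exact (map_one_apply Φ.free i j).symm
  | T_mul_Tbar i j =>
    simp only [ent', Matrix.map_mul, map_T, map_Tbar, Φ.T_mul_Tbar]
    exact (map_one_apply Φ.free i j).symm

/-- The homomorphism from the extended dynamical FRT algebra. -/
noncomputable def lift : ExtFRT B σ S →ₐ[k] R :=
  RingQuot.liftAlgHom k ⟨Φ.free, fun _ _ h => Φ.free_rel h⟩

theorem lift_proj (x : FreeAlgebra k (FRTGen L n)) : Φ.lift (ExtFRT.proj B σ S x) = Φ.free x :=
  RingQuot.liftAlgHom_mkAlgHom_apply k _ _ _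

theorem lift_source (l : L) : Φ.lift (ExtFRT.source B σ S l) = Φ.s l :=
  (Φ.lift_proj _).trans (Φ.free_src l)
theorem lift_target (l : Lᵐᵒᵖ) : Φ.lift (ExtFRT.target B σ S l) = Φ.t l :=
  (Φ.lift_proj _).trans (Φ.free_tgt _)
theorem lift_T (i j : n) : Φ.lift (ExtFRT.T B σ S i j) = Φ.T i j :=
  (Φ.lift_proj _).trans (Φ.free_T i j)
theorem lift_Tbar (i j : n) : Φ.lift (ExtFRT.Tbar B σ S i j) = Φ.Tbar i j :=
  (Φ.lift_proj _).trans (Φ.free_Tbar i j)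

end FRTRep

namespace ExtFRT

variable (B : BaseAlgebra k H L) (σ : H →ₐ[k] Matrix n n k) (S : Matrix (n × n) (n × n) L)

theorem proj_surjective : Function.Surjective (proj B σ S) := RingQuot.mkAlgHom_surjective k _

/-- The generators of the extended dynamical FRT algebra. -/
def generators : Set (ExtFRT B σ S) :=
  Set.range (source B σ S) ∪ Set.range (target B σ S) ∪
    Set.range (fun p : n × n => T B σ S p.1 p.2) ∪ Set.range (fun p : n × n => Tbar B σ S p.1 p.2)

theorem adjoin_generators : Algebra.adjoin k (generators B σ S) = ⊤ := by
  rw [eq_top_iff]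
  intro x _
  obtain ⟨y, rfl⟩ := proj_surjective B σ S x
  induction y using FreeAlgebra.induction with
  | grade0 r => rw [AlgHom.commutes]; exact Subalgebra.algebraMap_mem _ r
  | grade1 x =>
    apply Algebra.subset_adjoin
    cases x with
    | T i j => exact Or.inl (Or.inr ⟨(i, j), rfl⟩)
    | Tbar i j => exact Or.inr ⟨(i, j), rfl⟩
    | src l => exact Or.inl (Or.inl (Or.inl ⟨l, rfl⟩))
    | tgt l => exact Or.inl (Or.inl (Or.inr ⟨MulOpposite.op l, rfl⟩))
  | mul a b ha hb => rw [map_mul]; exact mul_mem (ha trivial) (hb trivial)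
  | add a b ha hb => rw [map_add]; exact add_mem (ha trivial) (hb trivial)

variable {B σ S}

theorem algHom_ext {f g : ExtFRT B σ S →ₐ[k] R}
    (hs : ∀ l, f (source B σ S l) = g (source B σ S l))
    (ht : ∀ l, f (target B σ S l) = g (target B σ S l))
    (hT : ∀ i j, f (T B σ S i j) = g (T B σ S i j))
    (hTbar : ∀ i j, f (Tbar B σ S i j) = g (Tbar B σ S i j)) : f = g := by
  refine AlgHom.ext_of_adjoin_eq_top (adjoin_generators B σ S) ?_
  rintro _ (((⟨l, rfl⟩ | ⟨l, rfl⟩) | ⟨p, rfl⟩) | ⟨p, rfl⟩)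
  exacts [hs l, ht l, hT _ _, hTbar _ _]

theorem source_target_commute (l : L) (m : Lᵐᵒᵖ) :
    Commute (source B σ S l) (target B σ S m) :=
  (map_mul (proj B σ S) _ _).symm.trans
    ((proj_rel B σ S (.src_tgt l m.unop)).trans (map_mul (proj B σ S) _ _))

theorem source_mul_T (l : L) (i j : n) : source B σ S l * T B σ S i j =
    ∑ r, T B σ S i r * source B σ S (B.eval (coeff σ r j) l) := by
  refine (map_mul (proj B σ S) _ _).symm.trans ((proj_rel B σ S (.src_T l i j)).trans ?_)
  simp only [map_sum, map_mul]
  rfl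

theorem source_mul_Tbar (l : L) (i j : n) : source B σ S l * Tbar B σ S i j =
    ∑ r, Tbar B σ S r j *
      source B σ S (B.eval (coeff σ i r ∘ₗ HopfAlgebra.antipode k) l) := by
  refine (map_mul (proj B σ S) _ _).symm.trans ((proj_rel B σ S (.src_Tbar l i j)).trans ?_)
  simp only [map_sum, map_mul]
  rfl

theorem target_mul_T (l : L) (i j : n) : target B σ S (MulOpposite.op l) * T B σ S i j =
    ∑ r, T B σ S r j * target B σ S (MulOpposite.op (B.eval (coeff σ i r) l)) := by
  refine (map_mul (proj B σ S) _ _).symm.trans ((proj_rel B σ S (.tgt_T l i j)).trans ?_)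
  simp only [map_sum, map_mul]
  rfl

theorem target_mul_Tbar (l : L) (i j : n) : target B σ S (MulOpposite.op l) * Tbar B σ S i j =
    ∑ r, Tbar B σ S i r * target B σ S
      (MulOpposite.op (B.eval (coeff σ r j ∘ₗ HopfAlgebra.antipode k) l)) := by
  refine (map_mul (proj B σ S) _ _).symm.trans ((proj_rel B σ S (.tgt_Tbar l i j)).trans ?_)
  simp only [map_sum, map_mul]
  rfl

theorem Tbar_mul_T : Tbar B σ S * T B σ S = 1 := by
  ext i j
  have h := proj_rel B σ S (.Tbar_mul_T i j)
  rw [Matrix.mul_apply, map_sum] at h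
  simp only [map_mul] at h
  rw [Matrix.mul_apply]
  exact h.trans (map_one_apply (proj B σ S) i j)

theorem T_mul_Tbar : T B σ S * Tbar B σ S = 1 := by
  ext i j
  have h := proj_rel B σ S (.T_mul_Tbar i j)
  rw [Matrix.mul_apply, map_sum] at h
  simp only [map_mul] at h
  rw [Matrix.mul_apply]
  exact h.trans (map_one_apply (proj B σ S) i j)

theorem opMatrix_T_T (p q : n × n) :
    ∑ r : n × n, target B σ S (MulOpposite.op (B.opMatrix σ S p r)) *
      (T B σ S r.1 q.1 * T B σ S r.2 q.2) =
    ∑ r : n × n, T B σ S p.1 r.1 * T B σ S p.2 r.2 * source B σ S (S r q) := by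
  have h := proj_rel B σ S (.T_T p q)
  rw [mul_assoc, Matrix.mul_apply, Matrix.mul_apply, map_sum, map_sum] at h
  simp only [leg₁_mul_leg₂_apply, map_mul] at h
  exact h

theorem T_T_target (p q : n × n) :
    ∑ r : n × n, T B σ S r.1 q.1 * T B σ S r.2 q.2 * target B σ S (MulOpposite.op (S p r)) =
    ∑ r : n × n, T B σ S p.1 r.1 * T B σ S p.2 r.2 * source B σ S (S r q) := by
  rw [← sum_opMatrix_mul target_mul_T, opMatrix_T_T]

end ExtFRT
end Representations

/-! ### Left and right multiplications of L inside the opposite of End(L) -/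

section Anchor

variable {k L : Type*} [Field k] [Ring L] [Algebra k L]

variable (k L) in
/-- The right action of `L` on itself. -/
noncomputable def anchorSource : L →ₐ[k] (Module.End k L)ᵐᵒᵖ :=
  AlgHom.ofLinearMap ((MulOpposite.opLinearEquiv k).toLinearMap ∘ₗ (LinearMap.mul k L).flip)
    (MulOpposite.unop_injective (LinearMap.ext fun x => mul_one x))
    (fun l m => MulOpposite.unop_injective (LinearMap.ext fun x => (mul_assoc x l m).symm))

variable (k L) in
/-- The left action of `L` on itself. -/
noncomputable def anchorTarget : Lᵐᵒᵖ →ₐ[k] (Module.End k L)ᵐᵒᵖ :=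
  AlgHom.ofLinearMap ((MulOpposite.opLinearEquiv k).toLinearMap ∘ₗ LinearMap.mul k L ∘ₗ
      (MulOpposite.opLinearEquiv k).symm.toLinearMap)
    (MulOpposite.unop_injective (LinearMap.ext fun x => one_mul x))
    (fun l m => MulOpposite.unop_injective
      (LinearMap.ext fun x => mul_assoc m.unop l.unop x))

theorem anchor_ext {f g : (Module.End k L)ᵐᵒᵖ} (h : ∀ x, f.unop x = g.unop x) : f = g :=
  MulOpposite.unop_injective (LinearMap.ext h)

theorem anchor_sum {ι : Type*} (u : Finset ι) (f : ι → (Module.End k L)ᵐᵒᵖ) (x : L) :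
    (∑ i ∈ u, f i).unop x = ∑ i ∈ u, (f i).unop x := by
  rw [Finset.unop_sum, LinearMap.sum_apply]

end Anchor

section Sums

variable {k L B : Type*} [Field k] [Ring L] [Algebra k L] [Ring B] [Algebra k B]
  {s : L →ₐ[k] B} {t : Lᵐᵒᵖ →ₐ[k] B}

theorem takeuchi_sum {ι : Type*} (u : Finset ι)
    (f : ι → (Module.End (B ⊗[k] B) (BalancedTensor s t))ᵐᵒᵖ) {z : ι → B ⊗[k] B}
    (h : ∀ i ∈ u, (f i).unop ((balancedIdeal s t).mkQ 1) = (balancedIdeal s t).mkQ (z i)) :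
    (∑ i ∈ u, f i).unop ((balancedIdeal s t).mkQ 1) =
      (balancedIdeal s t).mkQ (∑ i ∈ u, z i) := by
  rw [Finset.unop_sum, LinearMap.sum_apply, map_sum]
  exact Finset.sum_congr rfl h

end Sums

section MatrixInverse

/-- The repeated index collapses the first tensor factor to a Kronecker delta, after which the
second collapses as well. This is why the coproduct of an inverse matrix has its two tensor factors
interchanged. -/
theorem sum_tmul_inverse_mul {k R n : Type*} [Field k] [Ring R] [Algebra k R] [Fintype n]
    [DecidableEq n] {M N : Matrix n n R} (h : N * M = 1) (i j : n) :
    ∑ r, (∑ a, N a r ⊗ₜ[k] N i a) * (∑ b, M r b ⊗ₜ[k] M b j) =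
      (1 : Matrix n n (R ⊗[k] R)) i j := by
  have h : ∀ i j, ∑ r, N i r * M r j = (1 : Matrix n n R) i j :=
    fun i j => by rw [← h, Matrix.mul_apply]
  simp only [Finset.sum_mul, Finset.mul_sum, Algebra.TensorProduct.tmul_mul_tmul]
  calc _ = ∑ a, ∑ b, (∑ r, N b r * M r a) ⊗ₜ[k] (N i b * M a j) := by
        simp only [TensorProduct.sum_tmul]
        rw [Finset.sum_comm]
        exact Finset.sum_congr rfl fun _ _ => Finset.sum_comm
    _ = (1 : R) ⊗ₜ[k] ∑ a, N i a * M a j := by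
        rw [TensorProduct.tmul_sum]
        simp only [h, Matrix.one_apply, TensorProduct.ite_tmul]
        simp
    _ = _ := by
         rw [h, Matrix.one_apply, Matrix.one_apply]
         split_ifs <;> simp [Algebra.TensorProduct.one_def]

end MatrixInverse

/-! ### The bialgebroid structure of the extended dynamical FRT algebra -/

section Bialgebroid

variable {k H L n : Type*} [Field k] [Ring H] [HopfAlgebra k H] [Ring L] [Algebra k L]
  [Fintype n] [DecidableEq n]

namespace ExtFRT

variable (B : BaseAlgebra k H L) (σ : H →ₐ[k] Matrix n n k) (S : Matrix (n × n) (n × n) L)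

/-- The anchor of the extended dynamical FRT algebra. -/
noncomputable def anchorRep
    (hS : ∀ (l : L) (p q : n × n), ∑ r, S p r * B.eval (coeff (tensorSquare σ) r q) l =
      ∑ r, B.eval (coeff (tensorSquare σ) p r) l * S r q) :
    FRTRep B σ S (Module.End k L)ᵐᵒᵖ where
  s := anchorSource k L
  t := anchorTarget k L
  T := Matrix.of fun i j => MulOpposite.op (B.eval (coeff σ i j))
  Tbar := Matrix.of fun i j => MulOpposite.op (B.eval (coeff σ i j ∘ₗ HopfAlgebra.antipode k))
  commute l m := anchor_ext fun x => (mul_assoc _ _ _).symm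
  Tbar_mul_T := by
    ext1 i j
    refine anchor_ext fun x => ?_
    rw [Matrix.mul_apply, anchor_sum]
    refine (B.sum_eval_antipode_left σ i j x).trans ?_
    rw [Matrix.one_apply, Matrix.one_apply]
    split_ifs <;> simp
  T_mul_Tbar := by
    ext1 i j
    refine anchor_ext fun x => ?_
    rw [Matrix.mul_apply, anchor_sum]
    refine (B.sum_eval_antipode_right σ i j x).trans ?_
    rw [Matrix.one_apply, Matrix.one_apply]
    split_ifs <;> simp
  src_T l i j := anchor_ext fun x => by
    rw [anchor_sum]
    exact B.eval_coeff_mul σ i j x l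
  tgt_T l i j := anchor_ext fun x => by
    rw [anchor_sum]
    exact B.eval_coeff_mul σ i j l x
  -- Evaluated at x, the quadratic relation says that S commutes with the matrix (σ ⊗ σ)δ₂(x); this
  -- is the hypothesis `hS`.
  T_T p q := anchor_ext fun x => by
    rw [anchor_sum, anchor_sum]
    refine Eq.trans (Finset.sum_congr rfl fun r _ => ?_) ((hS x p q).trans
      (Finset.sum_congr rfl fun r _ => ?_))
    · rw [B.eval_tensorSquare]
      rfl
    · rw [B.eval_tensorSquare]
      rfl

variable {B σ S}

/-- `Tᵢⱼ ↦ ∑ Tᵢᵣ ⊗ Tᵣⱼ`. -/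
noncomputable def copT (B : BaseAlgebra k H L) (σ : H →ₐ[k] Matrix n n k)
    (S : Matrix (n × n) (n × n) L) (i j : n) : ExtFRT B σ S ⊗[k] ExtFRT B σ S :=
  ∑ r, T B σ S i r ⊗ₜ[k] T B σ S r j

/-- `T̄ᵢⱼ ↦ ∑ T̄ᵣⱼ ⊗ T̄ᵢᵣ`. -/
noncomputable def copTbar (B : BaseAlgebra k H L) (σ : H →ₐ[k] Matrix n n k)
    (S : Matrix (n × n) (n × n) L) (i j : n) : ExtFRT B σ S ⊗[k] ExtFRT B σ S :=
  ∑ r, Tbar B σ S r j ⊗ₜ[k] Tbar B σ S i r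

/-- Moving s(l) through the first T and t(l) through the second produces the same double sum up to
the name of the two inner indices, once s is balanced into t. -/
theorem takeuchi_copT (l : L) (i j : n) :
    (source B σ S l ⊗ₜ[k] (1 : ExtFRT B σ S)) •
        (balancedIdeal (source B σ S) (target B σ S)).mkQ (copT B σ S i j) =
      ((1 : ExtFRT B σ S) ⊗ₜ[k] target B σ S (MulOpposite.op l)) •
        (balancedIdeal (source B σ S) (target B σ S)).mkQ (copT B σ S i j) := by
  simp only [← mkQ_mul, copT, Finset.mul_sum, Algebra.TensorProduct.tmul_mul_tmul, one_mul,
    source_mul_T, target_mul_T, TensorProduct.sum_tmul, TensorProduct.tmul_sum]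
  simp only [map_sum, mkQ_balance]
  exact Finset.sum_comm

theorem takeuchi_copTbar (l : L) (i j : n) :
    (source B σ S l ⊗ₜ[k] (1 : ExtFRT B σ S)) •
        (balancedIdeal (source B σ S) (target B σ S)).mkQ (copTbar B σ S i j) =
      ((1 : ExtFRT B σ S) ⊗ₜ[k] target B σ S (MulOpposite.op l)) •
        (balancedIdeal (source B σ S) (target B σ S)).mkQ (copTbar B σ S i j) := by
  simp only [← mkQ_mul, copTbar, Finset.mul_sum, Algebra.TensorProduct.tmul_mul_tmul, one_mul,
    source_mul_Tbar, target_mul_Tbar, TensorProduct.sum_tmul, TensorProduct.tmul_sum]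
  simp only [map_sum, mkQ_balance]
  exact Finset.sum_comm

theorem copT_mul_copT (p q : n × n) : copT B σ S p.1 q.1 * copT B σ S p.2 q.2 =
    ∑ w : n × n, (T B σ S p.1 w.1 * T B σ S p.2 w.2) ⊗ₜ[k] (T B σ S w.1 q.1 * T B σ S w.2 q.2) := by
  simp only [copT, Finset.sum_mul, Finset.mul_sum, Algebra.TensorProduct.tmul_mul_tmul,
    Fintype.sum_prod_type]
  exact Finset.sum_comm

theorem copTbar_mul_copT (i j : n) :
    ∑ r, copTbar B σ S i r * copT B σ S r j =
      (1 : Matrix n n (ExtFRT B σ S ⊗[k] ExtFRT B σ S)) i j :=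
  sum_tmul_inverse_mul Tbar_mul_T i j

theorem copT_mul_copTbar (i j : n) :
    ∑ r, copT B σ S i r * copTbar B σ S r j =
      (1 : Matrix n n (ExtFRT B σ S ⊗[k] ExtFRT B σ S)) i j := by
  have h : ∀ i j, ∑ r, T B σ S i r * Tbar B σ S r j = (1 : Matrix n n (ExtFRT B σ S)) i j :=
    fun i j => by rw [← T_mul_Tbar, Matrix.mul_apply]
  simp only [copT, copTbar, Finset.sum_mul, Finset.mul_sum, Algebra.TensorProduct.tmul_mul_tmul]
  calc _ = ∑ b, ∑ a, (T B σ S i a * Tbar B σ S b j) ⊗ₜ[k] (∑ r, T B σ S a r * Tbar B σ S r b) := by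
        simp only [TensorProduct.tmul_sum]
        rw [Finset.sum_comm]
        exact Finset.sum_congr rfl fun _ _ => Finset.sum_comm
    _ = (∑ a, T B σ S i a * Tbar B σ S a j) ⊗ₜ[k] (1 : ExtFRT B σ S) := by
        rw [TensorProduct.sum_tmul]
        simp only [h, Matrix.one_apply, TensorProduct.tmul_ite]
        simp
    _ = _ := by
         rw [h, Matrix.one_apply, Matrix.one_apply]
         split_ifs <;> simp [Algebra.TensorProduct.one_def]

/-- The quadratic relation in the first tensor factor turns t(S) into s(S); balancing carries it to
the second factor as t(S), where the relation is applied once more. The form of the relation without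
S_op is what makes this passage possible. -/
theorem copT_T_T (p q : n × n) : (balancedIdeal (source B σ S) (target B σ S)).mkQ
      (∑ r : n × n, copT B σ S r.1 q.1 * copT B σ S r.2 q.2 *
        (target B σ S (MulOpposite.op (S p r)) ⊗ₜ[k] (1 : ExtFRT B σ S))) =
    (balancedIdeal (source B σ S) (target B σ S)).mkQ
      (∑ r : n × n, copT B σ S p.1 r.1 * copT B σ S p.2 r.2 *
        ((1 : ExtFRT B σ S) ⊗ₜ[k] source B σ S (S r q))) := by
  have h₁ : ∀ w : n × n, ∑ r : n × n, (T B σ S r.1 w.1 * T B σ S r.2 w.2 *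
      target B σ S (MulOpposite.op (S p r))) = ∑ r : n × n, T B σ S p.1 r.1 * T B σ S p.2 r.2 *
        source B σ S (S r w) := fun w => T_T_target p w
  have h₂ : ∀ w : n × n, ∑ r : n × n, (T B σ S r.1 q.1 * T B σ S r.2 q.2 *
      target B σ S (MulOpposite.op (S w r))) = ∑ r : n × n, T B σ S w.1 r.1 * T B σ S w.2 r.2 *
        source B σ S (S r q) := fun w => T_T_target w q
  calc _ = (balancedIdeal (source B σ S) (target B σ S)).mkQ (∑ w : n × n, ∑ r : n × n,
        (T B σ S p.1 r.1 * T B σ S p.2 r.2 * source B σ S (S r w)) ⊗ₜ[k]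
          (T B σ S w.1 q.1 * T B σ S w.2 q.2)) := by
        simp only [copT_mul_copT, Finset.sum_mul, Algebra.TensorProduct.tmul_mul_tmul, mul_one]
        rw [Finset.sum_comm]
        congr 1
        refine Finset.sum_congr rfl fun w _ => ?_
        rw [← TensorProduct.sum_tmul, ← TensorProduct.sum_tmul, h₁]
    _ = (balancedIdeal (source B σ S) (target B σ S)).mkQ (∑ w : n × n, ∑ r : n × n,
        (T B σ S p.1 w.1 * T B σ S p.2 w.2) ⊗ₜ[k]
          (T B σ S r.1 q.1 * T B σ S r.2 q.2 * target B σ S (MulOpposite.op (S w r)))) := by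
        simp only [map_sum, mkQ_balance]
        exact Finset.sum_comm
    _ = _ := by
        simp only [copT_mul_copT, Finset.sum_mul, Algebra.TensorProduct.tmul_mul_tmul, mul_one]
        conv_rhs => rw [Finset.sum_comm]
        congr 1
        refine Finset.sum_congr rfl fun w _ => ?_
        rw [← TensorProduct.tmul_sum, ← TensorProduct.tmul_sum, h₂]

variable (B σ S) in
/-- The coproduct of `Tᵢⱼ` as an element of the Takeuchi algebra. -/
noncomputable def endT (i j : n) : (Module.End (ExtFRT B σ S ⊗[k] ExtFRT B σ S)
    (BalancedTensor (source B σ S) (target B σ S)))ᵐᵒᵖ :=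
  takeuchiEnd _ fun l => takeuchi_copT l i j

variable (B σ S) in
/-- The coproduct of `T̄ᵢⱼ` as an element of the Takeuchi algebra. -/
noncomputable def endTbar (i j : n) : (Module.End (ExtFRT B σ S ⊗[k] ExtFRT B σ S)
    (BalancedTensor (source B σ S) (target B σ S)))ᵐᵒᵖ :=
  takeuchiEnd _ fun l => takeuchi_copTbar l i j

theorem endT_apply (i j : n) :
    (endT B σ S i j).unop ((balancedIdeal (source B σ S) (target B σ S)).mkQ 1) =
      (balancedIdeal (source B σ S) (target B σ S)).mkQ (copT B σ S i j) :=
  takeuchiEnd_apply _ fun l => takeuchi_copT l i j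

theorem endTbar_apply (i j : n) :
    (endTbar B σ S i j).unop ((balancedIdeal (source B σ S) (target B σ S)).mkQ 1) =
      (balancedIdeal (source B σ S) (target B σ S)).mkQ (copTbar B σ S i j) :=
  takeuchiEnd_apply _ fun l => takeuchi_copTbar l i j

theorem sum_endTbar_mul_endT (i j : n) : ∑ r, endTbar B σ S i r * endT B σ S r j =
    (1 : Matrix n n (Module.End (ExtFRT B σ S ⊗[k] ExtFRT B σ S)
      (BalancedTensor (source B σ S) (target B σ S)))ᵐᵒᵖ) i j := by
  refine takeuchi_ext ?_
  rw [takeuchi_sum _ _ fun r _ => takeuchi_mul_mk (endTbar_apply i r) (endT_apply r j),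
    copTbar_mul_copT, Matrix.one_apply, Matrix.one_apply]
  split_ifs
  · rfl
  · rw [map_zero]
    rfl

theorem sum_endT_mul_endTbar (i j : n) : ∑ r, endT B σ S i r * endTbar B σ S r j =
    (1 : Matrix n n (Module.End (ExtFRT B σ S ⊗[k] ExtFRT B σ S)
      (BalancedTensor (source B σ S) (target B σ S)))ᵐᵒᵖ) i j := by
  refine takeuchi_ext ?_
  rw [takeuchi_sum _ _ fun r _ => takeuchi_mul_mk (endT_apply i r) (endTbar_apply r j),
    copT_mul_copTbar, Matrix.one_apply, Matrix.one_apply]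
  split_ifs
  · rfl
  · rw [map_zero]
    rfl

theorem takeuchiSource_mul_endT (l : L) (i j : n) :
    takeuchiSource source_target_commute l * endT B σ S i j =
      ∑ r, endT B σ S i r * takeuchiSource source_target_commute (B.eval (coeff σ r j) l) := by
  refine takeuchi_ext ?_
  rw [takeuchi_mul_mk (takeuchiSource_apply _ l) (endT_apply i j),
    takeuchi_sum _ _ fun r _ => takeuchi_mul_mk (endT_apply i r) (takeuchiSource_apply _ _)]
  congr 1
  simp only [copT, Finset.mul_sum, Finset.sum_mul, Algebra.TensorProduct.tmul_mul_tmul, one_mul,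
    mul_one, source_mul_T, TensorProduct.tmul_sum]
  exact Finset.sum_comm

theorem takeuchiTarget_mul_endT (l : L) (i j : n) :
    takeuchiTarget source_target_commute (MulOpposite.op l) * endT B σ S i j =
      ∑ r, endT B σ S r j * takeuchiTarget source_target_commute
        (MulOpposite.op (B.eval (coeff σ i r) l)) := by
  refine takeuchi_ext ?_
  rw [takeuchi_mul_mk (takeuchiTarget_apply _ _) (endT_apply i j),
    takeuchi_sum _ _ fun r _ => takeuchi_mul_mk (endT_apply r j) (takeuchiTarget_apply _ _)]
  congr 1
  simp only [copT, Finset.mul_sum, Finset.sum_mul, Algebra.TensorProduct.tmul_mul_tmul, one_mul,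
    mul_one, target_mul_T, TensorProduct.sum_tmul]
  exact Finset.sum_comm

theorem sum_endT_mul_endT (p q : n × n) :
    ∑ r : n × n, endT B σ S r.1 q.1 * endT B σ S r.2 q.2 *
        takeuchiTarget source_target_commute (MulOpposite.op (S p r)) =
      ∑ r : n × n, endT B σ S p.1 r.1 * endT B σ S p.2 r.2 *
        takeuchiSource source_target_commute (S r q) := by
  refine takeuchi_ext ?_
  have h₁ := takeuchi_sum Finset.univ (fun r : n × n => endT B σ S r.1 q.1 * endT B σ S r.2 q.2 *
        takeuchiTarget source_target_commute (MulOpposite.op (S p r)))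
      (fun r _ => takeuchi_mul_mk (takeuchi_mul_mk
      (endT_apply r.1 q.1) (endT_apply r.2 q.2)) (takeuchiTarget_apply source_target_commute _))
  have h₂ := takeuchi_sum Finset.univ (fun r : n × n => endT B σ S p.1 r.1 * endT B σ S p.2 r.2 *
        takeuchiSource source_target_commute (S r q))
      (fun r _ => takeuchi_mul_mk (takeuchi_mul_mk
      (endT_apply p.1 r.1) (endT_apply p.2 r.2)) (takeuchiSource_apply source_target_commute _))
  exact h₁.trans ((copT_T_T p q).trans h₂.symm)

variable (B σ S) in
/-- The coproduct of the extended dynamical FRT algebra. -/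
noncomputable def comulRep : FRTRep B σ S (Module.End (ExtFRT B σ S ⊗[k] ExtFRT B σ S)
    (BalancedTensor (source B σ S) (target B σ S)))ᵐᵒᵖ where
  s := takeuchiSource source_target_commute
  t := takeuchiTarget source_target_commute
  T := Matrix.of (endT B σ S)
  Tbar := Matrix.of (endTbar B σ S)
  commute l m := takeuchi_ext (by
    rw [takeuchi_mul_mk (takeuchiSource_apply _ l) (takeuchiTarget_apply _ m),
      takeuchi_mul_mk (takeuchiTarget_apply _ m) (takeuchiSource_apply _ l)]
    simp)
  Tbar_mul_T := Matrix.ext fun i j => (Matrix.mul_apply).trans (sum_endTbar_mul_endT i j)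
  T_mul_Tbar := Matrix.ext fun i j => (Matrix.mul_apply).trans (sum_endT_mul_endTbar i j)
  src_T := takeuchiSource_mul_endT
  tgt_T := takeuchiTarget_mul_endT
  T_T := sum_endT_mul_endT

/-- The coproduct and the anchor of the extended dynamical FRT algebra. -/
noncomputable def pre (hS : ∀ (l : L) (p q : n × n),
    ∑ r, S p r * B.eval (coeff (tensorSquare σ) r q) l =
      ∑ r, B.eval (coeff (tensorSquare σ) p r) l * S r q) :
    PreBialgebroid (source B σ S) (target B σ S) where
  commute := source_target_commute
  copEnd := (comulRep B σ S).lift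
  anchorEnd := (anchorRep B σ S hS).lift
  copEnd_source l := by rw [FRTRep.lift_source]; exact takeuchiSource_apply source_target_commute l
  copEnd_target l := by rw [FRTRep.lift_target]; exact takeuchiTarget_apply source_target_commute l
  anchorEnd_source l x := by rw [FRTRep.lift_source]; rfl
  anchorEnd_target l x := by rw [FRTRep.lift_target]; rfl

section

variable (hS : ∀ (l : L) (p q : n × n), ∑ r, S p r * B.eval (coeff (tensorSquare σ) r q) l =
    ∑ r, B.eval (coeff (tensorSquare σ) p r) l * S r q)

theorem pre_comul_T (i j : n) : (pre hS).comul (T B σ S i j) =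
    (balancedIdeal (source B σ S) (target B σ S)).mkQ (copT B σ S i j) := by
  change ((comulRep B σ S).lift (T B σ S i j)).unop _ = _
  rw [FRTRep.lift_T]
  exact endT_apply i j

theorem pre_comul_Tbar (i j : n) : (pre hS).comul (Tbar B σ S i j) =
    (balancedIdeal (source B σ S) (target B σ S)).mkQ (copTbar B σ S i j) := by
  change ((comulRep B σ S).lift (Tbar B σ S i j)).unop _ = _
  rw [FRTRep.lift_Tbar]
  exact endTbar_apply i j

theorem pre_anchor_T (i j : n) (l : L) :
    ((pre hS).anchorEnd (T B σ S i j)).unop l = B.eval (coeff σ i j) l := by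
  change ((anchorRep B σ S hS).lift (T B σ S i j)).unop _ = _
  rw [FRTRep.lift_T]
  rfl

theorem pre_anchor_Tbar (i j : n) (l : L) :
    ((pre hS).anchorEnd (Tbar B σ S i j)).unop l =
      B.eval (coeff σ i j ∘ₗ HopfAlgebra.antipode k) l := by
  change ((anchorRep B σ S hS).lift (Tbar B σ S i j)).unop _ = _
  rw [FRTRep.lift_Tbar]
  rfl

/-- With the anchor of T known, the two contraction conditions are literally the exchange relations
of t(l) and s(l) with T. Coassociativity is that of a matrix coproduct. -/
theorem good_T (i j : n) : (pre hS).Good (T B σ S i j) := by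
  refine PreBialgebroid.Good.of_lift _ (pre_comul_T hS i j).symm (fun l => ?_) (fun l => ?_)
    (fun D hD => ?_)
  · rw [target_mul_T]
    simp only [copT, Finset.mul_sum, Algebra.TensorProduct.tmul_mul_tmul, one_mul, map_sum,
      PreBialgebroid.contractLeft_tmul, PreBialgebroid.counit_target_mul, pre_anchor_T]
  · rw [source_mul_T]
    simp only [copT, Finset.mul_sum, Algebra.TensorProduct.tmul_mul_tmul, one_mul, map_sum,
      PreBialgebroid.contractRight_tmul, PreBialgebroid.counit_source_mul, pre_anchor_T]
  · have h : ∀ i j, (balancedIdeal (source B σ S) (target B σ S)).mkQ (D (T B σ S i j)) =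
        (balancedIdeal (source B σ S) (target B σ S)).mkQ (copT B σ S i j) := fun i j => by
      rw [hD, pre_comul_T]
    conv_lhs => rw [copT]
    conv_rhs => rw [copT]
    simp only [map_sum, LinearMap.rTensor_tmul, LinearMap.lTensor_tmul,
      mkQ₃_assoc_of_mkQ_eq _ (h _ _), mkQ₃_tmul_of_mkQ_eq _ (h _ _)]
    simp only [copT, TensorProduct.sum_tmul, TensorProduct.tmul_sum, map_sum,
      TensorProduct.assoc_tmul]
    exact Finset.sum_comm

theorem good_Tbar (i j : n) : (pre hS).Good (Tbar B σ S i j) := by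
  refine PreBialgebroid.Good.of_lift _ (pre_comul_Tbar hS i j).symm (fun l => ?_) (fun l => ?_)
    (fun D hD => ?_)
  · rw [target_mul_Tbar]
    simp only [copTbar, Finset.mul_sum, Algebra.TensorProduct.tmul_mul_tmul, one_mul, map_sum,
      PreBialgebroid.contractLeft_tmul, PreBialgebroid.counit_target_mul, pre_anchor_Tbar]
  · rw [source_mul_Tbar]
    simp only [copTbar, Finset.mul_sum, Algebra.TensorProduct.tmul_mul_tmul, one_mul, map_sum,
      PreBialgebroid.contractRight_tmul, PreBialgebroid.counit_source_mul, pre_anchor_Tbar]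
  · have h : ∀ i j, (balancedIdeal (source B σ S) (target B σ S)).mkQ (D (Tbar B σ S i j)) =
        (balancedIdeal (source B σ S) (target B σ S)).mkQ (copTbar B σ S i j) := fun i j => by
      rw [hD, pre_comul_Tbar]
    conv_lhs => rw [copTbar]
    conv_rhs => rw [copTbar]
    simp only [map_sum, LinearMap.rTensor_tmul, LinearMap.lTensor_tmul,
      mkQ₃_assoc_of_mkQ_eq _ (h _ _), mkQ₃_tmul_of_mkQ_eq _ (h _ _)]
    simp only [copTbar, TensorProduct.sum_tmul, TensorProduct.tmul_sum, map_sum,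
      TensorProduct.assoc_tmul]
    exact Finset.sum_comm

theorem good (b : ExtFRT B σ S) : (pre hS).Good b := by
  refine (pre hS).good_of_adjoin ?_ (adjoin_generators B σ S) b
  rintro _ (((⟨l, rfl⟩ | ⟨l, rfl⟩) | ⟨p, rfl⟩) | ⟨p, rfl⟩)
  exacts [PreBialgebroid.good_source l, PreBialgebroid.good_target l, good_T hS _ _,
    good_Tbar hS _ _]

theorem isStandard : IsStandard ((pre hS).toRightBialgebroid (good hS)) where
  comul_T := pre_comul_T hS
  comul_Tbar := pre_comul_Tbar hS
  anchor_T l i j := ((pre hS).counit_source_mul l _).trans (pre_anchor_T hS i j l)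
  anchor_Tbar l i j := ((pre hS).counit_source_mul l _).trans (pre_anchor_Tbar hS i j l)

end

end ExtFRT
end Bialgebroid

/-! ### The antipode of a quasitriangular Hopf algebra is bijective -/

section Antipode

variable {k U : Type*} [Field k] [Ring U] [HopfAlgebra k U]

local notation "γ" => HopfAlgebra.antipode k (A := U)

theorem sum_antipode_mul_comul (x : U) :
    LinearMap.mul' k U (LinearMap.rTensor U γ (Coalgebra.comul (R := k) x)) =
      Coalgebra.counit (R := k) x • (1 : U) := by
  rw [HopfAlgebra.mul_antipode_rTensor_comul_apply, Algebra.algebraMap_eq_smul_one]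

theorem sum_mul_antipode_comul (x : U) :
    LinearMap.mul' k U (LinearMap.lTensor U γ (Coalgebra.comul (R := k) x)) =
      Coalgebra.counit (R := k) x • (1 : U) := by
  rw [HopfAlgebra.mul_antipode_lTensor_comul_apply, Algebra.algebraMap_eq_smul_one]

namespace UniversalRMatrix

variable (R : UniversalRMatrix k U)

/-- Applying ε to the first leg of (Δ ⊗ id)R = R₁₃R₂₃ gives R = (1 ⊗ (ε ⊗ id)R)R, and R is
cancelled. -/
theorem counit_fst : TensorProduct.lid k U
    ((Coalgebra.counit (R := k) (A := U)).rTensor U (R.R : U ⊗[k] U)) = 1 := by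
  have h := congrArg (TensorProduct.lid k (U ⊗[k] U) ∘
    (Coalgebra.counit (R := k) (A := U)).rTensor (U ⊗[k] U)) R.comul_fst
  have h₁ : ∀ w : U ⊗[k] U, TensorProduct.lid k (U ⊗[k] U)
      ((Coalgebra.counit (R := k) (A := U)).rTensor (U ⊗[k] U) (TensorProduct.assoc k U U U
        ((Coalgebra.comul (R := k) (A := U)).rTensor U w))) = w := by
    intro w
    induction w using TensorProduct.induction_on with
    | zero => simp
    | add p q hp hq => simp only [map_add, hp, hq]
    | tmul x y =>
      have e := congrArg (TensorProduct.lid k U) (Coalgebra.rTensor_counit_comul (R := k) x)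
      rw [TensorProduct.lid_tmul, one_smul] at e
      conv_rhs => rw [← e]
      rw [LinearMap.rTensor_tmul]
      generalize Coalgebra.comul (R := k) x = z
      induction z using TensorProduct.induction_on with
      | zero => simp
      | add p q hp hq => simp only [TensorProduct.add_tmul, map_add, hp, hq]
      | tmul p q => simp [TensorProduct.smul_tmul']
  have h₂ : ∀ w v : U ⊗[k] U, TensorProduct.lid k (U ⊗[k] U)
      ((Coalgebra.counit (R := k) (A := U)).rTensor (U ⊗[k] U)
        (Algebra.TensorProduct.map (AlgHom.id k U) Algebra.TensorProduct.includeRight w *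
          (1 : U) ⊗ₜ[k] v)) = ((1 : U) ⊗ₜ[k] TensorProduct.lid k U
            ((Coalgebra.counit (R := k) (A := U)).rTensor U w)) * v := by
    intro w v
    induction w using TensorProduct.induction_on with
    | zero => simp
    | add p q hp hq => simp only [TensorProduct.tmul_add, map_add, add_mul, hp, hq]
    | tmul x y => simp
  rw [Function.comp_apply, Function.comp_apply, h₁, h₂] at h
  have h₃ : (1 : U) ⊗ₜ[k] TensorProduct.lid k U
      ((Coalgebra.counit (R := k) (A := U)).rTensor U (R.R : U ⊗[k] U)) = (1 : U ⊗[k] U) :=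
    R.R.isUnit.mul_right_cancel (h.symm.trans (one_mul _).symm)
  have h₄ := congrArg (TensorProduct.lid k U ∘ (Coalgebra.counit (R := k) (A := U)).rTensor U) h₃
  simpa [Algebra.TensorProduct.one_def] using h₄

/-- Apply γ(x)y to the first two legs of (Δ ⊗ id)R = R₁₃R₂₃. -/
theorem antipode_fst_mul : LinearMap.rTensor U γ (R.R : U ⊗[k] U) * R.R = 1 := by
  have h := congrArg ((LinearMap.mul' k U ∘ₗ LinearMap.rTensor U γ).rTensor U ∘
    (TensorProduct.assoc k U U U).symm) R.comul_fst
  have h₁ : ∀ w : U ⊗[k] U, (LinearMap.mul' k U ∘ₗ LinearMap.rTensor U γ).rTensor U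
      ((Coalgebra.comul (R := k) (A := U)).rTensor U w) = (1 : U) ⊗ₜ[k] TensorProduct.lid k U
            ((Coalgebra.counit (R := k) (A := U)).rTensor U w) := by
    intro w
    induction w using TensorProduct.induction_on with
    | zero => simp
    | add p q hp hq => simp only [TensorProduct.tmul_add, map_add, hp, hq]
    | tmul x y =>
      simp only [LinearMap.rTensor_tmul, LinearMap.comp_apply, sum_antipode_mul_comul,
        TensorProduct.lid_tmul, TensorProduct.smul_tmul]
  have h₂ : ∀ w v : U ⊗[k] U, (LinearMap.mul' k U ∘ₗ LinearMap.rTensor U γ).rTensor U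
      ((TensorProduct.assoc k U U U).symm
        (Algebra.TensorProduct.map (AlgHom.id k U) Algebra.TensorProduct.includeRight w *
          (1 : U) ⊗ₜ[k] v)) = LinearMap.rTensor U γ w * v := by
    intro w v
    induction w using TensorProduct.induction_on with
    | zero => simp
    | add p q hp hq => simp only [map_add, add_mul, hp, hq]
    | tmul x y =>
      induction v using TensorProduct.induction_on with
      | zero => simp
      | add p q hp hq => simp only [TensorProduct.tmul_add, map_add, mul_add, hp, hq]
      | tmul x' y' => simp
  rw [Function.comp_apply, Function.comp_apply, LinearEquiv.symm_apply_apply, h₁, h₂,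
    R.counit_fst] at h
  exact h.symm

theorem counit_snd : TensorProduct.rid k U
    ((Coalgebra.counit (R := k) (A := U)).lTensor U (R.R : U ⊗[k] U)) = 1 := by
  have h := congrArg (TensorProduct.map LinearMap.id ((TensorProduct.lid k U).toLinearMap ∘ₗ
    (Coalgebra.counit (R := k) (A := U)).rTensor U)) R.comul_snd
  have h₁ : ∀ w : U ⊗[k] U, TensorProduct.map LinearMap.id ((TensorProduct.lid k U).toLinearMap ∘ₗ
      (Coalgebra.counit (R := k) (A := U)).rTensor U)
        ((Coalgebra.comul (R := k) (A := U)).lTensor U w) = w := by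
    intro w
    induction w using TensorProduct.induction_on with
    | zero => simp
    | add p q hp hq => simp only [map_add, hp, hq]
    | tmul x y => simp
  have h₂ : ∀ w v : U ⊗[k] U, TensorProduct.map LinearMap.id ((TensorProduct.lid k U).toLinearMap ∘ₗ
      (Coalgebra.counit (R := k) (A := U)).rTensor U)
        (Algebra.TensorProduct.map (AlgHom.id k U) Algebra.TensorProduct.includeRight w *
          Algebra.TensorProduct.map (AlgHom.id k U) Algebra.TensorProduct.includeLeft v) =
      w * ((TensorProduct.rid k U
    ((Coalgebra.counit (R := k) (A := U)).lTensor U v)) ⊗ₜ[k] 1) := by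
    intro w v
    induction w using TensorProduct.induction_on with
    | zero => simp
    | add p q hp hq => simp only [map_add, add_mul, hp, hq]
    | tmul x y =>
      induction v using TensorProduct.induction_on with
      | zero => simp
      | add p q hp hq => simp only [TensorProduct.add_tmul, map_add, mul_add, hp, hq]
      | tmul x' y' => simp [TensorProduct.smul_tmul]
  rw [h₁, h₂] at h
  have h₃ : (TensorProduct.rid k U
      ((Coalgebra.counit (R := k) (A := U)).lTensor U (R.R : U ⊗[k] U))) ⊗ₜ[k] (1 : U) =
        (1 : U ⊗[k] U) := R.R.isUnit.mul_left_cancel (h.symm.trans (mul_one _).symm)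
  have h₄ := congrArg (TensorProduct.rid k U ∘ (Coalgebra.counit (R := k) (A := U)).lTensor U) h₃
  simpa [Algebra.TensorProduct.one_def] using h₄

theorem comul_snd_inv :
    (Coalgebra.comul (R := k) (A := U)).lTensor U (↑R.R⁻¹ : U ⊗[k] U) =
    Algebra.TensorProduct.map (AlgHom.id k U) Algebra.TensorProduct.includeLeft
        (↑R.R⁻¹ : U ⊗[k] U) *
      Algebra.TensorProduct.map (AlgHom.id k U) Algebra.TensorProduct.includeRight
        (↑R.R⁻¹ : U ⊗[k] U) := by
  have h := R.comul_snd
  change Algebra.TensorProduct.map (AlgHom.id k U) (Bialgebra.comulAlgHom k U) _ = _ at h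
  change Algebra.TensorProduct.map (AlgHom.id k U) (Bialgebra.comulAlgHom k U) _ = _
  refine (left_inv_eq_right_inv (a := Algebra.TensorProduct.map (AlgHom.id k U)
    (Bialgebra.comulAlgHom k U) (R.R : U ⊗[k] U)) ?_ ?_)
  · rw [← map_mul, Units.inv_mul, map_one]
  · rw [h, mul_assoc, ← mul_assoc (Algebra.TensorProduct.map (AlgHom.id k U)
      Algebra.TensorProduct.includeLeft (R.R : U ⊗[k] U)), ← map_mul, Units.mul_inv, map_one,
      one_mul, ← map_mul, Units.mul_inv, map_one]

/-- Apply xγ(y) to the last two legs of the formula for (id ⊗ Δ)(R⁻¹). The inverse is used because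
its factors come in the order 12, 13, so that the result is again a product in U ⊗ U; for R itself
the order would be wrong. -/
theorem inv_mul_antipode_snd :
    (↑R.R⁻¹ : U ⊗[k] U) * LinearMap.lTensor U γ (↑R.R⁻¹ : U ⊗[k] U) = 1 := by
  have h := congrArg ((LinearMap.mul' k U ∘ₗ LinearMap.lTensor U γ).lTensor U) R.comul_snd_inv
  have h₁ : ∀ w : U ⊗[k] U, (LinearMap.mul' k U ∘ₗ LinearMap.lTensor U γ).lTensor U
      ((Coalgebra.comul (R := k) (A := U)).lTensor U w) = (TensorProduct.rid k U
            ((Coalgebra.counit (R := k) (A := U)).lTensor U w)) ⊗ₜ[k] (1 : U) := by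
    intro w
    induction w using TensorProduct.induction_on with
    | zero => simp
    | add p q hp hq => simp only [TensorProduct.add_tmul, map_add, hp, hq]
    | tmul x y =>
      simp only [LinearMap.lTensor_tmul, LinearMap.comp_apply, sum_mul_antipode_comul,
        TensorProduct.rid_tmul, TensorProduct.smul_tmul]
  have h₂ : ∀ w v : U ⊗[k] U, (LinearMap.mul' k U ∘ₗ LinearMap.lTensor U γ).lTensor U
        (Algebra.TensorProduct.map (AlgHom.id k U) Algebra.TensorProduct.includeLeft w *
          Algebra.TensorProduct.map (AlgHom.id k U) Algebra.TensorProduct.includeRight v) =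
      w * LinearMap.lTensor U γ v := by
    intro w v
    induction w using TensorProduct.induction_on with
    | zero => simp
    | add p q hp hq => simp only [map_add, add_mul, hp, hq]
    | tmul x y =>
      induction v using TensorProduct.induction_on with
      | zero => simp
      | add p q hp hq => simp only [map_add, mul_add, hp, hq]
      | tmul x' y' => simp
  have h₃ : TensorProduct.rid k U
      ((Coalgebra.counit (R := k) (A := U)).lTensor U (↑R.R⁻¹ : U ⊗[k] U)) = 1 := by
    have e := map_inv_of_one ((Algebra.TensorProduct.rid k k U).toAlgHom.comp
      (Algebra.TensorProduct.map (AlgHom.id k U) (Bialgebra.counitAlgHom k U))) R.R R.counit_snd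
    exact e
  rw [h₁, h₂, h₃] at h
  exact h.symm

theorem antipode_snd_inv : LinearMap.lTensor U γ (↑R.R⁻¹ : U ⊗[k] U) = R.R :=
  (left_inv_eq_right_inv R.R.mul_inv R.inv_mul_antipode_snd).symm

theorem antipode_fst : LinearMap.rTensor U γ (R.R : U ⊗[k] U) = ↑R.R⁻¹ :=
  left_inv_eq_right_inv R.antipode_fst_mul R.R.mul_inv

/-- Combine (γ ⊗ id)R = R⁻¹ with (id ⊗ γ)R⁻¹ = R. -/
theorem antipode_antipode : TensorProduct.map γ γ (R.R : U ⊗[k] U) = R.R := by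
  conv_rhs => rw [← R.antipode_snd_inv, ← R.antipode_fst]
  rw [← LinearMap.comp_apply, LinearMap.lTensor_comp_rTensor]

/-- `γ(b) a` for `a ⊗ b`. -/
noncomputable def drinfeldMap : U ⊗[k] U →ₗ[k] U :=
  TensorProduct.lift (LinearMap.mul k U ∘ₗ γ).flip

theorem drinfeldMap_tmul (a b : U) : drinfeldMap (a ⊗ₜ[k] b) = γ b * a := rfl

theorem drinfeldMap_mul_tmul (r : U ⊗[k] U) (p q : U) :
    drinfeldMap (r * p ⊗ₜ[k] q) = γ q * (drinfeldMap r * p) := by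
  induction r using TensorProduct.induction_on with
  | zero => simp
  | add x y hx hy => simp only [map_add, mul_add, add_mul, hx, hy]
  | tmul a b =>
    simp only [Algebra.TensorProduct.tmul_mul_tmul, drinfeldMap_tmul,
      HopfAlgebra.antipode_mul_antidistrib, mul_assoc]

/-- For r = a ⊗ b the value is γ(b)γ(x₁)x₂a, and the antipode axiom removes x. -/
theorem drinfeldMap_comm_comul_mul (r : U ⊗[k] U) (x : U) :
    drinfeldMap (TensorProduct.comm k U U (Coalgebra.comul (R := k) x) * r) =
      Coalgebra.counit (R := k) x • drinfeldMap r := by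
  induction r using TensorProduct.induction_on with
  | zero => simp
  | add x y hx hy => simp only [map_add, mul_add, smul_add, hx, hy]
  | tmul a b =>
    have h : ∀ z : U ⊗[k] U, drinfeldMap (TensorProduct.comm k U U z * a ⊗ₜ[k] b) =
        γ b * LinearMap.mul' k U (LinearMap.rTensor U γ z) * a := by
      intro z
      induction z using TensorProduct.induction_on with
      | zero => simp
      | add x y hx hy => simp only [map_add, mul_add, add_mul, hx, hy]
      | tmul p q =>
        simp [drinfeldMap_tmul, HopfAlgebra.antipode_mul_antidistrib, mul_assoc]
    rw [h, sum_antipode_mul_comul, drinfeldMap_tmul]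
    simp

/-- Write u = γ(R₂)R₁. Tensor the identity Δ_op(x₁)R = RΔ(x₁) with x₂ and apply z ⊗ w ↦
γ²(w)·`drinfeldMap` z. The left side is γ²(x)u by `drinfeldMap_comm_comul_mul`; the right side is
γ²(x₃)γ(x₂)u x₁ = γ(x₂γ(x₃))u x₁ = u x. -/
theorem antipode_antipode_mul_drinfeld (x : U) :
    γ (γ x) * drinfeldMap (R.R : U ⊗[k] U) = drinfeldMap (R.R : U ⊗[k] U) * x := by
  set Θ : (U ⊗[k] U) ⊗[k] U →ₗ[k] U := TensorProduct.lift
    ((LinearMap.mul k U ∘ₗ γ ∘ₗ γ).flip ∘ₗ drinfeldMap) with hΘ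
  have hΘt : ∀ z c, Θ (z ⊗ₜ[k] c) = γ (γ c) * drinfeldMap z := fun _ _ => rfl
  have h₁ : ∀ w : U ⊗[k] U, Θ ((LinearMap.mulRight k (R.R : U ⊗[k] U) ∘ₗ
      (TensorProduct.comm k U U).toLinearMap ∘ₗ Coalgebra.comul (R := k)).rTensor U w) =
      γ (γ (TensorProduct.lid k U ((Coalgebra.counit (R := k) (A := U)).rTensor U w))) *
        drinfeldMap (R.R : U ⊗[k] U) := by
    intro w
    induction w using TensorProduct.induction_on with
    | zero => simp
    | add p q hp hq => simp only [map_add, add_mul, hp, hq]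
    | tmul p q =>
      simp only [LinearMap.rTensor_tmul, LinearMap.comp_apply, LinearEquiv.coe_coe,
        LinearMap.mulRight_apply, hΘt, drinfeldMap_comm_comul_mul]
      simp
  have h₂ : ∀ w : U ⊗[k] U, Θ ((LinearMap.mulLeft k (R.R : U ⊗[k] U)).rTensor U
      ((TensorProduct.assoc k U U U).symm ((Coalgebra.comul (R := k) (A := U)).lTensor U w))) =
      drinfeldMap (R.R : U ⊗[k] U) *
        TensorProduct.rid k U ((Coalgebra.counit (R := k) (A := U)).lTensor U w) := by
    intro w
    induction w using TensorProduct.induction_on with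
    | zero => simp
    | add p q hp hq => simp only [map_add, mul_add, hp, hq]
    | tmul p q =>
      have h : ∀ z : U ⊗[k] U, Θ ((LinearMap.mulLeft k (R.R : U ⊗[k] U)).rTensor U
          ((TensorProduct.assoc k U U U).symm (p ⊗ₜ[k] z))) =
          γ (LinearMap.mul' k U (LinearMap.lTensor U γ z)) * (drinfeldMap (R.R : U ⊗[k] U) * p) := by
        intro z
        induction z using TensorProduct.induction_on with
        | zero => simp
        | add x y hx hy => simp only [map_add, add_mul, TensorProduct.tmul_add, hx, hy]
        | tmul a b =>
          simp only [TensorProduct.assoc_symm_tmul, LinearMap.rTensor_tmul,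
            LinearMap.mulLeft_apply, hΘt, drinfeldMap_mul_tmul, LinearMap.lTensor_tmul,
            LinearMap.mul'_apply, HopfAlgebra.antipode_mul_antidistrib, mul_assoc]
      rw [LinearMap.lTensor_tmul, h, sum_mul_antipode_comul]
      simp
  have h₃ := h₁ (Coalgebra.comul (R := k) x)
  have h₄ := h₂ (Coalgebra.comul (R := k) x)
  have h₅ : LinearMap.mulRight k (R.R : U ⊗[k] U) ∘ₗ
      (TensorProduct.comm k U U).toLinearMap ∘ₗ Coalgebra.comul (R := k) =
      LinearMap.mulLeft k (R.R : U ⊗[k] U) ∘ₗ Coalgebra.comul (R := k) :=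
    LinearMap.ext fun u => (R.intertwines u).symm
  rw [h₅, LinearMap.rTensor_comp, LinearMap.comp_apply,
    Coalgebra.rTensor_counit_comul, TensorProduct.lid_tmul, one_smul] at h₃
  rw [Coalgebra.lTensor_counit_comul, TensorProduct.rid_tmul, one_smul,
    ← Coalgebra.coassoc_apply, LinearEquiv.symm_apply_apply] at h₄
  exact h₃.symm.trans h₄

/-- `R₂ γ²(R₁)`. -/
noncomputable def drinfeldInv : U ⊗[k] U →ₗ[k] U :=
  TensorProduct.lift (LinearMap.mul k U).flip ∘ₗ (γ ∘ₗ γ).rTensor U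

theorem drinfeldInv_tmul (a b : U) : drinfeldInv (a ⊗ₜ[k] b) = b * γ (γ a) := rfl

/-- Moving u past R₂ by γ²(x)u = ux gives γ²(R₂) u γ²(R₁), which is `drinfeldMap` of R·(γ²(R₁) ⊗
γ(R₂)). By (γ ⊗ γ)R = R and (γ ⊗ id)R = R⁻¹ its argument is RR⁻¹. -/
theorem drinfeld_mul_inv :
    drinfeldMap (R.R : U ⊗[k] U) * drinfeldInv (R.R : U ⊗[k] U) = 1 := by
  have h : ∀ w : U ⊗[k] U, drinfeldMap (R.R : U ⊗[k] U) * drinfeldInv w =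
      drinfeldMap ((R.R : U ⊗[k] U) * LinearMap.rTensor U γ (TensorProduct.map γ γ w)) := by
    intro w
    induction w using TensorProduct.induction_on with
    | zero => simp
    | add p q hp hq => simp only [map_add, mul_add, hp, hq]
    | tmul a b =>
      rw [drinfeldInv_tmul, TensorProduct.map_tmul, LinearMap.rTensor_tmul, drinfeldMap_mul_tmul,
        ← mul_assoc, ← R.antipode_antipode_mul_drinfeld, mul_assoc]
  rw [h, R.antipode_antipode, R.antipode_fst, Units.mul_inv]
  exact (drinfeldMap_tmul 1 1).trans (by simp [HopfAlgebra.antipode_one])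

theorem antipode_antipode_drinfeldInv :
    γ (γ (drinfeldInv (R.R : U ⊗[k] U))) = drinfeldInv (R.R : U ⊗[k] U) := by
  have h : ∀ w : U ⊗[k] U, γ (γ (drinfeldInv w)) =
      drinfeldInv (TensorProduct.map γ γ (TensorProduct.map γ γ w)) := by
    intro w
    induction w using TensorProduct.induction_on with
    | zero => simp
    | add p q hp hq => simp only [map_add, hp, hq]
    | tmul a b =>
      simp only [drinfeldInv_tmul, TensorProduct.map_tmul, HopfAlgebra.antipode_mul_antidistrib]
  rw [h, R.antipode_antipode, R.antipode_antipode]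

theorem antipode_bijective (R : UniversalRMatrix k U) :
    Function.Bijective (HopfAlgebra.antipode k (A := U)) := by
  set u := drinfeldMap (R.R : U ⊗[k] U)
  set v := drinfeldInv (R.R : U ⊗[k] U)
  have huv : u * v = 1 := R.drinfeld_mul_inv
  -- The right inverse v is fixed by γ², so uv = γ²(v)u = vu.
  have hvu : v * u = 1 := by
    rw [← huv, ← R.antipode_antipode_mul_drinfeld, R.antipode_antipode_drinfeldInv]
  have h : ∀ x, γ (γ x) = u * x * v := fun x => by
    rw [← R.antipode_antipode_mul_drinfeld, mul_assoc, huv, mul_one]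
  -- γ² is conjugation by u; the preimage of y under γ is γ of the preimage v y u of y under γ².
  refine ⟨fun x y hxy => ?_, fun y => ⟨γ (v * y * u), ?_⟩⟩
  · have e := (h x).symm.trans ((congrArg γ hxy).trans (h y))
    have e' := congrArg (fun z => v * z * u) e
    simp only [mul_assoc, hvu, mul_one] at e'
    simpa only [← mul_assoc, hvu, one_mul] using e'
  · rw [h]
    simp only [mul_assoc, huv, mul_one]
    rw [← mul_assoc, huv, one_mul]

end UniversalRMatrix
end Antipode

/-! ### Invertibility of ζ from the dynamical cocycle equation -/

section Zeta

variable {k H U L : Type*} [Field k] [Ring H] [HopfAlgebra k H] [Ring U] [HopfAlgebra k U]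
  [Ring L] [Algebra k L]

local notation "γ" => HopfAlgebra.antipode k (A := U)

theorem tripleTensorInduction {p : U ⊗[k] (U ⊗[k] L) → Prop} (x : U ⊗[k] (U ⊗[k] L))
    (h0 : p 0) (hadd : ∀ x y, p x → p y → p (x + y))
    (h : ∀ a b l, p (a ⊗ₜ[k] (b ⊗ₜ[k] l))) : p x := by
  induction x using TensorProduct.induction_on with
  | zero => exact h0
  | add x y hx hy => exact hadd x y hx hy
  | tmul a y =>
    induction y using TensorProduct.induction_on with
    | zero => simpa using h0
    | add x y hx hy => rw [TensorProduct.tmul_add]; exact hadd _ _ hx hy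
    | tmul m l => exact h a m l

variable (k U L) in
/-- `x ⊗ y ⊗ l ↦ x γ(y) ⊗ l`. -/
noncomputable def foldR : U ⊗[k] (U ⊗[k] L) →ₗ[k] U ⊗[k] L :=
  (LinearMap.mul' k U ∘ₗ LinearMap.lTensor U γ).rTensor L ∘ₗ
    (TensorProduct.assoc k U U L).symm.toLinearMap

variable (k U L) in
/-- `x ⊗ y ⊗ l ↦ γ(x) y ⊗ l`. -/
noncomputable def foldL : U ⊗[k] (U ⊗[k] L) →ₗ[k] U ⊗[k] L :=
  (LinearMap.mul' k U ∘ₗ LinearMap.rTensor U γ).rTensor L ∘ₗ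
    (TensorProduct.assoc k U U L).symm.toLinearMap

@[simp] theorem foldR_tmul (x y : U) (l : L) :
    foldR k U L (x ⊗ₜ[k] (y ⊗ₜ[k] l)) = (x * γ y) ⊗ₜ[k] l := rfl

@[simp] theorem foldL_tmul (x y : U) (l : L) :
    foldL k U L (x ⊗ₜ[k] (y ⊗ₜ[k] l)) = (γ x * y) ⊗ₜ[k] l := rfl

theorem foldR_one : foldR k U L 1 = 1 := by
  simp [Algebra.TensorProduct.one_def, HopfAlgebra.antipode_one]

theorem foldL_one : foldL k U L 1 = 1 := by
  simp [Algebra.TensorProduct.one_def, HopfAlgebra.antipode_one]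

/-- `(x, y ⊗ z ⊗ l) ↦ x γ(y) z ⊗ l`. -/
noncomputable def cubeL : U ⊗[k] (U ⊗[k] (U ⊗[k] L)) →ₗ[k] U ⊗[k] L :=
  TensorProduct.lift ((LinearMap.mul k (U ⊗[k] L)).compl₁₂
    (Algebra.TensorProduct.includeLeft : U →ₐ[k] U ⊗[k] L).toLinearMap (foldL k U L))

/-- `(x, y ⊗ z ⊗ l) ↦ γ(x) y γ(z) ⊗ l`. -/
noncomputable def cubeR : U ⊗[k] (U ⊗[k] (U ⊗[k] L)) →ₗ[k] U ⊗[k] L :=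
  TensorProduct.lift ((LinearMap.mul k (U ⊗[k] L)).compl₁₂
    ((Algebra.TensorProduct.includeLeft : U →ₐ[k] U ⊗[k] L).toLinearMap ∘ₗ γ) (foldR k U L))

theorem cubeL_tmul (x : U) (w : U ⊗[k] (U ⊗[k] L)) :
    cubeL (x ⊗ₜ[k] w) = (x ⊗ₜ[k] (1 : L)) * foldL k U L w := rfl

theorem cubeR_tmul (x : U) (w : U ⊗[k] (U ⊗[k] L)) :
    cubeR (x ⊗ₜ[k] w) = (γ x ⊗ₜ[k] (1 : L)) * foldR k U L w := rfl

theorem copFst_tmul (x y : U) (l : L) : copFst k U L (x ⊗ₜ[k] (y ⊗ₜ[k] l)) =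
    TensorProduct.assoc k U U (U ⊗[k] L) (Coalgebra.comul (R := k) x ⊗ₜ[k] (y ⊗ₜ[k] l)) := rfl

theorem copSnd_tmul (x y : U) (l : L) : copSnd k U L (x ⊗ₜ[k] (y ⊗ₜ[k] l)) =
    x ⊗ₜ[k] TensorProduct.assoc k U U L (Coalgebra.comul (R := k) y ⊗ₜ[k] l) := rfl

theorem counitFst_tmul (x y : U) (l : L) : counitFst k U L (x ⊗ₜ[k] (y ⊗ₜ[k] l)) =
    Coalgebra.counit (R := k) x • (y ⊗ₜ[k] l) := rfl

theorem counitSnd_tmul (x y : U) (l : L) : counitSnd k U L (x ⊗ₜ[k] (y ⊗ₜ[k] l)) =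
    x ⊗ₜ[k] (Coalgebra.counit (R := k) y • l) := rfl

/-- With w = a ⊗ b and v = c ⊗ d (components in L aside) the folded product is a c₁γ(c₂)γ(b₁)b₂ d,
so the antipode axiom applies twice. -/
theorem cubeL_copSnd_mul_copFst (w v : U ⊗[k] (U ⊗[k] L)) :
    cubeL (copSnd k U L w * copFst k U L v) = counitSnd k U L w * counitFst k U L v := by
  refine tripleTensorInduction (p := fun w => cubeL (copSnd k U L w * copFst k U L v) =
    counitSnd k U L w * counitFst k U L v) w (by simp)
    (fun _ _ h h' => by simp only [map_add, add_mul, h, h']) fun a b l => ?_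
  refine tripleTensorInduction (p := fun v => cubeL (copSnd k U L _ * copFst k U L v) =
    counitSnd k U L _ * counitFst k U L v) v (by simp)
    (fun _ _ h h' => by simp only [map_add, mul_add, h, h']) fun c d m => ?_
  rw [copSnd_tmul, copFst_tmul, counitSnd_tmul, counitFst_tmul]
  have h : ∀ z z' : U ⊗[k] U, cubeL (a ⊗ₜ[k] TensorProduct.assoc k U U L (z ⊗ₜ[k] l) *
      TensorProduct.assoc k U U (U ⊗[k] L) (z' ⊗ₜ[k] (d ⊗ₜ[k] m))) =
      (a * LinearMap.mul' k U (LinearMap.lTensor U γ z') *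
        LinearMap.mul' k U (LinearMap.rTensor U γ z) * d) ⊗ₜ[k] (l * m) := by
    intro z z'
    induction z using TensorProduct.induction_on with
    | zero => simp
    | add p q hp hq => simp only [map_add, add_mul, mul_add, TensorProduct.add_tmul,
        TensorProduct.tmul_add, hp, hq]
    | tmul p q =>
    induction z' using TensorProduct.induction_on with
    | zero => simp
    | add p q hp hq => simp only [map_add, add_mul, mul_add, TensorProduct.add_tmul, hp, hq]
    | tmul p' q' => simp [cubeL_tmul, HopfAlgebra.antipode_mul_antidistrib, mul_assoc]
  rw [h, sum_mul_antipode_comul, sum_antipode_mul_comul]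
  simp [TensorProduct.smul_tmul', TensorProduct.tmul_smul, smul_smul, mul_comm]

/-- The folded product is γ(c)γ(a₁)a₂d₁γ(d₂)γ(b), for the same notation; two applications of the
antipode axiom leave γ(c)γ(b) = γ(bc). -/
theorem cubeR_copFst_mul_copSnd (w v : U ⊗[k] (U ⊗[k] L)) :
    cubeR (copFst k U L w * copSnd k U L v) =
      LinearMap.rTensor L γ (counitFst k U L w * counitSnd k U L v) := by
  refine tripleTensorInduction (p := fun w => cubeR (copFst k U L w * copSnd k U L v) =
    LinearMap.rTensor L γ (counitFst k U L w * counitSnd k U L v)) w (by simp)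
    (fun _ _ h h' => by simp only [map_add, add_mul, h, h']) fun a b l => ?_
  refine tripleTensorInduction (p := fun v => cubeR (copFst k U L _ * copSnd k U L v) =
    LinearMap.rTensor L γ (counitFst k U L _ * counitSnd k U L v)) v (by simp)
    (fun _ _ h h' => by simp only [map_add, mul_add, h, h']) fun c d m => ?_
  rw [copSnd_tmul, copFst_tmul, counitSnd_tmul, counitFst_tmul]
  have h : ∀ z z' : U ⊗[k] U, cubeR (
      TensorProduct.assoc k U U (U ⊗[k] L) (z' ⊗ₜ[k] (b ⊗ₜ[k] l)) *
      c ⊗ₜ[k] TensorProduct.assoc k U U L (z ⊗ₜ[k] m)) =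
      (γ c * LinearMap.mul' k U (LinearMap.rTensor U γ z') *
        LinearMap.mul' k U (LinearMap.lTensor U γ z) * γ b) ⊗ₜ[k] (l * m) := by
    intro z z'
    induction z using TensorProduct.induction_on with
    | zero => simp
    | add p q hp hq => simp only [map_add, add_mul, mul_add, TensorProduct.add_tmul,
        TensorProduct.tmul_add, hp, hq]
    | tmul p q =>
    induction z' using TensorProduct.induction_on with
    | zero => simp
    | add p q hp hq => simp only [map_add, add_mul, mul_add, TensorProduct.add_tmul, hp, hq]
    | tmul p' q' => simp [cubeR_tmul, HopfAlgebra.antipode_mul_antidistrib, mul_assoc]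
  rw [h, sum_mul_antipode_comul, sum_antipode_mul_comul]
  simp [TensorProduct.smul_tmul', TensorProduct.tmul_smul, smul_smul,
    HopfAlgebra.antipode_mul_antidistrib]

namespace BaseAlgebra

variable (B : BaseAlgebra k H L) (ι : H →ₐc[k] U)

/-- `kap Y (x ⊗ l) = (x ⊗ 1) Y δ(l)`. -/
noncomputable def kap (Y : U ⊗[k] L) : U ⊗[k] L →ₗ[k] U ⊗[k] L :=
  TensorProduct.lift ((LinearMap.mul k (U ⊗[k] L)).compl₁₂
    (LinearMap.mulRight k Y ∘ₗ (Algebra.TensorProduct.includeLeft : U →ₐ[k] U ⊗[k] L).toLinearMap)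
    (B.coactU ι).toLinearMap)

theorem kap_tmul (Y : U ⊗[k] L) (x : U) (l : L) :
    B.kap ι Y (x ⊗ₜ[k] l) = (x ⊗ₜ[k] (1 : L)) * Y * B.coactU ι l := rfl

theorem kap_add (Y Y' z : U ⊗[k] L) : B.kap ι (Y + Y') z = B.kap ι Y z + B.kap ι Y' z := by
  induction z using TensorProduct.induction_on with
  | zero => simp
  | add p q hp hq => rw [map_add, hp, hq, map_add, map_add]; abel
  | tmul p q => simp only [kap_tmul, mul_add, add_mul]

theorem kap_zero (z : U ⊗[k] L) : B.kap ι 0 z = 0 := by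
  have h := B.kap_add ι 0 0 z
  rwa [add_zero, left_eq_add] at h

/-- `x ⊗ l ↦ x γ(l₁) ⊗ l∞`. -/
noncomputable def untwist : U ⊗[k] L →ₗ[k] U ⊗[k] L :=
  TensorProduct.lift ((LinearMap.mul k (U ⊗[k] L)).compl₁₂
    (Algebra.TensorProduct.includeLeft : U →ₐ[k] U ⊗[k] L).toLinearMap
    (LinearMap.rTensor L γ ∘ₗ (B.coactU ι).toLinearMap))

theorem untwist_tmul (x : U) (l : L) :
    B.untwist ι (x ⊗ₜ[k] l) = (x ⊗ₜ[k] (1 : L)) * LinearMap.rTensor L γ (B.coactU ι l) := rfl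

/-- `x ⊗ l ↦ x l₁ ⊗ l∞`. -/
noncomputable def twist : U ⊗[k] L →ₗ[k] U ⊗[k] L := B.kap ι 1

theorem twist_tmul (x : U) (l : L) :
    B.twist ι (x ⊗ₜ[k] l) = (x ⊗ₜ[k] (1 : L)) * B.coactU ι l := by
  rw [twist, kap_tmul, mul_one]

end BaseAlgebra

theorem coactU_counit (B : BaseAlgebra k H L) (ι : H →ₐc[k] U) (l : L) :
    TensorProduct.lid k L ((Coalgebra.counit (R := k) (A := U)).rTensor L (B.coactU ι l)) = l := by
  have h := counitSnd_coact₂ B ι l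
  have h' := congrArg (TensorProduct.lid k L ∘ (Coalgebra.counit (R := k) (A := U)).rTensor L) h
  simp only [Function.comp_apply, LinearMap.rTensor_tmul, TensorProduct.lid_tmul,
    Bialgebra.counit_one, one_smul] at h'
  refine Eq.trans ?_ h'
  change _ = TensorProduct.lid k L ((Coalgebra.counit (R := k) (A := U)).rTensor L
    ((1 : U) ⊗ₜ[k] TensorProduct.lid k L ((Coalgebra.counit (R := k) (A := U)).rTensor L
    (B.coactU ι l))))
  simp

theorem foldR_delta₂ (B : BaseAlgebra k H L) (ι : H →ₐc[k] U) (l : L) :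
    foldR k U L (B.delta₂ ι l) = (1 : U) ⊗ₜ[k] l := by
  conv_rhs => rw [← coactU_counit B ι l]
  rw [BaseAlgebra.delta₂]
  generalize B.coactU ι l = w
  induction w using TensorProduct.induction_on with
  | zero => simp
  | add p q hp hq => simp only [map_add, TensorProduct.tmul_add, hp, hq]
  | tmul p q =>
    rw [foldR, LinearMap.comp_apply, LinearEquiv.coe_coe, LinearEquiv.symm_apply_apply,
      LinearMap.rTensor_tmul, LinearMap.rTensor_tmul, LinearMap.comp_apply,
      sum_mul_antipode_comul]
    simp [TensorProduct.smul_tmul']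

theorem foldL_delta₂ (B : BaseAlgebra k H L) (ι : H →ₐc[k] U) (l : L) :
    foldL k U L (B.delta₂ ι l) = (1 : U) ⊗ₜ[k] l := by
  conv_rhs => rw [← coactU_counit B ι l]
  rw [BaseAlgebra.delta₂]
  generalize B.coactU ι l = w
  induction w using TensorProduct.induction_on with
  | zero => simp
  | add p q hp hq => simp only [map_add, TensorProduct.tmul_add, hp, hq]
  | tmul p q =>
    rw [foldL, LinearMap.comp_apply, LinearEquiv.coe_coe, LinearEquiv.symm_apply_apply,
      LinearMap.rTensor_tmul, LinearMap.rTensor_tmul, LinearMap.comp_apply,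
      sum_antipode_mul_comul]
    simp [TensorProduct.smul_tmul']

/-- `conjInner Z (y ⊗ l) = Z₁ γ(y) ⊗ l Z_L`. -/
noncomputable def conjInner (Z : U ⊗[k] L) : U ⊗[k] L →ₗ[k] U ⊗[k] L :=
  TensorProduct.lift ((LinearMap.mul k (U ⊗[k] L)).flip.compl₁₂
    ((Algebra.TensorProduct.includeLeft : U →ₐ[k] U ⊗[k] L).toLinearMap ∘ₗ γ)
    (LinearMap.mulRight k Z ∘ₗ (Algebra.TensorProduct.includeRight : L →ₐ[k] U ⊗[k] L).toLinearMap))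

theorem conjInner_tmul (Z : U ⊗[k] L) (y : U) (l : L) :
    conjInner Z (y ⊗ₜ[k] l) = ((1 : U) ⊗ₜ[k] l) * Z * (γ y ⊗ₜ[k] (1 : L)) := rfl

/-- `conj Z (x ⊗ y ⊗ l) = x Z₁ γ(y) ⊗ l Z_L`. -/
noncomputable def conj (Z : U ⊗[k] L) : U ⊗[k] (U ⊗[k] L) →ₗ[k] U ⊗[k] L :=
  TensorProduct.lift ((LinearMap.mul k (U ⊗[k] L)).compl₁₂
    (Algebra.TensorProduct.includeLeft : U →ₐ[k] U ⊗[k] L).toLinearMap (conjInner Z))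

theorem conj_tmul (Z : U ⊗[k] L) (x : U) (w : U ⊗[k] L) :
    conj Z (x ⊗ₜ[k] w) = (x ⊗ₜ[k] (1 : L)) * conjInner Z w := rfl

theorem conj_tmul_tmul (Z : U ⊗[k] L) (x y : U) (l : L) : conj Z (x ⊗ₜ[k] (y ⊗ₜ[k] l)) =
    (x ⊗ₜ[k] l) * Z * (γ y ⊗ₜ[k] (1 : L)) := by
  rw [conj_tmul, conjInner_tmul, ← mul_assoc, ← mul_assoc, Algebra.TensorProduct.tmul_mul_tmul,
    mul_one, one_mul]

/-- γ reverses products, so the fold of the right factor sits inside the legs of the left one. -/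
theorem foldR_mul (t w : U ⊗[k] (U ⊗[k] L)) :
    foldR k U L (t * w) = conj (foldR k U L w) t := by
  refine tripleTensorInduction (p := fun t => foldR k U L (t * w) = conj (foldR k U L w) t) t
    (by simp) (fun _ _ h h' => by simp only [map_add, add_mul, h, h']) fun a b l => ?_
  rw [conj_tmul_tmul]
  refine tripleTensorInduction (p := fun w => foldR k U L (_ * w) = _ * foldR k U L w * _) w
    (by simp) (fun _ _ h h' => by simp only [map_add, mul_add, add_mul, h, h']) fun c d m => ?_
  simp [HopfAlgebra.antipode_mul_antidistrib, mul_assoc]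

theorem foldR_tmul_mul (x y : U) (l : L) (t : U ⊗[k] (U ⊗[k] L)) :
    foldR k U L (x ⊗ₜ[k] (y ⊗ₜ[k] l) * t) =
      (x ⊗ₜ[k] l) * foldR k U L t * (γ y ⊗ₜ[k] (1 : L)) := by
  rw [foldR_mul, conj_tmul_tmul]

/-- In the innermost position l₁γ(l₂) ⊗ l∞ reduces to 1 ⊗ l. Applied to F̄, which commutes with
δ₂(l), this yields the commutation rule of γ(ζ) with L needed in `opMul_untwist`. -/
theorem foldR_mul_delta₂ (B : BaseAlgebra k H L) (ι : H →ₐc[k] U) (w : U ⊗[k] (U ⊗[k] L)) (l : L) :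
    foldR k U L (w * B.delta₂ ι l) = foldR k U L w * ((1 : U) ⊗ₜ[k] l) := by
  refine tripleTensorInduction (p := fun w => foldR k U L (w * _) = foldR k U L w * _) w
    (by simp) (fun _ _ h h' => by simp only [map_add, add_mul, h, h']) fun a b m => ?_
  rw [foldR_tmul_mul, foldR_delta₂]
  simp

/-- `γ(x) m y ⊗ l' l` for `x ⊗ y ⊗ l` and `m ⊗ l'`. -/
noncomputable def sandwich (m : U ⊗[k] L) : U ⊗[k] (U ⊗[k] L) →ₗ[k] U ⊗[k] L :=
  TensorProduct.lift ((LinearMap.mul k (U ⊗[k] L)).compl₁₂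
    ((Algebra.TensorProduct.includeLeft : U →ₐ[k] U ⊗[k] L).toLinearMap ∘ₗ γ)
    (LinearMap.mulLeft k m))

theorem sandwich_tmul (m : U ⊗[k] L) (x : U) (w : U ⊗[k] L) :
    sandwich m (x ⊗ₜ[k] w) = (γ x ⊗ₜ[k] (1 : L)) * (m * w) := rfl

theorem foldL_mul (t w : U ⊗[k] (U ⊗[k] L)) :
    foldL k U L (t * w) = sandwich (foldL k U L t) w := by
  refine tripleTensorInduction (p := fun w => foldL k U L (t * w) = sandwich (foldL k U L t) w) w
    (by simp) (fun _ _ h h' => by simp only [map_add, mul_add, h, h']) fun a b l => ?_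
  rw [sandwich_tmul]
  refine tripleTensorInduction (p := fun t => foldL k U L (t * _) = _ * (foldL k U L t * _)) t
    (by simp) (fun _ _ h h' => by simp only [map_add, mul_add, add_mul, h, h']) fun c d m => ?_
  simp [HopfAlgebra.antipode_mul_antidistrib, mul_assoc]

/-- The product of `U ⊗ L_op`, written in `L`. -/
noncomputable def opMul : U ⊗[k] L →ₗ[k] U ⊗[k] L →ₗ[k] U ⊗[k] L :=
  TensorProduct.map₂ (LinearMap.mul k U) (LinearMap.mul k L).flip

theorem opMul_tmul (x y : U) (l m : L) :
    opMul (x ⊗ₜ[k] l) (y ⊗ₜ[k] m) = (x * y) ⊗ₜ[k] (m * l) := by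
  rw [opMul, TensorProduct.map₂_apply_tmul]
  simp

theorem opMul_tmul_left (x : U) (l : L) (Z : U ⊗[k] L) :
    opMul (x ⊗ₜ[k] l) Z = (x ⊗ₜ[k] (1 : L)) * Z * ((1 : U) ⊗ₜ[k] l) := by
  induction Z using TensorProduct.induction_on with
  | zero => simp
  | add p q hp hq => simp only [map_add, mul_add, add_mul, hp, hq]
  | tmul y m => simp [opMul_tmul]

theorem opMul_mul_left (x : U) (w Z : U ⊗[k] L) :
    opMul ((x ⊗ₜ[k] (1 : L)) * w) Z = (x ⊗ₜ[k] (1 : L)) * opMul w Z := by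
  induction w using TensorProduct.induction_on with
  | zero => simp
  | add p q hp hq => simp only [map_add, mul_add, LinearMap.add_apply, hp, hq]
  | tmul y m =>
    rw [Algebra.TensorProduct.tmul_mul_tmul, one_mul, opMul_tmul_left, opMul_tmul_left,
      ← mul_assoc, ← mul_assoc, Algebra.TensorProduct.tmul_mul_tmul, one_mul]

namespace BaseAlgebra

variable (B : BaseAlgebra k H L) (ι : H →ₐc[k] U)

/-- For w = a ⊗ b ⊗ l the antipode brings γ(b) in front of the fold of G, next to a; so aγ(b) is
formed on the left, while δ(l) stays on the right. -/
theorem cubeL_mul_coactLast (G w : U ⊗[k] (U ⊗[k] L)) :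
    cubeL (((1 : U) ⊗ₜ[k] G) * B.coactLast ι w) = B.kap ι (foldL k U L G) (foldR k U L w) := by
  refine tripleTensorInduction (p := fun w => cubeL (((1 : U) ⊗ₜ[k] G) * B.coactLast ι w) =
    B.kap ι (foldL k U L G) (foldR k U L w)) w (by simp)
    (fun _ _ h h' => by simp only [map_add, mul_add, h, h']) fun a b l => ?_
  have e : B.coactLast ι (a ⊗ₜ[k] (b ⊗ₜ[k] l)) = a ⊗ₜ[k] (b ⊗ₜ[k] B.coactU ι l) := rfl
  rw [e, foldR_tmul, kap_tmul, Algebra.TensorProduct.tmul_mul_tmul, one_mul, cubeL_tmul, mul_assoc]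
  have h : foldL k U L (G * b ⊗ₜ[k] B.coactU ι l) =
      (γ b ⊗ₜ[k] (1 : L)) * (foldL k U L G * B.coactU ι l) := by
    rw [foldL_mul, sandwich_tmul]
  rw [h, ← mul_assoc, Algebra.TensorProduct.tmul_mul_tmul, one_mul]

/-- `y ⊗ l ↦ y Z₁ γ(l₁) ⊗ l∞ Z_L`. -/
noncomputable def kapConj (Z : U ⊗[k] L) : U ⊗[k] L →ₗ[k] U ⊗[k] L :=
  TensorProduct.lift ((LinearMap.mul k (U ⊗[k] L)).compl₁₂
    (Algebra.TensorProduct.includeLeft : U →ₐ[k] U ⊗[k] L).toLinearMap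
    (conjInner Z ∘ₗ (B.coactU ι).toLinearMap))

theorem kapConj_tmul (Z : U ⊗[k] L) (y : U) (l : L) :
    B.kapConj ι Z (y ⊗ₜ[k] l) = (y ⊗ₜ[k] (1 : L)) * conjInner Z (B.coactU ι l) := rfl

theorem cubeR_coactLast_mul (G w : U ⊗[k] (U ⊗[k] L)) :
    cubeR (B.coactLast ι G * ((1 : U) ⊗ₜ[k] w)) = B.kapConj ι (foldR k U L w) (foldL k U L G) := by
  refine tripleTensorInduction (p := fun G => cubeR (B.coactLast ι G * ((1 : U) ⊗ₜ[k] w)) =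
    B.kapConj ι (foldR k U L w) (foldL k U L G)) G (by simp)
    (fun _ _ h h' => by simp only [map_add, add_mul, h, h']) fun a b l => ?_
  have e : B.coactLast ι (a ⊗ₜ[k] (b ⊗ₜ[k] l)) = a ⊗ₜ[k] (b ⊗ₜ[k] B.coactU ι l) := rfl
  rw [e, foldL_tmul, kapConj_tmul, Algebra.TensorProduct.tmul_mul_tmul, mul_one, cubeR_tmul,
    foldR_mul, conj_tmul, ← mul_assoc, Algebra.TensorProduct.tmul_mul_tmul, one_mul]

/-- For Y = y ⊗ m and z = x ⊗ l the left side is x y l₁γ(l₂)γ(m₁) ⊗ m∞l∞, and l₁γ(l₂) cancels.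
Untwisting thus converts the composition `kap`, produced by the cocycle equation, into an honest
product of U ⊗ L_op. -/
theorem untwist_kap (Y z : U ⊗[k] L) : B.untwist ι (B.kap ι Y z) = opMul z (B.untwist ι Y) := by
  induction Y using TensorProduct.induction_on with
  | zero => simp [kap_zero]
  | add p q hp hq => simp only [map_add, kap_add, hp, hq]
  | tmul y m =>
  induction z using TensorProduct.induction_on with
  | zero => simp
  | add p q hp hq => simp only [map_add, LinearMap.add_apply, hp, hq]
  | tmul x l =>
  rw [kap_tmul, untwist_tmul, Algebra.TensorProduct.tmul_mul_tmul, one_mul]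
  have h₁ : ∀ w : U ⊗[k] L, B.untwist ι ((x * y) ⊗ₜ[k] m * w) =
      TensorProduct.lift ((LinearMap.mul k (U ⊗[k] L)).compl₁₂
        ((Algebra.TensorProduct.includeLeft : U →ₐ[k] U ⊗[k] L).toLinearMap ∘ₗ
          LinearMap.mulLeft k (x * y))
        (LinearMap.rTensor L γ ∘ₗ LinearMap.mulLeft k (B.coactU ι m) ∘ₗ
          (B.coactU ι).toLinearMap)) w := by
    intro w
    induction w using TensorProduct.induction_on with
    | zero => simp
    | add p q hp hq => simp only [map_add, mul_add, hp, hq]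
    | tmul d e =>
      rw [Algebra.TensorProduct.tmul_mul_tmul, untwist_tmul, map_mul]
      rfl
  rw [h₁]
  generalize B.coactU ι m = M
  induction M using TensorProduct.induction_on with
  | zero =>
    simp only [map_zero, mul_zero]
    refine LinearMap.congr_fun (g := 0) (TensorProduct.ext' fun d e => ?_) _
    simp
  | add p q hp hq =>
    rw [map_add, mul_add, map_add, ← hp, ← hq, ← LinearMap.add_apply]
    congr 1
    ext d e
    simp only [add_mul, map_add, TensorProduct.AlgebraTensorModule.curry_apply,
      LinearMap.restrictScalars_self, TensorProduct.curry_apply, TensorProduct.lift.tmul,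
      LinearMap.compl₁₂_apply, LinearMap.comp_apply, LinearMap.mulLeft_apply, LinearMap.add_apply,
      LinearMap.mul_apply']
  | tmul a b =>
    have h₂ : ∀ w : U ⊗[k] L, TensorProduct.lift ((LinearMap.mul k (U ⊗[k] L)).compl₁₂
        ((Algebra.TensorProduct.includeLeft : U →ₐ[k] U ⊗[k] L).toLinearMap ∘ₗ
          LinearMap.mulLeft k (x * y))
        (LinearMap.rTensor L γ ∘ₗ LinearMap.mulLeft k (a ⊗ₜ[k] b) ∘ₗ
          (B.coactU ι).toLinearMap)) w =
        ((x * y) ⊗ₜ[k] b) * foldR k U L ((B.coactU ι).toLinearMap.lTensor U w) *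
          (γ a ⊗ₜ[k] (1 : L)) := by
      intro w
      induction w using TensorProduct.induction_on with
      | zero => simp
      | add p q hp hq => simp only [map_add, mul_add, add_mul, hp, hq]
      | tmul d e =>
        simp only [TensorProduct.lift.tmul, LinearMap.compl₁₂_apply, LinearMap.comp_apply,
          LinearMap.mulLeft_apply, LinearMap.lTensor_tmul, AlgHom.toLinearMap_apply,
          LinearMap.mul_apply', Algebra.TensorProduct.includeLeft_apply]
        generalize B.coactU ι e = w
        induction w using TensorProduct.induction_on with
        | zero => simp
        | add p q hp hq => simp only [map_add, TensorProduct.tmul_add, mul_add, add_mul, hp, hq]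
        | tmul p q => simp [HopfAlgebra.antipode_mul_antidistrib, mul_assoc]
    rw [h₂, ← delta₂_eq, foldR_delta₂]
    simp [opMul_tmul, mul_assoc]

/-- The hypothesis moves l∞ through Z at the price of l₂Z₁γ(l₃); the new l₂ cancels against the
γ(l₁) of the untwisting, and γ(l₃) remains as the factor in `kapConj`. -/
theorem opMul_untwist (Y Z : U ⊗[k] L)
    (hZ : ∀ l, Z * ((1 : U) ⊗ₜ[k] l) = conj Z (B.delta₂ ι l)) :
    opMul (B.untwist ι Y) Z = B.kapConj ι Z Y := by
  induction Y using TensorProduct.induction_on with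
  | zero => simp
  | add p q hp hq => simp only [map_add, LinearMap.add_apply, hp, hq]
  | tmul y l =>
  rw [untwist_tmul, opMul_mul_left, kapConj_tmul]
  congr 1
  set Λ : U ⊗[k] (U ⊗[k] (U ⊗[k] L)) →ₗ[k] U ⊗[k] L :=
    TensorProduct.lift ((LinearMap.mul k (U ⊗[k] L)).compl₁₂
      ((Algebra.TensorProduct.includeLeft : U →ₐ[k] U ⊗[k] L).toLinearMap ∘ₗ γ) (conj Z)) with hΛ
  have hΛt : ∀ d t, Λ (d ⊗ₜ[k] t) = (γ d ⊗ₜ[k] (1 : L)) * conj Z t := fun _ _ => rfl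
  have h₁ : ∀ w : U ⊗[k] L, opMul (LinearMap.rTensor L γ w) Z =
      Λ (((B.coactU ι).toLinearMap.lTensor U).lTensor U
        ((B.coactU ι).toLinearMap.lTensor U w)) := by
    intro w
    induction w using TensorProduct.induction_on with
    | zero => simp
    | add p q hp hq => simp only [map_add, LinearMap.add_apply, hp, hq]
    | tmul d e =>
      rw [LinearMap.rTensor_tmul, opMul_tmul_left, mul_assoc, hZ, delta₂_eq]
      rfl
  have h₂ : ∀ w : U ⊗[k] L, Λ (((B.coactU ι).toLinearMap.lTensor U).lTensor U
        (TensorProduct.assoc k U U L ((Coalgebra.comul (R := k) (A := U)).rTensor L w))) =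
      conjInner Z (B.coactU ι (TensorProduct.lid k L
        ((Coalgebra.counit (R := k) (A := U)).rTensor L w))) := by
    intro w
    induction w using TensorProduct.induction_on with
    | zero => simp
    | add p q hp hq => simp only [map_add, hp, hq]
    | tmul p q =>
      have h₃ : ∀ z : U ⊗[k] U, Λ (((B.coactU ι).toLinearMap.lTensor U).lTensor U
          (TensorProduct.assoc k U U L (z ⊗ₜ[k] q))) =
          (LinearMap.mul' k U (LinearMap.rTensor U γ z) ⊗ₜ[k] (1 : L)) *
            conjInner Z (B.coactU ι q) := by
        intro z
        induction z using TensorProduct.induction_on with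
        | zero => simp
        | add p q hp hq => simp only [map_add, TensorProduct.add_tmul, add_mul, hp, hq]
        | tmul a b =>
          simp only [TensorProduct.assoc_tmul, LinearMap.lTensor_tmul, hΛt, conj_tmul,
            ← mul_assoc, Algebra.TensorProduct.tmul_mul_tmul, one_mul, LinearMap.rTensor_tmul,
            LinearMap.mul'_apply, AlgHom.toLinearMap_apply]
      rw [LinearMap.rTensor_tmul, h₃, sum_antipode_mul_comul, LinearMap.rTensor_tmul,
        TensorProduct.lid_tmul, map_smul, map_smul, ← TensorProduct.smul_tmul',
        smul_mul_assoc, ← Algebra.TensorProduct.one_def, one_mul]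
  rw [h₁, ← delta₂_eq, delta₂, h₂, coactU_counit]

/-- Coassociativity of δ and γ(l₁)l₂ = ε(l₁). -/
theorem twist_untwist (Y : U ⊗[k] L) : B.twist ι (B.untwist ι Y) = Y := by
  induction Y using TensorProduct.induction_on with
  | zero => simp
  | add p q hp hq => simp only [map_add, hp, hq]
  | tmul y l =>
  have h : ∀ w : U ⊗[k] L, B.twist ι ((y ⊗ₜ[k] (1 : L)) * LinearMap.rTensor L γ w) =
      (y ⊗ₜ[k] (1 : L)) * foldL k U L ((B.coactU ι).toLinearMap.lTensor U w) := by
    intro w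
    induction w using TensorProduct.induction_on with
    | zero => simp
    | add p q hp hq => simp only [map_add, mul_add, hp, hq]
    | tmul d e =>
      rw [LinearMap.rTensor_tmul, Algebra.TensorProduct.tmul_mul_tmul, twist_tmul,
        LinearMap.lTensor_tmul, one_mul, AlgHom.toLinearMap_apply]
      generalize B.coactU ι e = w
      induction w using TensorProduct.induction_on with
      | zero => simp
      | add p q hp hq => simp only [map_add, TensorProduct.tmul_add, mul_add, hp, hq]
      | tmul p q => simp [mul_assoc]
  rw [untwist_tmul, h, ← delta₂_eq, foldL_delta₂]
  simp

end BaseAlgebra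

namespace DynamicalTwist

variable {B : BaseAlgebra k H L} {ι : H →ₐc[k] U} (J : DynamicalTwist B ι)

/-- `F̄₁ γ(F̄₂) ⊗ F̄_L`. -/
noncomputable def foldInv : U ⊗[k] L := foldR k U L (↑J.F⁻¹ : U ⊗[k] (U ⊗[k] L))

/-- The inverse of `foldInv` in `U ⊗ L_op`. -/
noncomputable def foldUntwist : U ⊗[k] L :=
  B.untwist ι (foldL k U L (J.F : U ⊗[k] (U ⊗[k] L)))

/-- Fold the cocycle equation in the form F̄₁₍₂₃₎F₍₁₂₎₃ = F₂₃F̄₁₂|₃ by x ⊗ y ⊗ z ↦ xγ(y)z. One side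
reduces to counits of F and F̄ and is 1 by normalization. After untwisting this is a one-sided
inverse for γ(ζ). -/
theorem kap_foldInv : B.kap ι (foldL k U L (J.F : U ⊗[k] (U ⊗[k] L))) J.foldInv = 1 := by
  rw [foldInv, ← BaseAlgebra.cubeL_mul_coactLast]
  have h : copSnd k U L (↑J.F⁻¹ : U ⊗[k] (U ⊗[k] L)) * copFst k U L (J.F : U ⊗[k] (U ⊗[k] L)) =
      ((1 : U) ⊗ₜ[k] (J.F : U ⊗[k] (U ⊗[k] L))) *
        B.coactLast ι (↑J.F⁻¹ : U ⊗[k] (U ⊗[k] L)) := by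
    have h₁ : copSnd k U L (↑J.F⁻¹ : U ⊗[k] (U ⊗[k] L)) * copSnd k U L (J.F : U ⊗[k] (U ⊗[k] L)) =
        1 := by rw [← map_mul, Units.inv_mul, map_one]
    have h₂ : B.coactLast ι (J.F : U ⊗[k] (U ⊗[k] L)) *
        B.coactLast ι (↑J.F⁻¹ : U ⊗[k] (U ⊗[k] L)) = 1 := by
      rw [← map_mul, Units.mul_inv, map_one]
    rw [← mul_one (copSnd k U L (↑J.F⁻¹ : U ⊗[k] (U ⊗[k] L)) * _), ← h₂, mul_assoc,
      ← mul_assoc (copFst k U L _), J.cocycle, ← mul_assoc, ← mul_assoc, h₁, one_mul]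
  rw [← h, cubeL_copSnd_mul_copFst, map_inv_of_one _ _ J.counitSnd_F, J.counitFst_F, one_mul]

/-- The mirror argument, giving the inverse on the other side: F̄₍₁₂₎₃F₁₍₂₃₎ = F₁₂|₃F̄₂₃ is folded
by x ⊗ y ⊗ z ↦ γ(x)yγ(z). -/
theorem kapConj_foldInv :
    B.kapConj ι J.foldInv (foldL k U L (J.F : U ⊗[k] (U ⊗[k] L))) = 1 := by
  rw [foldInv, ← BaseAlgebra.cubeR_coactLast_mul]
  have h : copFst k U L (↑J.F⁻¹ : U ⊗[k] (U ⊗[k] L)) * copSnd k U L (J.F : U ⊗[k] (U ⊗[k] L)) =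
      B.coactLast ι (J.F : U ⊗[k] (U ⊗[k] L)) *
        ((1 : U) ⊗ₜ[k] (↑J.F⁻¹ : U ⊗[k] (U ⊗[k] L))) := by
    have h₁ : copFst k U L (↑J.F⁻¹ : U ⊗[k] (U ⊗[k] L)) * copFst k U L (J.F : U ⊗[k] (U ⊗[k] L)) =
        1 := by rw [← map_mul, Units.inv_mul, map_one]
    have h₂ : ((1 : U) ⊗ₜ[k] (J.F : U ⊗[k] (U ⊗[k] L))) *
        ((1 : U) ⊗ₜ[k] (↑J.F⁻¹ : U ⊗[k] (U ⊗[k] L))) = 1 := by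
      rw [Algebra.TensorProduct.tmul_mul_tmul, Units.mul_inv, one_mul,
        Algebra.TensorProduct.one_def (A := U) (B := U ⊗[k] (U ⊗[k] L))]
    rw [← mul_one (copFst k U L (↑J.F⁻¹ : U ⊗[k] (U ⊗[k] L)) * _), ← h₂, mul_assoc,
      ← mul_assoc (copSnd k U L _), ← J.cocycle, ← mul_assoc, ← mul_assoc, h₁, one_mul]
  rw [← h, cubeR_copFst_mul_copSnd, map_inv_of_one _ _ J.counitFst_F, J.counitSnd_F, one_mul,
    Algebra.TensorProduct.one_def, LinearMap.rTensor_tmul, HopfAlgebra.antipode_one]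

theorem opMul_foldInv_foldUntwist : opMul J.foldInv J.foldUntwist = 1 := by
  rw [foldUntwist, ← BaseAlgebra.untwist_kap, kap_foldInv, Algebra.TensorProduct.one_def,
    BaseAlgebra.untwist_tmul, map_one, Algebra.TensorProduct.one_def, LinearMap.rTensor_tmul,
    HopfAlgebra.antipode_one, Algebra.TensorProduct.tmul_mul_tmul, one_mul, one_mul]

theorem opMul_foldUntwist_foldInv : opMul J.foldUntwist J.foldInv = 1 := by
  refine (B.opMul_untwist ι _ _ fun l => ?_).trans J.kapConj_foldInv
  rw [foldInv, ← foldR_mul_delta₂ B ι, delta₂_comm_inv, foldR_mul]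

/-- The fold of FF̄ = 1. This and `sandwich_twist_foldUntwist` are the inner cancellations in the
products of U and Ū. -/
theorem conj_foldInv : conj J.foldInv (J.F : U ⊗[k] (U ⊗[k] L)) = 1 := by
  rw [foldInv, ← foldR_mul, Units.mul_inv, foldR_one]

theorem sandwich_twist_foldUntwist :
    sandwich (B.twist ι J.foldUntwist) (↑J.F⁻¹ : U ⊗[k] (U ⊗[k] L)) = 1 := by
  rw [foldUntwist, BaseAlgebra.twist_untwist, ← foldL_mul, Units.mul_inv, foldL_one]

section Antipode

variable (hγ : Function.Bijective (HopfAlgebra.antipode k (A := U)))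

include hγ

theorem _root_.DynFRT.antipodeInv_antipode (x : U) : antipodeInv k U (γ x) = x := by
  rw [antipodeInv, dif_pos hγ]
  exact (LinearEquiv.ofBijective γ hγ).symm_apply_apply x

theorem _root_.DynFRT.antipode_antipodeInv (x : U) : γ (antipodeInv k U x) = x := by
  rw [antipodeInv, dif_pos hγ]
  exact (LinearEquiv.ofBijective γ hγ).apply_symm_apply x

theorem _root_.DynFRT.antipodeInv_mul (x y : U) :
    antipodeInv k U (x * y) = antipodeInv k U y * antipodeInv k U x := by
  apply hγ.1
  rw [antipode_antipodeInv hγ, HopfAlgebra.antipode_mul_antidistrib, antipode_antipodeInv hγ,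
    antipode_antipodeInv hγ]

/-- γ reverses F̄₂γ⁻¹(F̄₁) into F̄₁γ(F̄₂), removing the inverse antipode. -/
theorem antipode_zeta : LinearMap.rTensor L γ J.zeta = J.foldInv := by
  rw [zeta, foldInv]
  refine tripleTensorInduction (p := fun w => LinearMap.rTensor L γ
    ((TensorProduct.lift (LinearMap.mul k U).flip ∘ₗ (antipodeInv k U).rTensor U).rTensor L
    ((TensorProduct.assoc k U U L).symm w)) = foldR k U L w) _ (by simp)
    (fun _ _ h h' => by simp only [map_add, h, h']) fun a b l => ?_
  simp [HopfAlgebra.antipode_mul_antidistrib, antipode_antipodeInv hγ]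

/-- γ⁻¹ reverses the factors in U, and the product of L_op written in L is already reversed; so
inverses in U ⊗ L_op become inverses in U ⊗ L. -/
theorem _root_.DynFRT.rTensor_antipode_opMul (a b : U ⊗[k] L) :
    LinearMap.rTensor L (antipodeInv k U) (opMul a b) =
      LinearMap.rTensor L (antipodeInv k U) b * LinearMap.rTensor L (antipodeInv k U) a := by
  induction a using TensorProduct.induction_on with
  | zero => simp
  | add p q hp hq => simp only [map_add, mul_add, LinearMap.add_apply, hp, hq]
  | tmul x l =>
  induction b using TensorProduct.induction_on with
  | zero => simp
  | add p q hp hq => simp only [map_add, add_mul, hp, hq]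
  | tmul y m => simp [opMul_tmul, antipodeInv_mul hγ]

theorem _root_.DynFRT.rTensor_antipodeInv_antipode (a : U ⊗[k] L) :
    LinearMap.rTensor L (antipodeInv k U) (LinearMap.rTensor L γ a) = a := by
  rw [← LinearMap.comp_apply, ← LinearMap.rTensor_comp,
    show antipodeInv k U ∘ₗ γ = LinearMap.id from LinearMap.ext (antipodeInv_antipode hγ),
    LinearMap.rTensor_id, LinearMap.id_apply]

theorem _root_.DynFRT.rTensor_antipode_antipodeInv (a : U ⊗[k] L) :
    LinearMap.rTensor L γ (LinearMap.rTensor L (antipodeInv k U) a) = a := by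
  rw [← LinearMap.comp_apply, ← LinearMap.rTensor_comp,
    show γ ∘ₗ antipodeInv k U = LinearMap.id from LinearMap.ext (antipode_antipodeInv hγ),
    LinearMap.rTensor_id, LinearMap.id_apply]

theorem zeta_mul_inv : J.zeta * LinearMap.rTensor L (antipodeInv k U) J.foldUntwist = 1 ∧
    LinearMap.rTensor L (antipodeInv k U) J.foldUntwist * J.zeta = 1 := by
  have h : LinearMap.rTensor L (antipodeInv k U) (1 : U ⊗[k] L) = 1 := by
    rw [Algebra.TensorProduct.one_def, LinearMap.rTensor_tmul]
    congr 1
    apply hγ.1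
    rw [antipode_antipodeInv hγ, HopfAlgebra.antipode_one]
  constructor
  · conv_lhs => rw [← rTensor_antipodeInv_antipode hγ J.zeta, J.antipode_zeta hγ]
    rw [← rTensor_antipode_opMul hγ, J.opMul_foldUntwist_foldInv, h]
  · conv_lhs => rw [← rTensor_antipodeInv_antipode hγ J.zeta, J.antipode_zeta hγ]
    rw [← rTensor_antipode_opMul hγ, J.opMul_foldInv_foldUntwist, h]

theorem isUnit_zeta : IsUnit J.zeta :=
  ⟨⟨_, _, (J.zeta_mul_inv hγ).1, (J.zeta_mul_inv hγ).2⟩, rfl⟩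

theorem antipode_inverse_zeta : LinearMap.rTensor L γ (Ring.inverse J.zeta) = J.foldUntwist := by
  have h : Ring.inverse J.zeta = LinearMap.rTensor L (antipodeInv k U) J.foldUntwist :=
    Ring.inverse_unit (⟨_, _, (J.zeta_mul_inv hγ).1, (J.zeta_mul_inv hγ).2⟩ : (U ⊗[k] L)ˣ)
  rw [h, rTensor_antipode_antipodeInv hγ]

end Antipode

end DynamicalTwist

end Zeta

/-! ### The two actions of U on matrix coefficients and on their antipodes -/

section MatrixCoefficients

variable {k U A n : Type*} [Field k] [Ring U] [HopfAlgebra k U] [Ring A] [HopfAlgebra k A]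
  [Fintype n] [DecidableEq n]

variable (A) in
/-- A matrix representation, with scalars extended to `A`. -/
noncomputable def scalarRep (ρ : U →ₐ[k] Matrix n n k) : U →ₐ[k] Matrix n n A :=
  (Algebra.ofId k A).mapMatrix.comp ρ

theorem scalarRep_apply (ρ : U →ₐ[k] Matrix n n k) (x : U) (i j : n) :
    scalarRep A ρ x i j = algebraMap k A (ρ x i j) := rfl

theorem mul_scalarRep_apply (ρ : U →ₐ[k] Matrix n n k) (M : Matrix n n A) (x : U) (i j : n) :
    (M * scalarRep A ρ x) i j = ∑ r, ρ x r j • M i r := by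
  rw [Matrix.mul_apply]
  exact Finset.sum_congr rfl fun r _ => by
    rw [scalarRep_apply, ← Algebra.commutes, Algebra.smul_def]

theorem scalarRep_mul_apply (ρ : U →ₐ[k] Matrix n n k) (M : Matrix n n A) (x : U) (i j : n) :
    (scalarRep A ρ x * M) i j = ∑ r, ρ x i r • M r j := by
  rw [Matrix.mul_apply]
  exact Finset.sum_congr rfl fun r _ => by rw [scalarRep_apply, Algebra.smul_def]

namespace HopfDual

variable (D : HopfDual k U A) {ρ : U →ₐ[k] Matrix n n k} {c : Matrix n n A}
  (hc : ∀ (u : U) (i j : n), D.pair (c i j) u = ρ u i j)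

include hc

theorem lact_coefficient (x : U) (i j : n) :
    D.lact x (c i j) = (c * scalarRep A ρ x) i j := by
  refine D.ext fun u => ?_
  rw [D.pair_lact, mul_scalarRep_apply, hc, map_mul, Matrix.mul_apply]
  simp [hc, mul_comm]

theorem ract_coefficient (x : U) (i j : n) :
    D.ract x (c i j) = (scalarRep A ρ x * c) i j := by
  refine D.ext fun u => ?_
  rw [D.pair_ract, scalarRep_mul_apply, hc, map_mul, Matrix.mul_apply]
  simp [hc]

theorem act_coefficient (x y : U) (i j : n) :
    D.ract y (D.lact x (c i j)) = (scalarRep A ρ y * c * scalarRep A ρ x) i j := by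
  rw [D.lact_coefficient hc, mul_scalarRep_apply, mul_scalarRep_apply, map_sum]
  exact Finset.sum_congr rfl fun r _ => by rw [map_smul, D.ract_coefficient hc]

theorem lact_antipode_coefficient (x : U) (i j : n) :
    D.lact x (HopfAlgebra.antipode k (c i j)) = (scalarRep A ρ (HopfAlgebra.antipode k x) *
      c.map (HopfAlgebra.antipode k)) i j := by
  refine D.ext fun u => ?_
  rw [D.pair_lact, scalarRep_mul_apply, D.pair_antipode, hc,
    HopfAlgebra.antipode_mul_antidistrib, map_mul, Matrix.mul_apply]
  simp [hc, D.pair_antipode]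

theorem ract_antipode_coefficient (x : U) (i j : n) :
    D.ract x (HopfAlgebra.antipode k (c i j)) = (c.map (HopfAlgebra.antipode k) *
      scalarRep A ρ (HopfAlgebra.antipode k x)) i j := by
  refine D.ext fun u => ?_
  rw [D.pair_ract, mul_scalarRep_apply, D.pair_antipode, hc,
    HopfAlgebra.antipode_mul_antidistrib, map_mul, Matrix.mul_apply]
  simp [hc, D.pair_antipode, mul_comm]

/-- Compared with `act_coefficient` the roles of the two actions are exchanged, since the antipode
reverses arguments: the action of U now multiplies from the left and that of U_op from the right. -/
theorem act_antipode_coefficient (x y : U) (i j : n) :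
    D.ract y (D.lact x (HopfAlgebra.antipode k (c i j))) =
      (scalarRep A ρ (HopfAlgebra.antipode k x) * c.map (HopfAlgebra.antipode k) *
        scalarRep A ρ (HopfAlgebra.antipode k y)) i j := by
  rw [D.lact_antipode_coefficient hc, scalarRep_mul_apply, mul_assoc, scalarRep_mul_apply, map_sum]
  exact Finset.sum_congr rfl fun r _ => by
    rw [map_smul, Matrix.map_apply, D.ract_antipode_coefficient hc]

/-- `∑ aᵢ(u₁) bᵢ(u₂)`. -/
theorem pair_coefficient_mul (i j r s : n) (u : U) : D.pair (c i j * c r s) u =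
    LinearMap.mul' k k (TensorProduct.map (coeff ρ i j) (coeff ρ r s)
      (Coalgebra.comul (R := k) u)) := by
  rw [D.pair_mul]
  congr 3 <;> exact LinearMap.ext fun u => hc u _ _

theorem coefficient_mul_antipode : c * c.map (HopfAlgebra.antipode k) = 1 := by
  ext1 i j
  refine D.ext fun u => ?_
  have h : ∀ w : U ⊗[k] U, ∑ r, LinearMap.mul' k k (TensorProduct.map (D.pair (c i r))
      (D.pair (HopfAlgebra.antipode k (c r j))) w) =
      ρ (LinearMap.mul' k U (LinearMap.lTensor U (HopfAlgebra.antipode k) w)) i j := by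
    intro w
    induction w using TensorProduct.induction_on with
    | zero => simp
    | add p q hp hq => simp only [map_add, Finset.sum_add_distrib, hp, hq, Matrix.add_apply]
    | tmul p q => simp [hc, D.pair_antipode, Matrix.mul_apply]
  rw [Matrix.mul_apply, map_sum, LinearMap.sum_apply]
  simp only [D.pair_mul, Matrix.map_apply]
  rw [h, sum_mul_antipode_comul, map_smul, map_one, Matrix.smul_apply, Matrix.one_apply,
    Matrix.one_apply]
  split_ifs
  · rw [D.pair_one, smul_eq_mul, mul_one]
  · simp

theorem antipode_mul_coefficient : c.map (HopfAlgebra.antipode k) * c = 1 := by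
  ext1 i j
  refine D.ext fun u => ?_
  have h : ∀ w : U ⊗[k] U, ∑ r, LinearMap.mul' k k (TensorProduct.map
      (D.pair (HopfAlgebra.antipode k (c i r))) (D.pair (c r j)) w) =
      ρ (LinearMap.mul' k U (LinearMap.rTensor U (HopfAlgebra.antipode k) w)) i j := by
    intro w
    induction w using TensorProduct.induction_on with
    | zero => simp
    | add p q hp hq => simp only [map_add, Finset.sum_add_distrib, hp, hq, Matrix.add_apply]
    | tmul p q => simp [hc, D.pair_antipode, Matrix.mul_apply]
  rw [Matrix.mul_apply, map_sum, LinearMap.sum_apply]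
  simp only [D.pair_mul, Matrix.map_apply]
  rw [h, sum_antipode_mul_comul, map_smul, map_one, Matrix.smul_apply, Matrix.one_apply,
    Matrix.one_apply]
  split_ifs
  · rw [D.pair_one, smul_eq_mul, mul_one]
  · simp

end HopfDual

end MatrixCoefficients

/-! ### The matrix Ū is a two-sided inverse of U -/

section Inverse

variable {k H U L A n : Type*} [Field k] [Ring H] [HopfAlgebra k H] [Ring U] [HopfAlgebra k U]
  [Ring L] [Algebra k L] [Ring A] [HopfAlgebra k A] [Fintype n] [DecidableEq n]

/-- `X ⊗ l ↦ (P ρ(X) Q)ᵢⱼ ⊗ f(l)`. -/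
noncomputable def entryMap {Y : Type*} [AddCommGroup Y] [Module k Y] (ρ : U →ₐ[k] Matrix n n k)
    (P Q : Matrix n n A) (i j : n) (f : L →ₗ[k] Y) : U ⊗[k] L →ₗ[k] A ⊗[k] Y :=
  TensorProduct.map (Matrix.entryLinearMap k A i j ∘ₗ LinearMap.mulLeft k P ∘ₗ
    LinearMap.mulRight k Q ∘ₗ (scalarRep A ρ).toLinearMap) f

theorem entryMap_tmul {Y : Type*} [AddCommGroup Y] [Module k Y] (ρ : U →ₐ[k] Matrix n n k)
    (P Q : Matrix n n A) (i j : n) (f : L →ₗ[k] Y) (x : U) (l : L) :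
    entryMap ρ P Q i j f (x ⊗ₜ[k] l) = (P * scalarRep A ρ x * Q) i j ⊗ₜ[k] f l := by
  rw [mul_assoc]
  rfl

theorem sum_scalar_right (ρ : U →ₐ[k] Matrix n n k) (X Y : Matrix n n A) (x y : U) (i j : n)
    (l l' : L) :
    ∑ s, ∑ p, ∑ q, (X i s * Y p q) ⊗ₜ[k] ((ρ y q j • l) ⊗ₜ[k] (ρ x s p • l')) =
      (X * scalarRep A ρ x * Y * scalarRep A ρ y) i j ⊗ₜ[k] (l ⊗ₜ[k] l') := by
  have h : ∀ s p q, (X i s * Y p q) ⊗ₜ[k] ((ρ y q j • l) ⊗ₜ[k] (ρ x s p • l')) =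
      (ρ y q j • (ρ x s p • X i s) * Y p q) ⊗ₜ[k] (l ⊗ₜ[k] l') := by
    intro s p q
    simp only [TensorProduct.tmul_smul, ← TensorProduct.smul_tmul', smul_mul_assoc]
    rw [smul_comm]
  simp only [h, mul_scalarRep_apply, Matrix.mul_apply (N := Y), Finset.sum_mul, Finset.smul_sum,
    ← TensorProduct.sum_tmul]
  congr 1
  calc _ = ∑ s, ∑ q, ∑ p, ρ y q j • (ρ x s p • X i s) * Y p q :=
        Finset.sum_congr rfl fun _ _ => Finset.sum_comm
    _ = ∑ q, ∑ s, ∑ p, ρ y q j • (ρ x s p • X i s) * Y p q := Finset.sum_comm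
    _ = _ := Finset.sum_congr rfl fun _ _ => Finset.sum_comm.trans (by simp only [smul_mul_assoc])

theorem sum_scalar_left (ρ : U →ₐ[k] Matrix n n k) (X Y : Matrix n n A) (x y : U) (i j : n)
    (l l' : L) :
    ∑ s, ∑ p, ∑ q, (X p q * Y s j) ⊗ₜ[k] ((ρ x q s • l) ⊗ₜ[k] (ρ y i p • l')) =
      (scalarRep A ρ y * X * scalarRep A ρ x * Y) i j ⊗ₜ[k] (l ⊗ₜ[k] l') := by
  have h : ∀ s p q, (X p q * Y s j) ⊗ₜ[k] ((ρ x q s • l) ⊗ₜ[k] (ρ y i p • l')) =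
      (ρ x q s • (ρ y i p • X p q) * Y s j) ⊗ₜ[k] (l ⊗ₜ[k] l') := by
    intro s p q
    simp only [TensorProduct.tmul_smul, ← TensorProduct.smul_tmul', smul_mul_assoc]
    rw [smul_comm]
  simp only [h, Matrix.mul_apply (N := Y), mul_scalarRep_apply, scalarRep_mul_apply,
    Finset.sum_mul, Finset.smul_sum, ← TensorProduct.sum_tmul]
  congr 1
  exact Finset.sum_congr rfl fun _ _ => Finset.sum_comm

variable (D : HopfDual k U A) {ρ : U →ₐ[k] Matrix n n k} {c : Matrix n n A}
  (hc : ∀ (u : U) (i j : n), D.pair (c i j) u = ρ u i j)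

include hc

/-- The sum is the entry of ρ(G'₁) c ρ(G₁N₁γ(G₂)) γ(c) ρ(γ(G'₂)M₁). By hypothesis the inner factor
is 1, so cγ(c) = 1 applies and G'₁γ(G'₂)M₁ remains, with its components multiplied in L_op. -/
theorem sum_core_right (M N : U ⊗[k] L) (G' G : U ⊗[k] (U ⊗[k] L)) (hNG : conj N G = 1) (i j : n) :
    ∑ s, ∑ p, ∑ q, D.core L ((c i s ⊗ₜ[k] HopfAlgebra.antipode k (c p q)) ⊗ₜ[k]
        ((inL₂ k U L (contract (coeff ρ q j) M) * G') ⊗ₜ[k]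
          (G * inL₂ k U L (contract (coeff ρ s p) N)))) =
      entryMap ρ 1 1 i j ((TensorProduct.mk k L L).flip 1) (opMul (foldR k U L G') M) := by
  induction M using TensorProduct.induction_on with
  | zero => simp
  | add x y hx hy => simp only [map_add, add_mul, TensorProduct.add_tmul, TensorProduct.tmul_add,
      Finset.sum_add_distrib, hx, hy]
  | tmul m m' =>
  refine tripleTensorInduction (p := fun G' => ∑ s, ∑ p, ∑ q,
    D.core L ((c i s ⊗ₜ[k] HopfAlgebra.antipode k (c p q)) ⊗ₜ[k]
        ((inL₂ k U L (contract (coeff ρ q j) (m ⊗ₜ[k] m')) * G') ⊗ₜ[k]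
          (G * inL₂ k U L (contract (coeff ρ s p) N)))) =
      entryMap ρ 1 1 i j ((TensorProduct.mk k L L).flip 1) (opMul (foldR k U L G') (m ⊗ₜ[k] m')))
      G' (by simp) (fun _ _ h h' => by
        simp only [map_add, mul_add, TensorProduct.add_tmul, TensorProduct.tmul_add,
          Finset.sum_add_distrib, LinearMap.add_apply, h, h']) fun a b l => ?_
  have h : ∑ s, ∑ p, ∑ q, D.core L ((c i s ⊗ₜ[k] HopfAlgebra.antipode k (c p q)) ⊗ₜ[k]
        ((inL₂ k U L (contract (coeff ρ q j) (m ⊗ₜ[k] m')) * a ⊗ₜ[k] (b ⊗ₜ[k] l)) ⊗ₜ[k]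
          (G * inL₂ k U L (contract (coeff ρ s p) N)))) =
      entryMap ρ (scalarRep A ρ a * c) (c.map (HopfAlgebra.antipode k) *
        scalarRep A ρ (HopfAlgebra.antipode k b * m)) i j (TensorProduct.mk k L L (m' * l))
        (conj N G) := by
    clear hNG
    refine tripleTensorInduction (p := fun G => ∑ s, ∑ p, ∑ q,
        D.core L ((c i s ⊗ₜ[k] HopfAlgebra.antipode k (c p q)) ⊗ₜ[k]
          ((inL₂ k U L (contract (coeff ρ q j) (m ⊗ₜ[k] m')) * a ⊗ₜ[k] (b ⊗ₜ[k] l)) ⊗ₜ[k]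
            (G * inL₂ k U L (contract (coeff ρ s p) N)))) = entryMap _ _ _ i j _ (conj N G))
        G (by simp) (fun _ _ h h' => by
          simp only [map_add, add_mul, TensorProduct.tmul_add, Finset.sum_add_distrib, h, h'])
          fun a' b' l' => ?_
    induction N using TensorProduct.induction_on with
    | zero => simp [conj_tmul_tmul]
    | add x y hx hy =>
      simp only [map_add, mul_add, TensorProduct.tmul_add, Finset.sum_add_distrib, hx, hy,
        conj_tmul_tmul, add_mul] at *
    | tmul x x' =>
    have i1 : ∀ x : L, inL₂ k U L x = (1 : U) ⊗ₜ[k] ((1 : U) ⊗ₜ[k] x) := fun _ => rfl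
    have e : ∀ (x : U) (i j : n), coeff ρ i j x = ρ x i j := fun _ _ _ => rfl
    simp only [contract_tmul, i1, Algebra.TensorProduct.tmul_mul_tmul, one_mul, mul_one,
      D.core_tmul, D.act_coefficient hc, D.act_antipode_coefficient hc, conj_tmul_tmul,
      entryMap_tmul, e, smul_mul_assoc, mul_smul_comm, TensorProduct.mk_apply]
    rw [sum_scalar_right]
    simp only [map_mul, mul_assoc]
  rw [h, hNG, Algebra.TensorProduct.one_def, entryMap_tmul, foldR_tmul, opMul_tmul, entryMap_tmul,
    map_one, mul_one, mul_assoc (scalarRep A ρ a), ← mul_assoc c, D.coefficient_mul_antipode hc,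
    one_mul, ← map_mul, one_mul, mul_one, mul_assoc]
  rfl

/-- For simple tensors in the part in L the sum is the entry of ρ(xγ(a)) γ(c) ρ(γ(G'₁)M₁m₁G'₂) c
ρ(b), where m₁ ⊗ m∞ is the coaction of the component of M. In this order of the product the coaction
acts on the second coefficient, which explains the `twist`. -/
theorem sum_core_left_tmul (B : BaseAlgebra k H L) (ι : H →ₐc[k] U) (M : U ⊗[k] L)
    (G' : U ⊗[k] (U ⊗[k] L)) (i j : n) (x a b : U) (l : L) :
    ∑ s, ∑ p, ∑ q, D.core L ((HopfAlgebra.antipode k (c p q) ⊗ₜ[k] c s j) ⊗ₜ[k]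
        ((((1 : U) ⊗ₜ[k] B.coactU ι (contract (coeff ρ q s) M)) * G') ⊗ₜ[k]
          (ρ x i p • (a ⊗ₜ[k] (b ⊗ₜ[k] l))))) =
      entryMap ρ (scalarRep A ρ (x * HopfAlgebra.antipode k a) * c.map (HopfAlgebra.antipode k))
        (c * scalarRep A ρ b) i j ((TensorProduct.mk k L L).flip l)
        (sandwich (B.twist ι M) G') := by
  refine tripleTensorInduction (p := fun G' => ∑ s, ∑ p, ∑ q,
      D.core L ((HopfAlgebra.antipode k (c p q) ⊗ₜ[k] c s j) ⊗ₜ[k]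
        ((((1 : U) ⊗ₜ[k] B.coactU ι (contract (coeff ρ q s) M)) * G') ⊗ₜ[k]
          (ρ x i p • (a ⊗ₜ[k] (b ⊗ₜ[k] l))))) =
      entryMap ρ (scalarRep A ρ (x * HopfAlgebra.antipode k a) * c.map (HopfAlgebra.antipode k))
        (c * scalarRep A ρ b) i j ((TensorProduct.mk k L L).flip l)
        (sandwich (B.twist ι M) G'))
      G' (by simp) (fun _ _ h h' => by
        simp only [map_add, mul_add, TensorProduct.add_tmul, TensorProduct.tmul_add,
          Finset.sum_add_distrib, h, h']) fun a' b' m' => ?_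
  rw [sandwich_tmul]
  have e : ∀ (x : U) (i j : n), coeff ρ i j x = ρ x i j := fun _ _ _ => rfl
  induction M using TensorProduct.induction_on with
  | zero => simp
  | add x y hx hy =>
    simp only [map_add, mul_add, add_mul, TensorProduct.tmul_add, TensorProduct.add_tmul,
      Finset.sum_add_distrib, hx, hy]
  | tmul y y' =>
  simp only [contract_tmul, BaseAlgebra.twist_tmul, map_smul]
  generalize B.coactU ι y' = E
  induction E using TensorProduct.induction_on with
  | zero => simp
  | add x y hx hy =>
    simp only [map_add, mul_add, add_mul, TensorProduct.tmul_add, TensorProduct.add_tmul,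
      Finset.sum_add_distrib, smul_add, hx, hy]
  | tmul z z' =>
  simp only [Algebra.TensorProduct.tmul_mul_tmul, one_mul, smul_mul_assoc,
    ← TensorProduct.tmul_smul,
    D.core_tmul, D.act_coefficient hc, D.act_antipode_coefficient hc,
    entryMap_tmul, e, TensorProduct.mk_apply, LinearMap.flip_apply]
  rw [sum_scalar_left]
  simp only [map_mul, mul_assoc]

/-- The hypothesis makes the factor between γ(c) and c equal to 1, so γ(c)c = 1 applies. The outer
factors assemble to N₁γ(G₁)G₂l₁ ⊗ G_L l∞ with l the component of N, which is the composition `kap`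
of the cocycle equation. -/
theorem sum_core_left (B : BaseAlgebra k H L) (ι : H →ₐc[k] U) (M N : U ⊗[k] L)
    (G' G : U ⊗[k] (U ⊗[k] L)) (hMG : sandwich (B.twist ι M) G' = 1) (i j : n) :
    ∑ s, ∑ p, ∑ q, D.core L ((HopfAlgebra.antipode k (c p q) ⊗ₜ[k] c s j) ⊗ₜ[k]
        ((((1 : U) ⊗ₜ[k] B.coactU ι (contract (coeff ρ q s) M)) * G') ⊗ₜ[k]
          (G * ((1 : U) ⊗ₜ[k] B.coactU ι (contract (coeff ρ i p) N))))) =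
      entryMap ρ 1 1 i j (TensorProduct.mk k L L 1) (B.kap ι (foldL k U L G) N) := by
  have e : ∀ (x : U) (i j : n), coeff ρ i j x = ρ x i j := fun _ _ _ => rfl
  induction N using TensorProduct.induction_on with
  | zero => simp
  | add x y hx hy => simp only [map_add, mul_add, TensorProduct.tmul_add,
      Finset.sum_add_distrib, hx, hy]
  | tmul x x' =>
  rw [BaseAlgebra.kap_tmul]
  simp only [contract_tmul, map_smul, TensorProduct.tmul_smul (R := k) _ (1 : U), mul_smul_comm, e]
  generalize B.coactU ι x' = E
  induction E using TensorProduct.induction_on with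
  | zero => simp
  | add x y hx hy =>
    simp only [map_add, mul_add, TensorProduct.tmul_add, smul_add, Finset.sum_add_distrib, hx, hy]
  | tmul d l' =>
  refine tripleTensorInduction (p := fun G => ∑ s, ∑ p, ∑ q,
        D.core L ((HopfAlgebra.antipode k (c p q) ⊗ₜ[k] c s j) ⊗ₜ[k]
        (((1 : U) ⊗ₜ[k] B.coactU ι (contract (coeff ρ q s) M) * G') ⊗ₜ[k]
          (ρ x i p • (G * ((1 : U) ⊗ₜ[k] (d ⊗ₜ[k] l')))))) =
        entryMap ρ 1 1 i j (TensorProduct.mk k L L 1)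
          ((x ⊗ₜ[k] (1 : L)) * foldL k U L G * d ⊗ₜ[k] l')) G
        (by simp) (fun _ _ h h' => by
          simp only [map_add, mul_add, add_mul, TensorProduct.tmul_add, smul_add,
            Finset.sum_add_distrib, h, h'])
          fun a b l => ?_
  simp only [Algebra.TensorProduct.tmul_mul_tmul, mul_one]
  rw [sum_core_left_tmul D hc, hMG, Algebra.TensorProduct.one_def, entryMap_tmul, foldL_tmul,
    Algebra.TensorProduct.tmul_mul_tmul, Algebra.TensorProduct.tmul_mul_tmul, entryMap_tmul,
    map_one, mul_one, mul_assoc (scalarRep A ρ _), ← mul_assoc (c.map _),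
    D.antipode_mul_coefficient hc, one_mul, ← map_mul, one_mul, mul_one, one_mul]
  simp only [mul_assoc]
  rfl

namespace TwistedDual

variable {B : BaseAlgebra k H L} {ι : H →ₐc[k] U} (J : DynamicalTwist B ι)
  (hγ : Function.Bijective (HopfAlgebra.antipode k (A := U)))

omit hc in
theorem contract_comp_antipode (X : U ⊗[k] L) (i j : n) :
    contract (coeff ρ i j ∘ₗ HopfAlgebra.antipode k) X =
      contract (coeff ρ i j) (LinearMap.rTensor L (HopfAlgebra.antipode k) X) := by
  rw [contract, LinearMap.rTensor_comp]
  rfl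

omit hc in
include hγ in
theorem matUbar_apply (i j : n) : matUbar D J c ρ i j = ∑ p, ∑ q,
    elem D J (HopfAlgebra.antipode k (c p q)) (contract (coeff ρ q j) J.foldUntwist)
      (contract (coeff ρ i p) J.foldInv) := by
  rw [matUbar, Matrix.of_apply]
  simp only [contract_comp_antipode, J.antipode_zeta hγ, J.antipode_inverse_zeta hγ]

omit hc in
theorem entryMap_one (i j : n) (f : L →ₗ[k] L ⊗[k] L) (hf : f 1 = 1 ⊗ₜ[k] 1) :
    entryMap (A := A) ρ 1 1 i j f (1 : U ⊗[k] L) = (1 : Matrix n n (TwistedDual D J)) i j := by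
  rw [Algebra.TensorProduct.one_def, entryMap_tmul, map_one, mul_one, mul_one, hf,
    Matrix.one_apply, Matrix.one_apply]
  split_ifs
  · rfl
  · exact TensorProduct.zero_tmul _ _

include hγ

/-- Here G' = F̄ and G = F; the inner cancellation is `conj_foldInv`, the outer one is γ(ζ) times
its inverse in U ⊗ L_op. -/
theorem matU_mul_matUbar : matU D J c * matUbar D J c ρ = 1 := by
  ext1 i j
  rw [Matrix.mul_apply, ← entryMap_one D (ρ := ρ) J i j ((TensorProduct.mk k L L).flip 1) rfl,
    ← J.opMul_foldInv_foldUntwist, DynamicalTwist.foldInv,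
    ← sum_core_right D hc _ J.foldInv _ _ J.conj_foldInv i j]
  refine Finset.sum_congr rfl fun s _ => ?_
  rw [matUbar_apply D J hγ, Finset.mul_sum]
  refine Finset.sum_congr rfl fun p _ => ?_
  rw [Finset.mul_sum]
  refine Finset.sum_congr rfl fun q _ => ?_
  change elem D J (c i s) 1 1 * _ = _
  rw [elem_mul_elem, map_one, one_mul, mul_one]

theorem matUbar_mul_matU : matUbar D J c ρ * matU D J c = 1 := by
  ext1 i j
  rw [Matrix.mul_apply, ← entryMap_one D (ρ := ρ) J i j (TensorProduct.mk k L L 1) rfl,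
    ← J.kap_foldInv,
    ← sum_core_left D hc B ι _ J.foldInv _ _ J.sandwich_twist_foldUntwist i j]
  refine Finset.sum_congr rfl fun s _ => ?_
  rw [matUbar_apply D J hγ, Finset.sum_mul]
  refine Finset.sum_congr rfl fun p _ => ?_
  rw [Finset.sum_mul]
  refine Finset.sum_congr rfl fun q _ => ?_
  change _ * elem D J (c s j) 1 1 = _
  rw [elem_mul_elem, map_one, one_mul, mul_one]
  rfl

end TwistedDual

end Inverse

/-! ### Compatibility of the two actions with the coproduct of the dual -/

section DualActions

variable {k U A : Type*} [Field k] [Ring U] [HopfAlgebra k U] [Ring A] [HopfAlgebra k A]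
  (D : HopfDual k U A)

theorem HopfDual.lact_apply (x : U) (a : A) : D.lact x a =
    TensorProduct.rid k A ((D.pair.flip x).lTensor A (Coalgebra.comul (R := k) a)) := rfl

theorem HopfDual.ract_apply (x : U) (a : A) : D.ract x a =
    TensorProduct.lid k A ((D.pair.flip x).rTensor A (Coalgebra.comul (R := k) a)) := rfl

/-- Both sides are a₁⟨a₂, x⟩ ⊗ a₃. Elements of U can thus be moved across the coproduct, becoming
elements of U_op; the Takeuchi condition and the multiplicativity of the coproduct of the twisted
dual rest on this. -/
theorem HopfDual.lact_rTensor_comul (x : U) (a : A) :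
    (D.lact x).rTensor A (Coalgebra.comul (R := k) a) =
      (D.ract x).lTensor A (Coalgebra.comul (R := k) a) := by
  have h := congrArg (((TensorProduct.lid k A).toLinearMap ∘ₗ
    (D.pair.flip x).rTensor A).lTensor A) (Coalgebra.coassoc_apply (R := k) a)
  have h₁ : ∀ w : A ⊗[k] A, ((TensorProduct.lid k A).toLinearMap ∘ₗ
      (D.pair.flip x).rTensor A).lTensor A (TensorProduct.assoc k A A A
        ((Coalgebra.comul (R := k)).rTensor A w)) = (D.lact x).rTensor A w := by
    intro w
    induction w using TensorProduct.induction_on with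
    | zero => simp
    | add p q hp hq => simp only [map_add, hp, hq]
    | tmul p q =>
      rw [LinearMap.rTensor_tmul, LinearMap.rTensor_tmul, D.lact_apply]
      generalize Coalgebra.comul (R := k) p = w
      induction w using TensorProduct.induction_on with
      | zero => simp
      | add p q hp hq => simp only [map_add, TensorProduct.add_tmul, hp, hq]
      | tmul p q => simp [TensorProduct.smul_tmul]
  have h₂ : ∀ w : A ⊗[k] A, ((TensorProduct.lid k A).toLinearMap ∘ₗ
      (D.pair.flip x).rTensor A).lTensor A ((Coalgebra.comul (R := k)).lTensor A w) =
        (D.ract x).lTensor A w := by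
    intro w
    rw [← LinearMap.comp_apply, ← LinearMap.lTensor_comp]
    rfl
  rw [h₁, h₂] at h
  exact h

theorem HopfDual.comul_lact (x : U) (a : A) : Coalgebra.comul (R := k) (D.lact x a) =
    (D.lact x).lTensor A (Coalgebra.comul (R := k) a) := by
  have h := congrArg (((TensorProduct.rid k A).toLinearMap ∘ₗ
    (D.pair.flip x).lTensor A).lTensor A) (Coalgebra.coassoc_apply (R := k) a)
  have h₁ : ∀ w : A ⊗[k] A, ((TensorProduct.rid k A).toLinearMap ∘ₗ
      (D.pair.flip x).lTensor A).lTensor A (TensorProduct.assoc k A A A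
        ((Coalgebra.comul (R := k)).rTensor A w)) = Coalgebra.comul (R := k)
          (TensorProduct.rid k A ((D.pair.flip x).lTensor A w)) := by
    intro w
    induction w using TensorProduct.induction_on with
    | zero => simp
    | add p q hp hq => simp only [map_add, hp, hq]
    | tmul p q =>
      rw [LinearMap.rTensor_tmul, LinearMap.lTensor_tmul, TensorProduct.rid_tmul, map_smul]
      generalize Coalgebra.comul (R := k) p = w
      induction w using TensorProduct.induction_on with
      | zero => simp
      | add p q hp hq => simp only [map_add, TensorProduct.add_tmul, hp, hq, smul_add]
      | tmul p q => simp
  have h₂ : ∀ w : A ⊗[k] A, ((TensorProduct.rid k A).toLinearMap ∘ₗ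
      (D.pair.flip x).lTensor A).lTensor A ((Coalgebra.comul (R := k)).lTensor A w) =
        (D.lact x).lTensor A w := by
    intro w
    rw [← LinearMap.comp_apply, ← LinearMap.lTensor_comp]
    rfl
  rw [h₁, h₂] at h
  exact h

theorem HopfDual.comul_ract (x : U) (a : A) : Coalgebra.comul (R := k) (D.ract x a) =
    (D.ract x).rTensor A (Coalgebra.comul (R := k) a) := by
  have h := congrArg ((TensorProduct.lid k (A ⊗[k] A)).toLinearMap ∘ₗ
    (D.pair.flip x).rTensor (A ⊗[k] A)) (Coalgebra.coassoc_apply (R := k) a)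
  have h₁ : ∀ w : A ⊗[k] A, ((TensorProduct.lid k (A ⊗[k] A)).toLinearMap ∘ₗ
      (D.pair.flip x).rTensor (A ⊗[k] A)) ((Coalgebra.comul (R := k)).lTensor A w) =
        Coalgebra.comul (R := k) (TensorProduct.lid k A ((D.pair.flip x).rTensor A w)) := by
    intro w
    induction w using TensorProduct.induction_on with
    | zero => simp
    | add p q hp hq => simp only [map_add, hp, hq]
    | tmul p q => simp
  have h₂ : ∀ w : A ⊗[k] A, ((TensorProduct.lid k (A ⊗[k] A)).toLinearMap ∘ₗ
      (D.pair.flip x).rTensor (A ⊗[k] A)) (TensorProduct.assoc k A A A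
        ((Coalgebra.comul (R := k)).rTensor A w)) = (D.ract x).rTensor A w := by
    intro w
    induction w using TensorProduct.induction_on with
    | zero => simp
    | add p q hp hq => simp only [map_add, hp, hq]
    | tmul p q =>
      rw [LinearMap.rTensor_tmul, LinearMap.rTensor_tmul, D.ract_apply]
      generalize Coalgebra.comul (R := k) p = w
      induction w using TensorProduct.induction_on with
      | zero => simp
      | add p q hp hq => simp only [map_add, TensorProduct.add_tmul, hp, hq]
      | tmul p q => simp [TensorProduct.smul_tmul']
  rw [h₁, h₂] at h
  exact h.symm

/-- The action of U_op touches only the first factor of the coproduct and that of U only the second.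
-/
theorem HopfDual.comul_ract_lact (x y : U) (a : A) :
    Coalgebra.comul (R := k) (D.ract y (D.lact x a)) =
      TensorProduct.map (D.ract y) (D.lact x) (Coalgebra.comul (R := k) a) := by
  rw [D.comul_ract, D.comul_lact, ← LinearMap.comp_apply, LinearMap.rTensor_comp_lTensor]

end DualActions

/-! ### The coproduct of the twisted dual -/

namespace TwistedDual

variable {k H U L A : Type*} [Field k] [Ring H] [HopfAlgebra k H] [Ring U] [HopfAlgebra k U]
  [Ring L] [Algebra k L] [Ring A] [HopfAlgebra k A]
  (D : HopfDual k U A) {B : BaseAlgebra k H L} {ι : H →ₐc[k] U} (J : DynamicalTwist B ι)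

theorem elem_induction {p : TwistedDual D J → Prop} (x : TwistedDual D J) (h0 : p 0)
    (hadd : ∀ x y, p x → p y → p (x + y)) (h : ∀ a m l, p (elem D J a m l)) : p x :=
  tripleInduction x h0 hadd h

theorem source_target_commute (l : L) (m : Lᵐᵒᵖ) : Commute (source D J l) (target D J m) := by
  rw [Commute, SemiconjBy, source_apply, target_apply, elem_mul_target, elem_mul_source, mul_one,
    one_mul]

theorem inDual_mul_target_mul_source (a : A) (m l : L) :
    inDual D J a * target D J (MulOpposite.op m) * source D J l = elem D J a m l := by
  change elem D J a 1 1 * elem D J 1 m 1 * elem D J 1 1 l = _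
  rw [elem_mul_target, elem_mul_source, mul_one, one_mul]

/-- `elem` as a linear map. -/
noncomputable def elemMap : A →ₗ[k] L →ₗ[k] L →ₗ[k] TwistedDual D J :=
  LinearMap.mk₂ k (fun a m => (TensorProduct.mk k A (L ⊗[k] L) a ∘ₗ TensorProduct.mk k L L m :
      L →ₗ[k] A ⊗[k] (L ⊗[k] L)))
    (fun a b m => by ext l; exact TensorProduct.add_tmul _ _ _)
    (fun c a m => by ext l; rfl)
    (fun a m m' => by
      ext l
      exact (congrArg (a ⊗ₜ[k] ·) (TensorProduct.add_tmul m m' l)).trans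
        (TensorProduct.tmul_add _ _ _))
    (fun c a m => by ext l; exact TensorProduct.tmul_smul c a (m ⊗ₜ[k] l))

theorem elemMap_apply (a : A) (m l : L) : elemMap D J a m l = elem D J a m l := rfl

/-- `D.core` as a map on `A ⊗ A`. -/
noncomputable def coreR (G' G : U ⊗[k] (U ⊗[k] L)) : A ⊗[k] A →ₗ[k] TwistedDual D J :=
  (D.core L ∘ₗ (TensorProduct.mk k (A ⊗[k] A) _).flip (G' ⊗ₜ[k] G) :
    A ⊗[k] A →ₗ[k] A ⊗[k] (L ⊗[k] L))

theorem coreR_apply (G' G : U ⊗[k] (U ⊗[k] L)) (w : A ⊗[k] A) :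
    coreR D J G' G w = D.core L (w ⊗ₜ[k] (G' ⊗ₜ[k] G)) := rfl

theorem coreR_tmul (a b : A) (g₁ g₂ f₁ f₂ : U) (m l : L) :
    coreR D J (g₁ ⊗ₜ[k] (g₂ ⊗ₜ[k] m)) (f₁ ⊗ₜ[k] (f₂ ⊗ₜ[k] l)) (a ⊗ₜ[k] b) =
      elem D J (D.ract g₁ (D.lact f₁ a) * D.ract g₂ (D.lact f₂ b)) m l :=
  D.core_tmul a b g₁ g₂ f₁ f₂ m l

/-- The first legs of the twists act on 1 through the counit, so normalization removes F and F̄, and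
only δ(l) acts on a. The sum over a finite set is a representative of δ(l). -/
theorem source_mul_elem {l : L} {S : Finset (U × L)}
    (hS : B.coactU ι l = ∑ i ∈ S, i.1 ⊗ₜ[k] i.2) (a : A) (m l' : L) :
    source D J l * elem D J a m l' = ∑ i ∈ S, elem D J (D.lact i.1 a) m (i.2 * l') := by
  have e₁ : ∀ x : L, counitFst k U L (inL₂ k U L x) = (1 : U) ⊗ₜ[k] x := fun x => by
    simp [counitFst, inL₂]
  have e₂ : ∀ x : L, counitFst k U L (B.coact₂ ι x) = B.coactU ι x := fun x => by
    simp [counitFst, BaseAlgebra.coact₂]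
  rw [source_apply, elem_mul_elem, core_one_left, map_one, one_mul, map_mul, map_mul, map_mul,
    J.counitFst_F, map_inv_of_one _ _ J.counitFst_F, one_mul, mul_one, e₁, e₁, e₂, hS,
    Finset.sum_mul, TensorProduct.tmul_sum, TensorProduct.tmul_sum, map_sum]
  refine Finset.sum_congr rfl fun i _ => ?_
  rw [Algebra.TensorProduct.tmul_mul_tmul, mul_one]
  simp [HopfDual.base, D.ract_unit, elem]
  rfl

theorem target_mul_elem {l : L} {S : Finset (U × L)}
    (hS : B.coactU ι l = ∑ i ∈ S, i.1 ⊗ₜ[k] i.2) (a : A) (m l' : L) :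
    target D J (MulOpposite.op l) * elem D J a m l' =
      ∑ i ∈ S, elem D J (D.ract i.1 a) (m * i.2) l' := by
  have e₁ : ∀ x : L, counitFst k U L (inL₂ k U L x) = (1 : U) ⊗ₜ[k] x := fun x => by
    simp [counitFst, inL₂]
  have e₂ : ∀ x : L, counitFst k U L (B.coact₂ ι x) = B.coactU ι x := fun x => by
    simp [counitFst, BaseAlgebra.coact₂]
  rw [target_apply, elem_mul_elem, core_one_left, map_one, mul_one, map_mul, map_mul, map_mul,
    J.counitFst_F, map_inv_of_one _ _ J.counitFst_F, one_mul, mul_one, e₁, e₁, e₂,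
    MulOpposite.unop_op, hS, Finset.mul_sum, TensorProduct.sum_tmul, TensorProduct.tmul_sum,
    map_sum]
  refine Finset.sum_congr rfl fun i _ => ?_
  rw [Algebra.TensorProduct.tmul_mul_tmul, one_mul]
  simp [HopfDual.base, D.lact_unit, elem]
  rfl

/-- `a ⊗ b ↦ (a ⊗ m ⊗ l) ⊗ (b ⊗ m' ⊗ l')`. -/
noncomputable def elemPair (m l m' l' : L) :
    A ⊗[k] A →ₗ[k] TwistedDual D J ⊗[k] TwistedDual D J :=
  TensorProduct.map (((elemMap D J).flip m).flip l) (((elemMap D J).flip m').flip l')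

theorem elemPair_tmul (m l m' l' : L) (a b : A) :
    elemPair D J m l m' l' (a ⊗ₜ[k] b) = elem D J a m l ⊗ₜ[k] elem D J b m' l' := rfl

/-- `a ⊗ m ⊗ l ↦ (a₁ ⊗ m ⊗ 1) ⊗ (a₂ ⊗ 1 ⊗ l)`. -/
noncomputable def copLift : TwistedDual D J →ₗ[k] TwistedDual D J ⊗[k] TwistedDual D J :=
  (TensorProduct.map
      (((TensorProduct.mk k L L).flip 1).lTensor A)
      ((TensorProduct.mk k L L 1).lTensor A) ∘ₗ
    (TensorProduct.tensorTensorTensorComm k A A L L).toLinearMap ∘ₗ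
      (Coalgebra.comul (R := k) (A := A)).rTensor (L ⊗[k] L) :
    A ⊗[k] (L ⊗[k] L) →ₗ[k] (A ⊗[k] (L ⊗[k] L)) ⊗[k] (A ⊗[k] (L ⊗[k] L)))

theorem copLift_elem (a : A) (m l : L) : copLift D J (elem D J a m l) =
    elemPair D J m 1 1 l (Coalgebra.comul (R := k) a) := by
  change TensorProduct.map (((TensorProduct.mk k L L).flip 1).lTensor A)
      ((TensorProduct.mk k L L 1).lTensor A) (TensorProduct.tensorTensorTensorComm k A A L L
    (Coalgebra.comul (R := k) a ⊗ₜ[k] (m ⊗ₜ[k] l))) = _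
  obtain ⟨S, hS⟩ := TensorProduct.exists_finset (Coalgebra.comul (R := k) a)
  rw [hS, TensorProduct.sum_tmul, map_sum, map_sum, map_sum]
  rfl

/-- The coproduct of the twisted dual. -/
noncomputable def cop : TwistedDual D J →ₗ[k] BalancedTensor (source D J) (target D J) :=
  (balancedIdeal (source D J) (target D J)).mkQ.restrictScalars k ∘ₗ copLift D J

theorem cop_apply (x : TwistedDual D J) :
    cop D J x = (balancedIdeal (source D J) (target D J)).mkQ (copLift D J x) := rfl

theorem cop_elem (a : A) (m l : L) : cop D J (elem D J a m l) =
    (balancedIdeal (source D J) (target D J)).mkQ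
      (elemPair D J m 1 1 l (Coalgebra.comul (R := k) a)) := by
  rw [cop_apply, copLift_elem]

theorem mkQ_elemPair (w : A ⊗[k] A) (m l m' l' l'' : L) :
    (balancedIdeal (source D J) (target D J)).mkQ (elemPair D J m (l * l'') m' l' w) =
      (balancedIdeal (source D J) (target D J)).mkQ (elemPair D J m l (l'' * m') l' w) := by
  induction w using TensorProduct.induction_on with
  | zero => simp
  | add p q hp hq => simp only [map_add, hp, hq]
  | tmul a b =>
    rw [elemPair_tmul, elemPair_tmul, ← elem_mul_source, ← elem_mul_target, ← source_apply]
    exact mkQ_balance l'' _ _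

theorem source_mul_elemPair {l : L} {S : Finset (U × L)}
    (hS : B.coactU ι l = ∑ i ∈ S, i.1 ⊗ₜ[k] i.2) (m l₁ m' l' : L) (w : A ⊗[k] A) :
    (source D J l ⊗ₜ[k] (1 : TwistedDual D J)) * elemPair D J m l₁ m' l' w =
      ∑ i ∈ S, elemPair D J m (i.2 * l₁) m' l' ((D.lact i.1).rTensor A w) := by
  induction w using TensorProduct.induction_on with
  | zero => simp
  | add p q hp hq => simp only [map_add, mul_add, Finset.sum_add_distrib, hp, hq]
  | tmul a b =>
    simp only [elemPair_tmul, Algebra.TensorProduct.tmul_mul_tmul, one_mul,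
      source_mul_elem D J hS, TensorProduct.sum_tmul, LinearMap.rTensor_tmul]

theorem target_mul_elemPair {l : L} {S : Finset (U × L)}
    (hS : B.coactU ι l = ∑ i ∈ S, i.1 ⊗ₜ[k] i.2) (m l₁ m' l' : L) (w : A ⊗[k] A) :
    ((1 : TwistedDual D J) ⊗ₜ[k] target D J (MulOpposite.op l)) * elemPair D J m l₁ m' l' w =
      ∑ i ∈ S, elemPair D J m l₁ (m' * i.2) l' ((D.ract i.1).lTensor A w) := by
  induction w using TensorProduct.induction_on with
  | zero => simp
  | add p q hp hq => simp only [map_add, mul_add, Finset.sum_add_distrib, hp, hq]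
  | tmul a b =>
    simp only [elemPair_tmul, Algebra.TensorProduct.tmul_mul_tmul, one_mul,
      target_mul_elem D J hS, TensorProduct.tmul_sum, LinearMap.lTensor_tmul]

/-- s(l) produces l₁ ▶ a₁ and l∞ in the first factor; `lact_rTensor_comul` moves l₁ to a₂ as an
element of U_op and balancing moves l∞, which together give the action of t(l) on the second factor.
-/
theorem takeuchi_cop (l : L) (x : TwistedDual D J) :
    (source D J l ⊗ₜ[k] (1 : TwistedDual D J)) • cop D J x =
      ((1 : TwistedDual D J) ⊗ₜ[k] target D J (MulOpposite.op l)) • cop D J x := by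
  refine elem_induction D J (p := fun x => (source D J l ⊗ₜ[k] (1 : TwistedDual D J)) • cop D J x =
      ((1 : TwistedDual D J) ⊗ₜ[k] target D J (MulOpposite.op l)) • cop D J x) x (by simp)
    (fun _ _ h h' => by simp only [map_add, smul_add, h, h']) fun a m l' => ?_
  obtain ⟨S, hS⟩ := TensorProduct.exists_finset (B.coactU ι l)
  rw [cop_elem, ← mkQ_mul, ← mkQ_mul, source_mul_elemPair D J hS, target_mul_elemPair D J hS,
    map_sum, map_sum]
  refine Finset.sum_congr rfl fun i _ => ?_
  rw [mul_one, ← one_mul i.2, mkQ_elemPair, D.lact_rTensor_comul, one_mul, one_mul, mul_one]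

/-- `(a ⊗ b) ⊗ (c ⊗ d) ↦ core (a ⊗ b) ⊗ core (c ⊗ d)`. -/
noncomputable def corePair (G' X Y G : U ⊗[k] (U ⊗[k] L)) :
    A ⊗[k] A →ₗ[k] A ⊗[k] A →ₗ[k] TwistedDual D J ⊗[k] TwistedDual D J :=
  (TensorProduct.mk k (A ⊗[k] A) (A ⊗[k] A)).compr₂
    (TensorProduct.map (coreR D J G' X) (coreR D J Y G) ∘ₗ
      (TensorProduct.tensorTensorTensorComm k A A A A).toLinearMap)

theorem corePair_tmul (G' X Y G : U ⊗[k] (U ⊗[k] L)) (a b c d : A) :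
    corePair D J G' X Y G (a ⊗ₜ[k] b) (c ⊗ₜ[k] d) =
      coreR D J G' X (a ⊗ₜ[k] c) ⊗ₜ[k] coreR D J Y G (b ⊗ₜ[k] d) := rfl

theorem coreR_add_left (G' G'' G : U ⊗[k] (U ⊗[k] L)) :
    coreR D J (G' + G'') G = coreR D J G' G + coreR D J G'' G := by
  refine LinearMap.ext fun w => ?_
  rw [LinearMap.add_apply, coreR_apply, TensorProduct.add_tmul, TensorProduct.tmul_add, map_add]
  rfl

theorem coreR_add_right (G' G G'' : U ⊗[k] (U ⊗[k] L)) :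
    coreR D J G' (G + G'') = coreR D J G' G + coreR D J G' G'' := by
  refine LinearMap.ext fun w => ?_
  rw [LinearMap.add_apply, coreR_apply, TensorProduct.tmul_add, TensorProduct.tmul_add, map_add]
  rfl

theorem coreR_zero_left (G : U ⊗[k] (U ⊗[k] L)) : coreR D J 0 G = 0 := by
  have h := coreR_add_left D J 0 0 G
  rwa [add_zero, left_eq_add] at h

theorem coreR_zero_right (G : U ⊗[k] (U ⊗[k] L)) : coreR D J G 0 = 0 := by
  have h := coreR_add_right D J G 0 0
  rwa [add_zero, left_eq_add] at h

theorem corePair_zero_left (X Y G : U ⊗[k] (U ⊗[k] L)) : corePair D J 0 X Y G = 0 := by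
  rw [corePair, coreR_zero_left, TensorProduct.map_zero_left]
  rfl

theorem corePair_add_left (G' G'' X Y G : U ⊗[k] (U ⊗[k] L)) :
    corePair D J (G' + G'') X Y G = corePair D J G' X Y G + corePair D J G'' X Y G := by
  rw [corePair, coreR_add_left, TensorProduct.map_add_left]
  rfl

theorem corePair_zero_right (G' X Y : U ⊗[k] (U ⊗[k] L)) : corePair D J G' X Y 0 = 0 := by
  rw [corePair, coreR_zero_right, TensorProduct.map_zero_right]
  rfl

theorem corePair_add_right (G' X Y G G'' : U ⊗[k] (U ⊗[k] L)) :
    corePair D J G' X Y (G + G'') = corePair D J G' X Y G + corePair D J G' X Y G'' := by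
  rw [corePair, coreR_add_right, TensorProduct.map_add_right]
  rfl

theorem corePair_zero₂ (G' Y G : U ⊗[k] (U ⊗[k] L)) : corePair D J G' 0 Y G = 0 := by
  rw [corePair, coreR_zero_right, TensorProduct.map_zero_left]
  rfl

theorem corePair_add₂ (G' X X' Y G : U ⊗[k] (U ⊗[k] L)) :
    corePair D J G' (X + X') Y G = corePair D J G' X Y G + corePair D J G' X' Y G := by
  rw [corePair, coreR_add_right, TensorProduct.map_add_left]
  rfl

theorem corePair_zero₃ (G' X G : U ⊗[k] (U ⊗[k] L)) : corePair D J G' X 0 G = 0 := by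
  rw [corePair, coreR_zero_left, TensorProduct.map_zero_right]
  rfl

theorem corePair_add₃ (G' X Y Y' G : U ⊗[k] (U ⊗[k] L)) :
    corePair D J G' X (Y + Y') G = corePair D J G' X Y G + corePair D J G' X Y' G := by
  rw [corePair, coreR_add_left, TensorProduct.map_add_right]
  rfl

theorem corePair_elem (g₁ g₂ x₁ x₂ y₁ y₂ f₁ f₂ : U) (m x y l : L) (w v : A ⊗[k] A) :
    corePair D J (g₁ ⊗ₜ[k] (g₂ ⊗ₜ[k] m)) (x₁ ⊗ₜ[k] (x₂ ⊗ₜ[k] x)) (y₁ ⊗ₜ[k] (y₂ ⊗ₜ[k] y))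
        (f₁ ⊗ₜ[k] (f₂ ⊗ₜ[k] l)) w v =
      elemPair D J m x y l
        (TensorProduct.map (D.ract g₁ ∘ₗ D.lact x₁) (D.ract y₁ ∘ₗ D.lact f₁) w *
          TensorProduct.map (D.ract g₂ ∘ₗ D.lact x₂) (D.ract y₂ ∘ₗ D.lact f₂) v) := by
  induction w using TensorProduct.induction_on with
  | zero => simp
  | add p q hp hq => simp only [map_add, LinearMap.add_apply, add_mul, hp, hq]
  | tmul a b =>
  induction v using TensorProduct.induction_on with
  | zero => simp
  | add p q hp hq => simp only [map_add, mul_add, hp, hq]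
  | tmul c d =>
    rw [corePair_tmul, coreR_tmul, coreR_tmul, TensorProduct.map_tmul, TensorProduct.map_tmul,
      Algebra.TensorProduct.tmul_mul_tmul, elemPair_tmul]
    rfl

/-- By `comul_ract_lact` the twist in U_op acts on the first tensor factor only and the twist in U
on the second only; the two middle slots of `corePair` are trivial. They are filled by F and F̄ in
the product of two coproducts. -/
theorem copLift_coreR (G' G : U ⊗[k] (U ⊗[k] L)) (a b : A) :
    copLift D J (coreR D J G' G (a ⊗ₜ[k] b)) =
      corePair D J G' 1 1 G (Coalgebra.comul (R := k) a) (Coalgebra.comul (R := k) b) := by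
  refine tripleTensorInduction (p := fun G' => copLift D J (coreR D J G' G (a ⊗ₜ[k] b)) =
      corePair D J G' 1 1 G (Coalgebra.comul (R := k) a) (Coalgebra.comul (R := k) b)) G'
    (by simp [coreR_zero_left, corePair_zero_left])
    (fun _ _ h h' => by simp only [coreR_add_left, corePair_add_left, LinearMap.add_apply, map_add,
      h, h']) fun g₁ g₂ m => ?_
  refine tripleTensorInduction (p := fun G => copLift D J (coreR D J _ G (a ⊗ₜ[k] b)) =
      corePair D J _ 1 1 G (Coalgebra.comul (R := k) a) (Coalgebra.comul (R := k) b)) G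
    (by simp [coreR_zero_right, corePair_zero_right])
    (fun _ _ h h' => by simp only [coreR_add_right, corePair_add_right, LinearMap.add_apply,
      map_add, h, h']) fun f₁ f₂ l => ?_
  have hl : D.lact 1 = LinearMap.id := LinearMap.ext D.lact_unit
  have hr : D.ract 1 = LinearMap.id := LinearMap.ext D.ract_unit
  have h1 : (1 : U ⊗[k] (U ⊗[k] L)) = (1 : U) ⊗ₜ[k] ((1 : U) ⊗ₜ[k] (1 : L)) := rfl
  rw [coreR_tmul, copLift_elem, h1, corePair_elem, Bialgebra.comul_mul, D.comul_ract_lact,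
    D.comul_ract_lact]
  simp only [hl, hr, LinearMap.comp_id, LinearMap.id_comp]

theorem map_lact_comul (f g : A →ₗ[k] A) (x : U) (a : A) :
    TensorProduct.map (f ∘ₗ D.lact x) g (Coalgebra.comul (R := k) a) =
      TensorProduct.map f (g ∘ₗ D.ract x) (Coalgebra.comul (R := k) a) := by
  rw [← LinearMap.map_comp_rTensor, ← LinearMap.map_comp_lTensor, LinearMap.comp_apply,
    LinearMap.comp_apply, D.lact_rTensor_comul]

/-- The legs of X in U cross the coproducts of a and b and the leg in L crosses ⊗_L. In the second
factor they meet the legs of Y, and since U_op composes in reverse they form the product XY of U ⊗ U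
⊗ L. -/
theorem mkQ_corePair (G' X Y G : U ⊗[k] (U ⊗[k] L)) (a b : A) :
    (balancedIdeal (source D J) (target D J)).mkQ (corePair D J G' X Y G
        (Coalgebra.comul (R := k) a) (Coalgebra.comul (R := k) b)) =
      (balancedIdeal (source D J) (target D J)).mkQ (corePair D J G' 1 (X * Y) G
        (Coalgebra.comul (R := k) a) (Coalgebra.comul (R := k) b)) := by
  generalize hQ : (balancedIdeal (source D J) (target D J)).mkQ = Q
  generalize hda : Coalgebra.comul (R := k) a = da
  generalize hdb : Coalgebra.comul (R := k) b = db
  refine tripleTensorInduction (p := fun G' => Q (corePair D J G' X Y G da db) =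
      Q (corePair D J G' 1 (X * Y) G da db)) G'
    (by simp only [corePair_zero_left, LinearMap.zero_apply])
    (fun _ _ h h' => by simp only [corePair_add_left, LinearMap.add_apply, map_add, h, h'])
    fun g₁ g₂ m => ?_
  generalize hG' : g₁ ⊗ₜ[k] (g₂ ⊗ₜ[k] m) = G₁
  refine tripleTensorInduction (p := fun G => Q (corePair D J G₁ X Y G da db) =
      Q (corePair D J G₁ 1 (X * Y) G da db)) G
    (by simp only [corePair_zero_right, LinearMap.zero_apply])
    (fun _ _ h h' => by simp only [corePair_add_right, LinearMap.add_apply, map_add, h, h'])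
    fun f₁ f₂ l => ?_
  generalize hG : f₁ ⊗ₜ[k] (f₂ ⊗ₜ[k] l) = G₂
  refine tripleTensorInduction (p := fun X => Q (corePair D J G₁ X Y G₂ da db) =
      Q (corePair D J G₁ 1 (X * Y) G₂ da db)) X
    (by simp only [zero_mul, corePair_zero₂, corePair_zero₃, LinearMap.zero_apply])
    (fun _ _ h h' => by simp only [add_mul, corePair_add₂, corePair_add₃, LinearMap.add_apply,
      map_add, h, h']) fun x₁ x₂ x => ?_
  generalize hX : x₁ ⊗ₜ[k] (x₂ ⊗ₜ[k] x) = X₁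
  refine tripleTensorInduction (p := fun Y => Q (corePair D J G₁ X₁ Y G₂ da db) =
      Q (corePair D J G₁ 1 (X₁ * Y) G₂ da db)) Y
    (by simp only [mul_zero, corePair_zero₃, LinearMap.zero_apply])
    (fun _ _ h h' => by simp only [mul_add, corePair_add₃, LinearMap.add_apply,
      map_add, h, h']) fun y₁ y₂ y => ?_
  have hl : D.lact 1 = LinearMap.id := LinearMap.ext D.lact_unit
  have h1 : (1 : U ⊗[k] (U ⊗[k] L)) = (1 : U) ⊗ₜ[k] ((1 : U) ⊗ₜ[k] (1 : L)) := rfl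
  have e : ∀ x y f : U, (D.ract y ∘ₗ D.lact f) ∘ₗ D.ract x = D.ract (x * y) ∘ₗ D.lact f := by
    intro x y f
    refine LinearMap.ext fun a => ?_
    simp only [LinearMap.comp_apply, D.lact_ract, D.ract_ract]
  rw [← hQ, ← hX, ← hG, ← hG', h1, Algebra.TensorProduct.tmul_mul_tmul,
    Algebra.TensorProduct.tmul_mul_tmul, corePair_elem, corePair_elem, ← one_mul x, mkQ_elemPair,
    one_mul, ← hda, ← hdb, map_lact_comul, map_lact_comul, e, e, hl, LinearMap.comp_id,
    LinearMap.comp_id]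

end TwistedDual

namespace TwistedDual

variable {k H U L A : Type*} [Field k] [Ring H] [HopfAlgebra k H] [Ring U] [HopfAlgebra k U]
  [Ring L] [Algebra k L] [Ring A] [HopfAlgebra k A]
  (D : HopfDual k U A) {B : BaseAlgebra k H L} {ι : H →ₐc[k] U} (J : DynamicalTwist B ι)

theorem elemPair_mul_elemPair (m l m' l' : L) (w v : A ⊗[k] A) :
    elemPair D J m 1 1 l w * elemPair D J m' 1 1 l' v =
      corePair D J (inL₂ k U L m' * (B.coact₂ ι m * (↑J.F⁻¹ : U ⊗[k] (U ⊗[k] L)))) J.F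
        (↑J.F⁻¹ : U ⊗[k] (U ⊗[k] L)) (J.F * B.coact₂ ι l * inL₂ k U L l') w v := by
  induction w using TensorProduct.induction_on with
  | zero => simp
  | add p q hp hq => simp only [map_add, LinearMap.add_apply, add_mul, hp, hq]
  | tmul a b =>
  induction v using TensorProduct.induction_on with
  | zero => simp
  | add p q hp hq => simp only [map_add, mul_add, hp, hq]
  | tmul c d =>
    rw [corePair_tmul, elemPair_tmul, elemPair_tmul, Algebra.TensorProduct.tmul_mul_tmul,
      elem_mul_elem, elem_mul_elem, map_one, map_one, mul_one, mul_one, one_mul, one_mul]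
    rfl

/-- The product of two coproducts has F in the first factor and F̄ in the second as middle slots. By
`mkQ_corePair` they merge into FF̄ = 1, which leaves the coproduct of the product. -/
theorem cop_mul (x y : TwistedDual D J) : cop D J (x * y) = copLift D J x • cop D J y := by
  refine elem_induction D J (p := fun x => cop D J (x * y) = copLift D J x • cop D J y) x
    (by simp only [zero_mul, map_zero, zero_smul])
    (fun _ _ h h' => by simp only [add_mul, map_add, add_smul, h, h']) fun a m l => ?_
  refine elem_induction D J (p := fun y => cop D J (elem D J a m l * y) =
      copLift D J (elem D J a m l) • cop D J y) y
    (by simp only [mul_zero, map_zero, smul_zero])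
    (fun _ _ h h' => by simp only [mul_add, map_add, smul_add, h, h']) fun b m' l' => ?_
  rw [cop_apply, cop_apply, ← mkQ_mul, elem_mul_elem, ← coreR_apply D J, copLift_coreR,
    copLift_elem, copLift_elem, elemPair_mul_elemPair, mkQ_corePair D J _ 1 1,
    mkQ_corePair D J _ (J.F : U ⊗[k] (U ⊗[k] L)), Units.mul_inv, mul_one]

theorem cop_one : cop D J 1 = (balancedIdeal (source D J) (target D J)).mkQ 1 := by
  rw [one_eq, cop_elem, Bialgebra.comul_one]
  rfl

/-- The coproduct as a homomorphism to the Takeuchi algebra. -/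
noncomputable def copEnd : TwistedDual D J →ₐ[k]
    (Module.End (TwistedDual D J ⊗[k] TwistedDual D J)
      (BalancedTensor (source D J) (target D J)))ᵐᵒᵖ :=
  takeuchiHom (cop D J) (takeuchi_cop D J) (cop_one D J)
    fun x y => ⟨copLift D J x, rfl, cop_mul D J x y⟩

theorem copEnd_apply (x : TwistedDual D J) :
    (copEnd D J x).unop ((balancedIdeal (source D J) (target D J)).mkQ 1) = cop D J x :=
  takeuchiHom_apply _ _ _ _ _

end TwistedDual

/-! ### The anchor and the bialgebroid structure of the twisted dual -/

section Anchor

variable {k H U L A : Type*} [Field k] [Ring H] [HopfAlgebra k H] [Ring U] [HopfAlgebra k U]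
  [Ring L] [Algebra k L] [Ring A] [HopfAlgebra k A]
  (D : HopfDual k U A) (B : BaseAlgebra k H L) (ι : H →ₐc[k] U)

/-- The action `x ↦ ⟨a, x₁⟩ x∞` of the dual of `U` on `L`. -/
noncomputable def HopfDual.evalU : A →ₗ[k] Module.End k L where
  toFun a := contract (D.pair a) ∘ₗ (B.coactU ι).toLinearMap
  map_add' a b := by
    rw [map_add, contract, LinearMap.rTensor_add, LinearMap.comp_add, LinearMap.add_comp]
    rfl
  map_smul' c a := by
    rw [map_smul, contract, LinearMap.rTensor_smul, LinearMap.comp_smul, LinearMap.smul_comp]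
    rfl

theorem HopfDual.evalU_apply (a : A) (x : L) :
    D.evalU B ι a x = contract (D.pair a) (B.coactU ι x) := rfl

theorem HopfDual.evalU_one (x : L) : D.evalU B ι 1 x = x := by
  have h : D.pair 1 = Coalgebra.counit (R := k) := LinearMap.ext D.pair_one
  rw [D.evalU_apply, h]
  exact coactU_counit B ι x

theorem HopfDual.evalU_apply_one (a : A) : D.evalU B ι a 1 = Coalgebra.counit (R := k) a • 1 := by
  rw [D.evalU_apply, map_one, Algebra.TensorProduct.one_def, contract_tmul, D.pair_counit]

/-- `x ⊗ y ⊗ l ↦ ⟨a, x⟩ ⟨b, y⟩ l`. -/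
noncomputable def HopfDual.contract₂ (L : Type*) [Ring L] [Algebra k L] (a b : A) :
    U ⊗[k] (U ⊗[k] L) →ₗ[k] L :=
  contract (D.pair b) ∘ₗ contract (L := U ⊗[k] L) (D.pair a)

theorem HopfDual.contract₂_tmul (a b : A) (x y : U) (l : L) :
    D.contract₂ L a b (x ⊗ₜ[k] (y ⊗ₜ[k] l)) = D.pair a x • D.pair b y • l := by
  rw [HopfDual.contract₂, LinearMap.comp_apply, contract_tmul, map_smul, contract_tmul]

theorem HopfDual.contract_coact₂_mul (a : A) (m l : L) (w : U ⊗[k] (U ⊗[k] L)) :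
    contract (L := U ⊗[k] L) (D.pair a) (B.coact₂ ι m * w * B.coact₂ ι l) =
      B.coactU ι m * contract (L := U ⊗[k] L) (D.pair a) w * B.coactU ι l := by
  have e : ∀ x : L, B.coact₂ ι x = (1 : U) ⊗ₜ[k] B.coactU ι x := fun _ => rfl
  induction w using TensorProduct.induction_on with
  | zero => simp
  | add p q hp hq => simp only [mul_add, add_mul, map_add, hp, hq]
  | tmul p q =>
    rw [e, e, Algebra.TensorProduct.tmul_mul_tmul, Algebra.TensorProduct.tmul_mul_tmul,
      contract_tmul, contract_tmul, one_mul, mul_one, mul_smul_comm, smul_mul_assoc]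

theorem HopfDual.contract₂_inL₂_mul (a b : A) (m l : L) (w : U ⊗[k] (U ⊗[k] L)) :
    D.contract₂ L a b (inL₂ k U L m * w * inL₂ k U L l) = m * (D.contract₂ L a b w * l) := by
  have e : ∀ x : L, inL₂ k U L x = (1 : U) ⊗ₜ[k] ((1 : U) ⊗ₜ[k] x) := fun _ => rfl
  refine tripleTensorInduction (p := fun w =>
    D.contract₂ L a b (inL₂ k U L m * w * inL₂ k U L l) = m * (D.contract₂ L a b w * l)) w
    (by simp) (fun _ _ h h' => by simp only [mul_add, add_mul, map_add, h, h']) fun x y z => ?_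
  rw [e, e]
  simp only [Algebra.TensorProduct.tmul_mul_tmul, one_mul, mul_one, D.contract₂_tmul,
    mul_smul_comm, smul_mul_assoc, mul_assoc]

/-- Coassociativity: pairing away the first leg of δ₂(z) leaves the coaction of ⟨a, z₁⟩z∞. -/
theorem HopfDual.contract_delta₂ (a : A) (z : L) :
    contract (L := U ⊗[k] L) (D.pair a) (B.delta₂ ι z) = B.coactU ι (D.evalU B ι a z) := by
  rw [delta₂_eq, D.evalU_apply]
  induction B.coactU ι z using TensorProduct.induction_on with
  | zero => simp
  | add p q hp hq => simp only [map_add, hp, hq]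
  | tmul p q => rw [LinearMap.lTensor_tmul, contract_tmul, contract_tmul, map_smul]; rfl

namespace TwistedDual

variable {B ι} (J : DynamicalTwist B ι)

/-- The anchor `x ↦ m ⟨a, x₁⟩ x∞ l` of `a ⊗ m ⊗ l`. -/
noncomputable def anchorMap : TwistedDual D J →ₗ[k] Module.End k L :=
  (TensorProduct.lift ((LinearMap.mul k (Module.End k L)).flip.compl₁₂ (D.evalU B ι)
    (TensorProduct.lift ((LinearMap.mul k (Module.End k L)).compl₁₂ (LinearMap.mul k L)
      (LinearMap.mul k L).flip))) : A ⊗[k] (L ⊗[k] L) →ₗ[k] Module.End k L)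

theorem anchorMap_elem (a : A) (m l x : L) :
    anchorMap D J (elem D J a m l) x = m * (D.evalU B ι a x * l) := rfl

/-- The product of A pairs with z₁ through Δ, which turns δ(z) into δ₂(z); the actions of U_op and U
become left and right multiplications of its legs. -/
theorem anchorMap_coreR (G' G : U ⊗[k] (U ⊗[k] L)) (a b : A) (z : L) :
    anchorMap D J (coreR D J G' G (a ⊗ₜ[k] b)) z =
      D.contract₂ L a b (G' * B.delta₂ ι z * G) := by
  refine tripleTensorInduction (p := fun G' => anchorMap D J (coreR D J G' G (a ⊗ₜ[k] b)) z =
      D.contract₂ L a b (G' * B.delta₂ ι z * G)) G'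
    (by simp only [coreR_zero_left, zero_mul, map_zero, LinearMap.zero_apply])
    (fun _ _ h h' => by simp only [coreR_add_left, add_mul, map_add, LinearMap.add_apply, h, h'])
    fun g₁ g₂ m => ?_
  generalize hG' : g₁ ⊗ₜ[k] (g₂ ⊗ₜ[k] m) = G₁
  refine tripleTensorInduction (p := fun G => anchorMap D J (coreR D J G₁ G (a ⊗ₜ[k] b)) z =
      D.contract₂ L a b (G₁ * B.delta₂ ι z * G)) G
    (by simp only [coreR_zero_right, mul_zero, map_zero, LinearMap.zero_apply])
    (fun _ _ h h' => by simp only [coreR_add_right, mul_add, map_add, LinearMap.add_apply, h, h'])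
    fun f₁ f₂ l => ?_
  rw [← hG', coreR_tmul, anchorMap_elem, D.evalU_apply, BaseAlgebra.delta₂]
  generalize B.coactU ι z = w
  induction w using TensorProduct.induction_on with
  | zero => simp
  | add p q hp hq => simp only [map_add, mul_add, add_mul, hp, hq]
  | tmul u w =>
  rw [contract_tmul, D.pair_mul, LinearMap.rTensor_tmul]
  generalize Coalgebra.comul (R := k) u = v
  induction v using TensorProduct.induction_on with
  | zero => simp
  | add p q hp hq =>
    simp only [map_add, TensorProduct.add_tmul, mul_add, add_mul, add_smul, hp, hq]
  | tmul p q =>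
    rw [TensorProduct.assoc_tmul, Algebra.TensorProduct.tmul_mul_tmul,
      Algebra.TensorProduct.tmul_mul_tmul, Algebra.TensorProduct.tmul_mul_tmul,
      Algebra.TensorProduct.tmul_mul_tmul, D.contract₂_tmul, TensorProduct.map_tmul,
      LinearMap.mul'_apply, D.pair_ract, D.pair_ract, D.pair_lact, D.pair_lact, smul_smul,
      smul_mul_assoc, mul_smul_comm, mul_assoc m]

/-- As F̄ commutes with δ₂(z), the twist disappears from F̄δ₂(z)F. What remains is the
multiplicativity of δ on m⟨a, z₁⟩z∞l. -/
theorem anchorMap_mul (x y : TwistedDual D J) (z : L) :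
    anchorMap D J (x * y) z = anchorMap D J y (anchorMap D J x z) := by
  refine elem_induction D J (p := fun x => anchorMap D J (x * y) z =
      anchorMap D J y (anchorMap D J x z)) x
    (by simp only [zero_mul, map_zero, LinearMap.zero_apply])
    (fun _ _ h h' => by simp only [add_mul, map_add, LinearMap.add_apply, h, h']) fun a m l => ?_
  refine elem_induction D J (p := fun y => anchorMap D J (elem D J a m l * y) z =
      anchorMap D J y (anchorMap D J (elem D J a m l) z)) y
    (by simp only [mul_zero, map_zero, LinearMap.zero_apply])
    (fun _ _ h h' => by simp only [mul_add, map_add, LinearMap.add_apply, h, h']) fun b m' l' => ?_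
  have e : inL₂ k U L m' * (B.coact₂ ι m * (↑J.F⁻¹ : U ⊗[k] (U ⊗[k] L))) * B.delta₂ ι z *
      (J.F * B.coact₂ ι l * inL₂ k U L l') =
        inL₂ k U L m' * (B.coact₂ ι m * B.delta₂ ι z * B.coact₂ ι l) * inL₂ k U L l' := by
    have h := delta₂_comm_inv B ι J z
    calc _ = inL₂ k U L m' * (B.coact₂ ι m * ((↑J.F⁻¹ : U ⊗[k] (U ⊗[k] L)) * B.delta₂ ι z) *
          J.F * B.coact₂ ι l) * inL₂ k U L l' := by simp only [mul_assoc]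
      _ = _ := by
        rw [h, ← mul_assoc (B.coact₂ ι m), mul_assoc (_ * _) (_ : U ⊗[k] (U ⊗[k] L)) ↑J.F,
          Units.inv_mul, mul_one]
  rw [elem_mul_elem, ← coreR_apply D J, anchorMap_coreR, e, D.contract₂_inL₂_mul, anchorMap_elem,
    anchorMap_elem, D.evalU_apply B ι b, map_mul (B.coactU ι), map_mul (B.coactU ι), ← D.contract_delta₂,
    ← mul_assoc (B.coactU ι m), ← D.contract_coact₂_mul]
  rfl

/-- The anchor as an algebra homomorphism. -/
noncomputable def anchorEnd : TwistedDual D J →ₐ[k] (Module.End k L)ᵐᵒᵖ :=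
  AlgHom.ofLinearMap ((MulOpposite.opLinearEquiv k).toLinearMap ∘ₗ anchorMap D J)
    (anchor_ext fun x => by
      change anchorMap D J (elem D J 1 1 1) x = x
      rw [anchorMap_elem, D.evalU_one, mul_one, one_mul])
    (fun x y => anchor_ext fun z => anchorMap_mul D J x y z)

theorem anchorEnd_elem (a : A) (m l x : L) :
    (anchorEnd D J (elem D J a m l)).unop x = m * (D.evalU B ι a x * l) := rfl

/-- The coproduct and the anchor of the twisted dual. -/
noncomputable def pre : PreBialgebroid (source D J) (target D J) where
  commute := source_target_commute D J
  copEnd := copEnd D J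
  anchorEnd := anchorEnd D J
  copEnd_source l := by
    rw [copEnd_apply, source_apply, cop_elem, Bialgebra.comul_one]
    rfl
  copEnd_target l := by
    rw [copEnd_apply, target_apply, cop_elem, Bialgebra.comul_one]
    rfl
  anchorEnd_source l x := by
    rw [source_apply, anchorEnd_elem, D.evalU_one, one_mul]
  anchorEnd_target l x := by
    rw [target_apply, anchorEnd_elem, D.evalU_one, mul_one, MulOpposite.unop_op]

theorem pre_comul_inDual (a : A) : (pre D J).comul (inDual D J a) =
    (balancedIdeal (source D J) (target D J)).mkQ
      (TensorProduct.map (inDual D J) (inDual D J) (Coalgebra.comul (R := k) a)) :=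
  (copEnd_apply D J _).trans (cop_elem D J a 1 1)

theorem pre_counit_target_mul (l : L) (a : A) :
    (pre D J).counit (target D J (MulOpposite.op l) * inDual D J a) = D.evalU B ι a l := by
  rw [PreBialgebroid.counit_target_mul]
  exact (anchorEnd_elem D J a 1 1 l).trans (by rw [mul_one, one_mul])

theorem pre_counit_source_mul (l : L) (a : A) :
    (pre D J).counit (source D J l * inDual D J a) = D.evalU B ι a l := by
  rw [PreBialgebroid.counit_source_mul]
  exact (anchorEnd_elem D J a 1 1 l).trans (by rw [mul_one, one_mul])

theorem inDual_mul_target (a : A) (l : L) :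
    inDual D J a * target D J (MulOpposite.op l) = elem D J a l 1 :=
  (elem_mul_target D J a 1 1 l).trans (by rw [mul_one])

theorem inDual_mul_source (a : A) (l : L) :
    inDual D J a * source D J l = elem D J a 1 l :=
  (elem_mul_source D J a 1 1 l).trans (by rw [one_mul])

/-- Since ε(t(l)a₁) = ⟨a₁, l₁⟩l∞, the contraction equals ⟨a₁, l₁⟩a₂ with l∞ in L_op, which is the
exchange rule of t(l) with a. -/
theorem contractLeft_inDual (l : L) (a : A) :
    (pre D J).contractLeft ((target D J (MulOpposite.op l) ⊗ₜ[k] (1 : TwistedDual D J)) *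
      TensorProduct.map (inDual D J) (inDual D J) (Coalgebra.comul (R := k) a)) =
        target D J (MulOpposite.op l) * inDual D J a := by
  obtain ⟨S, hS⟩ := TensorProduct.exists_finset (B.coactU ι l)
  have h : ∀ w : A ⊗[k] A, (pre D J).contractLeft
      ((target D J (MulOpposite.op l) ⊗ₜ[k] (1 : TwistedDual D J)) *
        TensorProduct.map (inDual D J) (inDual D J) w) =
      ∑ i ∈ S, elem D J (TensorProduct.lid k A ((D.pair.flip i.1).rTensor A w)) i.2 1 := by
    intro w
    simp only [← elemMap_apply]
    induction w using TensorProduct.induction_on with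
    | zero => simp
    | add p q hp hq =>
      simp only [map_add, mul_add, hp, hq, LinearMap.add_apply, Finset.sum_add_distrib]
    | tmul a b =>
      rw [TensorProduct.map_tmul, Algebra.TensorProduct.tmul_mul_tmul, one_mul,
        PreBialgebroid.contractLeft_tmul, pre_counit_target_mul, inDual_mul_target,
        D.evalU_apply, hS, map_sum, ← elemMap_apply, map_sum, LinearMap.sum_apply]
      refine Finset.sum_congr rfl fun i _ => ?_
      rw [contract_tmul, LinearMap.rTensor_tmul, TensorProduct.lid_tmul]
      simp only [map_smul, LinearMap.smul_apply]
      rfl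
  rw [h]
  exact ((target_mul_elem D J hS a 1 1).trans (Finset.sum_congr rfl fun i _ => by
    rw [one_mul]; rfl)).symm

theorem contractRight_inDual (l : L) (a : A) :
    (pre D J).contractRight (((1 : TwistedDual D J) ⊗ₜ[k] source D J l) *
      TensorProduct.map (inDual D J) (inDual D J) (Coalgebra.comul (R := k) a)) =
        source D J l * inDual D J a := by
  obtain ⟨S, hS⟩ := TensorProduct.exists_finset (B.coactU ι l)
  have h : ∀ w : A ⊗[k] A, (pre D J).contractRight
      (((1 : TwistedDual D J) ⊗ₜ[k] source D J l) *
        TensorProduct.map (inDual D J) (inDual D J) w) =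
      ∑ i ∈ S, elem D J (TensorProduct.rid k A ((D.pair.flip i.1).lTensor A w)) 1 i.2 := by
    intro w
    simp only [← elemMap_apply]
    induction w using TensorProduct.induction_on with
    | zero => simp
    | add p q hp hq =>
      simp only [map_add, mul_add, hp, hq, LinearMap.add_apply, Finset.sum_add_distrib]
    | tmul a b =>
      rw [TensorProduct.map_tmul, Algebra.TensorProduct.tmul_mul_tmul, one_mul,
        PreBialgebroid.contractRight_tmul, pre_counit_source_mul, inDual_mul_source,
        D.evalU_apply, hS, map_sum, ← elemMap_apply, map_sum]
      refine Finset.sum_congr rfl fun i _ => ?_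
      rw [contract_tmul, LinearMap.lTensor_tmul, TensorProduct.rid_tmul]
      simp only [map_smul, LinearMap.smul_apply]
      rfl
  rw [h]
  exact ((source_mul_elem D J hS a 1 1).trans (Finset.sum_congr rfl fun i _ => by
    rw [mul_one]; rfl)).symm

theorem coassoc_inDual (E : TwistedDual D J →ₗ[k] TwistedDual D J ⊗[k] TwistedDual D J)
    (hE : ∀ b, (balancedIdeal (source D J) (target D J)).mkQ (E b) = (pre D J).comul b) (a : A) :
    (balancedIdeal₃ (source D J) (target D J)).mkQ (TensorProduct.assoc k _ _ _
        (E.rTensor _ (TensorProduct.map (inDual D J) (inDual D J) (Coalgebra.comul (R := k) a)))) =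
      (balancedIdeal₃ (source D J) (target D J)).mkQ
        (E.lTensor _ (TensorProduct.map (inDual D J) (inDual D J) (Coalgebra.comul (R := k) a))) := by
  have e : ∀ a, (balancedIdeal (source D J) (target D J)).mkQ (E (inDual D J a)) =
      (balancedIdeal (source D J) (target D J)).mkQ
        (TensorProduct.map (inDual D J) (inDual D J) (Coalgebra.comul (R := k) a)) := fun a => by
    rw [hE, pre_comul_inDual]
  have h₁ : ∀ w : A ⊗[k] A, (balancedIdeal₃ (source D J) (target D J)).mkQ
      (TensorProduct.assoc k _ _ _ (E.rTensor _ (TensorProduct.map (inDual D J) (inDual D J) w))) =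
      (balancedIdeal₃ (source D J) (target D J)).mkQ (TensorProduct.map (inDual D J)
        (TensorProduct.map (inDual D J) (inDual D J))
        (TensorProduct.assoc k A A A ((Coalgebra.comul (R := k)).rTensor A w))) := by
    intro w
    induction w using TensorProduct.induction_on with
    | zero => simp
    | add p q hp hq => simp only [map_add, hp, hq]
    | tmul a b =>
      rw [TensorProduct.map_tmul, LinearMap.rTensor_tmul, mkQ₃_assoc_of_mkQ_eq _ (e a),
        LinearMap.rTensor_tmul]
      congr 1
      generalize Coalgebra.comul (R := k) a = v
      induction v using TensorProduct.induction_on with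
      | zero => simp
      | add p q hp hq => simp only [map_add, TensorProduct.add_tmul, hp, hq]
      | tmul a b => rfl
  have h₂ : ∀ w : A ⊗[k] A, (balancedIdeal₃ (source D J) (target D J)).mkQ
      (E.lTensor _ (TensorProduct.map (inDual D J) (inDual D J) w)) =
      (balancedIdeal₃ (source D J) (target D J)).mkQ (TensorProduct.map (inDual D J)
        (TensorProduct.map (inDual D J) (inDual D J)) ((Coalgebra.comul (R := k)).lTensor A w)) := by
    intro w
    induction w using TensorProduct.induction_on with
    | zero => simp
    | add p q hp hq => simp only [map_add, hp, hq]
    | tmul a b =>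
      rw [TensorProduct.map_tmul, LinearMap.lTensor_tmul, mkQ₃_tmul_of_mkQ_eq _ (e b),
        LinearMap.lTensor_tmul]
      rfl
  rw [h₁, h₂, Coalgebra.coassoc_apply]

theorem good_inDual (a : A) : (pre D J).Good (inDual D J a) :=
  PreBialgebroid.Good.of_lift _ (pre_comul_inDual D J a).symm
    (fun l => contractLeft_inDual D J l a) (fun l => contractRight_inDual D J l a)
    fun E hE => coassoc_inDual D J E hE a

theorem good (x : TwistedDual D J) : (pre D J).Good x := by
  refine elem_induction D J (p := (pre D J).Good) x ?_ (fun _ _ h h' => h.add h') fun a m l => ?_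
  · rw [← map_zero (source D J)]
    exact PreBialgebroid.good_source 0
  -- Every simple tensor is a product a t(m) s(l), so the conditions need only be known for a in the
  -- dual.
  · rw [← inDual_mul_target_mul_source]
    exact ((good_inDual D J a).mul (PreBialgebroid.good_target _)).mul
      (PreBialgebroid.good_source l)

theorem isStandard : IsStandard ((pre D J).toRightBialgebroid (good D J)) where
  comul_inDual := pre_comul_inDual D J
  counit_inDual a := (anchorEnd_elem D J a 1 1 1).trans (by
    rw [D.evalU_apply_one, mul_one, one_mul])

end TwistedDual
end Anchor

/-! ### Matrices of tensors under ρ ⊗ ρ, and the braiding P(ρ ⊗ ρ)(R) -/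

section TensorRepresentation

variable {k U L n : Type*} [Field k] [Ring U] [HopfAlgebra k U] [Ring L] [Algebra k L]
  [Fintype n] [DecidableEq n]

/-- The representation `ρ ⊗ ρ` of `U ⊗ U`. -/
noncomputable def tensorRep (ρ : U →ₐ[k] Matrix n n k) :
    U ⊗[k] U →ₐ[k] Matrix (n × n) (n × n) k :=
  (kroneckerHom k n).comp (Algebra.TensorProduct.map ρ ρ)

theorem tensorRep_tmul (ρ : U →ₐ[k] Matrix n n k) (x y : U) (p q : n × n) :
    tensorRep ρ (x ⊗ₜ[k] y) p q = ρ x p.1 q.1 * ρ y p.2 q.2 := kroneckerHom_tmul _ _ _ _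

theorem tensorRep_comm (ρ : U →ₐ[k] Matrix n n k) (w : U ⊗[k] U) :
    tensorRep ρ (TensorProduct.comm k U U w) =
      (tensorRep ρ w).submatrix (Equiv.prodComm n n) (Equiv.prodComm n n) := by
  ext p q
  rw [Matrix.submatrix_apply]
  induction w using TensorProduct.induction_on with
  | zero => simp
  | add x y hx hy => simp only [map_add, Matrix.add_apply, hx, hy]
  | tmul x y => rw [TensorProduct.comm_tmul, tensorRep_tmul, tensorRep_tmul, mul_comm]; rfl

/-- The braiding matrix `P (ρ ⊗ ρ)(R)`. -/
noncomputable def UniversalRMatrix.braiding (R : UniversalRMatrix k U)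
    (ρ : U →ₐ[k] Matrix n n k) : Matrix (n × n) (n × n) k :=
  (tensorRep ρ (R.R : U ⊗[k] U)).submatrix (Equiv.prodComm n n) (Equiv.refl _)

/-- RΔ = Δ_op R, and the flip P conjugates Δ_op into Δ. -/
theorem UniversalRMatrix.braiding_mul_comul (R : UniversalRMatrix k U)
    (ρ : U →ₐ[k] Matrix n n k) (u : U) :
    R.braiding ρ * tensorRep ρ (Coalgebra.comul (R := k) u) =
      tensorRep ρ (Coalgebra.comul (R := k) u) * R.braiding ρ := by
  have h := congrArg (fun w => (tensorRep ρ w).submatrix (Equiv.prodComm n n) (Equiv.refl (n × n)))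
    (R.intertwines u)
  simp only [map_mul, tensorRep_comm] at h
  rw [← Matrix.submatrix_mul_equiv _ _ _ (Equiv.refl (n × n)),
    ← Matrix.submatrix_mul_equiv _ _ _ (Equiv.prodComm n n)] at h
  exact h

/-- The matrix `(ρ ⊗ ρ ⊗ id)(X)`. -/
noncomputable def legsRep (ρ : U →ₐ[k] Matrix n n k) (X : U ⊗[k] (U ⊗[k] L)) :
    Matrix (n × n) (n × n) L :=
  Matrix.of fun p q => contract (coeff ρ p.2 q.2) (contract (L := U ⊗[k] L) (coeff ρ p.1 q.1) X)

theorem legsRep_apply (ρ : U →ₐ[k] Matrix n n k) (X : U ⊗[k] (U ⊗[k] L)) (p q : n × n) :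
    legsRep ρ X p q =
      contract (coeff ρ p.2 q.2) (contract (L := U ⊗[k] L) (coeff ρ p.1 q.1) X) := rfl

theorem legsRep_tmul (ρ : U →ₐ[k] Matrix n n k) (x y : U) (l : L) (p q : n × n) :
    legsRep ρ (x ⊗ₜ[k] (y ⊗ₜ[k] l)) p q = ρ x p.1 q.1 • ρ y p.2 q.2 • l := by
  rw [legsRep_apply, contract_tmul, map_smul, contract_tmul]
  rfl

theorem legsRep_zero (ρ : U →ₐ[k] Matrix n n k) :
    legsRep ρ (0 : U ⊗[k] (U ⊗[k] L)) = 0 := by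
  ext p q
  simp [legsRep_apply]

theorem legsRep_add (ρ : U →ₐ[k] Matrix n n k) (X Y : U ⊗[k] (U ⊗[k] L)) :
    legsRep ρ (X + Y) = legsRep ρ X + legsRep ρ Y := by
  ext p q
  simp [legsRep_apply]

theorem legsRep_mul (ρ : U →ₐ[k] Matrix n n k) (X Y : U ⊗[k] (U ⊗[k] L)) :
    legsRep ρ (X * Y) = legsRep ρ X * legsRep ρ Y := by
  ext p q
  rw [Matrix.mul_apply, Fintype.sum_prod_type]
  simp only [legsRep_apply, contract_coeff_mul, map_sum]

theorem legsRep_one (ρ : U →ₐ[k] Matrix n n k) : legsRep ρ (1 : U ⊗[k] (U ⊗[k] L)) = 1 := by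
  ext p q
  have h : (1 : U ⊗[k] (U ⊗[k] L)) = (1 : U) ⊗ₜ[k] ((1 : U) ⊗ₜ[k] (1 : L)) := rfl
  have e : ∀ i j : n, ρ 1 i j = if i = j then 1 else 0 := fun i j => by
    rw [map_one, Matrix.one_apply]
  rw [h, legsRep_tmul, e, e, Matrix.one_apply]
  simp only [Prod.ext_iff, ite_and, ite_smul, one_smul, zero_smul]

theorem legsRep_inUU (ρ : U →ₐ[k] Matrix n n k) (w : U ⊗[k] U) :
    legsRep ρ (inUU L w) = (tensorRep ρ w).map (algebraMap k L) := by
  ext p q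
  rw [Matrix.map_apply]
  induction w using TensorProduct.induction_on with
  | zero => simp [legsRep_zero]
  | add x y hx hy => simp only [map_add, legsRep_add, Matrix.add_apply, hx, hy]
  | tmul x y =>
    rw [tensorRep_tmul, Algebra.algebraMap_eq_smul_one, mul_smul]
    exact legsRep_tmul ρ x y 1 p q

theorem legsRep_leftComm (ρ : U →ₐ[k] Matrix n n k) (X : U ⊗[k] (U ⊗[k] L)) :
    legsRep ρ (TensorProduct.leftComm k U U L X) =
      (legsRep ρ X).submatrix (Equiv.prodComm n n) (Equiv.prodComm n n) := by
  ext p q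
  rw [Matrix.submatrix_apply]
  refine tripleTensorInduction (p := fun X => legsRep ρ (TensorProduct.leftComm k U U L X) p q =
    legsRep ρ X (Equiv.prodComm n n p) (Equiv.prodComm n n q)) X (by simp [legsRep_zero])
    (fun _ _ h h' => by simp only [map_add, legsRep_add, Matrix.add_apply, h, h']) fun x y l => ?_
  rw [TensorProduct.leftComm_tmul, legsRep_tmul, legsRep_tmul, smul_comm]
  rfl

variable {H : Type*} [Ring H] [HopfAlgebra k H] {B : BaseAlgebra k H L} {ι : H →ₐc[k] U}

theorem BaseAlgebra.eval_coeff_comp (B : BaseAlgebra k H L) (ι : H →ₐc[k] U)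
    (ρ : U →ₐ[k] Matrix n n k) (i j : n) (l : L) :
    B.eval (coeff (ρ.comp (ι : H →ₐ[k] U)) i j) l = contract (coeff ρ i j) (B.coactU ι l) := by
  rw [B.eval_apply, BaseAlgebra.coactU, AlgHom.comp_apply]
  generalize B.coact l = w
  induction w using TensorProduct.induction_on with
  | zero => simp
  | add x y hx hy => simp only [map_add, hx, hy]
  | tmul x y => rfl

theorem legsRep_delta₂ (ρ : U →ₐ[k] Matrix n n k) (l : L) (p q : n × n) :
    legsRep ρ (B.delta₂ ι l) p q =
      B.eval (coeff (tensorSquare (ρ.comp (ι : H →ₐ[k] U))) p q) l := by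
  rw [B.eval_tensorSquare, B.eval_coeff_comp, B.eval_coeff_comp, legsRep_apply, delta₂_eq]
  congr 1
  generalize B.coactU ι l = w
  induction w using TensorProduct.induction_on with
  | zero => simp
  | add x y hx hy => simp only [map_add, hx, hy]
  | tmul x y => rw [LinearMap.lTensor_tmul, contract_tmul, contract_tmul, map_smul]; rfl

/-- δ₂(l) is Δ(l₁) ⊗ l∞, and R has no component in L, so RΔ = Δ_op R applies to the first two
factors. -/
theorem UniversalRMatrix.inUU_mul_delta₂ (R : UniversalRMatrix k U) (l : L) :
    inUU L (R.R : U ⊗[k] U) * B.delta₂ ι l =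
      TensorProduct.leftComm k U U L (B.delta₂ ι l) * inUU L (R.R : U ⊗[k] U) := by
  have h : ∀ (w : U ⊗[k] U) (l : L), TensorProduct.assoc k U U L (w ⊗ₜ[k] l) =
      inUU L w * inL₂ k U L l := by
    intro w l
    induction w using TensorProduct.induction_on with
    | zero => simp
    | add x y hx hy => simp only [map_add, add_mul, TensorProduct.add_tmul, hx, hy]
    | tmul x y => simp [inUU, inL₂]
  have h' : ∀ (w : U ⊗[k] U) (l : L), TensorProduct.leftComm k U U L
      (TensorProduct.assoc k U U L (w ⊗ₜ[k] l)) =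
        inUU L (TensorProduct.comm k U U w) * inL₂ k U L l := by
    intro w l
    induction w using TensorProduct.induction_on with
    | zero => simp
    | add x y hx hy => simp only [map_add, add_mul, TensorProduct.add_tmul, hx, hy]
    | tmul x y => simp [inUU, inL₂]
  have hc : ∀ (w : U ⊗[k] U) (l : L), inUU L w * inL₂ k U L l = inL₂ k U L l * inUU L w := by
    intro w l
    induction w using TensorProduct.induction_on with
    | zero => simp
    | add x y hx hy => simp only [map_add, add_mul, mul_add, hx, hy]
    | tmul x y => simp [inUU, inL₂]
  rw [BaseAlgebra.delta₂]
  generalize B.coactU ι l = w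
  induction w using TensorProduct.induction_on with
  | zero => simp
  | add x y hx hy => simp only [map_add, mul_add, add_mul, hx, hy]
  | tmul x y =>
    rw [LinearMap.rTensor_tmul, h', h, ← mul_assoc, ← map_mul, R.intertwines, map_mul, mul_assoc,
      hc, ← mul_assoc]

end TensorRepresentation

/-! ### The dynamical matrix S̃ = F̄ŘF -/

section DynamicalMatrix

variable {k H U L n : Type*} [Field k] [Ring H] [HopfAlgebra k H] [Ring U] [HopfAlgebra k U]
  [Ring L] [Algebra k L] [Fintype n] [DecidableEq n] {B : BaseAlgebra k H L} {ι : H →ₐc[k] U}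
  (J : DynamicalTwist B ι) (R : UniversalRMatrix k U) (ρ : U →ₐ[k] Matrix n n k)

namespace DynamicalTwist

theorem dynS_eq_submatrix : J.dynS R ρ =
    (legsRep ρ (J.dynR R)).submatrix (Equiv.prodComm n n) (Equiv.refl _) := by
  ext p q
  rw [Matrix.submatrix_apply, dynS, Matrix.of_apply]
  generalize J.dynR R = X
  refine tripleTensorInduction (p := fun X => contract (LinearMap.mul' k k ∘ₗ
      TensorProduct.map (coeff ρ p.2 q.1) (coeff ρ p.1 q.2)) ((TensorProduct.assoc k U U L).symm X) =
    legsRep ρ X (Equiv.prodComm n n p) (Equiv.refl _ q)) X (by simp [legsRep_zero])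
    (fun _ _ h h' => by simp only [map_add, legsRep_add, Matrix.add_apply, h, h']) fun x y l => ?_
  rw [TensorProduct.assoc_symm_tmul, legsRep_tmul, smul_smul]
  rfl

/-- The braiding matrix, with coefficients in `L`. -/
theorem dynS_eq : J.dynS R ρ = legsRep ρ (↑J.F⁻¹ : U ⊗[k] (U ⊗[k] L)) *
    ((R.braiding ρ).map (algebraMap k L) * legsRep ρ (J.F : U ⊗[k] (U ⊗[k] L))) := by
  rw [dynS_eq_submatrix, dynR, legsRep_mul, legsRep_mul, legsRep_leftComm, mul_assoc,
    ← Matrix.submatrix_mul_equiv _ _ _ (Equiv.prodComm n n),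
    ← Matrix.submatrix_mul_equiv _ _ _ (Equiv.refl (n × n)), legsRep_inUU]
  rfl

theorem legsRep_mul_inv : legsRep ρ (J.F : U ⊗[k] (U ⊗[k] L)) *
    legsRep ρ (↑J.F⁻¹ : U ⊗[k] (U ⊗[k] L)) = 1 := by
  rw [← legsRep_mul, Units.mul_inv, legsRep_one]

theorem dynS_mul_inv : J.dynS R ρ * legsRep ρ (↑J.F⁻¹ : U ⊗[k] (U ⊗[k] L)) =
    legsRep ρ (↑J.F⁻¹ : U ⊗[k] (U ⊗[k] L)) * (R.braiding ρ).map (algebraMap k L) := by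
  rw [dynS_eq, mul_assoc, mul_assoc, legsRep_mul_inv, mul_one]

theorem twist_mul_dynS : legsRep ρ (J.F : U ⊗[k] (U ⊗[k] L)) * J.dynS R ρ =
    (R.braiding ρ).map (algebraMap k L) * legsRep ρ (J.F : U ⊗[k] (U ⊗[k] L)) := by
  rw [dynS_eq, ← mul_assoc, legsRep_mul_inv, one_mul]

theorem braiding_mul_delta₂ (l : L) :
    (R.braiding ρ).map (algebraMap k L) * legsRep ρ (B.delta₂ ι l) =
      legsRep ρ (B.delta₂ ι l) * (R.braiding ρ).map (algebraMap k L) := by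
  have h := congrArg (fun X => (legsRep ρ X).submatrix (Equiv.prodComm n n) (Equiv.refl (n × n)))
    (R.inUU_mul_delta₂ (B := B) (ι := ι) l)
  simp only [legsRep_mul, legsRep_leftComm, legsRep_inUU] at h
  rw [← Matrix.submatrix_mul_equiv _ _ _ (Equiv.refl (n × n)),
    ← Matrix.submatrix_mul_equiv _ _ _ (Equiv.prodComm n n)] at h
  exact h

/-- Each of the three factors F̄, Ř and F commutes with the image of δ₂(l). Entrywise, in
`sum_dynS_mul_eval`, this is the condition for the FRT algebra to have its anchor. -/
theorem dynS_mul_delta₂ (l : L) :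
    J.dynS R ρ * legsRep ρ (B.delta₂ ι l) = legsRep ρ (B.delta₂ ι l) * J.dynS R ρ := by
  rw [dynS_eq, mul_assoc, mul_assoc, ← legsRep_mul, delta₂_comm, legsRep_mul, ← mul_assoc _ (legsRep
    ρ (B.delta₂ ι l)), braiding_mul_delta₂, mul_assoc, ← mul_assoc, ← mul_assoc, ← legsRep_mul,
    delta₂_comm_inv, legsRep_mul]
  simp only [mul_assoc]

theorem sum_dynS_mul_eval (l : L) (p q : n × n) :
    ∑ r, J.dynS R ρ p r *
        B.eval (coeff (tensorSquare (ρ.comp (ι : H →ₐ[k] U))) r q) l =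
      ∑ r, B.eval (coeff (tensorSquare (ρ.comp (ι : H →ₐ[k] U))) p r) l * J.dynS R ρ r q := by
  simp only [← legsRep_delta₂ (B := B) (ι := ι)]
  rw [← Matrix.mul_apply, ← Matrix.mul_apply, dynS_mul_delta₂]

end DynamicalTwist

end DynamicalMatrix

/-! ### The FRT relation for matrix coefficients and their twisted product -/

section Relations

variable {k H U L A n : Type*} [Field k] [Ring H] [HopfAlgebra k H] [Ring U] [HopfAlgebra k U]
  [Ring L] [Algebra k L] [Ring A] [HopfAlgebra k A] [Fintype n] [DecidableEq n]
  (D : HopfDual k U A) {ρ : U →ₐ[k] Matrix n n k} {c : Matrix n n A}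

/-- The undeformed FRT relation: paired with u, the products of coefficients become the entries of
(ρ ⊗ ρ)Δ(u), which commutes with Ř. -/
theorem HopfDual.braiding_coefficient (R : UniversalRMatrix k U)
    (hc : ∀ (u : U) (i j : n), D.pair (c i j) u = ρ u i j) (p q : n × n) :
    ∑ r : n × n, R.braiding ρ p r • (c r.1 q.1 * c r.2 q.2) =
      ∑ r : n × n, R.braiding ρ r q • (c p.1 r.1 * c p.2 r.2) := by
  refine D.ext fun u => ?_
  have h : ∀ (p q : n × n), D.pair (c p.1 q.1 * c p.2 q.2) u =
      tensorRep ρ (Coalgebra.comul (R := k) u) p q := by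
    intro p q
    rw [D.pair_coefficient_mul hc]
    generalize Coalgebra.comul (R := k) u = w
    induction w using TensorProduct.induction_on with
    | zero => simp
    | add x y hx hy => simp only [map_add, Matrix.add_apply, hx, hy]
    | tmul x y => rw [tensorRep_tmul]; rfl
  have e := congrFun (congrFun (R.braiding_mul_comul ρ u) p) q
  rw [Matrix.mul_apply, Matrix.mul_apply] at e
  simp only [map_sum, map_smul, LinearMap.sum_apply, LinearMap.smul_apply, h, smul_eq_mul, e]
  exact Finset.sum_congr rfl fun _ _ => mul_comm _ _

/-- As the actions on c are matrix multiplications, the twisted product is the ordinary c₁c₂ between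
the matrices of G' and G, whose entries lie in L_op and L. -/
theorem HopfDual.core_coefficient
    (hc : ∀ (u : U) (i j : n), D.pair (c i j) u = ρ u i j) (G' G : U ⊗[k] (U ⊗[k] L))
    (p q : n × n) : D.core L ((c p.1 q.1 ⊗ₜ[k] c p.2 q.2) ⊗ₜ[k] (G' ⊗ₜ[k] G)) =
      ∑ a : n × n, ∑ b : n × n,
        (c a.1 b.1 * c a.2 b.2) ⊗ₜ[k] (legsRep ρ G' p a ⊗ₜ[k] legsRep ρ G b q) := by
  refine tripleTensorInduction (p := fun G' => D.core L ((c p.1 q.1 ⊗ₜ[k] c p.2 q.2) ⊗ₜ[k]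
      (G' ⊗ₜ[k] G)) = ∑ a : n × n, ∑ b : n × n,
        (c a.1 b.1 * c a.2 b.2) ⊗ₜ[k] (legsRep ρ G' p a ⊗ₜ[k] legsRep ρ G b q)) G'
    (by simp [legsRep_zero])
    (fun _ _ h h' => by
      simp only [legsRep_add, Matrix.add_apply, TensorProduct.add_tmul, TensorProduct.tmul_add,
        map_add, Finset.sum_add_distrib, h, h']) fun g₁ g₂ m => ?_
  generalize hG' : g₁ ⊗ₜ[k] (g₂ ⊗ₜ[k] m) = G₁
  refine tripleTensorInduction (p := fun G => D.core L ((c p.1 q.1 ⊗ₜ[k] c p.2 q.2) ⊗ₜ[k]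
      (G₁ ⊗ₜ[k] G)) = ∑ a : n × n, ∑ b : n × n,
        (c a.1 b.1 * c a.2 b.2) ⊗ₜ[k] (legsRep ρ G₁ p a ⊗ₜ[k] legsRep ρ G b q)) G
    (by simp [legsRep_zero])
    (fun _ _ h h' => by
      simp only [legsRep_add, Matrix.add_apply, TensorProduct.tmul_add,
        map_add, Finset.sum_add_distrib, h, h']) fun f₁ f₂ l => ?_
  rw [← hG', D.core_tmul, D.act_coefficient hc, D.act_coefficient hc]
  have e : ∀ a b : n × n, (c a.1 b.1 * c a.2 b.2) ⊗ₜ[k]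
      (legsRep ρ (g₁ ⊗ₜ[k] (g₂ ⊗ₜ[k] m)) p a ⊗ₜ[k] legsRep ρ (f₁ ⊗ₜ[k] (f₂ ⊗ₜ[k] l)) b q) =
      ((ρ f₁ b.1 q.1 • ρ g₁ p.1 a.1 • c a.1 b.1) * (ρ f₂ b.2 q.2 • ρ g₂ p.2 a.2 • c a.2 b.2)) ⊗ₜ[k]
        (m ⊗ₜ[k] l) := by
    intro a b
    rw [legsRep_tmul, legsRep_tmul]
    simp only [TensorProduct.tmul_smul, ← TensorProduct.smul_tmul', smul_mul_assoc,
      mul_smul_comm, smul_smul]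
    congr 1
    ring
  simp only [e, ← TensorProduct.sum_tmul, mul_scalarRep_apply, scalarRep_mul_apply,
    Finset.smul_sum]
  congr 1
  conv_rhs => rw [Finset.sum_comm, Fintype.sum_prod_type]
  rw [Finset.sum_mul]
  refine Finset.sum_congr rfl fun b₁ _ => ?_
  rw [Finset.mul_sum]
  refine Finset.sum_congr rfl fun b₂ _ => ?_
  rw [Fintype.sum_prod_type, Finset.sum_mul]
  exact Finset.sum_congr rfl fun a₁ _ => Finset.mul_sum _ _ _

end Relations

/-! ### Coproducts of matrix coefficients and of inverse matrices -/

section MatrixCoproduct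

variable {k U A n : Type*} [Field k] [Ring U] [HopfAlgebra k U] [Ring A] [HopfAlgebra k A]
  [Fintype n] [DecidableEq n]

/-- Evaluations at elements of U separate the points of A. Over a field they still do so on the
right factor of A ⊗ A: expand the left factor in a basis and compare coefficients. -/
theorem HopfDual.ext_lTensor (D : HopfDual k U A) {w v : A ⊗[k] A}
    (h : ∀ u, TensorProduct.rid k A ((D.pair.flip u).lTensor A w) =
      TensorProduct.rid k A ((D.pair.flip u).lTensor A v)) : w = v := by
  classical
  set b := Module.Basis.ofVectorSpace k A
  apply (TensorProduct.equivFinsuppOfBasisLeft (N := A) b).injective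
  ext1 i
  rw [TensorProduct.equivFinsuppOfBasisLeft_apply, TensorProduct.equivFinsuppOfBasisLeft_apply]
  refine D.ext fun u => ?_
  have e : ∀ w : A ⊗[k] A, D.pair (TensorProduct.lid k A ((b.coord i).rTensor A w)) u =
      b.coord i (TensorProduct.rid k A ((D.pair.flip u).lTensor A w)) := by
    intro w
    induction w using TensorProduct.induction_on with
    | zero => simp
    | add x y hx hy => simp only [map_add, LinearMap.add_apply, hx, hy]
    | tmul x y => simp [mul_comm]
  rw [e, e, h]

theorem HopfDual.comul_coefficient (D : HopfDual k U A) {ρ : U →ₐ[k] Matrix n n k}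
    {c : Matrix n n A} (hc : ∀ (u : U) (i j : n), D.pair (c i j) u = ρ u i j) (i j : n) :
    Coalgebra.comul (R := k) (c i j) = ∑ r, c i r ⊗ₜ[k] c r j := by
  refine D.ext_lTensor fun u => ?_
  rw [← D.lact_apply, D.lact_coefficient hc, mul_scalarRep_apply, map_sum, map_sum]
  exact Finset.sum_congr rfl fun r _ => by simp [hc]

end MatrixCoproduct

section MatrixInverse

/-- The coproduct of the inverse of a matrix coalgebra. -/
theorem PreBialgebroid.comul_inverse {k L R n : Type*} [Field k] [Ring L] [Algebra k L] [Ring R]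
    [Algebra k R] [Fintype n] [DecidableEq n] {s : L →ₐ[k] R} {t : Lᵐᵒᵖ →ₐ[k] R}
    (G : PreBialgebroid s t) {M N : Matrix n n R} (h₁ : N * M = 1) (h₂ : M * N = 1)
    (hM : ∀ i j, G.comul (M i j) = (balancedIdeal s t).mkQ (∑ r, M i r ⊗ₜ[k] M r j)) (i j : n) :
    G.comul (N i j) = (balancedIdeal s t).mkQ (∑ r, N r j ⊗ₜ[k] N i r) := by
  -- The coproduct of MN = 1. It is solved for Δ(N) with the left inverse of the matrix ∑ M ⊗ M
  -- provided by `sum_tmul_inverse_mul`.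
  have e₁ : ∀ i j, ∑ r, (∑ b, M i b ⊗ₜ[k] M b r) • G.comul (N r j) =
      (1 : Matrix n n (R ⊗[k] R)) i j • (balancedIdeal s t).mkQ 1 := by
    intro i j
    have h := congrArg G.comul (congrFun (congrFun h₂ i) j)
    rw [Matrix.mul_apply, map_sum] at h
    rw [← Finset.sum_congr rfl fun r _ => G.comul_mul (M i r) (N r j) _ (hM i r).symm, h,
      Matrix.one_apply, Matrix.one_apply]
    split_ifs
    · rw [G.comul_one, one_smul]
    · rw [map_zero, zero_smul]
  calc G.comul (N i j) = ∑ r, (1 : Matrix n n (R ⊗[k] R)) i r • G.comul (N r j) := by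
        simp [Matrix.one_apply, ite_smul]
    _ = ∑ r, (∑ a, N a r ⊗ₜ[k] N i a) • ∑ q, (∑ b, M r b ⊗ₜ[k] M b q) • G.comul (N q j) := by
        simp only [← sum_tmul_inverse_mul h₁, Finset.sum_smul, Finset.smul_sum, mul_smul]
        exact Finset.sum_comm
    _ = _ := by
        simp only [e₁]
        rw [Finset.sum_eq_single j (fun b _ hb => by rw [Matrix.one_apply_ne hb, zero_smul,
          smul_zero]) (by simp), Matrix.one_apply_eq, one_smul, ← mkQ_mul, mul_one]

end MatrixInverse

/-! ### Homomorphisms of bialgebroids tested on the matrix T -/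

namespace ExtFRT

variable {k H L n R : Type*} [Field k] [Ring H] [HopfAlgebra k H] [Ring L] [Algebra k L]
  [Fintype n] [DecidableEq n] [Ring R] [Algebra k R]
  {B : BaseAlgebra k H L} {σ : H →ₐ[k] Matrix n n k} {S : Matrix (n × n) (n × n) L}

/-- The images of T̄ are determined as the inverse matrix of the images of T. -/
theorem algHom_ext_of_T {f g : ExtFRT B σ S →ₐ[k] R}
    (hs : ∀ l, f (source B σ S l) = g (source B σ S l))
    (ht : ∀ l, f (target B σ S l) = g (target B σ S l))
    (hT : ∀ i j, f (T B σ S i j) = g (T B σ S i j)) : f = g := by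
  refine algHom_ext hs ht hT fun i j => ?_
  have hm : ∀ f : ExtFRT B σ S →ₐ[k] R, (Tbar B σ S).map f * (T B σ S).map f = 1 ∧
      (T B σ S).map f * (Tbar B σ S).map f = 1 := fun f => by
    rw [← Matrix.map_mul, ← Matrix.map_mul, Tbar_mul_T, T_mul_Tbar,
      Matrix.map_one _ (map_zero f) (map_one f)]
    exact ⟨rfl, rfl⟩
  have e : (T B σ S).map f = (T B σ S).map g := Matrix.ext hT
  have h := left_inv_eq_right_inv (hm f).1 (e ▸ (hm g).2)
  exact congrFun (congrFun h i) j

/-- A homomorphism that respects the coproduct of the generators is one of right bialgebroids. -/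
theorem isHom_of_generators
    (hS : ∀ (l : L) (p q : n × n), ∑ r, S p r * B.eval (coeff (tensorSquare σ) r q) l =
      ∑ r, B.eval (coeff (tensorSquare σ) p r) l * S r q)
    {s : L →ₐ[k] R} {t : Lᵐᵒᵖ →ₐ[k] R} (G : PreBialgebroid s t) (hG : ∀ b, G.Good b)
    (φ : ExtFRT B σ S →ₐ[k] R) (hs : ∀ l, φ (source B σ S l) = s l)
    (ht : ∀ l, φ (target B σ S l) = t l)
    (hT : ∀ i j, G.comul (φ (T B σ S i j)) =
      (balancedIdeal s t).mkQ (∑ r, φ (T B σ S i r) ⊗ₜ[k] φ (T B σ S r j)))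
    (hε : ∀ i j l, (G.anchorEnd (φ (T B σ S i j))).unop l = B.eval (coeff σ i j) l) :
    ((pre hS).toRightBialgebroid (good hS)).IsHom (G.toRightBialgebroid hG) φ where
  source := hs
  target := ht
  counit b := by
    -- The counit is not multiplicative, but it is the value at 1 of the anchor, which is; so the
    -- anchors are compared on generators.
    have h : G.anchorEnd.comp φ = (pre hS).anchorEnd := algHom_ext_of_T
      (fun l => anchor_ext fun x => by
        rw [AlgHom.comp_apply, hs, G.anchorEnd_source, (pre hS).anchorEnd_source])
      (fun l => anchor_ext fun x => by
        rw [AlgHom.comp_apply, ht, ← MulOpposite.op_unop l, G.anchorEnd_target,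
          (pre hS).anchorEnd_target])
      (fun i j => anchor_ext fun x => by rw [AlgHom.comp_apply, hε, pre_anchor_T])
    exact congrArg (fun f => (f.unop 1 : L)) (DFunLike.congr_fun h b)
  comul := by
    -- φ ⊗ φ respects the balancing, so one representative of each coproduct suffices below.
    have hwd : ∀ {z w : ExtFRT B σ S ⊗[k] ExtFRT B σ S},
        (balancedIdeal (source B σ S) (target B σ S)).mkQ z =
          (balancedIdeal (source B σ S) (target B σ S)).mkQ w →
        (balancedIdeal s t).mkQ (Algebra.TensorProduct.map φ φ z) =
          (balancedIdeal s t).mkQ (Algebra.TensorProduct.map φ φ w) := by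
      intro z w h
      refine eq_of_mkQ_eq ((balancedIdeal s t).mkQ.toAddMonoidHom.comp
        (Algebra.TensorProduct.map φ φ).toLinearMap.toAddMonoidHom) (fun x y l => ?_) h
      change (balancedIdeal s t).mkQ (φ (x * source B σ S l) ⊗ₜ[k] φ y) =
        (balancedIdeal s t).mkQ (φ x ⊗ₜ[k] φ (y * target B σ S (MulOpposite.op l)))
      rw [map_mul, map_mul, hs, ht, mkQ_balance]
    have hTbar : ∀ i j, G.comul (φ (Tbar B σ S i j)) =
        (balancedIdeal s t).mkQ (∑ r, φ (Tbar B σ S r j) ⊗ₜ[k] φ (Tbar B σ S i r)) :=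
      G.comul_inverse (M := (T B σ S).map φ) (N := (Tbar B σ S).map φ)
        (by rw [← Matrix.map_mul, Tbar_mul_T, Matrix.map_one _ (map_zero φ) (map_one φ)])
        (by rw [← Matrix.map_mul, T_mul_Tbar, Matrix.map_one _ (map_zero φ) (map_one φ)]) hT
    have key : ∀ b, ∃ z, (balancedIdeal (source B σ S) (target B σ S)).mkQ z =
        (pre hS).comul b ∧
          G.comul (φ b) = (balancedIdeal s t).mkQ (Algebra.TensorProduct.map φ φ z) := by
      have hsrc : ∀ l, ∃ z, (balancedIdeal (source B σ S) (target B σ S)).mkQ z =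
          (pre hS).comul (source B σ S l) ∧ G.comul (φ (source B σ S l)) =
            (balancedIdeal s t).mkQ (Algebra.TensorProduct.map φ φ z) := fun l =>
        ⟨1 ⊗ₜ source B σ S l, ((pre hS).copEnd_source l).symm, by
          rw [Algebra.TensorProduct.map_tmul, map_one, hs]
          exact G.copEnd_source l⟩
      intro b
      have hb : b ∈ Algebra.adjoin k (generators B σ S) :=
        (adjoin_generators B σ S) ▸ Algebra.mem_top
      induction hb using Algebra.adjoin_induction with
      | mem x hx =>
        rcases hx with ((⟨l, rfl⟩ | ⟨l, rfl⟩) | ⟨p, rfl⟩) | ⟨p, rfl⟩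
        · exact hsrc l
        · refine ⟨target B σ S l ⊗ₜ 1, ((pre hS).copEnd_target l).symm, ?_⟩
          rw [Algebra.TensorProduct.map_tmul, map_one, ht]
          exact G.copEnd_target l
        · refine ⟨copT B σ S p.1 p.2, (pre_comul_T hS p.1 p.2).symm, (hT _ _).trans ?_⟩
          rw [copT, map_sum (Algebra.TensorProduct.map φ φ)]
          rfl
        · refine ⟨copTbar B σ S p.1 p.2, (pre_comul_Tbar hS p.1 p.2).symm, (hTbar _ _).trans ?_⟩
          rw [copTbar, map_sum (Algebra.TensorProduct.map φ φ)]
          rfl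
      | algebraMap r =>
        rw [← (source B σ S).commutes r]
        exact hsrc _
      | add x y _ _ hx hy =>
        obtain ⟨z, hz, hz'⟩ := hx
        obtain ⟨w, hw, hw'⟩ := hy
        exact ⟨z + w, by rw [map_add, map_add, hz, hw], by 
          rw [map_add, map_add, map_add, map_add, hz', hw']⟩
      | mul x y _ _ hx hy =>
        obtain ⟨z, hz, hz'⟩ := hx
        obtain ⟨w, hw, hw'⟩ := hy
        exact ⟨z * w, by rw [(pre hS).comul_mul x y z hz, mkQ_mul, hw], by
          rw [map_mul φ, G.comul_mul _ _ _ hz'.symm, map_mul (Algebra.TensorProduct.map φ φ),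
            mkQ_mul, hw']⟩
    intro b z hz
    obtain ⟨w, hw, h⟩ := key b
    exact h.trans (hwd (hw.trans hz.symm))

end ExtFRT

/-! ### The homomorphism from the extended dynamical FRT algebra to the twisted dual -/

namespace TwistedDual

variable {k H U L A n : Type*} [Field k] [Ring H] [HopfAlgebra k H] [Ring U] [HopfAlgebra k U]
  [Ring L] [Algebra k L] [Ring A] [HopfAlgebra k A] [Fintype n] [DecidableEq n]
  (D : HopfDual k U A) {B : BaseAlgebra k H L} {ι : H →ₐc[k] U} (J : DynamicalTwist B ι)
  {ρ : U →ₐ[k] Matrix n n k} {c : Matrix n n A}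

theorem matU_apply (i j : n) : matU D J c i j = elem D J (c i j) 1 1 := rfl

theorem source_mul_matU (hc : ∀ (u : U) (i j : n), D.pair (c i j) u = ρ u i j) (l : L) (i j : n) :
    source D J l * matU D J c i j = ∑ r, matU D J c i r *
      source D J (B.eval (coeff (ρ.comp (ι : H →ₐ[k] U)) r j) l) := by
  obtain ⟨S, hS⟩ := TensorProduct.exists_finset (B.coactU ι l)
  have e : ∀ r, matU D J c i r * source D J (B.eval (coeff (ρ.comp (ι : H →ₐ[k] U)) r j) l) =
      ∑ u ∈ S, ρ u.1 r j • elemMap D J (c i r) 1 u.2 := fun r => by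
    rw [matU_apply, source_apply, elem_mul_source, one_mul, B.eval_coeff_comp, hS, map_sum,
      ← elemMap_apply, map_sum]
    exact Finset.sum_congr rfl fun u _ => by rw [contract_tmul, map_smul]; rfl
  simp only [e]
  rw [matU_apply, source_mul_elem D J hS, Finset.sum_comm]
  refine Finset.sum_congr rfl fun u _ => ?_
  rw [D.lact_coefficient hc, mul_scalarRep_apply, mul_one, ← elemMap_apply, map_sum]
  simp only [map_smul, LinearMap.sum_apply, LinearMap.smul_apply]

theorem target_mul_matU (hc : ∀ (u : U) (i j : n), D.pair (c i j) u = ρ u i j) (l : L) (i j : n) :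
    target D J (MulOpposite.op l) * matU D J c i j = ∑ r, matU D J c r j *
      target D J (MulOpposite.op (B.eval (coeff (ρ.comp (ι : H →ₐ[k] U)) i r) l)) := by
  obtain ⟨S, hS⟩ := TensorProduct.exists_finset (B.coactU ι l)
  have e : ∀ r, matU D J c r j *
      target D J (MulOpposite.op (B.eval (coeff (ρ.comp (ι : H →ₐ[k] U)) i r) l)) =
      ∑ u ∈ S, ρ u.1 i r • elemMap D J (c r j) u.2 1 := fun r => by
    rw [matU_apply, target_apply, elem_mul_target, mul_one, MulOpposite.unop_op,
      B.eval_coeff_comp, hS, map_sum, ← elemMap_apply, map_sum, LinearMap.sum_apply]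
    exact Finset.sum_congr rfl fun u _ => by
      rw [contract_tmul, map_smul, LinearMap.smul_apply]; rfl
  simp only [e]
  rw [matU_apply, target_mul_elem D J hS, Finset.sum_comm]
  refine Finset.sum_congr rfl fun u _ => ?_
  rw [D.ract_coefficient hc, scalarRep_mul_apply, one_mul, ← elemMap_apply, map_sum]
  simp only [map_smul, LinearMap.sum_apply, LinearMap.smul_apply]

theorem matU_mul_matU (hc : ∀ (u : U) (i j : n), D.pair (c i j) u = ρ u i j) (p q : n × n) :
    matU D J c p.1 q.1 * matU D J c p.2 q.2 = ∑ a : n × n, ∑ b : n × n,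
      elemMap D J (c a.1 b.1 * c a.2 b.2) (legsRep ρ (↑J.F⁻¹ : U ⊗[k] (U ⊗[k] L)) p a)
        (legsRep ρ (J.F : U ⊗[k] (U ⊗[k] L)) b q) := by
  rw [matU_apply, matU_apply, elem_mul_elem, map_one, map_one, mul_one, mul_one, one_mul,
    one_mul]
  exact D.core_coefficient hc _ _ p q

theorem elemMap_mul_target (a : A) (m l m' : L) :
    elemMap D J a m l * target D J (MulOpposite.op m') = elemMap D J a (m' * m) l :=
  elem_mul_target D J a m l m'

theorem elemMap_mul_source (a : A) (m l l' : L) :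
    elemMap D J a m l * source D J l' = elemMap D J a m (l * l') :=
  elem_mul_source D J a m l l'

/-- The product U₁U₂ is F̄(c₁c₂)F, with F̄ in L_op and F in L. From S̃F̄ = F̄Ř and FS̃ = ŘF, the
matrix S̃ on either outer side becomes the scalar matrix Ř next to c₁c₂, and Ř commutes with c₁c₂ by
the undeformed relation. -/
theorem matU_mul_matU_dynS (R : UniversalRMatrix k U)
    (hc : ∀ (u : U) (i j : n), D.pair (c i j) u = ρ u i j) (p q : n × n) :
    ∑ r : n × n, matU D J c r.1 q.1 * matU D J c r.2 q.2 *
        target D J (MulOpposite.op (J.dynS R ρ p r)) =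
      ∑ r : n × n, matU D J c p.1 r.1 * matU D J c p.2 r.2 * source D J (J.dynS R ρ r q) := by
  have h₁ : ∀ a, ∑ r, J.dynS R ρ p r * legsRep ρ (↑J.F⁻¹ : U ⊗[k] (U ⊗[k] L)) r a =
      ∑ d, R.braiding ρ d a • legsRep ρ (↑J.F⁻¹ : U ⊗[k] (U ⊗[k] L)) p d := fun a => by
    rw [← Matrix.mul_apply, J.dynS_mul_inv, Matrix.mul_apply]
    exact Finset.sum_congr rfl fun d _ => by
      rw [Matrix.map_apply, ← Algebra.commutes, Algebra.smul_def]
  have h₂ : ∀ b, ∑ r, legsRep ρ (J.F : U ⊗[k] (U ⊗[k] L)) b r * J.dynS R ρ r q =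
      ∑ d, R.braiding ρ b d • legsRep ρ (J.F : U ⊗[k] (U ⊗[k] L)) d q := fun b => by
    rw [← Matrix.mul_apply, J.twist_mul_dynS, Matrix.mul_apply]
    exact Finset.sum_congr rfl fun d _ => by rw [Matrix.map_apply, Algebra.smul_def]
  set X := legsRep ρ (↑J.F⁻¹ : U ⊗[k] (U ⊗[k] L)) with hX
  set Y := legsRep ρ (J.F : U ⊗[k] (U ⊗[k] L)) with hY
  simp only [matU_mul_matU D J hc, ← hX, ← hY, Finset.sum_mul, elemMap_mul_target,
    elemMap_mul_source]
  calc _ = ∑ a : n × n, ∑ b : n × n, elemMap D J (c a.1 b.1 * c a.2 b.2)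
        (∑ r, J.dynS R ρ p r * X r a) (Y b q) := by
        rw [Finset.sum_comm]
        refine Finset.sum_congr rfl fun a _ => ?_
        rw [Finset.sum_comm]
        simp only [map_sum, LinearMap.sum_apply]
    _ = ∑ d : n × n, ∑ b : n × n, elemMap D J
        (∑ a : n × n, R.braiding ρ d a • (c a.1 b.1 * c a.2 b.2)) (X p d) (Y b q) := by
        simp only [h₁, map_sum, map_smul, LinearMap.sum_apply, LinearMap.smul_apply]
        conv_lhs => rw [Finset.sum_comm]
        conv_rhs => rw [Finset.sum_comm]
        exact Finset.sum_congr rfl fun _ _ => Finset.sum_comm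
    _ = ∑ a : n × n, ∑ b : n × n, elemMap D J (c a.1 b.1 * c a.2 b.2) (X p a)
        (∑ d, R.braiding ρ b d • Y d q) := by
        simp only [D.braiding_coefficient R hc, map_sum, map_smul, LinearMap.sum_apply,
          LinearMap.smul_apply]
        exact Finset.sum_congr rfl fun _ _ => Finset.sum_comm
    _ = _ := by
        simp only [← h₂, map_sum]
        conv_rhs => rw [Finset.sum_comm]
        refine Finset.sum_congr rfl fun a _ => ?_
        conv_rhs => rw [Finset.sum_comm]

/-- The matrices `U` and `Ū` satisfy the relations of the extended dynamical FRT algebra. -/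
noncomputable def frtRep (R : UniversalRMatrix k U)
    (hc : ∀ (u : U) (i j : n), D.pair (c i j) u = ρ u i j) :
    FRTRep B (ρ.comp (ι : H →ₐ[k] U)) (J.dynS R ρ) (TwistedDual D J) where
  s := source D J
  t := target D J
  T := matU D J c
  Tbar := matUbar D J c ρ
  commute := source_target_commute D J
  Tbar_mul_T := matUbar_mul_matU D hc J R.antipode_bijective
  T_mul_Tbar := matU_mul_matUbar D hc J R.antipode_bijective
  src_T := source_mul_matU D J hc
  tgt_T := target_mul_matU D J hc
  T_T := matU_mul_matU_dynS D J R hc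

theorem comul_matU (hc : ∀ (u : U) (i j : n), D.pair (c i j) u = ρ u i j) (i j : n) :
    (pre D J).comul (matU D J c i j) = (balancedIdeal (source D J) (target D J)).mkQ
      (∑ r, matU D J c i r ⊗ₜ[k] matU D J c r j) := by
  refine (pre_comul_inDual D J (c i j)).trans ?_
  rw [D.comul_coefficient hc, map_sum]
  rfl

theorem anchor_matU (hc : ∀ (u : U) (i j : n), D.pair (c i j) u = ρ u i j) (i j : n) (l : L) :
    ((pre D J).anchorEnd (matU D J c i j)).unop l =
      B.eval (coeff (ρ.comp (ι : H →ₐ[k] U)) i j) l := by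
  refine (anchorEnd_elem D J (c i j) 1 1 l).trans ?_
  have h : D.pair (c i j) = coeff ρ i j := LinearMap.ext fun u => hc u i j
  rw [mul_one, one_mul, D.evalU_apply, h, B.eval_coeff_comp]

theorem isHom_lift (R : UniversalRMatrix k U)
    (hc : ∀ (u : U) (i j : n), D.pair (c i j) u = ρ u i j) :
    ((ExtFRT.pre (J.sum_dynS_mul_eval R ρ)).toRightBialgebroid
      (ExtFRT.good (J.sum_dynS_mul_eval R ρ))).IsHom ((pre D J).toRightBialgebroid (good D J))
        (frtRep D J R hc).lift := by
  have hT : ∀ i j, (frtRep D J R hc).lift (ExtFRT.T _ _ _ i j) = matU D J c i j :=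
    fun i j => FRTRep.lift_T _ i j
  refine ExtFRT.isHom_of_generators _ _ _ _ (FRTRep.lift_source _) (FRTRep.lift_target _)
    (fun i j => ?_) (fun i j l => ?_)
  · simp only [hT]
    exact comul_matU D J hc i j
  · rw [hT]
    exact anchor_matU D J hc i j l

end TwistedDual

end DynFRT

theorem mainTheorem8 {k H U L A n : Type*} [Field k] [Ring H] [HopfAlgebra k H]
    [Ring U] [HopfAlgebra k U] [Ring L] [Algebra k L] [Ring A] [HopfAlgebra k A]
    [Fintype n] [DecidableEq n]
    (hH : Function.Bijective (HopfAlgebra.antipode k (A := H)))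
    (ι : H →ₐc[k] U) (hι : Function.Injective ι)
    (B : DynFRT.BaseAlgebra k H L) (R : DynFRT.UniversalRMatrix k U)
    (J : DynFRT.DynamicalTwist B ι) (D : DynFRT.HopfDual k U A)
    (ρ : U →ₐ[k] Matrix n n k) (c : Matrix n n A)
    (hc : ∀ (u : U) (i j : n), D.pair (c i j) u = ρ u i j) :
    IsUnit J.zeta ∧
    DynFRT.TwistedDual.matU D J c * DynFRT.TwistedDual.matUbar D J c ρ = 1 ∧
    DynFRT.TwistedDual.matUbar D J c ρ * DynFRT.TwistedDual.matU D J c = 1 ∧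
    ∃ (G : DynFRT.RightBialgebroid
          (DynFRT.ExtFRT.source B (ρ.comp (ι : H →ₐ[k] U)) (J.dynS R ρ))
          (DynFRT.ExtFRT.target B (ρ.comp (ι : H →ₐ[k] U)) (J.dynS R ρ)))
      (G' : DynFRT.RightBialgebroid (DynFRT.TwistedDual.source D J)
          (DynFRT.TwistedDual.target D J)),
      DynFRT.ExtFRT.IsStandard G ∧ DynFRT.TwistedDual.IsStandard G' ∧
      ∃! φ : DynFRT.ExtFRT B (ρ.comp (ι : H →ₐ[k] U)) (J.dynS R ρ) →ₐ[k]
          DynFRT.TwistedDual D J,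
        G.IsHom G' φ ∧
        (∀ i j : n, φ (DynFRT.ExtFRT.T B (ρ.comp (ι : H →ₐ[k] U)) (J.dynS R ρ) i j) =
          DynFRT.TwistedDual.matU D J c i j) ∧
        ∀ i j : n, φ (DynFRT.ExtFRT.Tbar B (ρ.comp (ι : H →ₐ[k] U)) (J.dynS R ρ) i j) =
          DynFRT.TwistedDual.matUbar D J c ρ i j := by
  refine ⟨J.isUnit_zeta R.antipode_bijective,
    DynFRT.TwistedDual.matU_mul_matUbar D hc J R.antipode_bijective,
    DynFRT.TwistedDual.matUbar_mul_matU D hc J R.antipode_bijective, _, _,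
    DynFRT.ExtFRT.isStandard (J.sum_dynS_mul_eval R ρ), DynFRT.TwistedDual.isStandard D J,
    (DynFRT.TwistedDual.frtRep D J R hc).lift,
    ⟨DynFRT.TwistedDual.isHom_lift D J R hc, DynFRT.FRTRep.lift_T _, DynFRT.FRTRep.lift_Tbar _⟩, ?_⟩
  rintro ψ ⟨hψ, hT, -⟩
  -- A bialgebroid homomorphism is prescribed on s(L) and t(L), and its values on T fix those on T̄.
  refine DynFRT.ExtFRT.algHom_ext_of_T (fun l => ?_) (fun l => ?_) (fun i j => ?_)
  · rw [hψ.source, DynFRT.FRTRep.lift_source]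
    rfl
  · rw [hψ.target, DynFRT.FRTRep.lift_target]
    rfl
  · rw [hT, DynFRT.FRTRep.lift_T]
    rfl
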